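/- For a graph $G$ let $\lambda(G)=\max_{U\subseteq V(G),\,|U|\ge 2}|E(U)|/(|U|-1)$ denote its arboricity, where $E(U)$ is the set of edges with both endpoints in $U$; for a path $\Pi$ let $|\Pi|$ be its number of edges (vertices may repeat). Work on a word RAM with words of $\Theta(\log n)$ bits, in which real edge weights may be copied, added and compared in unit time, and in which $G$ is stored by adjacency lists sorted by weight. Theorem. Let $G$ be an undirected $n$-vertex graph with at least one edge, with nonnegative real edge weights and arboricity $\lambda$, and let $k\ge 1$ be an integer. There is a randomized path-reporting distance oracle for $G$ with the following properties. (1) For every query pair $(u,v)$ of vertices in the same connected component, the oracle always returns a $u$–$v$ path $\hat\Pi$ in $G$ of weight at most $(6k-1)\,d_G(u,v)$, together with this weight as distance estimate; for vertices in different components it reports that there is no path (in this case put $|\hat\Pi|=0$). (2) Beyond the storage of $G$, its size is $O(n)$ words with high probability. (3) For every query, the expected query time, over the random choices made in constructing the oracle, is $O\big(n^{\frac12+\frac1{2k+2}}\cdot k\cdot(\lambda+\log n)\big)$, and if all weights are $1$ it is $O\big(n^{\frac12+\frac1{2k+2}}\cdot k\cdot\lambda\big)$, in each case up to an additive term $O(|\hat\Pi|)$.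 With high probability, all queries simultaneously satisfy the same bounds multiplied by $O(\log n)$, again up to an additive term $O(|\hat\Pi|)$. Here "with high probability" means with probability at least $1-n^{-c}$, for every constant $c$; the implied constants are absolute in the expectation bounds and depend only on $c$ in the high-probability bounds. -/

import Mathlib

open scoped ENNReal

noncomputable section

namespace PathOracle

/-! ### Weighted graphs -/

/-- The arboricity `max_{|U| ≥ 2} |E(U)| / (|U| - 1)`, where `E(U)` is the set of edges with both
endpoints in `U`. -/
def arboricity {n : ℕ} (G : SimpleGraph (Fin n)) : ℝ :=
  ⨆ U : {U : Finset (Fin n) // 2 ≤ U.card},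
    (({e ∈ G.edgeSet | ∀ x ∈ e, x ∈ U.1}.ncard : ℕ) : ℝ) / ((U.1.card : ℝ) - 1)

/-- The total weight of a walk, with multiplicities. -/
def walkWeight {n : ℕ} {G : SimpleGraph (Fin n)} (w : Sym2 (Fin n) → ℝ) {u v : Fin n}
    (p : G.Walk u v) : ℝ :=
  (p.edges.map w).sum

/-- The weighted distance of two vertices (meaningful for vertices in one component). -/
def wdist {n : ℕ} (G : SimpleGraph (Fin n)) (w : Sym2 (Fin n) → ℝ) (u v : Fin n) : ℝ :=
  ⨅ p : G.Walk u v, walkWeight w p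

open Classical in
/-- The adjacency list of `v`, in the order of nondecreasing edge weight (ties by vertex number). -/
def adjList {n : ℕ} (G : SimpleGraph (Fin n)) (w : Sym2 (Fin n) → ℝ) (v : Fin n) :
    List (Fin n) :=
  ((List.finRange n).filter (fun x => G.Adj v x)).insertionSort
    (fun x y => w s(v, x) ≤ w s(v, y))

/-! ### The machine

A word RAM with `wordBits`-bit words, given as a structured language with a step count.
Its read-only memory holds the stored graph (adjacency lists) and a table of words (the oracle).
Its working memory consists of zero-initialised arrays of words and arrays of real numbers.
The real numbers come only from edge weights and can only be copied, added and compared. -/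

/-- What a query can read. -/
structure Env where
  wordBits : ℕ
  /-- the oracle: a table of words -/
  table : List ℕ
  /-- the number of vertices -/
  order : ℕ
  /-- the adjacency lists of the stored graph -/
  nbrs : ℕ → List ℕ
  /-- the weights of the edges, in the order of the adjacency lists -/
  wts : ℕ → List ℝ

/-- The working memory and the output written so far. -/
structure State where
  words : ℕ → ℕ → ℕ
  reals : ℕ → ℕ → ℝ
  out : List ℕ

/-- Store the word `x` at position `i` of the array `a`. -/
def State.setW (s : State) (a i x : ℕ) : State :=
  { s with words := Function.update s.words a (Function.update (s.words a) i x) }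

/-- Store the real number `x` at position `i` of the real array `a`. -/
def State.setR (s : State) (a i : ℕ) (x : ℝ) : State :=
  { s with reals := Function.update s.reals a (Function.update (s.reals a) i x) }

/-- Arithmetic of words. -/
inductive Op
  | add
  | sub
  | mul
  | div
  | mod

/-- The value of an operation before it is reduced to a word (subtraction is truncated). -/
def Op.eval : Op → ℕ → ℕ → ℕ
  | add, x, y => x + y
  | sub, x, y => x - y
  | mul, x, y => x * y
  | div, x, y => x / y
  | mod, x, y => x % y

/-- Expressions whose values are words. -/
inductive WExpr
  /-- a constant -/
  | lit (c : ℕ)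
  /-- the entry at position `i` of the working array `a` -/
  | cell (a : ℕ) (i : WExpr)
  /-- the entry at position `i` of the oracle -/
  | table (i : WExpr)
  /-- the number of vertices -/
  | order
  /-- the degree of vertex `v` -/
  | deg (v : WExpr)
  /-- the entry at position `i` of the adjacency list of `v` -/
  | nbr (v i : WExpr)
  /-- arithmetic -/
  | op (o : Op) (x y : WExpr)

/-- The value of a word expression, always a word of `wordBits` bits. -/
def WExpr.eval (E : Env) (s : State) : WExpr → ℕ
  | lit c => c % 2 ^ E.wordBits
  | cell a i => s.words a (i.eval E s) % 2 ^ E.wordBits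
  | table i => E.table.getD (i.eval E s) 0 % 2 ^ E.wordBits
  | order => E.order % 2 ^ E.wordBits
  | deg v => (E.nbrs (v.eval E s)).length % 2 ^ E.wordBits
  | nbr v i => (E.nbrs (v.eval E s)).getD (i.eval E s) 0 % 2 ^ E.wordBits
  | op o x y => o.eval (x.eval E s) (y.eval E s) % 2 ^ E.wordBits

/-- One step for every access and every operation. -/
def WExpr.cost : WExpr → ℕ
  | lit _ => 1
  | cell _ i => i.cost + 1
  | table i => i.cost + 1
  | order => 1
  | deg v => v.cost + 1
  | nbr v i => v.cost + i.cost + 1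
  | op _ x y => x.cost + y.cost + 1

/-- Expressions whose values are real numbers. -/
inductive RExpr
  | zero
  /-- the entry at position `i` of the real working array `a` -/
  | cell (a : ℕ) (i : WExpr)
  /-- the weight of the edge at position `i` of the adjacency list of `v` -/
  | wt (v i : WExpr)
  | add (x y : RExpr)

/-- The value of a real expression. -/
def RExpr.eval (E : Env) (s : State) : RExpr → ℝ
  | zero => 0
  | cell a i => s.reals a (i.eval E s)
  | wt v i => (E.wts (v.eval E s)).getD (i.eval E s) 0
  | add x y => x.eval E s + y.eval E s

/-- One step for every access and every operation. -/
def RExpr.cost : RExpr → ℕ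
  | zero => 1
  | cell _ i => i.cost + 1
  | wt v i => v.cost + i.cost + 1
  | add x y => x.cost + y.cost + 1

/-- Tests. -/
inductive Test
  | weq (x y : WExpr)
  | wlt (x y : WExpr)
  | rlt (x y : RExpr)
  | neg (b : Test)
  | both (b c : Test)

/-- The truth of a test. -/
def Test.Holds (E : Env) (s : State) : Test → Prop
  | weq x y => x.eval E s = y.eval E s
  | wlt x y => x.eval E s < y.eval E s
  | rlt x y => x.eval E s < y.eval E s
  | neg b => ¬ b.Holds E s
  | both b c => b.Holds E s ∧ c.Holds E s

/-- One step for every access, operation, comparison and connective. -/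
def Test.cost : Test → ℕ
  | weq x y => x.cost + y.cost + 1
  | wlt x y => x.cost + y.cost + 1
  | rlt x y => x.cost + y.cost + 1
  | neg b => b.cost + 1
  | both b c => b.cost + c.cost + 1

/-- Programs. -/
inductive Prog
  | skip
  /-- store the word `x` at position `i` of the array `a` -/
  | setW (a : ℕ) (i x : WExpr)
  /-- store the real number `x` at position `i` of the real array `a` -/
  | setR (a : ℕ) (i : WExpr) (x : RExpr)
  /-- append the word `x` to the output -/
  | emit (x : WExpr)
  | seq (p q : Prog)
  | branch (b : Test) (p q : Prog)
  | loop (b : Test) (p : Prog)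

/-- `Exec E p s t s'`: the program `p`, started in the state `s`, halts after exactly `t` steps in
the state `s'`. -/
inductive Exec (E : Env) : Prog → State → ℕ → State → Prop
  | skip (s : State) : Exec E .skip s 1 s
  | setW (a : ℕ) (i x : WExpr) (s : State) :
      Exec E (.setW a i x) s (i.cost + x.cost + 1)
        (s.setW a (i.eval E s) (x.eval E s))
  | setR (a : ℕ) (i : WExpr) (x : RExpr) (s : State) :
      Exec E (.setR a i x) s (i.cost + x.cost + 1)
        (s.setR a (i.eval E s) (x.eval E s))
  | emit (x : WExpr) (s : State) :
      Exec E (.emit x) s (x.cost + 1) { s with out := s.out ++ [x.eval E s] }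
  | seq {p q : Prog} {s s' s'' : State} {t t' : ℕ} (hp : Exec E p s t s')
      (hq : Exec E q s' t' s'') : Exec E (.seq p q) s (t + t') s''
  | branch_true {b : Test} {p : Prog} (q : Prog) {s s' : State} {t : ℕ} (hb : b.Holds E s)
      (hp : Exec E p s t s') : Exec E (.branch b p q) s (b.cost + t + 1) s'
  | branch_false {b : Test} (p : Prog) {q : Prog} {s s' : State} {t : ℕ} (hb : ¬ b.Holds E s)
      (hq : Exec E q s t s') : Exec E (.branch b p q) s (b.cost + t + 1) s'
  | loop_done {b : Test} (p : Prog) {s : State} (hb : ¬ b.Holds E s) :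
      Exec E (.loop b p) s (b.cost + 1) s
  | loop_step {b : Test} {p : Prog} {s s' s'' : State} {t t' : ℕ} (hb : b.Holds E s)
      (hp : Exec E p s t s') (hl : Exec E (.loop b p) s' t' s'') :
      Exec E (.loop b p) s (b.cost + t + t' + 1) s''

/-- The machine is deterministic: running time and final state are determined by the input. -/
theorem Exec.unique {E : Env} {p : Prog} {s s₁ s₂ : State} {t₁ t₂ : ℕ}
    (h₁ : Exec E p s t₁ s₁) (h₂ : Exec E p s t₂ s₂) : t₁ = t₂ ∧ s₁ = s₂ := by
  induction h₁ generalizing t₂ s₂ with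
  | skip s => cases h₂; exact ⟨rfl, rfl⟩
  | setW => cases h₂; exact ⟨rfl, rfl⟩
  | setR => cases h₂; exact ⟨rfl, rfl⟩
  | emit => cases h₂; exact ⟨rfl, rfl⟩
  | seq _ _ ihp ihq =>
    cases h₂ with
    | seq hp hq =>
      obtain ⟨rfl, rfl⟩ := ihp hp
      obtain ⟨rfl, rfl⟩ := ihq hq
      exact ⟨rfl, rfl⟩
  | branch_true _ hb _ ih =>
    cases h₂ with
    | branch_true _ _ hp => obtain ⟨rfl, rfl⟩ := ih hp; exact ⟨rfl, rfl⟩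
    | branch_false _ hb' _ => exact absurd hb hb'
  | branch_false _ hb _ ih =>
    cases h₂ with
    | branch_true _ hb' _ => exact absurd hb' hb
    | branch_false _ _ hq => obtain ⟨rfl, rfl⟩ := ih hq; exact ⟨rfl, rfl⟩
  | loop_done _ hb =>
    cases h₂ with
    | loop_done _ _ => exact ⟨rfl, rfl⟩
    | loop_step hb' _ _ => exact absurd hb' hb
  | loop_step hb _ _ ihp ihl =>
    cases h₂ with
    | loop_done _ hb' => exact absurd hb hb'
    | loop_step _ hp hl =>
      obtain ⟨rfl, rfl⟩ := ihp hp
      obtain ⟨rfl, rfl⟩ := ihl hl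
      exact ⟨rfl, rfl⟩

/-! ### Oracles -/

/-- Words of `Θ(log n)` bits: `b` times the number of binary digits of `n`. -/
def wordLength (b n : ℕ) : ℕ := b * (Nat.log 2 n + 1)

/-- The read-only memory for the weighted graph `(G, w)` and the oracle `M`. -/
def env (b : ℕ) {n : ℕ} (G : SimpleGraph (Fin n)) (w : Sym2 (Fin n) → ℝ) (M : List ℕ) : Env where
  wordBits := wordLength b n
  table := M
  order := n
  nbrs v := if h : v < n then (adjList G w ⟨v, h⟩).map Fin.val else []
  wts v := if h : v < n then (adjList G w ⟨v, h⟩).map (fun x => w s(⟨v, h⟩, x)) else []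

/-- The working memory at the start of the query `(u, v)`: the query in the first two cells of the
array `0`, zero everywhere else. -/
def start (u v : ℕ) : State where
  words := Function.update (fun _ _ => 0) 0
    (Function.update (Function.update (fun _ => 0) 0 u) 1 v)
  reals := fun _ _ => 0
  out := []

/-- On the query `(u, v)` the program `Q` halts after exactly `t` steps, has written the list `π`
and leaves the distance estimate `δ` in the first cell of the real array `0`. -/
def Answers (E : Env) (Q : Prog) (u v t : ℕ) (π : List ℕ) (δ : ℝ) : Prop :=
  ∃ s, Exec E Q (start u v) t s ∧ s.out = π ∧ s.reals 0 0 = δ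

/-- `(π, δ)` is a correct answer with stretch `α` to the query `(u, v)`: the vertex list of a walk
of `G` from `u` to `v` of weight `δ ≤ α · d(u, v)`, and the empty list if there is no walk. -/
def CorrectAnswer {n : ℕ} (G : SimpleGraph (Fin n)) (w : Sym2 (Fin n) → ℝ) (α : ℝ) (u v : Fin n)
    (π : List ℕ) (δ : ℝ) : Prop :=
  (G.Reachable u v → ∃ p : G.Walk u v, π = p.support.map Fin.val ∧ δ = walkWeight w p ∧
    walkWeight w p ≤ α * wdist G w u v) ∧
  (¬ G.Reachable u v → π = [])

/-- The number of edges of a path given as a list of vertices. -/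
def hops (π : List ℕ) : ℕ := π.length - 1

/-- The expectation of `f` under the distribution `μ`. -/
def expect {α : Type} (μ : PMF α) (f : α → ℝ≥0∞) : ℝ≥0∞ := ∑' x, μ x * f x

/-- Over a random oracle with distribution `μ`, the expected time of every query is at most `A * B`,
plus `A` for each edge of the reported path. -/
def ExpectedQueryTime {n : ℕ} (μ : PMF (List ℕ)) (T : List ℕ → Fin n → Fin n → ℕ)
    (path : List ℕ → Fin n → Fin n → List ℕ) (A B : ℝ) : Prop :=
  ∀ u v, expect μ (fun M => ENNReal.ofReal ((T M u v : ℝ) - A * (hops (path M u v) : ℝ))) ≤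
    ENNReal.ofReal (A * B)

/-- The event `S` has probability at least `1 - n ^ (-c)`. -/
def Whp (n c : ℕ) (μ : PMF (List ℕ)) (S : Set (List ℕ)) : Prop :=
  ENNReal.ofReal (1 - 1 / (n : ℝ) ^ c) ≤ μ.toOuterMeasure S

/-- With probability at least `1 - n ^ (-c)`, every query takes time at most `C * B`, plus `C` for
each edge of the reported path. -/
def WhpQueryTime {n : ℕ} (c : ℕ) (μ : PMF (List ℕ)) (T : List ℕ → Fin n → Fin n → ℕ)
    (path : List ℕ → Fin n → Fin n → List ℕ) (C B : ℝ) : Prop :=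
  Whp n c μ {M | ∀ u v, (T M u v : ℝ) ≤ C * B + C * (hops (path M u v) : ℝ)}

/-- The main term `n ^ (1/2 + 1/(2k+2)) * k` of the query time. -/
def mainTerm (n k : ℕ) : ℝ := (n : ℝ) ^ ((1 : ℝ) / 2 + 1 / (2 * (k : ℝ) + 2)) * (k : ℝ)

end PathOracle

end

/-! Let N = n^(1/(2k+2)). The oracle rests on a random set S of about N^k pivots. A query (u, v)
runs a shortest-path search from v until it meets u, a pivot or the end of the component, and then
one from u until it meets v, a pivot or the end. If a search meets the other endpoint, its tree
contains an exact answer. Otherwise the search from v met a pivot c before u and the search from u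
met a pivot a before v, so d(u,a) and d(v,c) are at most d(u,v) and d(a,c) is at most 3 d(u,v). A
(2k-1)-spanner of the metric on S leads from a to c, and the total is at most (1 + 3(2k-1) + 1)
d(u,v) = (6k-1) d(u,v) (`query_spec`).

Space. The greedy spanner has no cycle of at most 2k edges. With t about 2N we have |S| ≤ t^k, and
then the spanner has at most t|S| = O(√n) edges (`exists_spanner`, `NoBypass.ncard_edges_le`). Each
spanner edge stands for a path of G that can be long, so the paths cannot be stored vertex by
vertex. They are chosen as shortest paths that are unique after breaking ties; two of them have one
contiguous common part, so one leaves the other at no more than two vertices (`card_splits_le`). At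
a vertex where all stored paths through it agree, it suffices to store its two neighbours on them: a
walker who knows where it came from takes the other one. Only at the remaining vertices, the branch
vertices, does every path record its own next step. Each of the O(√n) paths has O(√n) branch
vertices (`length_routeCode_le`), which makes O(n) words. The matrix of next hops between pivots
also has O(n) entries (`exists_table`, `exists_oracle`).

Time. The order in which a search discovers vertices does not depend on the pivots. So the number of
vertices found before the first pivot is the hitting time of a fixed sequence by a random set: for m
independent choices its mean is at most n/(m+1), and it exceeds J with probability at most
(1-(J+1)/n)^m (`SearchRun.sum_delay_le`, `SearchRun.card_delayed_le`). Here n/m is at most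
n^(1/2+1/(2k+2)).

It remains to discover i vertices in O(i(λ + log n)) steps, whatever their degrees are. Each
discovered vertex reads its list, which is sorted by weight, only up to its first undiscovered
neighbour, where it waits. The entries passed are edges between discovered vertices, so there are at
most 2λi of them (`DInv.scanned_le_arboricity`). The least key over these waiting places is still
the distance of the next vertex (`QInv.min_le`). A vertex may change its waiting place often, so
insertions and decreases of keys must take constant amortized time. This is provided by hollow
heaps: a decreased item gets a new node, the old node stays in its tree as a hollow one with its two
children of highest rank, and a system of credits (`HInv`) pays for the links. Only the extraction
of the minimum costs a logarithm (`HInv.two_pow_rank_le`, `extract_spec`). For unit weights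
breadth-first search replaces the heap. The parameter β is the price of a round: O(log n) for
Dijkstra's algorithm and 1 for breadth-first search.

Execution. Programs are verified with the predicate `WP`, in which loop invariants carry a budget
for the remaining steps. The search is verified once, on its own memory and without a table, and is
then transported along an injection of array names (`Exec.relabel`). This yields two disjoint copies
for the two searches of a query, each following a run that is fixed before the pivots are drawn. -/

noncomputable section

namespace PathOracle

/-! ### Program logic -/

/-- The program `P` started in `s` halts, and its running time and final state satisfy `Q`. -/
def WP (E : Env) (P : Prog) (s : State) (Q : ℕ → State → Prop) : Prop :=
  ∃ t s', Exec E P s t s' ∧ Q t s'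

/-- The contents of a word array as seen by expressions. -/
def arr (E : Env) (s : State) (a i : ℕ) : ℕ := s.words a i % 2 ^ E.wordBits

section Logic

variable {E : Env} {s : State} {Q R : ℕ → State → Prop}

theorem WP.mono {P : Prog} (h : WP E P s Q) (hQ : ∀ t s', Q t s' → R t s') : WP E P s R := by
  obtain ⟨t, s', h1, h2⟩ := h
  exact ⟨t, s', h1, hQ _ _ h2⟩

@[simp] theorem WP_skip : WP E .skip s Q ↔ Q 1 s :=
  ⟨by rintro ⟨t, s', h, hq⟩; cases h; exact hq, fun h => ⟨_, _, .skip s, h⟩⟩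

@[simp] theorem WP_setW {a : ℕ} {i x : WExpr} : WP E (.setW a i x) s Q ↔
    Q (i.cost + x.cost + 1) (s.setW a (i.eval E s) (x.eval E s)) :=
  ⟨by rintro ⟨t, s', h, hq⟩; cases h; exact hq, fun h => ⟨_, _, .setW a i x s, h⟩⟩

@[simp] theorem WP_setR {a : ℕ} {i : WExpr} {x : RExpr} : WP E (.setR a i x) s Q ↔
    Q (i.cost + x.cost + 1) (s.setR a (i.eval E s) (x.eval E s)) :=
  ⟨by rintro ⟨t, s', h, hq⟩; cases h; exact hq, fun h => ⟨_, _, .setR a i x s, h⟩⟩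

@[simp] theorem WP_emit {x : WExpr} : WP E (.emit x) s Q ↔
    Q (x.cost + 1) { s with out := s.out ++ [x.eval E s] } :=
  ⟨by rintro ⟨t, s', h, hq⟩; cases h; exact hq, fun h => ⟨_, _, .emit x s, h⟩⟩

@[simp] theorem WP_seq {p q : Prog} : WP E (.seq p q) s Q ↔
    WP E p s (fun t s' => WP E q s' (fun t' s'' => Q (t + t') s'')) := by
  constructor
  · rintro ⟨t, s', h, hq⟩
    cases h with
    | seq hp hq' => exact ⟨_, _, hp, _, _, hq', hq⟩
  · rintro ⟨t, s', hp, t', s'', hq', hq⟩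
    exact ⟨_, _, .seq hp hq', hq⟩

theorem WP_branch {b : Test} {p q : Prog} : WP E (.branch b p q) s Q ↔
    (b.Holds E s → WP E p s (fun t s' => Q (b.cost + t + 1) s')) ∧
    (¬ b.Holds E s → WP E q s (fun t s' => Q (b.cost + t + 1) s')) := by
  constructor
  · rintro ⟨t, s', h, hq⟩
    cases h with
    | branch_true _ hb hp => exact ⟨fun _ => ⟨_, _, hp, hq⟩, fun h => absurd hb h⟩
    | branch_false _ hb hp => exact ⟨fun h => absurd h hb, fun _ => ⟨_, _, hp, hq⟩⟩
  · rintro ⟨h1, h2⟩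
    by_cases hb : b.Holds E s
    · obtain ⟨t, s', h, hq⟩ := h1 hb
      exact ⟨_, _, .branch_true _ hb h, hq⟩
    · obtain ⟨t, s', h, hq⟩ := h2 hb
      exact ⟨_, _, .branch_false _ hb h, hq⟩

theorem WP_branch_pos {b : Test} {p q : Prog} (hb : b.Holds E s)
    (h : WP E p s (fun t s' => Q (b.cost + t + 1) s')) : WP E (.branch b p q) s Q :=
  WP_branch.2 ⟨fun _ => h, fun h' => absurd hb h'⟩

theorem WP_branch_neg {b : Test} {p q : Prog} (hb : ¬ b.Holds E s)
    (h : WP E q s (fun t s' => Q (b.cost + t + 1) s')) : WP E (.branch b p q) s Q :=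
  WP_branch.2 ⟨fun h' => absurd h' hb, fun _ => h⟩

/-- The loop rule: `I s φ` is an invariant with a budget `φ` that pays for all remaining steps. -/
theorem WP_loop {b : Test} {p : Prog} (I : State → ℕ → Prop)
    (hI : ∀ s φ, I s φ → b.Holds E s →
      WP E p s (fun t s' => ∃ φ', I s' φ' ∧ b.cost + t + 1 + φ' ≤ φ))
    {s : State} {φ : ℕ} (h : I s φ)
    (hQ : ∀ t s' φ', I s' φ' → ¬ b.Holds E s' → t + φ' ≤ φ + (b.cost + 1) → Q t s') :
    WP E (.loop b p) s Q := by
  suffices H : ∀ φ s, I s φ → WP E (.loop b p) s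
      (fun t s' => ∃ φ', I s' φ' ∧ ¬ b.Holds E s' ∧ t + φ' ≤ φ + (b.cost + 1)) by
    obtain ⟨t, s', h1, φ', h2, h3, h4⟩ := H φ s h
    exact ⟨t, s', h1, hQ t s' φ' h2 h3 h4⟩
  intro φ
  -- Every round uses up at least one unit of the budget, so induction on the budget also proves
  -- termination.
  induction φ using Nat.strong_induction_on with
  | _ φ ih =>
    intro s hs
    by_cases hb : b.Holds E s
    · obtain ⟨t, s', h1, φ', h2, h3⟩ := hI s φ hs hb
      obtain ⟨t', s'', h4, φ'', h5, h6, h7⟩ := ih φ' (by omega) s' h2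
      exact ⟨_, _, .loop_step hb h1 h4, φ'', h5, h6, by omega⟩
    · exact ⟨_, _, .loop_done p hb, φ, hs, hb, by omega⟩

@[simp] theorem arr_mod (a i : ℕ) : arr E s a i % 2 ^ E.wordBits = arr E s a i := Nat.mod_mod _ _

@[simp] theorem arr_lt (a i : ℕ) : arr E s a i < 2 ^ E.wordBits :=
  Nat.mod_lt _ (by positivity)

@[simp] theorem arr_setR (a i : ℕ) (x : ℝ) (a' : ℕ) : arr E (s.setR a i x) a' = arr E s a' := rfl

theorem arr_setW (a i x : ℕ) (a' : ℕ) : arr E (s.setW a i x) a' =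
    if a' = a then Function.update (arr E s a) i (x % 2 ^ E.wordBits) else arr E s a' := by
  funext j
  by_cases h : a' = a
  · subst h
    by_cases hj : j = i
    · subst hj; simp [arr, State.setW]
    · simp [arr, State.setW, Function.update_of_ne hj]
  · simp [arr, State.setW, h]

@[simp] theorem reals_setW (a i x : ℕ) : (s.setW a i x).reals = s.reals := rfl

theorem reals_setR (a i : ℕ) (x : ℝ) (a' : ℕ) : (s.setR a i x).reals a' =
    if a' = a then Function.update (s.reals a) i x else s.reals a' := by
  simp only [State.setR, Function.update_apply]

@[simp] theorem out_setW (a i x : ℕ) : (s.setW a i x).out = s.out := rfl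
@[simp] theorem out_setR (a i : ℕ) (x : ℝ) : (s.setR a i x).out = s.out := rfl

theorem WExpr.eval_lt (x : WExpr) : x.eval E s < 2 ^ E.wordBits := by
  cases x <;> exact Nat.mod_lt _ (by positivity)

@[simp] theorem eval_lit (c : ℕ) : (WExpr.lit c).eval E s = c % 2 ^ E.wordBits := rfl
@[simp] theorem eval_cell (a : ℕ) (i : WExpr) : (WExpr.cell a i).eval E s =
    arr E s a (i.eval E s) := rfl
@[simp] theorem eval_order : WExpr.order.eval E s = E.order % 2 ^ E.wordBits := rfl
@[simp] theorem eval_table (i : WExpr) : (WExpr.table i).eval E s =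
    E.table.getD (i.eval E s) 0 % 2 ^ E.wordBits := rfl
@[simp] theorem eval_deg (i : WExpr) : (WExpr.deg i).eval E s =
    (E.nbrs (i.eval E s)).length % 2 ^ E.wordBits := rfl
@[simp] theorem eval_nbr (v i : WExpr) : (WExpr.nbr v i).eval E s =
    (E.nbrs (v.eval E s)).getD (i.eval E s) 0 % 2 ^ E.wordBits := rfl
@[simp] theorem eval_add (x y : WExpr) : (WExpr.op .add x y).eval E s =
    (x.eval E s + y.eval E s) % 2 ^ E.wordBits := rfl
@[simp] theorem eval_sub (x y : WExpr) : (WExpr.op .sub x y).eval E s =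
    x.eval E s - y.eval E s := by
  show (x.eval E s - y.eval E s) % _ = _
  exact Nat.mod_eq_of_lt (lt_of_le_of_lt (Nat.sub_le _ _) x.eval_lt)
@[simp] theorem eval_mul (x y : WExpr) : (WExpr.op .mul x y).eval E s =
    (x.eval E s * y.eval E s) % 2 ^ E.wordBits := rfl
@[simp] theorem reval_zero : RExpr.zero.eval E s = 0 := rfl
@[simp] theorem reval_cell (a : ℕ) (i : WExpr) : (RExpr.cell a i).eval E s =
    s.reals a (i.eval E s) := rfl
@[simp] theorem reval_wt (v i : WExpr) : (RExpr.wt v i).eval E s =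
    (E.wts (v.eval E s)).getD (i.eval E s) 0 := rfl
@[simp] theorem reval_add (x y : RExpr) : (RExpr.add x y).eval E s =
    x.eval E s + y.eval E s := rfl
@[simp] theorem holds_weq (x y : WExpr) : (Test.weq x y).Holds E s ↔
    x.eval E s = y.eval E s := Iff.rfl
@[simp] theorem holds_wlt (x y : WExpr) : (Test.wlt x y).Holds E s ↔
    x.eval E s < y.eval E s := Iff.rfl
@[simp] theorem holds_rlt (x y : RExpr) : (Test.rlt x y).Holds E s ↔
    x.eval E s < y.eval E s := Iff.rfl
@[simp] theorem holds_neg (b : Test) : (Test.neg b).Holds E s ↔ ¬ b.Holds E s := Iff.rfl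
@[simp] theorem holds_both (b c : Test) : (Test.both b c).Holds E s ↔
    b.Holds E s ∧ c.Holds E s := Iff.rfl

attribute [simp] WExpr.cost RExpr.cost Test.cost

end Logic

/-! ### Transport of programs along an injection of array names -/

/-- Rename the arrays. -/
def WExpr.relabel (f : ℕ → ℕ) : WExpr → WExpr
  | lit c => lit c
  | cell a i => cell (f a) (i.relabel f)
  | table i => table (i.relabel f)
  | order => order
  | deg v => deg (v.relabel f)
  | nbr v i => nbr (v.relabel f) (i.relabel f)
  | op o x y => op o (x.relabel f) (y.relabel f)

/-- The expression does not read the oracle. -/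
def WExpr.TableFree : WExpr → Prop
  | lit _ => True
  | cell _ i => i.TableFree
  | table _ => False
  | order => True
  | deg v => v.TableFree
  | nbr v i => v.TableFree ∧ i.TableFree
  | op _ x y => x.TableFree ∧ y.TableFree

/-- Rename the arrays. -/
def RExpr.relabel (f : ℕ → ℕ) : RExpr → RExpr
  | zero => zero
  | cell a i => cell (f a) (i.relabel f)
  | wt v i => wt (v.relabel f) (i.relabel f)
  | add x y => add (x.relabel f) (y.relabel f)

/-- The expression does not read the oracle. -/
def RExpr.TableFree : RExpr → Prop
  | zero => True
  | cell _ i => i.TableFree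
  | wt v i => v.TableFree ∧ i.TableFree
  | add x y => x.TableFree ∧ y.TableFree

/-- Rename the arrays. -/
def Test.relabel (f : ℕ → ℕ) : Test → Test
  | weq x y => weq (x.relabel f) (y.relabel f)
  | wlt x y => wlt (x.relabel f) (y.relabel f)
  | rlt x y => rlt (x.relabel f) (y.relabel f)
  | neg b => neg (b.relabel f)
  | both b c => both (b.relabel f) (c.relabel f)

/-- The test does not read the oracle. -/
def Test.TableFree : Test → Prop
  | weq x y => x.TableFree ∧ y.TableFree
  | wlt x y => x.TableFree ∧ y.TableFree
  | rlt x y => x.TableFree ∧ y.TableFree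
  | neg b => b.TableFree
  | both b c => b.TableFree ∧ c.TableFree

/-- Rename the arrays. -/
def Prog.relabel (f : ℕ → ℕ) : Prog → Prog
  | skip => skip
  | setW a i x => setW (f a) (i.relabel f) (x.relabel f)
  | setR a i x => setR (f a) (i.relabel f) (x.relabel f)
  | emit x => emit (x.relabel f)
  | seq p q => seq (p.relabel f) (q.relabel f)
  | branch b p q => branch (b.relabel f) (p.relabel f) (q.relabel f)
  | loop b p => loop (b.relabel f) (p.relabel f)

/-- The program neither reads the oracle nor writes output. -/
def Prog.Silent : Prog → Prop
  | skip => True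
  | setW _ i x => i.TableFree ∧ x.TableFree
  | setR _ i x => i.TableFree ∧ x.TableFree
  | emit _ => False
  | seq p q => p.Silent ∧ q.Silent
  | branch b p q => b.TableFree ∧ p.Silent ∧ q.Silent
  | loop b p => b.TableFree ∧ p.Silent

/-- The memory `s` is stored in `S` with array `a` under the name `f a`. -/
def Embeds (f : ℕ → ℕ) (s S : State) : Prop :=
  (∀ a, S.words (f a) = s.words a) ∧ ∀ a, S.reals (f a) = s.reals a

/-- `S` and `S'` differ only in arrays whose names are values of `f`. -/
def SameOff (f : ℕ → ℕ) (S S' : State) : Prop :=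
  (∀ a, a ∉ Set.range f → S'.words a = S.words a ∧ S'.reals a = S.reals a) ∧ S'.out = S.out

section Relabel

variable {f : ℕ → ℕ} {E : Env} {s S : State} (M : List ℕ)

theorem WExpr.relabel_cost (x : WExpr) : (x.relabel f).cost = x.cost := by
  induction x <;> simp_all [WExpr.relabel]

theorem RExpr.relabel_cost (x : RExpr) : (x.relabel f).cost = x.cost := by
  induction x <;> simp_all [RExpr.relabel, WExpr.relabel_cost]

theorem Test.relabel_cost (x : Test) : (x.relabel f).cost = x.cost := by
  induction x <;> simp_all [Test.relabel, WExpr.relabel_cost, RExpr.relabel_cost]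

theorem WExpr.relabel_eval (h : Embeds f s S) (x : WExpr) (hx : x.TableFree) :
    (x.relabel f).eval { E with table := M } S = x.eval E s := by
  induction x with
  | lit => rfl
  | cell a i ih => simp [WExpr.relabel, arr, ih hx, h.1]
  | table => exact hx.elim
  | order => rfl
  | deg v ih => simp [WExpr.relabel, ih hx]
  | nbr v i ihv ihi => simp [WExpr.relabel, ihv hx.1, ihi hx.2]
  | op o x y ihx ihy => simp [WExpr.relabel, WExpr.eval, ihx hx.1, ihy hx.2]

theorem RExpr.relabel_eval (h : Embeds f s S) (x : RExpr) (hx : x.TableFree) :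
    (x.relabel f).eval { E with table := M } S = x.eval E s := by
  induction x with
  | zero => rfl
  | cell a i => simp [RExpr.relabel, WExpr.relabel_eval M h i hx, h.2]
  | wt v i => simp [RExpr.relabel, WExpr.relabel_eval M h v hx.1, WExpr.relabel_eval M h i hx.2]
  | add x y ihx ihy => simp [RExpr.relabel, ihx hx.1, ihy hx.2]

theorem Test.relabel_holds (h : Embeds f s S) (b : Test) (hb : b.TableFree) :
    (b.relabel f).Holds { E with table := M } S ↔ b.Holds E s := by
  induction b with
  | weq x y => simp [Test.relabel, WExpr.relabel_eval M h x hb.1, WExpr.relabel_eval M h y hb.2]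
  | wlt x y => simp [Test.relabel, WExpr.relabel_eval M h x hb.1, WExpr.relabel_eval M h y hb.2]
  | rlt x y => simp [Test.relabel, RExpr.relabel_eval M h x hb.1, RExpr.relabel_eval M h y hb.2]
  | neg b ih => simp [Test.relabel, ih hb]
  | both b c ihb ihc => simp [Test.relabel, ihb hb.1, ihc hb.2]

theorem Embeds.setW (hf : f.Injective) (h : Embeds f s S) (a i x : ℕ) :
    Embeds f (s.setW a i x) (S.setW (f a) i x) := by
  refine ⟨fun a' => ?_, h.2⟩
  by_cases e : a' = a
  · subst e; simp [State.setW, h.1]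
  · simp [State.setW, e, hf.ne e, h.1]

theorem Embeds.setR (hf : f.Injective) (h : Embeds f s S) (a i : ℕ) (x : ℝ) :
    Embeds f (s.setR a i x) (S.setR (f a) i x) := by
  refine ⟨h.1, fun a' => ?_⟩
  by_cases e : a' = a
  · subst e; simp [State.setR, h.2]
  · simp [State.setR, e, hf.ne e, h.2]

theorem SameOff.refl (f : ℕ → ℕ) (S : State) : SameOff f S S := ⟨fun _ _ => ⟨rfl, rfl⟩, rfl⟩

theorem SameOff.trans {S S' S'' : State} (h : SameOff f S S') (h' : SameOff f S' S'') :
    SameOff f S S'' :=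
  ⟨fun a ha => ⟨(h'.1 a ha).1.trans (h.1 a ha).1, (h'.1 a ha).2.trans (h.1 a ha).2⟩,
    h'.2.trans h.2⟩

theorem SameOff.setW (a i x : ℕ) : SameOff f S (S.setW (f a) i x) := by
  refine ⟨fun a' ha => ⟨?_, rfl⟩, rfl⟩
  have : a' ≠ f a := fun h => ha ⟨a, h.symm⟩
  simp [State.setW, this]

theorem SameOff.setR (a i : ℕ) (x : ℝ) : SameOff f S (S.setR (f a) i x) := by
  refine ⟨fun a' ha => ⟨rfl, ?_⟩, rfl⟩
  have : a' ≠ f a := fun h => ha ⟨a, h.symm⟩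
  simp [State.setR, this]

/-- A silent program runs in the same way on a renamed copy of its memory, whatever the oracle. -/
theorem Exec.relabel (hf : f.Injective) {P : Prog} {t : ℕ} {s' : State} (h : Exec E P s t s')
    (hP : P.Silent) (hS : Embeds f s S) :
    ∃ S', Exec { E with table := M } (P.relabel f) S t S' ∧ Embeds f s' S' ∧ SameOff f S S' := by
  induction h generalizing S with
  | skip s => exact ⟨S, .skip S, hS, .refl f S⟩
  | setW a i x s =>
    have e := Exec.setW (E := { E with table := M }) (f a) (i.relabel f) (x.relabel f) S
    rw [WExpr.relabel_eval M hS i hP.1, WExpr.relabel_eval M hS x hP.2, WExpr.relabel_cost,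
      WExpr.relabel_cost] at e
    exact ⟨_, e, hS.setW hf _ _ _, .setW _ _ _⟩
  | setR a i x s =>
    have e := Exec.setR (E := { E with table := M }) (f a) (i.relabel f) (x.relabel f) S
    rw [WExpr.relabel_eval M hS i hP.1, RExpr.relabel_eval M hS x hP.2, WExpr.relabel_cost,
      RExpr.relabel_cost] at e
    exact ⟨_, e, hS.setR hf _ _ _, .setR _ _ _⟩
  | emit => exact hP.elim
  | seq _ _ ihp ihq =>
    obtain ⟨S', h1, h2, h3⟩ := ihp hP.1 hS
    obtain ⟨S'', h4, h5, h6⟩ := ihq hP.2 h2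
    exact ⟨S'', .seq h1 h4, h5, h3.trans h6⟩
  | @branch_true b p q s s' t hb _ ih =>
    obtain ⟨S', h1, h2, h3⟩ := ih hP.2.1 hS
    have := Exec.branch_true (q.relabel f) ((Test.relabel_holds M hS b hP.1).2 hb) h1
    rw [Test.relabel_cost] at this
    exact ⟨S', this, h2, h3⟩
  | @branch_false b p q s s' t hb _ ih =>
    obtain ⟨S', h1, h2, h3⟩ := ih hP.2.2 hS
    have := Exec.branch_false (p.relabel f) (fun h => hb ((Test.relabel_holds M hS b hP.1).1 h)) h1
    rw [Test.relabel_cost] at this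
    exact ⟨S', this, h2, h3⟩
  | @loop_done b p s hb =>
    have := Exec.loop_done (E := { E with table := M }) (s := S) (p.relabel f)
      (fun h => hb ((Test.relabel_holds M hS b hP.1).1 h))
    rw [Test.relabel_cost] at this
    exact ⟨S, this, hS, .refl f S⟩
  | @loop_step b p s s' s'' t t' hb _ _ ihp ihl =>
    obtain ⟨S', h1, h2, h3⟩ := ihp hP.2 hS
    obtain ⟨S'', h4, h5, h6⟩ := ihl hP h2
    have := Exec.loop_step ((Test.relabel_holds M hS b hP.1).2 hb) h1 h4
    rw [Test.relabel_cost] at this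
    exact ⟨S'', this, h5, h3.trans h6⟩

end Relabel

/-! ### Walks, distances, adjacency lists -/

section Graph

variable {n : ℕ} {G : SimpleGraph (Fin n)} {w : Sym2 (Fin n) → ℝ}

@[simp] theorem walkWeight_nil (u : Fin n) : walkWeight w (.nil : G.Walk u u) = 0 := rfl

@[simp] theorem walkWeight_cons {u v x : Fin n} (h : G.Adj u v) (p : G.Walk v x) :
    walkWeight w (.cons h p) = w s(u, v) + walkWeight w p := by
  simp [walkWeight]

@[simp] theorem walkWeight_append {u v x : Fin n} (p : G.Walk u v) (q : G.Walk v x) :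
    walkWeight w (p.append q) = walkWeight w p + walkWeight w q := by
  simp [walkWeight]

@[simp] theorem walkWeight_reverse {u v : Fin n} (p : G.Walk u v) :
    walkWeight w p.reverse = walkWeight w p := by
  simp [walkWeight]

theorem walkWeight_nonneg (hw : ∀ e ∈ G.edgeSet, 0 ≤ w e) {u v : Fin n} (p : G.Walk u v) :
    0 ≤ walkWeight w p := by
  refine List.sum_nonneg fun x hx => ?_
  obtain ⟨e, he, rfl⟩ := List.mem_map.1 hx
  exact hw e (p.edges_subset_edgeSet he)

theorem wdist_le (hw : ∀ e ∈ G.edgeSet, 0 ≤ w e) {u v : Fin n} (p : G.Walk u v) :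
    wdist G w u v ≤ walkWeight w p :=
  ciInf_le ⟨0, by rintro _ ⟨p, rfl⟩; exact walkWeight_nonneg hw p⟩ p

theorem mem_adjList {v x : Fin n} : x ∈ adjList G w v ↔ G.Adj v x := by
  classical
  unfold adjList
  rw [List.mem_insertionSort]
  simp

theorem adjList_nodup (v : Fin n) : (adjList G w v).Nodup := by
  classical
  unfold adjList
  rw [(List.perm_insertionSort _ _).nodup_iff]
  exact (List.nodup_finRange n).filter _

theorem adjList_sorted (v : Fin n) :
    (adjList G w v).Pairwise (fun x y => w s(v, x) ≤ w s(v, y)) := by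
  classical
  have : Std.Total (fun x y => w s(v, x) ≤ w s(v, y)) := ⟨fun a b => le_total _ _⟩
  have : IsTrans (Fin n) (fun x y => w s(v, x) ≤ w s(v, y)) := ⟨fun a b c => le_trans⟩
  exact List.pairwise_insertionSort _ _

end Graph

/-! ### Hollow heaps -/

/-- The arrays of a heap. The nodes are numbered from `1`; the node `z` is full if
`cur (item z) = z`, otherwise it is hollow. The full roots are stored in `A` by rank, the children
of a full node `z` in a row of `ch` by rank, the two children of a hollow node in `k1` and `k2`. -/
structure Heap where
  item : ℕ → ℕ
  rank : ℕ → ℕ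
  k1 : ℕ → ℕ
  k2 : ℕ → ℕ
  ch : ℕ → ℕ
  cur : ℕ → ℕ
  A : ℕ → ℕ
  key : ℕ → ℝ

/-- The position of a node in the forest. -/
inductive Place
  | dead
  | root
  | stk
  | kid (p : ℕ)

/-- The node holds the current key of its item. -/
def Heap.Full (h : Heap) (z : ℕ) : Prop := h.cur (h.item z) = z

/-- The invariants of a heap with `fr` nodes created so far. The nodes of the list `L` wait for
being made roots. The credits `cr` pay for links. -/
structure HInv (n : ℕ) (h : Heap) (fr : ℕ) (pl : ℕ → Place) (cr : ℕ → ℕ) (L : List ℕ) : Prop where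
  node : ∀ z, pl z ≠ .dead → 1 ≤ z ∧ z ≤ fr ∧ h.item z < n
  rootA : ∀ r, h.A r ≠ 0 → pl (h.A r) = .root ∧ h.rank (h.A r) = r
  root : ∀ z, pl z = .root → h.A (h.rank z) = z ∧ h.Full z ∧ 1 ≤ cr z
  stk : ∀ z, pl z = .stk ↔ z ∈ L
  nodup : L.Nodup
  stk_cr : ∀ z ∈ L, 2 ≤ cr z
  full : ∀ z i, pl z ≠ .dead → h.Full z → i < h.rank z →
    pl (h.ch (h.item z + n * i)) = .kid z ∧ h.rank (h.ch (h.item z + n * i)) = i ∧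
      h.key z ≤ h.key (h.ch (h.item z + n * i))
  hollow1 : ∀ z, pl z ≠ .dead → ¬ h.Full z → 1 ≤ h.rank z →
    pl (h.k1 z) = .kid z ∧ h.rank (h.k1 z) + 1 = h.rank z ∧ h.key z ≤ h.key (h.k1 z) ∧
      2 ≤ cr (h.k1 z)
  hollow2 : ∀ z, pl z ≠ .dead → ¬ h.Full z → 2 ≤ h.rank z →
    pl (h.k2 z) = .kid z ∧ h.rank (h.k2 z) + 2 = h.rank z ∧ h.key z ≤ h.key (h.k2 z) ∧
      2 ≤ cr (h.k2 z)
  kid : ∀ z p, pl z = .kid p → pl p ≠ .dead ∧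
    (h.Full p → h.rank z < h.rank p ∧ h.ch (h.item p + n * h.rank z) = z) ∧
    (¬ h.Full p → (1 ≤ h.rank p ∧ h.k1 p = z) ∨ (2 ≤ h.rank p ∧ h.k2 p = z))

/-- The item `y` is in the heap. -/
def Heap.Has (h : Heap) (pl : ℕ → Place) (y : ℕ) : Prop :=
  pl (h.cur y) ≠ .dead ∧ h.item (h.cur y) = y

/-- The sum of all credits. -/
def credits (fr : ℕ) (cr : ℕ → ℕ) : ℕ := ∑ z ∈ Finset.range (fr + 1), cr z

theorem credits_update {fr z v : ℕ} (cr : ℕ → ℕ) (hz : z ≤ fr) :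
    credits fr (Function.update cr z v) + cr z = credits fr cr + v := by
  unfold credits
  have hm : z ∈ Finset.range (fr + 1) := Finset.mem_range.2 (by omega)
  rw [Finset.sum_update_of_mem hm, ← Finset.add_sum_erase _ cr hm,
    Finset.sdiff_singleton_eq_erase]
  omega

theorem credits_succ (fr v : ℕ) (cr : ℕ → ℕ) :
    credits (fr + 1) (Function.update cr (fr + 1) v) = credits fr cr + v := by
  unfold credits
  rw [Finset.sum_range_succ, Function.update_self]
  congr 1
  refine Finset.sum_congr rfl fun z hz => Function.update_of_ne ?_ _ _
  have := Finset.mem_range.1 hz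
  omega

section

variable {n fr : ℕ} {h : Heap} {pl : ℕ → Place} {cr : ℕ → ℕ} {L : List ℕ}

/-- The item is the remainder and the rank the quotient of an address modulo n, so the rows of
children of different items do not overlap in `ch`. -/
theorem add_mul_inj {n a b i j : ℕ} (ha : a < n) (hb : b < n) (h : a + n * i = b + n * j) :
    a = b ∧ i = j := by
  have h1 : (a + n * i) % n = (b + n * j) % n := by rw [h]
  simp only [Nat.add_mul_mod_self_left, Nat.mod_eq_of_lt ha, Nat.mod_eq_of_lt hb] at h1
  subst h1
  have h2 : n * i = n * j := by omega
  exact ⟨rfl, Nat.eq_of_mul_eq_mul_left (by omega) h2⟩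

-- Full or hollow, a node of rank r + 1 or r + 2 has a child of rank r, and a child knows its
-- parent. So the nodes of these two ranks inject into the nodes of rank r. Keeping two children in
-- a hollow node is exactly what saves this Fibonacci recursion.
open Classical in
theorem HInv.count_le (H : HInv n h fr pl cr L) (r : ℕ) :
    ({z ∈ Finset.range (fr + 1) | pl z ≠ .dead ∧ h.rank z = r + 1} : Finset ℕ).card +
    ({z ∈ Finset.range (fr + 1) | pl z ≠ .dead ∧ h.rank z = r + 2} : Finset ℕ).card ≤
    ({z ∈ Finset.range (fr + 1) | pl z ≠ .dead ∧ h.rank z = r} : Finset ℕ).card := by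
  rw [← Finset.card_union_of_disjoint]
  swap
  · rw [Finset.disjoint_left]
    intro z h1 h2
    simp only [Finset.mem_filter] at h1 h2
    omega
  have key : ∀ z, pl z ≠ .dead → (h.rank z = r + 1 ∨ h.rank z = r + 2) →
      ∃ c, pl c = .kid z ∧ h.rank c = r := by
    intro z hz hr
    by_cases hf : h.Full z
    · obtain ⟨h1, h2, -⟩ := H.full z r hz hf (by omega)
      exact ⟨_, h1, h2⟩
    · rcases hr with hr | hr
      · obtain ⟨h1, h2, -⟩ := H.hollow1 z hz hf (by omega)
        exact ⟨_, h1, by omega⟩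
      · obtain ⟨h1, h2, -⟩ := H.hollow2 z hz hf (by omega)
        exact ⟨_, h1, by omega⟩
  have key' : ∀ z, ∃ c, pl z ≠ .dead → (h.rank z = r + 1 ∨ h.rank z = r + 2) →
      pl c = .kid z ∧ h.rank c = r := by
    intro z
    by_cases hz : pl z ≠ .dead ∧ (h.rank z = r + 1 ∨ h.rank z = r + 2)
    · obtain ⟨c, hc⟩ := key z hz.1 hz.2
      exact ⟨c, fun _ _ => hc⟩
    · exact ⟨0, fun h1 h2 => absurd ⟨h1, h2⟩ hz⟩
  choose c hc using key'
  refine Finset.card_le_card_of_injOn c ?_ ?_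
  · intro z hz
    simp only [Finset.coe_union, Finset.coe_filter, Set.mem_union, Set.mem_ofPred_eq] at hz
    have h1 := hc z (by tauto) (by tauto)
    have h2 : pl (c z) ≠ .dead := by rw [h1.1]; simp
    simp only [Finset.coe_filter, Finset.mem_range, Set.mem_ofPred_eq]
    exact ⟨by have := (H.node _ h2).2.1; omega, h2, h1.2⟩
  · intro z hz z' hz' e
    simp only [Finset.coe_union, Finset.coe_filter, Set.mem_union, Set.mem_ofPred_eq] at hz hz'
    have h1 := (hc z (by tauto) (by tauto)).1
    have h2 := (hc z' (by tauto) (by tauto)).1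
    rw [e, h2] at h1
    simpa using h1.symm

/-- Ranks are logarithmic in the number of nodes. -/
theorem HInv.two_pow_rank_le (H : HInv n h fr pl cr L) {z : ℕ} (hz : pl z ≠ .dead) :
    2 ^ (h.rank z / 2) ≤ fr := by
  classical
  set N : ℕ → ℕ := fun r =>
    ({z ∈ Finset.range (fr + 1) | pl z ≠ .dead ∧ h.rank z = r} : Finset ℕ).card with hN
  have step : ∀ r, N (r + 1) + N (r + 2) ≤ N r := H.count_le
  have bound : ∀ r, N r ≤ fr := by
    intro r
    have : ({z ∈ Finset.range (fr + 1) | pl z ≠ .dead ∧ h.rank z = r} : Finset ℕ) ⊆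
        Finset.Icc 1 fr := by
      intro z hz
      simp only [Finset.mem_filter] at hz
      have := H.node z hz.2.1
      simp only [Finset.mem_Icc]; omega
    simpa using Finset.card_le_card this
  have pos : 1 ≤ N (h.rank z) := by
    refine Finset.card_pos.2 ⟨z, ?_⟩
    have := H.node z hz
    simp only [Finset.mem_filter, Finset.mem_range]
    exact ⟨by omega, hz, trivial⟩
  -- Two applications of the recursion give N(r) ≥ N(r+1) + N(r+2) ≥ 2 N(r+2), so the counts double
  -- every two ranks on the way down.
  have grow : ∀ r, 1 ≤ N r → ∀ j, 2 * j ≤ r → 2 ^ j * 1 ≤ N (r - 2 * j) := by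
    intro r hr j
    have e : ∀ j, 2 * j ≤ r → 2 ^ j ≤ N (r - 2 * j) := by
      intro j
      induction j with
      | zero => intro _; simpa using hr
      | succ j ih =>
        intro hj
        have h1 := ih (by omega)
        have h2 := step (r - 2 * (j + 1))
        have h3 := step (r - 2 * (j + 1) + 1)
        have e1 : r - 2 * (j + 1) + 2 = r - 2 * j := by omega
        have e2 : r - 2 * (j + 1) + 1 + 1 = r - 2 * j := by omega
        rw [e1] at h2
        rw [e2] at h3
        rw [pow_succ]
        omega
    simpa using e j
  have := grow _ pos (h.rank z / 2) (by omega)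
  have := bound (h.rank z - 2 * (h.rank z / 2))
  omega

theorem HInv.rank_le (H : HInv n h fr pl cr L) {z : ℕ} (hz : pl z ≠ .dead) :
    h.rank z ≤ 2 * Nat.log 2 fr + 1 := by
  have h1 := H.two_pow_rank_le hz
  have h2 : h.rank z / 2 ≤ Nat.log 2 fr := Nat.le_log_of_pow_le (by norm_num) h1
  omega

/-- Some root has a key that is at most the key of a given node. -/
theorem HInv.exists_root_le (H : HInv n h fr pl cr []) {z : ℕ} (hz : pl z ≠ .dead) :
    ∃ r, h.A r ≠ 0 ∧ h.key (h.A r) ≤ h.key z := by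
  -- A parent has larger rank and no larger key than its child. Ranks are bounded, so climbing ends,
  -- and it ends at a root because no node is waiting.
  induction hm : 2 * Nat.log 2 fr + 1 - h.rank z using Nat.strong_induction_on generalizing z with
  | _ m ih =>
    cases hp : pl z with
    | dead => exact absurd hp hz
    | stk => simpa using (H.stk z).1 hp
    | root =>
      have := (H.root z hp).1
      have hz1 := (H.node z hz).1
      exact ⟨h.rank z, by omega, by rw [this]⟩
    | kid p =>
      obtain ⟨h1, h2, h3⟩ := H.kid z p hp
      have hr := H.rank_le h1
      have : h.rank z < h.rank p ∧ h.key p ≤ h.key z := by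
        by_cases hf : h.Full p
        · obtain ⟨h4, h5⟩ := h2 hf
          have := (H.full p _ h1 hf h4).2.2
          rw [h5] at this
          exact ⟨h4, this⟩
        · rcases h3 hf with ⟨h4, rfl⟩ | ⟨h4, rfl⟩
          · have := H.hollow1 p h1 hf h4
            exact ⟨by omega, this.2.2.1⟩
          · have := H.hollow2 p h1 hf h4
            exact ⟨by omega, this.2.2.1⟩
      obtain ⟨r, hr1, hr2⟩ := ih _ (by omega) h1 rfl
      exact ⟨r, hr1, hr2.trans this.2⟩

/-- Link two full trees `a` and `b` of equal rank, one of them a root and one waiting. -/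
theorem HInv.link {a b r : ℕ} {L' : List ℕ} (H : HInv n h fr pl cr L') (hab : a ≠ b)
    (hL : L' = a :: L ∧ pl b = .root ∨ L' = b :: L ∧ pl a = .root)
    (ha : h.Full a) (hra : h.rank a = r) (hrb : h.rank b = r)
    (hk : h.key a ≤ h.key b) :
    HInv n { h with A := Function.update h.A r 0, ch := Function.update h.ch (h.item a + n * r) b,
                    rank := Function.update h.rank a (r + 1) } fr
      (Function.update (Function.update pl b (.kid a)) a .stk)
      (Function.update (Function.update cr b 0) a 2) (a :: L) := by
  have hpa : pl a = .root ∨ pl a = .stk := by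
    rcases hL with ⟨rfl, -⟩ | ⟨rfl, h1⟩
    · exact .inr ((H.stk a).2 (by simp))
    · exact .inl h1
  have hpb : pl b = .root ∨ pl b = .stk := by
    rcases hL with ⟨rfl, h1⟩ | ⟨rfl, -⟩
    · exact .inl h1
    · exact .inr ((H.stk b).2 (by simp))
  have hA : h.A r = a ∨ h.A r = b := by
    rcases hL with ⟨rfl, h1⟩ | ⟨rfl, h1⟩
    · right; rw [← hrb]; exact (H.root b h1).1
    · left; rw [← hra]; exact (H.root a h1).1
  have hda : pl a ≠ .dead := by rcases hpa with e | e <;> simp [e]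
  have hdb : pl b ≠ .dead := by rcases hpb with e | e <;> simp [e]
  have hia := (H.node a hda).2.2
  have hna : ∀ p, pl a ≠ .kid p := by intro p; rcases hpa with e | e <;> simp [e]
  have hnb : ∀ p, pl b ≠ .kid p := by intro p; rcases hpb with e | e <;> simp [e]
  -- A row of `ch` belongs to an item, and an item has only one full node. So the single cell that
  -- the link overwrites is read by no full node but `a`.
  have hrow : ∀ z i, pl z ≠ .dead → h.Full z → h.item z + n * i = h.item a + n * r →
      z = a ∧ i = r := by
    intro z i hz hf e
    obtain ⟨e1, e2⟩ := add_mul_inj (H.node z hz).2.2 hia e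
    refine ⟨?_, e2⟩
    unfold Heap.Full at hf ha
    rw [← hf, e1, ha]
  have hLa : a ∉ L := by
    rcases hL with ⟨rfl, -⟩ | ⟨rfl, h1⟩
    · have := H.nodup; simp at this; exact this.1
    · intro hm
      have := (H.stk a).2 (by simp [hm])
      rw [h1] at this; cases this
  have hLb : b ∉ L := by
    rcases hL with ⟨rfl, h1⟩ | ⟨rfl, -⟩
    · intro hm
      have := (H.stk b).2 (by simp [hm])
      rw [h1] at this; cases this
    · have := H.nodup; simp at this; exact this.1
  have hLn : L.Nodup := by rcases hL with ⟨rfl, -⟩ | ⟨rfl, -⟩ <;> exact (List.nodup_cons.1 H.nodup).2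
  have hLm : ∀ z, z ≠ a → z ≠ b → (z ∈ L' ↔ z ∈ L) := by
    intro z h1 h2
    rcases hL with ⟨rfl, -⟩ | ⟨rfl, -⟩ <;> simp [h1, h2]
  have pl' : ∀ z, z ≠ a → z ≠ b →
      Function.update (Function.update pl b (.kid a)) a .stk z = pl z := by
    intro z h1 h2; simp [h1, h2]
  have pla : Function.update (Function.update pl b (.kid a)) a .stk a = .stk := by simp
  have plb : Function.update (Function.update pl b (.kid a)) a .stk b = .kid a := by
    simp [hab.symm]
  have dd : ∀ z, Function.update (Function.update pl b (.kid a)) a .stk z ≠ .dead →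
      pl z ≠ .dead := by
    intro z hz
    by_cases h1 : z = a
    · rw [h1]; exact hda
    by_cases h2 : z = b
    · rw [h2]; exact hdb
    rwa [pl' z h1 h2] at hz
  have hne : ∀ z p, pl z = .kid p → z ≠ a ∧ z ≠ b := by
    intro z p hz
    refine ⟨?_, ?_⟩ <;> rintro rfl
    · exact hna p hz
    · exact hnb p hz
  constructor
  · exact fun z hz => H.node z (dd z hz)
  · intro q hq
    by_cases e : q = r
    · simp [e] at hq
    · simp only [Function.update_of_ne e] at hq ⊢
      obtain ⟨h1, h2⟩ := H.rootA q hq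
      have n1 : h.A q ≠ a := by rintro h3; rw [h3] at h2; omega
      have n2 : h.A q ≠ b := by rintro h3; rw [h3] at h2; omega
      rw [pl' _ n1 n2, Function.update_of_ne n1]
      exact ⟨h1, h2⟩
  · intro z hz
    have n1 : z ≠ a := by rintro rfl; rw [pla] at hz; cases hz
    have n2 : z ≠ b := by rintro rfl; rw [plb] at hz; cases hz
    rw [pl' z n1 n2] at hz
    obtain ⟨h1, h2, h3⟩ := H.root z hz
    have n3 : h.rank z ≠ r := by
      intro e; rw [e] at h1
      rcases hA with e' | e' <;> omega
    simp only [Function.update_of_ne n1, Function.update_of_ne n2, Function.update_of_ne n3]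
    exact ⟨h1, h2, h3⟩
  · intro z
    by_cases h1 : z = a
    · subst h1; simp
    by_cases h2 : z = b
    · subst h2; rw [plb]; simp [h1, hLb]
    rw [pl' z h1 h2, H.stk, hLm z h1 h2]; simp [h1]
  · exact List.nodup_cons.2 ⟨hLa, hLn⟩
  · intro z hz
    by_cases h1 : z = a
    · subst h1; simp
    have h3 : z ∈ L := by simpa [h1] using hz
    have h2 : z ≠ b := by rintro rfl; exact hLb h3
    simp only [Function.update_of_ne h1, Function.update_of_ne h2]
    exact H.stk_cr z ((hLm z h1 h2).2 h3)
  · intro z i hz hf hi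
    have hz' := dd z hz
    change h.Full z at hf
    dsimp only at hi ⊢
    by_cases h1 : z = a ∧ i = r
    · obtain ⟨rfl, rfl⟩ := h1
      simp only [Function.update_self]
      rw [plb, Function.update_of_ne hab.symm]
      exact ⟨rfl, hrb, hk⟩
    · have h2 : h.item z + n * i ≠ h.item a + n * r := fun e => h1 (hrow z i hz' hf e)
      have hi' : i < h.rank z := by
        by_cases h3 : z = a
        · subst h3
          simp at hi
          have : i ≠ r := fun e => h1 ⟨rfl, e⟩
          omega
        · rwa [Function.update_of_ne h3] at hi
      obtain ⟨h4, h5, h6⟩ := H.full z i hz' hf hi'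
      obtain ⟨n1, n2⟩ := hne _ _ h4
      simp only [Function.update_of_ne h2, Function.update_of_ne n1, Function.update_of_ne n2]
      exact ⟨h4, h5, h6⟩
  · intro z hz hf hi
    have hz' := dd z hz
    change ¬ h.Full z at hf
    have n0 : z ≠ a := by rintro rfl; exact hf ha
    simp only [Function.update_of_ne n0] at hi ⊢
    obtain ⟨h4, h5, h6⟩ := H.hollow1 z hz' hf hi
    obtain ⟨n1, n2⟩ := hne _ _ h4
    simp only [Function.update_of_ne n1, Function.update_of_ne n2]
    exact ⟨h4, h5, h6⟩
  · intro z hz hf hi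
    have hz' := dd z hz
    change ¬ h.Full z at hf
    have n0 : z ≠ a := by rintro rfl; exact hf ha
    simp only [Function.update_of_ne n0] at hi ⊢
    obtain ⟨h4, h5, h6⟩ := H.hollow2 z hz' hf hi
    obtain ⟨n1, n2⟩ := hne _ _ h4
    simp only [Function.update_of_ne n1, Function.update_of_ne n2]
    exact ⟨h4, h5, h6⟩
  · intro z p hz
    by_cases h1 : z = a
    · subst h1; rw [pla] at hz; cases hz
    by_cases h2 : z = b
    · subst h2
      rw [plb] at hz
      cases hz
      rw [pla]
      refine ⟨by simp, fun _ => ?_, fun hf => absurd ha hf⟩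
      simp [h1, hrb]
    · rw [pl' z h1 h2] at hz
      obtain ⟨h4, h5, h6⟩ := H.kid z p hz
      refine ⟨?_, fun hf => ?_, fun hf => ?_⟩
      · by_cases h7 : p = a
        · subst h7; rw [pla]; simp
        by_cases h8 : p = b
        · subst h8; rw [plb]; simp
        rwa [pl' p h7 h8]
      · change h.Full p at hf
        obtain ⟨h7, h8⟩ := h5 hf
        simp only [Function.update_of_ne h1]
        have h9 : h.item p + n * h.rank z ≠ h.item a + n * r := by
          intro e
          obtain ⟨rfl, e2⟩ := hrow p _ h4 hf e
          omega
        rw [Function.update_of_ne h9]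
        refine ⟨?_, h8⟩
        by_cases h10 : p = a
        · subst h10; simp; omega
        · rwa [Function.update_of_ne h10]
      · change ¬ h.Full p at hf
        have n0 : p ≠ a := by rintro rfl; exact hf ha
        simp only [Function.update_of_ne n0]
        exact h6 hf

/-- Make a waiting full node a root. -/
theorem HInv.place {z : ℕ} (H : HInv n h fr pl cr (z :: L)) (hz : h.Full z)
    (hA : h.A (h.rank z) = 0) :
    HInv n { h with A := Function.update h.A (h.rank z) z } fr
      (Function.update pl z .root) (Function.update cr z 1) L := by
  have hs := (H.stk z).2 (by simp)
  have hzL : z ∉ L := (List.nodup_cons.1 H.nodup).1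
  have hd : pl z ≠ .dead := by simp [hs]
  have pl' : ∀ c, c ≠ z → Function.update pl z .root c = pl c := by
    intro c hc; simp [hc]
  have dd : ∀ c, Function.update pl z .root c ≠ .dead → pl c ≠ .dead := by
    intro c hc
    by_cases h1 : c = z
    · rwa [h1]
    · rwa [pl' c h1] at hc
  have hne : ∀ c p, pl c = .kid p → c ≠ z := by
    rintro c p hc rfl; rw [hs] at hc; cases hc
  constructor
  · exact fun c hc => H.node c (dd c hc)
  · intro r hr
    by_cases e : r = h.rank z
    · subst e; simp
    · simp only [Function.update_of_ne e] at hr ⊢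
      obtain ⟨h1, h2⟩ := H.rootA r hr
      have : h.A r ≠ z := by intro e; rw [e, hs] at h1; cases h1
      rw [pl' _ this]
      exact ⟨h1, h2⟩
  · intro c hc
    by_cases h1 : c = z
    · subst h1; simp [Heap.Full] at hz ⊢; exact hz
    · rw [pl' c h1] at hc
      obtain ⟨h2, h3, h4⟩ := H.root c hc
      have : h.rank c ≠ h.rank z := by
        intro e; rw [e, hA] at h2
        have := (H.node c (by simp [hc])).1
        omega
      simp only [Function.update_of_ne this, Function.update_of_ne h1]
      exact ⟨h2, h3, h4⟩
  · intro c
    by_cases h1 : c = z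
    · subst h1; simp [hzL]
    · rw [pl' c h1, H.stk]; simp [h1]
  · exact (List.nodup_cons.1 H.nodup).2
  · intro c hc
    have h1 : c ≠ z := by rintro rfl; exact hzL hc
    rw [Function.update_of_ne h1]
    exact H.stk_cr c (by simp [hc])
  · intro c i hc hf hi
    obtain ⟨h4, h5, h6⟩ := H.full c i (dd c hc) hf hi
    dsimp only
    rw [pl' _ (hne _ _ h4)]
    exact ⟨h4, h5, h6⟩
  · intro c hc hf hi
    obtain ⟨h4, h5, h6⟩ := H.hollow1 c (dd c hc) hf hi
    dsimp only
    rw [pl' _ (hne _ _ h4), Function.update_of_ne (hne _ _ h4)]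
    exact ⟨h4, h5, h6⟩
  · intro c hc hf hi
    obtain ⟨h4, h5, h6⟩ := H.hollow2 c (dd c hc) hf hi
    dsimp only
    rw [pl' _ (hne _ _ h4), Function.update_of_ne (hne _ _ h4)]
    exact ⟨h4, h5, h6⟩
  · intro c p hc
    by_cases h1 : c = z
    · subst h1; simp at hc
    · rw [pl' c h1] at hc
      obtain ⟨h4, h5, h6⟩ := H.kid c p hc
      refine ⟨?_, h5, h6⟩
      by_cases h2 : p = z
      · subst h2; simp
      · rwa [pl' p h2]

/-- Remove a root or a waiting node; its children become waiting nodes. -/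
theorem HInv.remove {z : ℕ} {L' L₁ : List ℕ} {A' : ℕ → ℕ} {cr' : ℕ → ℕ}
    (H : HInv n h fr pl cr L')
    (hz : (pl z = .root ∧ A' = Function.update h.A (h.rank z) 0 ∧ L' = L) ∨
      (A' = h.A ∧ L' = z :: L))
    (hL₁ : L₁.Nodup) (hkid : ∀ c, c ∈ L₁ ↔ pl c = .kid z)
    (hcr : ∀ c, c ≠ z → cr c ≤ cr' c) (hcr2 : ∀ c, pl c = .kid z → 2 ≤ cr' c) :
    ∃ pl', HInv n { h with A := A' } fr pl' cr' (L₁ ++ L) ∧ pl' z = .dead ∧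
      ∀ c, c ≠ z → (pl' c = .dead ↔ pl c = .dead) := by
  classical
  have hsub : ∀ c, c ≠ z → (c ∈ L' ↔ c ∈ L) := by
    intro c hc
    rcases hz with ⟨-, -, rfl⟩ | ⟨-, rfl⟩ <;> simp [hc]
  have hzL : z ∉ L := by
    rcases hz with ⟨h1, -, rfl⟩ | ⟨-, rfl⟩
    · intro hm
      have := (H.stk z).2 hm
      rw [h1] at this; cases this
    · exact (List.nodup_cons.1 H.nodup).1
  have hzk : ∀ p, pl z ≠ .kid p := by
    intro p hp
    rcases hz with ⟨h1, -, rfl⟩ | ⟨-, rfl⟩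
    · rw [h1] at hp; cases hp
    · rw [(H.stk z).2 (by simp)] at hp; cases hp
  set pl' : ℕ → Place := fun c => if c = z then .dead else if pl c = .kid z then .stk else pl c
    with hpl'
  have plz : pl' z = .dead := by simp [hpl']
  have plk : ∀ c, pl c = .kid z → pl' c = .stk := by
    intro c hc
    have : c ≠ z := by rintro rfl; exact hzk _ hc
    simp [hpl', this, hc]
  have plo : ∀ c, c ≠ z → pl c ≠ .kid z → pl' c = pl c := by
    intro c h1 h2; simp [hpl', h1, h2]
  have hdd : ∀ c, c ≠ z → (pl' c = .dead ↔ pl c = .dead) := by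
    intro c hc
    by_cases h1 : pl c = .kid z
    · rw [plk c h1, h1]; simp
    · rw [plo c hc h1]
  have dd : ∀ c, pl' c ≠ .dead → c ≠ z ∧ pl c ≠ .dead := by
    intro c hc
    have h1 : c ≠ z := by rintro rfl; exact hc plz
    exact ⟨h1, fun h2 => hc ((hdd c h1).2 h2)⟩
  have hkk : ∀ c p, p ≠ z → pl c = .kid p → pl' c = .kid p := by
    intro c p hp hc
    rw [plo c, hc]
    · rintro rfl; exact hzk _ hc
    · rw [hc]; simpa using hp
  refine ⟨pl', ?_, plz, hdd⟩
  constructor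
  · exact fun c hc => H.node c (dd c hc).2
  · intro r hr
    have hr' : h.A r ≠ 0 ∧ A' r = h.A r := by
      rcases hz with ⟨-, rfl, -⟩ | ⟨rfl, -⟩
      · by_cases e : r = h.rank z
        · simp [e] at hr
        · simp only [Function.update_of_ne e] at hr; simp [hr, e]
      · exact ⟨hr, rfl⟩
    obtain ⟨h1, h2⟩ := H.rootA r hr'.1
    dsimp only at hr ⊢
    rw [hr'.2]
    refine ⟨?_, h2⟩
    rw [plo, h1]
    · intro e
      rcases hz with ⟨-, rfl, -⟩ | ⟨-, rfl⟩
      · rw [e] at h2; rw [h2] at hr; simp at hr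
      · rw [e, (H.stk z).2 (by simp)] at h1; cases h1
    · rw [h1]; simp
  · intro c hc
    obtain ⟨h1, h2⟩ := dd c (by simp [hc])
    have h3 : pl c ≠ .kid z := by intro e; rw [plk c e] at hc; cases hc
    rw [plo c h1 h3] at hc
    obtain ⟨h4, h5, h6⟩ := H.root c hc
    refine ⟨?_, h5, h6.trans (hcr c h1)⟩
    rcases hz with ⟨h7, rfl, -⟩ | ⟨rfl, -⟩
    · have : h.rank c ≠ h.rank z := by
        intro e; rw [e, (H.root z h7).1] at h4; exact h1 h4.symm
      simpa [this] using h4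
    · exact h4
  · intro c
    rw [List.mem_append, hkid]
    by_cases h1 : c = z
    · subst h1; rw [plz]; simp [hzk, hzL]
    by_cases h2 : pl c = .kid z
    · simp [plk c h2, h2]
    · rw [plo c h1 h2, H.stk, hsub c h1]; simp [h2]
  · rw [List.nodup_append]
    refine ⟨hL₁, ?_, ?_⟩
    · rcases hz with ⟨-, -, rfl⟩ | ⟨-, rfl⟩
      · exact H.nodup
      · exact (List.nodup_cons.1 H.nodup).2
    · rintro a ha b hb rfl
      have h1 := (hkid a).1 ha
      have h2 : a ≠ z := by rintro rfl; exact hzL hb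
      have := (H.stk a).2 ((hsub a h2).2 hb)
      rw [h1] at this; cases this
  · intro c hc
    rcases List.mem_append.1 hc with h1 | h1
    · exact hcr2 c ((hkid c).1 h1)
    · have h2 : c ≠ z := by rintro rfl; exact hzL h1
      exact (H.stk_cr c ((hsub c h2).2 h1)).trans (hcr c h2)
  · intro c i hc hf hi
    obtain ⟨h1, h2⟩ := dd c hc
    obtain ⟨h4, h5, h6⟩ := H.full c i h2 hf hi
    exact ⟨hkk _ _ h1 h4, h5, h6⟩
  · intro c hc hf hi
    obtain ⟨h1, h2⟩ := dd c hc
    obtain ⟨h4, h5, h6, h7⟩ := H.hollow1 c h2 hf hi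
    exact ⟨hkk _ _ h1 h4, h5, h6, h7.trans (hcr _ (by intro e; exact hzk _ (e ▸ h4)))⟩
  · intro c hc hf hi
    obtain ⟨h1, h2⟩ := dd c hc
    obtain ⟨h4, h5, h6, h7⟩ := H.hollow2 c h2 hf hi
    exact ⟨hkk _ _ h1 h4, h5, h6, h7.trans (hcr _ (by intro e; exact hzk _ (e ▸ h4)))⟩
  · intro c p hc
    obtain ⟨h1, h2⟩ := dd c (by simp [hc])
    have h3 : pl c ≠ .kid z := by intro e; rw [plk c e] at hc; cases hc
    rw [plo c h1 h3] at hc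
    obtain ⟨h4, h5, h6⟩ := H.kid c p hc
    have hp : p ≠ z := by rintro rfl; exact h3 hc
    exact ⟨fun e => h4 ((hdd p hp).1 e), h5, h6⟩

/-- Create a node for a new item. -/
theorem HInv.insert {y : ℕ} {κ : ℝ} (H : HInv n h fr pl cr []) (hy : y < n) (hc : h.cur y = 0) :
    HInv n { h with item := Function.update h.item (fr + 1) y
                    rank := Function.update h.rank (fr + 1) 0
                    key := Function.update h.key (fr + 1) κ
                    cur := Function.update h.cur y (fr + 1) } (fr + 1)
      (Function.update pl (fr + 1) .stk) (Function.update cr (fr + 1) 2) [fr + 1] := by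
  have hd : pl (fr + 1) = .dead := by
    by_contra h1
    have := (H.node _ h1).2.1
    omega
  set pl' := Function.update pl (fr + 1) .stk with hpl'
  have plz : pl' (fr + 1) = .stk := by simp [hpl']
  have plo : ∀ c, c ≠ fr + 1 → pl' c = pl c := by intro c hc; simp [hpl', hc]
  have dd : ∀ c, c ≠ fr + 1 → pl' c ≠ .dead → pl c ≠ .dead := by
    intro c h1 h2; rwa [plo c h1] at h2
  have hk : ∀ c p, pl c = .kid p → c ≠ fr + 1 := by
    rintro c p h1 rfl; rw [hd] at h1; cases h1
  have hF : ∀ c, c ≠ fr + 1 → pl c ≠ .dead →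
      (Function.update h.cur y (fr + 1) (Function.update h.item (fr + 1) y c) = c ↔ h.Full c) := by
    intro c h1 h2
    rw [Function.update_of_ne h1]
    unfold Heap.Full
    by_cases e : h.item c = y
    · have := (H.node c h2).1
      rw [e, Function.update_self, hc]
      omega
    · rw [Function.update_of_ne e]
  have hnk : ∀ c, pl c ≠ .kid (fr + 1) := by
    intro c h1; exact (H.kid c _ h1).1 hd
  constructor
  · intro c h1
    by_cases e : c = fr + 1
    · subst e; simp [hy]
    · have := H.node c (dd c e h1)
      simp only [Function.update_of_ne e]
      omega
  · intro r hr
    obtain ⟨h1, h2⟩ := H.rootA r hr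
    have h3 : h.A r ≠ fr + 1 := by intro e; rw [e, hd] at h1; cases h1
    dsimp only
    rw [plo _ h3, Function.update_of_ne h3]
    exact ⟨h1, h2⟩
  · intro c h1
    have e : c ≠ fr + 1 := by rintro rfl; rw [plz] at h1; cases h1
    rw [plo c e] at h1
    obtain ⟨h2, h3, h4⟩ := H.root c h1
    dsimp only
    rw [Function.update_of_ne e, Function.update_of_ne e]
    exact ⟨h2, (hF c e (by simp [h1])).2 h3, h4⟩
  · intro c
    by_cases e : c = fr + 1
    · subst e; simp [plz]
    · rw [plo c e, H.stk]; simp [e]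
  · simp
  · intro c h1
    have : c = fr + 1 := by simpa using h1
    subst this; simp
  · intro c i h1 hf hi
    by_cases e : c = fr + 1
    · subst e; simp at hi
    have h2 := dd c e h1
    have hf' := (hF c e h2).1 hf
    simp only [Function.update_of_ne e] at hi ⊢
    obtain ⟨h4, h5, h6⟩ := H.full c i h2 hf' hi
    have e' := hk _ _ h4
    rw [plo _ e', Function.update_of_ne e', Function.update_of_ne e']
    exact ⟨h4, h5, h6⟩
  · intro c h1 hf hi
    by_cases e : c = fr + 1
    · subst e; simp at hi
    have h2 := dd c e h1
    have hf' := (not_congr (hF c e h2)).1 hf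
    simp only [Function.update_of_ne e] at hi ⊢
    obtain ⟨h4, h5, h6, h7⟩ := H.hollow1 c h2 hf' hi
    have e' := hk _ _ h4
    rw [plo _ e', Function.update_of_ne e', Function.update_of_ne e', Function.update_of_ne e']
    exact ⟨h4, h5, h6, h7⟩
  · intro c h1 hf hi
    by_cases e : c = fr + 1
    · subst e; simp at hi
    have h2 := dd c e h1
    have hf' := (not_congr (hF c e h2)).1 hf
    simp only [Function.update_of_ne e] at hi ⊢
    obtain ⟨h4, h5, h6, h7⟩ := H.hollow2 c h2 hf' hi
    have e' := hk _ _ h4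
    rw [plo _ e', Function.update_of_ne e', Function.update_of_ne e', Function.update_of_ne e']
    exact ⟨h4, h5, h6, h7⟩
  · intro c p h1
    have e : c ≠ fr + 1 := by rintro rfl; rw [plz] at h1; cases h1
    rw [plo c e] at h1
    obtain ⟨h4, h5, h6⟩ := H.kid c p h1
    have e' : p ≠ fr + 1 := by rintro rfl; exact hnk c h1
    have hF' := hF p e' h4
    dsimp only
    rw [plo p e', Function.update_of_ne e, Function.update_of_ne e', Function.update_of_ne e']
    exact ⟨h4, fun hf => h5 (hF'.1 hf), fun hf => h6 (fun h => hf (hF'.2 h))⟩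

/-- Decrease the key of a root. -/
theorem HInv.decrease_root {u : ℕ} {κ : ℝ} (H : HInv n h fr pl cr L) (hu : pl u = .root)
    (hκ : κ ≤ h.key u) :
    HInv n { h with key := Function.update h.key u κ } fr pl cr L := by
  have hk : ∀ c p, pl c = .kid p → c ≠ u := by
    rintro c p h1 rfl; rw [hu] at h1; cases h1
  have hle : ∀ c, Function.update h.key u κ c ≤ h.key c := by
    intro c
    by_cases e : c = u
    · subst e; simpa using hκ
    · rw [Function.update_of_ne e]
  refine ⟨H.node, H.rootA, H.root, H.stk, H.nodup, H.stk_cr, ?_, ?_, ?_, H.kid⟩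
  · intro c i h1 hf hi
    obtain ⟨h4, h5, h6⟩ := H.full c i h1 hf hi
    refine ⟨h4, h5, ?_⟩
    dsimp only
    rw [Function.update_of_ne (hk _ _ h4)]
    exact (hle c).trans h6
  · intro c h1 hf hi
    obtain ⟨h4, h5, h6, h7⟩ := H.hollow1 c h1 hf hi
    refine ⟨h4, h5, ?_, h7⟩
    dsimp only
    rw [Function.update_of_ne (hk _ _ h4)]
    exact (hle c).trans h6
  · intro c h1 hf hi
    obtain ⟨h4, h5, h6, h7⟩ := H.hollow2 c h1 hf hi
    refine ⟨h4, h5, ?_, h7⟩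
    dsimp only
    rw [Function.update_of_ne (hk _ _ h4)]
    exact (hle c).trans h6

/-- Decrease the key of an item whose node `u` is not a root: `u` becomes hollow and keeps its two
children of highest rank, the others go to a new node. -/
theorem HInv.decrease {y u r c₁ c₂ : ℕ} {κ : ℝ} (H : HInv n h fr pl cr []) (hu : h.cur y = u)
    (hy : h.Has pl y) (hnr : pl u ≠ .root) (hr : h.rank u = r)
    (hc₁ : c₁ = h.ch (y + n * (r - 1))) (hc₂ : c₂ = h.ch (y + n * (r - 2)))
    (hκ : κ ≤ h.key u) :
    ∃ pl', HInv n { h with item := Function.update h.item (fr + 1) y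
                           rank := Function.update h.rank (fr + 1) (r - 2)
                           key := Function.update h.key (fr + 1) κ
                           k1 := Function.update h.k1 u c₁
                           k2 := Function.update h.k2 u c₂
                           cur := Function.update h.cur y (fr + 1) } (fr + 1) pl'
      (Function.update (Function.update (Function.update cr c₁ 2) c₂ 2) (fr + 1) 2) [fr + 1] ∧
      pl' (fr + 1) = .stk ∧ ∀ c, c ≠ fr + 1 → (pl' c = .dead ↔ pl c = .dead) := by
  classical
  have hd : pl (fr + 1) = .dead := by
    by_contra h1
    have := (H.node _ h1).2.1
    omega
  obtain ⟨hyd, hyi⟩ := hy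
  rw [hu] at hyd hyi
  have hfu : h.Full u := by unfold Heap.Full; rw [hyi, hu]
  have hyn : y < n := by rw [← hyi]; exact (H.node u hyd).2.2
  have huz : u ≠ fr + 1 := by rintro rfl; exact hyd hd
  set z := fr + 1 with hz
  -- The children of rank below r - 2 move from `u` to the new node without any write to `ch`: they
  -- stay in the row of the item `y`, which the new full node inherits.
  set pl' : ℕ → Place := fun c => if c = z then .stk else
    if pl c = .kid u ∧ h.rank c < r - 2 then .kid z else pl c with hpl'
  have plz : pl' z = .stk := by simp [hpl']
  have plk : ∀ c, c ≠ z → pl c = .kid u → h.rank c < r - 2 → pl' c = .kid z := by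
    intro c h1 h2 h3; simp [hpl', h1, h2, h3]
  have plo : ∀ c, c ≠ z → (pl c ≠ .kid u ∨ r - 2 ≤ h.rank c) → pl' c = pl c := by
    intro c h1 h2
    have : ¬ (pl c = .kid u ∧ h.rank c < r - 2) := by
      rintro ⟨h3, h4⟩
      rcases h2 with h2 | h2
      · exact h2 h3
      · omega
    simp [hpl', h1, this]
  have hdd : ∀ c, c ≠ z → (pl' c = .dead ↔ pl c = .dead) := by
    intro c hc
    by_cases h1 : pl c = .kid u ∧ h.rank c < r - 2
    · rw [plk c hc h1.1 h1.2, h1.1]; simp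
    · rw [plo c hc (by by_contra! h9; exact h1 ⟨h9.1, h9.2⟩)]
  have dd : ∀ c, c ≠ z → pl' c ≠ .dead → pl c ≠ .dead := by
    intro c h1 h2 h3; exact h2 ((hdd c h1).2 h3)
  have hk : ∀ c p, pl c = .kid p → c ≠ z := by
    rintro c p h1 rfl; rw [hd] at h1; cases h1
  have hnk : ∀ c, pl c ≠ .kid z := by
    intro c h1; exact (H.kid c _ h1).1 hd
  have hF : ∀ c, c ≠ z → c ≠ u → pl c ≠ .dead →
      (Function.update h.cur y z (Function.update h.item z y c) = c ↔ h.Full c) := by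
    intro c h1 h3 h2
    rw [Function.update_of_ne h1]
    unfold Heap.Full
    by_cases e : h.item c = y
    · rw [e, Function.update_self, hu]
      exact ⟨fun h => absurd h.symm h1, fun h => absurd h.symm h3⟩
    · rw [Function.update_of_ne e]
  have hFu : ¬ Function.update h.cur y z (Function.update h.item z y u) = u := by
    rw [Function.update_of_ne huz, hyi, Function.update_self]; exact fun h => huz h.symm
  have hFz : Function.update h.cur y z (Function.update h.item z y z) = z := by simp
  have hcr : ∀ c v, c ≠ z → v ≤ 2 → v ≤ cr c →
      v ≤ Function.update (Function.update (Function.update cr c₁ 2) c₂ 2) z 2 c := by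
    intro c v h1 h2 h3
    rw [Function.update_of_ne h1]
    by_cases e : c = c₂
    · subst e; simpa using h2
    rw [Function.update_of_ne e]
    by_cases e : c = c₁
    · subst e; simpa using h2
    rwa [Function.update_of_ne e]
  have hrow := fun i (hi : i < r) => H.full u i hyd hfu (by omega)
  rw [hyi] at hrow
  refine ⟨pl', ?_, plz, hdd⟩
  constructor
  · intro c h1
    by_cases e : c = z
    · subst e; simp [hyn]; omega
    · have := H.node c (dd c e h1)
      simp only [Function.update_of_ne e]
      omega
  · intro q hq
    obtain ⟨h1, h2⟩ := H.rootA q hq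
    have h3 : h.A q ≠ z := by intro e; rw [e, hd] at h1; cases h1
    dsimp only
    rw [plo _ h3 (by simp [h1]), Function.update_of_ne h3]
    exact ⟨h1, h2⟩
  · intro c h1
    have e : c ≠ z := by rintro rfl; rw [plz] at h1; cases h1
    have h2 : ¬ (pl c = .kid u ∧ h.rank c < r - 2) := by
      rintro ⟨h2, h3⟩; rw [plk c e h2 h3] at h1; cases h1
    rw [plo c e (by by_contra! h9; exact h2 ⟨h9.1, h9.2⟩)] at h1
    obtain ⟨h2, h3, h4⟩ := H.root c h1
    have e2 : c ≠ u := by rintro rfl; exact hnr h1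
    dsimp only
    rw [Function.update_of_ne e]
    exact ⟨h2, (hF c e e2 (by simp [h1])).2 h3, hcr c 1 e (by norm_num) h4⟩
  · intro c
    by_cases e : c = z
    · subst e; simp [plz]
    · simp only [List.mem_singleton, e, iff_false]
      intro h1
      by_cases h2 : pl c = .kid u ∧ h.rank c < r - 2
      · rw [plk c e h2.1 h2.2] at h1; cases h1
      · rw [plo c e (by by_contra! h9; exact h2 ⟨h9.1, h9.2⟩), H.stk] at h1; simp at h1
  · simp
  · intro c h1
    have : c = z := by simpa using h1
    subst this; simp
  · intro c i h1 hf hi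
    by_cases e : c = z
    · subst e
      simp only [Function.update_self] at hi ⊢
      obtain ⟨h4, h5, h6⟩ := hrow i (by omega)
      have e' := hk _ _ h4
      rw [plk _ e' h4 (by omega), Function.update_of_ne e', Function.update_of_ne e']
      exact ⟨rfl, h5, hκ.trans h6⟩
    have h2 := dd c e h1
    have e2 : c ≠ u := by rintro rfl; exact hFu hf
    have hf' := (hF c e e2 h2).1 hf
    simp only [Function.update_of_ne e] at hi ⊢
    obtain ⟨h4, h5, h6⟩ := H.full c i h2 hf' hi
    have e' := hk _ _ h4
    rw [plo _ e' (by simp [h4, e2]), Function.update_of_ne e', Function.update_of_ne e']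
    exact ⟨h4, h5, h6⟩
  · intro c h1 hf hi
    by_cases e : c = z
    · subst e; exact absurd hFz hf
    have h2 := dd c e h1
    simp only [Function.update_of_ne e] at hi ⊢
    by_cases e2 : c = u
    · subst e2
      obtain ⟨h4, h5, h6⟩ := hrow (r - 1) (by omega)
      rw [← hc₁] at h4 h5 h6
      have e' := hk _ _ h4
      rw [Function.update_self, plo _ e' (by omega), Function.update_of_ne e',
        Function.update_of_ne e', Function.update_of_ne e']
      refine ⟨h4, by omega, h6, ?_⟩
      -- For r = 1 the truncated subtraction makes both children the same node.
      by_cases e3 : c₁ = c₂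
      · rw [e3]; simp
      · rw [Function.update_of_ne e3]; simp
    have hf' := (not_congr (hF c e e2 h2)).1 hf
    obtain ⟨h4, h5, h6, h7⟩ := H.hollow1 c h2 hf' hi
    have e' := hk _ _ h4
    rw [Function.update_of_ne e2, plo _ e' (by simp [h4, e2]), Function.update_of_ne e',
      Function.update_of_ne e']
    exact ⟨h4, h5, h6, hcr _ 2 e' le_rfl h7⟩
  · intro c h1 hf hi
    by_cases e : c = z
    · subst e; exact absurd hFz hf
    have h2 := dd c e h1
    simp only [Function.update_of_ne e] at hi ⊢
    by_cases e2 : c = u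
    · subst e2
      obtain ⟨h4, h5, h6⟩ := hrow (r - 2) (by omega)
      rw [← hc₂] at h4 h5 h6
      have e' := hk _ _ h4
      rw [Function.update_self, plo _ e' (by omega), Function.update_of_ne e',
        Function.update_of_ne e', Function.update_of_ne e']
      exact ⟨h4, by omega, h6, by simp⟩
    have hf' := (not_congr (hF c e e2 h2)).1 hf
    obtain ⟨h4, h5, h6, h7⟩ := H.hollow2 c h2 hf' hi
    have e' := hk _ _ h4
    rw [Function.update_of_ne e2, plo _ e' (by simp [h4, e2]), Function.update_of_ne e',
      Function.update_of_ne e']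
    exact ⟨h4, h5, h6, hcr _ 2 e' le_rfl h7⟩
  · intro c p h1
    have e : c ≠ z := by rintro rfl; rw [plz] at h1; cases h1
    by_cases hcu : pl c = .kid u
    · have h7 := (H.kid c u hcu).2.1 hfu
      rw [hyi, hr] at h7
      by_cases hlow : h.rank c < r - 2
      · rw [plk c e hcu hlow] at h1
        cases h1
        rw [plz]
        refine ⟨by simp, fun _ => ?_, fun hf => absurd hFz hf⟩
        simp [Function.update_of_ne e, hlow, h7.2]
      · rw [plo c e (by omega), hcu] at h1
        cases h1
        refine ⟨fun h => hyd ((hdd u huz).1 h), fun hf => absurd hf hFu, fun _ => ?_⟩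
        simp only [Function.update_of_ne huz, Function.update_self, hr]
        rcases (by omega : h.rank c = r - 1 ∨ (h.rank c = r - 2 ∧ 2 ≤ r)) with h8 | h8
        · left; rw [hc₁, ← h8]; exact ⟨by omega, h7.2⟩
        · right; rw [hc₂, ← h8.1]; exact ⟨h8.2, h7.2⟩
    · rw [plo c e (.inl hcu)] at h1
      obtain ⟨h4, h5, h6⟩ := H.kid c p h1
      have e' : p ≠ z := by rintro rfl; exact hnk c h1
      have e2 : p ≠ u := by rintro rfl; exact hcu h1
      have hF' := hF p e' e2 h4
      dsimp only
      rw [Function.update_of_ne e, Function.update_of_ne e', Function.update_of_ne e',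
        Function.update_of_ne e2, Function.update_of_ne e2]
      exact ⟨fun h => h4 ((hdd p e').1 h), fun hf => h5 (hF'.1 hf),
        fun hf => h6 (fun h => hf (hF'.2 h))⟩

end

/-! ### Heap programs

Arrays of the search program: `0` root, `1` number of ranks, `2` last discovered vertex, `3` flag
for exhaustion, `4` discovered vertices, `5` parents, `6` positions in the adjacency lists, `7` and
`8` lists of vertices that wait at a common neighbour, `9`-`15` the heap, `16` and `17` a stack,
`18` number of heap nodes, `19`-`26` local variables. Real arrays: `0` distances, `1` keys,
`2` a local variable. -/

/-- A variable is the first cell of an array. -/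
abbrev WExpr.var (a : ℕ) : WExpr := .cell a (.lit 0)

/-- Assignment to a variable. -/
abbrev Prog.assign (a : ℕ) (x : WExpr) : Prog := .setW a (.lit 0) x

/-- The heap in the memory. -/
def heapOf (E : Env) (s : State) : Heap where
  item := arr E s 10
  rank := arr E s 11
  k1 := arr E s 12
  k2 := arr E s 13
  ch := arr E s 14
  cur := arr E s 9
  A := arr E s 15
  key := s.reals 1

/-- The word arrays outside the list `l` are the same in both states. -/
def Frame (E : Env) (l : List ℕ) (s s' : State) : Prop := ∀ a, a ∉ l → arr E s' a = arr E s a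

theorem Frame.refl (E : Env) (l : List ℕ) (s : State) : Frame E l s s := fun _ _ => rfl

theorem Frame.trans {E : Env} {l : List ℕ} {s s' s'' : State} (h : Frame E l s s')
    (h' : Frame E l s' s'') : Frame E l s s'' := fun a ha => (h' a ha).trans (h a ha)

theorem Frame.mono {E : Env} {l l' : List ℕ} {s s' : State} (h : Frame E l s s')
    (hl : l ⊆ l') : Frame E l' s s' := fun a ha => h a (fun h => ha (hl h))

/-- Exchange the nodes in the variables `19` and `25` if the key of the second one is smaller. -/
def swapProg : Prog :=
  .branch (.rlt (.cell 1 (.var 25)) (.cell 1 (.var 19)))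
    (.seq (.assign 26 (.var 19)) (.seq (.assign 19 (.var 25)) (.assign 25 (.var 26)))) .skip

/-- One link: the tree of the node `19` and the root of rank `20`. -/
def linkProg : Prog :=
  .seq (.assign 25 (.cell 15 (.var 20))) <|
  .seq (.setW 15 (.var 20) (.lit 0)) <|
  .seq swapProg <|
  .seq (.setW 14 (.op .add (.cell 10 (.var 19)) (.op .mul .order (.var 20))) (.var 25)) <|
  .seq (.assign 20 (.op .add (.var 20) (.lit 1)))
    (.setW 11 (.var 19) (.var 20))

/-- Make the node in variable `19` a root. -/
def addRoot : Prog :=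
  .seq (.assign 20 (.cell 11 (.var 19))) <|
  .seq (.loop (.neg (.weq (.cell 15 (.var 20)) (.lit 0))) linkProg)
    (.setW 15 (.var 20) (.var 19))

/-- The numbers that occur fit into words; `β` bounds the ranks. -/
structure Fits (E : Env) (n β : ℕ) : Prop where
  order : E.order = n
  pos : 1 ≤ n
  beta : 4 ≤ β
  nodes : ∀ fr, fr ≤ 2 * n ^ 2 + 2 * n + 2 → 2 * Nat.log 2 fr + 3 ≤ β
  word : 100 * (n + β + 1) ^ 2 ≤ 2 ^ E.wordBits

section

variable {E : Env} {n β fr : ℕ} {s : State} {pl : ℕ → Place} {cr : ℕ → ℕ} {L : List ℕ}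

theorem Fits.lt (F : Fits E n β) {x : ℕ} (hx : x ≤ 99 * (n + β + 1) ^ 2) :
    x < 2 ^ E.wordBits := by
  have := F.word
  have h2 : 0 < (n + β + 1) ^ 2 := by positivity
  nlinarith

theorem Fits.lt' (F : Fits E n β) {x : ℕ} (hx : x ≤ 99 * (n + β + 1)) :
    x < 2 ^ E.wordBits := F.lt (by nlinarith)

theorem swapProg_spec {Q : ℕ → State → Prop} {z t : ℕ} (hz : arr E s 19 0 = z)
    (ht : arr E s 25 0 = t)
    (hQ : ∀ s' a b, (a = z ∧ b = t ∨ a = t ∧ b = z) → s.reals 1 a ≤ s.reals 1 b →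
      arr E s' 19 0 = a → arr E s' 25 0 = b → Frame E [19, 25, 26] s s' → s'.reals = s.reals →
      ∀ c ≤ 30, Q c s') :
    WP E swapProg s Q := by
  have hzm : z % 2 ^ E.wordBits = z := by rw [← hz]; simp
  have htm : t % 2 ^ E.wordBits = t := by rw [← ht]; simp
  unfold swapProg
  rw [WP_branch]
  constructor
  · intro hb
    simp only [holds_rlt, reval_cell, eval_cell, eval_lit, Nat.zero_mod, hz, ht] at hb
    simp only [WP_seq, WP_setW]
    refine hQ _ t z (.inr ⟨rfl, rfl⟩) hb.le ?_ ?_ ?_ ?_ _ ?_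
    · simp [arr_setW, ht, htm]
    · simp [arr_setW, hz, hzm]
    · intro a ha
      simp only [List.mem_cons, List.not_mem_nil, or_false, not_or] at ha
      simp [arr_setW, ha]
    · rfl
    · simp
  · intro hb
    simp only [holds_rlt, reval_cell, eval_cell, eval_lit, Nat.zero_mod, hz, ht, not_lt] at hb
    simp only [WP_skip]
    exact hQ _ z t (.inl ⟨rfl, rfl⟩) hb hz ht (Frame.refl _ _ _) rfl _ (by simp)

/-- The node with the larger key becomes a child of a full node and needs no credit there. Of the
three credits of the two nodes, the winner keeps two because it is waiting again, and the third pays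
for the link. -/
theorem link_spec (F : Fits E n β) (hfr : fr ≤ 2 * n ^ 2 + 2 * n + 2) {z : ℕ}
    (H : HInv n (heapOf E s) fr pl cr (z :: L)) (hz : arr E s 19 0 = z)
    (hf : (heapOf E s).Full z) (hr : arr E s 20 0 = arr E s 11 z)
    (hA : arr E s 15 (arr E s 20 0) ≠ 0) {Q : ℕ → State → Prop}
    (hQ : ∀ s' pl' cr' a c, HInv n (heapOf E s') fr pl' cr' (a :: L) → arr E s' 19 0 = a →
      (heapOf E s').Full a → arr E s' 20 0 = arr E s' 11 a →
      (∀ c, pl' c = .dead ↔ pl c = .dead) → credits fr cr' + 1 ≤ credits fr cr →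
      Frame E [11, 14, 15, 19, 20, 25, 26] s s' → s'.reals = s.reals → c ≤ 100 → Q c s') :
    WP E linkProg s Q := by
  set r := arr E s 20 0 with hrdef
  set t := arr E s 15 r with ht
  obtain ⟨hpt, hrt⟩ := H.rootA r hA
  change pl t = .root at hpt
  change (heapOf E s).rank t = r at hrt
  have hzs := (H.stk z).2 (by simp)
  have hzt : z ≠ t := by rintro rfl; rw [hzs] at hpt; cases hpt
  have hfit := F.lt' (x := 1) (by omega)
  unfold linkProg
  simp only [WP_seq, WP_setW]
  refine swapProg_spec (z := z) (t := t) ?_ ?_ ?_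
  · simp [arr_setW, hz]
  · have : t % 2 ^ E.wordBits = t := by rw [ht]; simp
    simp [arr_setW, ← hrdef, ← ht, this]
  intro s' a b hab hkey ha hb hfr' hre c hc
  have hab' : a ≠ b := by rcases hab with ⟨rfl, rfl⟩ | ⟨rfl, rfl⟩ <;> [exact hzt; exact hzt.symm]
  have hra : (heapOf E s).rank a = r := by
    rcases hab with ⟨rfl, rfl⟩ | ⟨rfl, rfl⟩
    · exact hr.symm
    · exact hrt
  have hrb : (heapOf E s).rank b = r := by
    rcases hab with ⟨rfl, rfl⟩ | ⟨rfl, rfl⟩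
    · exact hrt
    · exact hr.symm
  have hfa : (heapOf E s).Full a := by
    rcases hab with ⟨rfl, rfl⟩ | ⟨rfl, rfl⟩
    · exact hf
    · exact (H.root _ hpt).2.1
  have hda : pl a ≠ .dead := by
    rcases hab with ⟨rfl, rfl⟩ | ⟨rfl, rfl⟩ <;> simp [hzs, hpt]
  have hdb : pl b ≠ .dead := by
    rcases hab with ⟨rfl, rfl⟩ | ⟨rfl, rfl⟩ <;> simp [hzs, hpt]
  have key := H.link hab' (L := L) (r := r) (by
    rcases hab with ⟨rfl, rfl⟩ | ⟨rfl, rfl⟩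
    · exact .inl ⟨rfl, hpt⟩
    · exact .inr ⟨rfl, hpt⟩) hfa hra hrb hkey
  have hrβ : r ≤ β := by
    have h1 := H.rank_le hda
    have h2 := F.nodes fr hfr
    omega
  have hin : arr E s 10 a < n := (H.node a hda).2.2
  have h10 : arr E s' 10 = arr E s 10 := by rw [hfr' 10 (by simp)]; simp [arr_setW]
  have h20 : arr E s' 20 = arr E s 20 := by rw [hfr' 20 (by simp)]; simp [arr_setW]
  have h11 : arr E s' 11 = arr E s 11 := by rw [hfr' 11 (by simp)]; simp [arr_setW]
  have h14 : arr E s' 14 = arr E s 14 := by rw [hfr' 14 (by simp)]; simp [arr_setW]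
  have h15 : arr E s' 15 = Function.update (arr E s 15) r 0 := by
    rw [hfr' 15 (by simp)]; simp [arr_setW, ← hrdef]
  have h9 : arr E s' 9 = arr E s 9 := by rw [hfr' 9 (by simp)]; simp [arr_setW]
  have h12 : arr E s' 12 = arr E s 12 := by rw [hfr' 12 (by simp)]; simp [arr_setW]
  have h13 : arr E s' 13 = arr E s 13 := by rw [hfr' 13 (by simp)]; simp [arr_setW]
  have hm1 : n % 2 ^ E.wordBits = n := Nat.mod_eq_of_lt (F.lt' (by omega))
  have hm2 : (n * r) % 2 ^ E.wordBits = n * r := Nat.mod_eq_of_lt (F.lt (by nlinarith))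
  have hm3 : (arr E s 10 a + n * r) % 2 ^ E.wordBits = arr E s 10 a + n * r :=
    Nat.mod_eq_of_lt (F.lt (by nlinarith))
  have hm4 : (r + 1) % 2 ^ E.wordBits = r + 1 := Nat.mod_eq_of_lt (F.lt' (by omega))
  have hm5 : 1 % 2 ^ E.wordBits = 1 := Nat.mod_eq_of_lt hfit
  have hbN : b % 2 ^ E.wordBits = b := by rw [← hb]; simp
  refine hQ _ _ _ a _ (by convert key using 1; simp [heapOf, arr_setW, F.order, h9, h10, h11, h12, h13, h14, h15, h20, ha, hb, hre, hm1, hm2, hm3, hm4, hm5, ← hrdef, hbN]) ?_ ?_ ?_ ?_ ?_ ?_ ?_ ?_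
  · simp [arr_setW, ha]
  · simpa [heapOf, Heap.Full, arr_setW, h9, h10] using hfa
  · simp [arr_setW, ha, h20, ← hrdef, hm4, hm5]
  · intro c
    by_cases e1 : c = a
    · subst e1; simp [hda]
    by_cases e2 : c = b
    · subst e2; simp [e1, hdb]
    simp [e1, e2]
  -- The waiting node has at least two credits and the root at least one; two remain with `a`.
  · have h1 := credits_update (v := 0) cr (H.node b hdb).2.1
    have h2 := credits_update (v := 2) (Function.update cr b 0) (H.node a hda).2.1
    rw [Function.update_of_ne hab'] at h2
    have h3 := H.stk_cr z (by simp)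
    have h4 := (H.root t hpt).2.2
    rcases hab with ⟨rfl, rfl⟩ | ⟨rfl, rfl⟩ <;> omega
  · intro x hx
    simp only [List.mem_cons, List.not_mem_nil, or_false, not_or] at hx
    simp [arr_setW, hx, hfr' x]
  · simp [hre]
  · simp; omega

/-- A credit is worth 200 steps, and each round of the loop sets one free. The last node needs one
credit less as a root than as a waiting node, which covers the constant overhead; hence the surplus
of 100 in the postcondition. -/
theorem addRoot_spec (F : Fits E n β) (hfr : fr ≤ 2 * n ^ 2 + 2 * n + 2) {z : ℕ}
    (H : HInv n (heapOf E s) fr pl cr (z :: L)) (hz : arr E s 19 0 = z)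
    (hf : (heapOf E s).Full z) {Q : ℕ → State → Prop}
    (hQ : ∀ s' pl' cr' t, HInv n (heapOf E s') fr pl' cr' L →
      (∀ c, pl' c = .dead ↔ pl c = .dead) → t + 100 + 200 * credits fr cr' ≤ 200 * credits fr cr →
      Frame E [11, 14, 15, 19, 20, 25, 26] s s' → s'.reals = s.reals → Q t s') :
    WP E addRoot s Q := by
  unfold addRoot
  simp only [WP_seq, WP_setW]
  refine WP_loop (φ := 200 * credits fr cr)
    (fun s₁ φ => ∃ pl₁ cr₁ z₁, HInv n (heapOf E s₁) fr pl₁ cr₁ (z₁ :: L) ∧ arr E s₁ 19 0 = z₁ ∧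
      (heapOf E s₁).Full z₁ ∧ arr E s₁ 20 0 = arr E s₁ 11 z₁ ∧
      (∀ c, pl₁ c = .dead ↔ pl c = .dead) ∧ φ = 200 * credits fr cr₁ ∧
      Frame E [11, 14, 15, 19, 20, 25, 26] s s₁ ∧ s₁.reals = s.reals) ?_ ?_ ?_
  · rintro s₁ φ ⟨pl₁, cr₁, z₁, H₁, hz₁, hf₁, hr₁, hd₁, rfl, hfr₁, hre₁⟩ hb
    simp only [holds_neg, holds_weq, eval_cell, eval_lit, Nat.zero_mod] at hb
    refine link_spec F hfr H₁ hz₁ hf₁ hr₁ hb ?_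
    intro s₂ pl₂ cr₂ a c H₂ hz₂ hf₂ hr₂ hd₂ hc₂ hfr₂ hre₂ hc
    refine ⟨_, ⟨pl₂, cr₂, a, H₂, hz₂, hf₂, hr₂, fun c => (hd₂ c).trans (hd₁ c), rfl,
      hfr₁.trans hfr₂, hre₂.trans hre₁⟩, ?_⟩
    simp; omega
  · refine ⟨pl, cr, z, ?_, ?_, ?_, ?_, fun _ => Iff.rfl, rfl, ?_, rfl⟩
    · simpa [heapOf, arr_setW] using H
    · simp [arr_setW, hz]
    · simpa [heapOf, arr_setW] using hf
    · simp [arr_setW, hz]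
    · intro x hx
      simp only [List.mem_cons, List.not_mem_nil, or_false, not_or] at hx
      simp [arr_setW, hx]
  · rintro t s₁ φ ⟨pl₁, cr₁, z₁, H₁, hz₁, hf₁, hr₁, hd₁, rfl, hfr₁, hre₁⟩ hb ht
    simp only [holds_neg, holds_weq, eval_cell, eval_lit, Nat.zero_mod, not_not] at hb
    have hzs := (H₁.stk z₁).2 (by simp)
    have hm : z₁ % 2 ^ E.wordBits = z₁ := by rw [← hz₁]; simp
    have key := H₁.place hf₁ (by show arr E s₁ 15 (arr E s₁ 11 z₁) = 0; rw [← hr₁]; exact hb)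
    refine hQ _ _ _ _ (by convert key using 1; simp [heapOf, arr_setW, hz₁, hr₁, hm]) ?_ ?_ ?_ ?_
    · intro c
      rw [← hd₁]
      by_cases e : c = z₁
      · subst e; simp [hzs]
      · simp [e]
    · have h1 := credits_update (v := 1) cr₁ (H₁.node z₁ (by simp [hzs])).2.1
      have h2 := H₁.stk_cr z₁ (by simp)
      simp at ht ⊢; omega
    · refine hfr₁.trans ?_
      intro x hx
      simp only [List.mem_cons, List.not_mem_nil, or_false, not_or] at hx
      simp [arr_setW, hx]
    · simp [hre₁]

end

/-! ### Insertion and decrease of keys in constant amortized time -/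

/-- From `h` to `h'` the key of `y` is set to `κ` and nothing else changes. -/
def KeySet (h h' : Heap) (pl pl' : ℕ → Place) (y : ℕ) (κ : ℝ) : Prop :=
  (∀ y', y' ≠ y → h'.cur y' = h.cur y' ∧ (h'.Has pl' y' ↔ h.Has pl y') ∧
    (h.Has pl y' → h'.key (h'.cur y') = h.key (h.cur y'))) ∧
  h'.Has pl' y ∧ h'.key (h'.cur y) = κ

/-- Create a node for the item in variable `23` with the key in the real variable `2`. -/
def insertProg : Prog :=
  .seq (.assign 18 (.op .add (.var 18) (.lit 1))) <|
  .seq (.assign 19 (.var 18)) <|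
  .seq (.setW 10 (.var 19) (.var 23)) <|
  .seq (.setW 11 (.var 19) (.lit 0)) <|
  .seq (.setR 1 (.var 19) (.cell 2 (.lit 0))) <|
  .seq (.setW 9 (.var 23) (.var 19)) addRoot

/-- Replace the node in variable `25` of the item in variable `23`. -/
def replaceProg : Prog :=
  .seq (.setW 12 (.var 25) (.cell 14 (.op .add (.var 23)
    (.op .mul .order (.op .sub (.cell 11 (.var 25)) (.lit 1)))))) <|
  .seq (.setW 13 (.var 25) (.cell 14 (.op .add (.var 23)
    (.op .mul .order (.op .sub (.cell 11 (.var 25)) (.lit 2)))))) <|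
  .seq (.assign 18 (.op .add (.var 18) (.lit 1))) <|
  .seq (.assign 19 (.var 18)) <|
  .seq (.setW 10 (.var 19) (.var 23)) <|
  .seq (.setW 11 (.var 19) (.op .sub (.cell 11 (.var 25)) (.lit 2))) <|
  .seq (.setR 1 (.var 19) (.cell 2 (.lit 0))) <|
  .seq (.setW 9 (.var 23) (.var 19)) addRoot

/-- Decrease the key of the item in variable `23` to the real variable `2`. -/
def decreaseProg : Prog :=
  .seq (.assign 25 (.cell 9 (.var 23))) <|
  .branch (.weq (.cell 15 (.cell 11 (.var 25))) (.var 25))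
    (.setR 1 (.var 25) (.cell 2 (.lit 0))) replaceProg

/-- The word arrays that heap operations change. -/
abbrev heapArrays : List ℕ := [9, 10, 11, 12, 13, 14, 15, 18, 19, 20, 25, 26]

section

variable {E : Env} {n β fr : ℕ} {s : State} {pl : ℕ → Place} {cr : ℕ → ℕ}

theorem credits_update_le (fr c v : ℕ) (cr : ℕ → ℕ) :
    credits fr (Function.update cr c v) ≤ credits fr cr + v := by
  by_cases hc : c ≤ fr
  · have := credits_update (v := v) cr hc
    omega
  · refine le_trans (le_of_eq ?_) (Nat.le_add_right _ _)
    refine Finset.sum_congr rfl fun z hz => Function.update_of_ne ?_ _ _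
    have := Finset.mem_range.1 hz
    omega

theorem Fits.lt_nodes (F : Fits E n β) {x : ℕ} (hx : x ≤ 2 * n ^ 2 + 2 * n + 2) :
    x < 2 ^ E.wordBits := by
  refine F.lt (hx.trans ?_)
  have : n ^ 2 ≤ (n + β + 1) ^ 2 := Nat.pow_le_pow_left (by omega) 2
  have : n + β + 1 ≤ (n + β + 1) ^ 2 := Nat.le_self_pow (by norm_num) _
  omega

/-- Only the two credits of the new node are added. The requirement that `cur` be 0 at `y` says that
the item never had a node, so no other node becomes hollow. -/
theorem insert_spec (F : Fits E n β) (hfr : fr + 1 ≤ 2 * n ^ 2 + 2 * n + 2) {y : ℕ} {κ : ℝ}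
    (H : HInv n (heapOf E s) fr pl cr []) (hf18 : arr E s 18 0 = fr) (hy : arr E s 23 0 = y)
    (hyn : y < n) (hκ : s.reals 2 0 = κ) (hc : arr E s 9 y = 0) {Q : ℕ → State → Prop}
    (hQ : ∀ s' pl' cr' t, HInv n (heapOf E s') (fr + 1) pl' cr' [] → arr E s' 18 0 = fr + 1 →
      KeySet (heapOf E s) (heapOf E s') pl pl' y κ →
      t + 200 * credits (fr + 1) cr' ≤ 200 * credits fr cr + 1000 →
      Frame E heapArrays s s' → (∀ a, a ≠ 1 → s'.reals a = s.reals a) → Q t s') :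
    WP E insertProg s Q := by
  have hm : (fr + 1) % 2 ^ E.wordBits = fr + 1 := Nat.mod_eq_of_lt (F.lt_nodes hfr)
  have hm1 : 1 % 2 ^ E.wordBits = 1 := Nat.mod_eq_of_lt (F.lt' (by omega))
  have hmy : y % 2 ^ E.wordBits = y := Nat.mod_eq_of_lt (F.lt' (by omega))
  have hd : pl (fr + 1) = .dead := by
    by_contra h1
    have := (H.node _ h1).2.1
    omega
  have key := H.insert (y := y) (κ := κ) hyn hc
  unfold insertProg
  simp only [WP_seq, WP_setW, WP_setR]
  refine addRoot_spec F hfr (by convert key using 1; simp [heapOf, arr_setW, reals_setR, hm, hm1, hmy, hf18, hy, hκ]) ?_ ?_ ?_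
  · simp [arr_setW, hf18, hm1, hm]
  · simp [Heap.Full, heapOf, arr_setW, hf18, hm1, hm, hy, hmy]
  intro s' pl' cr' t H' hdd ht hfr' hre
  have h9 : arr E s' 9 = Function.update (arr E s 9) y (fr + 1) := by
    rw [hfr' 9 (by simp)]; simp [arr_setW, hf18, hm, hm1, hy]
  have h10 : arr E s' 10 = Function.update (arr E s 10) (fr + 1) y := by
    rw [hfr' 10 (by simp)]; simp [arr_setW, hf18, hm, hm1, hy, hmy]
  have h18 : arr E s' 18 0 = fr + 1 := by
    rw [hfr' 18 (by simp)]; simp [arr_setW, hf18, hm, hm1]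
  have hk : s'.reals 1 = Function.update (s.reals 1) (fr + 1) κ := by
    rw [hre]; simp [arr_setW, reals_setR, hf18, hm, hm1, hκ]
  refine hQ s' pl' cr' _ H' h18 ⟨?_, ?_, ?_⟩ ?_ ?_ ?_
  · intro y' hy'
    have e : (heapOf E s').cur y' = (heapOf E s).cur y' := by
      show arr E s' 9 y' = arr E s 9 y'
      rw [h9, Function.update_of_ne hy']
    rw [e]
    by_cases hz : (heapOf E s).cur y' = fr + 1
    · have : ¬ (heapOf E s).Has pl y' := by rintro ⟨h1, -⟩; rw [hz] at h1; exact h1 hd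
      have h2 : ¬ (heapOf E s').Has pl' y' := by
        rintro ⟨-, h2⟩
        rw [e, hz] at h2
        change arr E s' 10 (fr + 1) = y' at h2
        rw [h10, Function.update_self] at h2
        exact hy' h2.symm
      tauto
    · refine ⟨rfl, ?_, ?_⟩
      · unfold Heap.Has
        rw [e, Ne, Ne, hdd, Function.update_of_ne hz]
        show _ ∧ arr E s' 10 _ = y' ↔ _
        rw [h10, Function.update_of_ne hz]
        rfl
      · intro _
        show s'.reals 1 _ = s.reals 1 _
        rw [hk, Function.update_of_ne hz]
  · have e : (heapOf E s').cur y = fr + 1 := by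
      show arr E s' 9 y = fr + 1
      rw [h9, Function.update_self]
    refine ⟨?_, ?_⟩
    · rw [e, Ne, hdd]; simp
    · rw [e]; show arr E s' 10 (fr + 1) = y; rw [h10, Function.update_self]
  · show s'.reals 1 (arr E s' 9 y) = κ
    rw [h9, hk]; simp
  · have := credits_succ fr 2 cr
    simp; omega
  · refine Frame.trans ?_ (hfr'.mono (by simp))
    intro x hx
    simp only [List.mem_cons, List.not_mem_nil, or_false, not_or] at hx
    simp [arr_setW, hx]
  · intro a ha
    rw [hre]; simp [reals_setR, ha]

-- A root simply gets the smaller key. Any other node stays where it is as a hollow node, so its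
-- ancestors need no repair and no cascade can arise. At most six new credits are handed out: two
-- for the new node and two for each of the two children that stay behind.
set_option maxHeartbeats 1000000 in
theorem decrease_spec (F : Fits E n β) (hfr : fr + 1 ≤ 2 * n ^ 2 + 2 * n + 2) {y : ℕ} {κ : ℝ}
    (H : HInv n (heapOf E s) fr pl cr []) (hf18 : arr E s 18 0 = fr) (hy : arr E s 23 0 = y)
    (hκ : s.reals 2 0 = κ) (hhas : (heapOf E s).Has pl y)
    (hle : κ ≤ (heapOf E s).key ((heapOf E s).cur y)) {Q : ℕ → State → Prop}
    (hQ : ∀ s' fr' pl' cr' t, fr' ≤ fr + 1 → HInv n (heapOf E s') fr' pl' cr' [] →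
      arr E s' 18 0 = fr' → KeySet (heapOf E s) (heapOf E s') pl pl' y κ →
      t + 200 * credits fr' cr' ≤ 200 * credits fr cr + 2000 →
      Frame E heapArrays s s' → (∀ a, a ≠ 1 → s'.reals a = s.reals a) → Q t s') :
    WP E decreaseProg s Q := by
  have hm : (fr + 1) % 2 ^ E.wordBits = fr + 1 := Nat.mod_eq_of_lt (F.lt_nodes hfr)
  have hm1 : 1 % 2 ^ E.wordBits = 1 := Nat.mod_eq_of_lt (F.lt' (by omega))
  have hm2 : 2 % 2 ^ E.wordBits = 2 := Nat.mod_eq_of_lt (F.lt' (by omega))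
  have hm0 : n % 2 ^ E.wordBits = n := Nat.mod_eq_of_lt (F.lt' (by omega))
  obtain ⟨u, hu⟩ : ∃ u, arr E s 9 y = u := ⟨_, rfl⟩
  have hcu : (heapOf E s).cur y = u := hu
  have hud : pl u ≠ .dead := by have := hhas.1; rwa [hcu] at this
  have huy : arr E s 10 u = y := by have := hhas.2; rwa [hcu] at this
  have hun := H.node u hud
  have hyn : y < n := by have := hun.2.2; change arr E s 10 u < n at this; rwa [huy] at this
  have hmu : u % 2 ^ E.wordBits = u := Nat.mod_eq_of_lt (F.lt_nodes (by omega))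
  have hmy : y % 2 ^ E.wordBits = y := Nat.mod_eq_of_lt (F.lt' (by omega))
  obtain ⟨r, hr⟩ : ∃ r, arr E s 11 u = r := ⟨_, rfl⟩
  have hrβ : r ≤ β := by
    have h1 := H.rank_le hud
    have h2 := F.nodes fr (by omega)
    change arr E s 11 u ≤ _ at h1
    omega
  unfold decreaseProg
  simp only [WP_seq, WP_setW]
  rw [WP_branch]
  constructor
  · intro hb
    simp [arr_setW, hu, hmu, hr, hy] at hb
    have hroot : pl u = .root := by
      have := (H.rootA r (by show arr E s 15 r ≠ 0; omega)).1
      change pl (arr E s 15 r) = _ at this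
      rwa [hb] at this
    simp only [WP_setR]
    have key := H.decrease_root (κ := κ) hroot (by rwa [hcu] at hle)
    have hh : ∀ x, heapOf E ((s.setW 25 0 x).setR 1 u κ) =
        { heapOf E s with key := Function.update (heapOf E s).key u κ } := by
      intro x; simp [heapOf, arr_setW, reals_setR]
    have e : ((WExpr.lit 0).eval E s) = 0 := by simp
    refine hQ _ fr pl cr _ (by omega) (by convert key using 1; simp [heapOf, arr_setW, reals_setR, hu, hmu, hy, hκ]) ?_ ⟨?_, ?_, ?_⟩ ?_ ?_ ?_
    · simp [arr_setW, hf18]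
    · intro y' hy'
      refine ⟨by simp [heapOf, arr_setW], by simp [Heap.Has, heapOf, arr_setW], ?_⟩
      intro hh
      have : arr E s 9 y' ≠ u := by
        intro h1
        have := hh.2
        change arr E s 10 (arr E s 9 y') = y' at this
        rw [h1, huy] at this
        exact hy' this.symm
      simp [heapOf, arr_setW, reals_setR, hu, hmu, hy, this]
    · simpa [Heap.Has, heapOf, arr_setW] using hhas
    · simp [heapOf, arr_setW, reals_setR, hu, hmu, hy, hκ]
    · simp; omega
    · intro x hx
      simp only [List.mem_cons, List.not_mem_nil, or_false, not_or] at hx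
      simp [arr_setW, hx]
    · intro a ha
      simp [reals_setR, ha]
  · intro hb
    simp [arr_setW, hu, hmu, hr, hy] at hb
    have hnr : pl u ≠ .root := by
      intro h1
      have := (H.root u h1).1
      change arr E s 15 (arr E s 11 u) = u at this
      rw [hr] at this
      exact hb this
    have hd : pl (fr + 1) = .dead := by
      by_contra h1
      have := (H.node _ h1).2.1
      omega
    have huz : u ≠ fr + 1 := by omega
    obtain ⟨pl₁, key, hz1, hdd1⟩ := H.decrease (κ := κ) (c₁ := arr E s 14 (y + n * (r - 1)))
      (c₂ := arr E s 14 (y + n * (r - 2))) hcu hhas hnr hr rfl rfl (by rwa [hcu] at hle)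
    have hr1 : n * (r - 1) ≤ n * β := Nat.mul_le_mul_left _ (by omega)
    have hr2 : n * (r - 2) ≤ n * β := Nat.mul_le_mul_left _ (by omega)
    have hm3 : n * (r - 1) % 2 ^ E.wordBits = n * (r - 1) := Nat.mod_eq_of_lt (F.lt (by nlinarith))
    have hm4 : n * (r - 2) % 2 ^ E.wordBits = n * (r - 2) := Nat.mod_eq_of_lt (F.lt (by nlinarith))
    have hm5 : (y + n * (r - 1)) % 2 ^ E.wordBits = y + n * (r - 1) :=
      Nat.mod_eq_of_lt (F.lt (by nlinarith))
    have hm6 : (y + n * (r - 2)) % 2 ^ E.wordBits = y + n * (r - 2) :=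
      Nat.mod_eq_of_lt (F.lt (by nlinarith))
    have hm7 : (r - 2) % 2 ^ E.wordBits = r - 2 := Nat.mod_eq_of_lt (F.lt' (by omega))
    unfold replaceProg
    simp only [WP_seq, WP_setW, WP_setR]
    refine addRoot_spec F hfr (by convert key using 1; simp [heapOf, arr_setW, reals_setR, hm0, hm, hm1, hm2, hm3, hm4, hm5, hm6, hm7, hmy, hf18, hy, hκ, hu, hmu, hr, F.order]) ?_ ?_ ?_
    · simp [arr_setW, hf18, hm1, hm]
    · simp [Heap.Full, heapOf, arr_setW, hf18, hm1, hm, hy, hmy]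
    intro s' pl' cr' t H' hdd ht hfr' hre
    have h9 : arr E s' 9 = Function.update (arr E s 9) y (fr + 1) := by
      rw [hfr' 9 (by simp)]; simp [arr_setW, hf18, hm, hm1, hy]
    have h10 : arr E s' 10 = Function.update (arr E s 10) (fr + 1) y := by
      rw [hfr' 10 (by simp)]; simp [arr_setW, hf18, hm, hm1, hy, hmy]
    have h18 : arr E s' 18 0 = fr + 1 := by
      rw [hfr' 18 (by simp)]; simp [arr_setW, hf18, hm, hm1]
    have hk : s'.reals 1 = Function.update (s.reals 1) (fr + 1) κ := by
      rw [hre]; simp [arr_setW, reals_setR, hf18, hm, hm1, hκ]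
    refine hQ s' (fr + 1) pl' cr' _ le_rfl H' h18 ⟨?_, ?_, ?_⟩ ?_ ?_ ?_
    · intro y' hy'
      have e : (heapOf E s').cur y' = (heapOf E s).cur y' := by
        show arr E s' 9 y' = arr E s 9 y'
        rw [h9, Function.update_of_ne hy']
      rw [e]
      by_cases hz : (heapOf E s).cur y' = fr + 1
      · have : ¬ (heapOf E s).Has pl y' := by rintro ⟨h1, -⟩; rw [hz] at h1; exact h1 hd
        have h2 : ¬ (heapOf E s').Has pl' y' := by
          rintro ⟨-, h2⟩
          rw [e, hz] at h2
          change arr E s' 10 (fr + 1) = y' at h2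
          rw [h10, Function.update_self] at h2
          exact hy' h2.symm
        tauto
      · refine ⟨rfl, ?_, ?_⟩
        · unfold Heap.Has
          rw [e, Ne, Ne, hdd, hdd1 _ hz]
          show _ ∧ arr E s' 10 _ = y' ↔ _
          rw [h10, Function.update_of_ne hz]
          rfl
        · intro _
          show s'.reals 1 _ = s.reals 1 _
          rw [hk, Function.update_of_ne hz]
    · have e : (heapOf E s').cur y = fr + 1 := by
        show arr E s' 9 y = fr + 1
        rw [h9, Function.update_self]
      refine ⟨?_, ?_⟩
      · rw [e, Ne, hdd, hz1]; simp
      · rw [e]; show arr E s' 10 (fr + 1) = y; rw [h10, Function.update_self]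
    · show s'.reals 1 (arr E s' 9 y) = κ
      rw [h9, hk]; simp
    · have := credits_succ fr 2 (Function.update (Function.update cr
        (arr E s 14 (y + n * (r - 1))) 2) (arr E s 14 (y + n * (r - 2))) 2)
      have h2 := credits_update_le fr (arr E s 14 (y + n * (r - 2))) 2 (Function.update cr
        (arr E s 14 (y + n * (r - 1))) 2)
      have h3 := credits_update_le fr (arr E s 14 (y + n * (r - 1))) 2 cr
      simp; omega
    · refine Frame.trans ?_ (hfr'.mono (by simp))
      intro x hx
      simp only [List.mem_cons, List.not_mem_nil, or_false, not_or] at hx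
      simp [arr_setW, hx]
    · intro a ha
      rw [hre]; simp [reals_setR, ha]

end

/-! ### Shortest-path search -/

section Search

variable {n : ℕ} {G : SimpleGraph (Fin n)} {w : Sym2 (Fin n) → ℝ}

/-- The discovered vertices, newest first, form a tree with root `r`, parents `par` and
distances `dist` to the root. -/
inductive Tree (G : SimpleGraph (Fin n)) (w : Sym2 (Fin n) → ℝ) (r : Fin n) (par : ℕ → ℕ)
    (dist : ℕ → ℝ) : List (Fin n) → Prop
  | nil : Tree G w r par dist []
  | one : dist r = 0 → Tree G w r par dist [r]
  | cons {x y : Fin n} {D : List (Fin n)} : Tree G w r par dist D → x ∉ D → y ∈ D →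
      par x = y → G.Adj y x → dist x = dist y + w s(y, x) → Tree G w r par dist (x :: D)

theorem Tree.nodup {r : Fin n} {par : ℕ → ℕ} {dist : ℕ → ℝ} {D : List (Fin n)}
    (h : Tree G w r par dist D) : D.Nodup := by
  induction h with
  | nil => simp
  | one => simp
  | cons _ hx _ _ _ _ ih => exact List.nodup_cons.2 ⟨hx, ih⟩

theorem Tree.root_mem {r : Fin n} {par : ℕ → ℕ} {dist : ℕ → ℝ} {D : List (Fin n)}
    (h : Tree G w r par dist D) (hD : D ≠ []) : r ∈ D := by
  induction h with
  | nil => simp at hD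
  | one => simp
  | cons _ _ hy _ _ _ ih => exact List.mem_cons_of_mem _ (ih (List.ne_nil_of_mem hy))

theorem Tree.congr {r : Fin n} {par par' : ℕ → ℕ} {dist dist' : ℕ → ℝ} {D : List (Fin n)}
    (h : Tree G w r par dist D) (hp : ∀ x ∈ D, par' x = par x) (hd : ∀ x ∈ D, dist' x = dist x) :
    Tree G w r par' dist' D := by
  induction h with
  | nil => exact .nil
  | one h => exact .one (by rw [hd _ (by simp), h])
  | @cons x y D _ hx hy e ha ed ih =>
    refine .cons (ih (fun z hz => hp z (by simp [hz])) (fun z hz => hd z (by simp [hz]))) hx hy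
      ?_ ha ?_
    · rw [hp x (by simp), e]
    · rw [hd x (by simp), hd y (by simp [hy]), ed]

theorem Tree.exists_walk {r : Fin n} {par : ℕ → ℕ} {dist : ℕ → ℝ} {D : List (Fin n)}
    (h : Tree G w r par dist D) {x : Fin n} (hx : x ∈ D) :
    ∃ p : G.Walk r x, walkWeight w p = dist x := by
  induction h generalizing x with
  | nil => simp at hx
  | one h =>
    have : x = r := by simpa using hx
    subst this
    exact ⟨.nil, by simp [h]⟩
  | @cons x' y D _ _ hy _ ha ed ih =>
    rcases List.mem_cons.1 hx with rfl | hx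
    · obtain ⟨p, hp⟩ := ih hy
      exact ⟨p.append (.cons ha .nil), by simp [hp, ed]⟩
    · exact ih hx

/-- The invariants of a search from `r` that do not concern the choice of the next vertex. -/
structure DInv (G : SimpleGraph (Fin n)) (w : Sym2 (Fin n) → ℝ) (r : Fin n)
    (D : List (Fin n)) (disc par ptr : ℕ → ℕ) (dist : ℕ → ℝ) : Prop where
  mem_disc : ∀ x ∈ D, disc x = 1
  not_mem_disc : ∀ x : Fin n, x ∉ D → disc x = 0
  tree : Tree G w r par dist D
  exact : ∀ x ∈ D, ∀ p : G.Walk r x, dist x ≤ walkWeight w p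
  far : ∀ x ∈ D, ∀ z ∉ D, ∀ p : G.Walk r z, dist x ≤ walkWeight w p
  ptr_mem : ∀ (x : Fin n) (i : ℕ), i < ptr x → ∃ y ∈ D, (adjList G w x)[i]? = some y
  ptr_zero : ∀ x : Fin n, x ∉ D → ptr x = 0

/-- A walk that leaves `D` does so along an edge. -/
theorem exists_exit (hw : ∀ e ∈ G.edgeSet, 0 ≤ w e) (D : List (Fin n)) {u z : Fin n}
    (p : G.Walk u z) (hu : u ∈ D) (hz : z ∉ D) :
    ∃ a ∈ D, ∃ b ∉ D, ∃ q : G.Walk u a, G.Adj a b ∧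
      walkWeight w q + w s(a, b) ≤ walkWeight w p := by
  induction p with
  | nil => exact absurd hu hz
  | @cons u v z h p ih =>
    by_cases hv : v ∈ D
    · obtain ⟨a, ha, b, hb, q, hab, hq⟩ := ih hv hz
      exact ⟨a, ha, b, hb, .cons h q, hab, by simpa [add_assoc] using hq⟩
    · refine ⟨u, hu, v, hv, .nil, h, ?_⟩
      have := walkWeight_nonneg hw p
      simp; linarith

/-- Dijkstra's step: the vertex that minimises the distance over all edges that leave `D`. -/
theorem DInv.extend {r : Fin n} {D : List (Fin n)} {disc par ptr : ℕ → ℕ} {dist : ℕ → ℝ}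
    {disc' ptr' : ℕ → ℕ} {dist' : ℕ → ℝ}
    (H : DInv G w r D disc par ptr dist) {y : Fin n} (hy : y ∉ D)
    (hdisc : disc' = Function.update disc y 1)
    (htree : Tree G w r par dist' (y :: D))
    (hdist : ∀ x ∈ D, dist' x = dist x)
    (hptr : ptr' = ptr)
    (hmin : ∀ z ∉ D, ∀ p : G.Walk r z, dist' y ≤ walkWeight w p) :
    DInv G w r (y :: D) disc' par ptr' dist' where
  mem_disc := by
    intro x hx
    rw [hdisc]
    by_cases e : x = y
    · rw [e]; simp
    · rw [Function.update_of_ne (by simpa [Fin.val_inj] using e)]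
      exact H.mem_disc x (by simpa [e] using hx)
  not_mem_disc := by
    intro x hx
    simp only [List.mem_cons, not_or] at hx
    rw [hdisc, Function.update_of_ne (by simpa [Fin.val_inj] using hx.1)]
    exact H.not_mem_disc x hx.2
  tree := htree
  exact := by
    intro x hx p
    rcases List.mem_cons.1 hx with rfl | hx
    · exact hmin _ hy p
    · rw [hdist x hx]; exact H.exact x hx p
  far := by
    intro x hx z hz p
    simp only [List.mem_cons, not_or] at hz
    rcases List.mem_cons.1 hx with rfl | hx
    · exact hmin _ hz.2 p
    · rw [hdist x hx]; exact H.far x hx z hz.2 p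
  ptr_mem := by
    intro x i hi
    rw [hptr] at hi
    obtain ⟨z, hz, h⟩ := H.ptr_mem x i hi
    exact ⟨z, by simp [hz], h⟩
  ptr_zero := by
    intro x hx
    rw [hptr]
    exact H.ptr_zero x (by simp at hx; tauto)

theorem length_adjList_le (x : Fin n) : (adjList G w x).length ≤ n := by
  simpa using (adjList_nodup (G := G) (w := w) x).length_le_card

theorem env_nbrs (b : ℕ) (M : List ℕ) (x : Fin n) :
    (env b G w M).nbrs x = (adjList G w x).map Fin.val := by
  simp [env]

theorem env_wts (b : ℕ) (M : List ℕ) (x : Fin n) :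
    (env b G w M).wts x = (adjList G w x).map (fun y => w s(x, y)) := by
  simp [env]

theorem DInv.ptr_le {r : Fin n} {D : List (Fin n)} {disc par ptr : ℕ → ℕ} {dist : ℕ → ℝ}
    (H : DInv G w r D disc par ptr dist) (x : Fin n) : ptr x ≤ (adjList G w x).length := by
  rcases Nat.eq_zero_or_pos (ptr x) with h | h
  · omega
  · obtain ⟨y, -, hy⟩ := H.ptr_mem x (ptr x - 1) (by omega)
    have := (List.getElem?_eq_some_iff.1 hy).1
    omega

/-! ### Advancing in an adjacency list -/

/-- Advance the vertex in variable `22` in its list to the next undiscovered vertex. -/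
def advanceProg : Prog :=
  .loop (.both (.wlt (.cell 6 (.var 22)) (.deg (.var 22)))
      (.weq (.cell 4 (.nbr (.var 22) (.cell 6 (.var 22)))) (.lit 1)))
    (.setW 6 (.var 22) (.op .add (.cell 6 (.var 22)) (.lit 1)))

/-- Decrease or set the key of the item in variable `23` reached from the vertex `22`. -/
def relaxProg : Prog :=
  .branch (.weq (.cell 9 (.var 23)) (.lit 0))
    (.seq (.setW 5 (.var 23) (.var 22)) insertProg)
    (.branch (.rlt (.cell 2 (.lit 0)) (.cell 1 (.cell 9 (.var 23))))
      (.seq (.setW 5 (.var 23) (.var 22)) decreaseProg) .skip)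

/-- Let the vertex in variable `22` wait at its next undiscovered neighbour. -/
def parkProg : Prog :=
  .seq (.assign 23 (.nbr (.var 22) (.cell 6 (.var 22)))) <|
  .seq (.setW 8 (.var 22) (.cell 7 (.var 23))) <|
  .seq (.setW 7 (.var 23) (.op .add (.var 22) (.lit 1))) <|
  .seq (.setR 2 (.lit 0) (.add (.cell 0 (.var 22)) (.wt (.var 22) (.cell 6 (.var 22)))))
    relaxProg

/-- Advance the vertex in variable `22` and let it wait. -/
def processProg : Prog :=
  .seq advanceProg (.branch (.wlt (.cell 6 (.var 22)) (.deg (.var 22))) parkProg .skip)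

/-- The linked list with first entry `h` is `l`. -/
def Chain (nx : ℕ → ℕ) : ℕ → List (Fin n) → Prop
  | h, [] => h = 0
  | h, x :: l => h = x + 1 ∧ Chain nx (nx x) l

theorem Chain.congr {nx nx' : ℕ → ℕ} : ∀ {h : ℕ} {l : List (Fin n)}, Chain nx h l →
    (∀ x ∈ l, nx' x = nx x) → Chain nx' h l
  | _, [], h1, _ => h1
  | _, x :: l, h1, h2 => ⟨h1.1, by
      rw [h2 x (by simp)]; exact h1.2.congr (fun y hy => h2 y (by simp [hy]))⟩

/-- The invariants of the queue of Dijkstra's algorithm. Every discovered vertex outside `P` waits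
at an undiscovered vertex or has reached the end of its adjacency list. -/
structure QInv (G : SimpleGraph (Fin n)) (w : Sym2 (Fin n) → ℝ) (r : Fin n) (E : Env) (s : State)
    (D P : List (Fin n)) (W : Fin n → List (Fin n)) (fr : ℕ) (pl : ℕ → Place) (cr : ℕ → ℕ) :
    Prop where
  heap : HInv n (heapOf E s) fr pl cr []
  count : arr E s 18 0 = fr
  key : ∀ y : Fin n, (heapOf E s).Has pl y → y ∉ D ∧
    ((y = r ∧ D = [] ∧ s.reals 1 (arr E s 9 y) = 0) ∨
      ∃ x ∈ D, arr E s 5 y = x ∧ G.Adj x y ∧ s.reals 1 (arr E s 9 y) = s.reals 0 x + w s(x, y))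
  cur : ∀ y : Fin n, y ∉ D → arr E s 9 y ≠ 0 → (heapOf E s).Has pl y
  park : ∀ x ∈ D, x ∈ P ∨ arr E s 6 x = (adjList G w x).length ∨
    ∃ y, (adjList G w x)[arr E s 6 x]? = some y ∧ y ∉ D ∧ (heapOf E s).Has pl y ∧
      s.reals 1 (arr E s 9 y) ≤ s.reals 0 x + w s(x, y) ∧ x ∈ W y
  chain : ∀ y : Fin n, y ∉ D → Chain (arr E s 8) (arr E s 7 y) (W y) ∧ (W y).Nodup ∧
    ∀ x ∈ W y, x ∈ D ∧ x ∉ P ∧ (adjList G w x)[arr E s 6 x]? = some y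
  start : D = [] → (heapOf E s).Has pl r

variable {b β fr : ℕ} {s : State} {r : Fin n} {D P : List (Fin n)} {W : Fin n → List (Fin n)}
  {pl : ℕ → Place} {cr : ℕ → ℕ}

local notation "𝓔" => env b G w []

/-- The pointer passes only entries that are discovered already, which keeps `DInv.ptr_mem`. The
number of passed entries pays for the loop. -/
theorem advance_spec (F : Fits 𝓔 n β) {x : Fin n} (hx : arr 𝓔 s 22 0 = x) (hxD : x ∈ D)
    (HD : DInv G w r D (arr 𝓔 s 4) (arr 𝓔 s 5) (arr 𝓔 s 6) (s.reals 0)) {Q : ℕ → State → Prop}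
    (hQ : ∀ s' j t, arr 𝓔 s 6 x ≤ j → arr 𝓔 s' 6 = Function.update (arr 𝓔 s 6) x j →
      (j = (adjList G w x).length ∨ ∃ y ∉ D, (adjList G w x)[j]? = some y) →
      DInv G w r D (arr 𝓔 s' 4) (arr 𝓔 s' 5) (arr 𝓔 s' 6) (s'.reals 0) →
      t + 100 * arr 𝓔 s 6 x ≤ 100 * j + 100 → Frame 𝓔 [6] s s' → s'.reals = s.reals → Q t s') :
    WP 𝓔 advanceProg s Q := by
  have hm : ∀ i ≤ n, i % 2 ^ (env b G w []).wordBits = i := fun i hi =>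
    Nat.mod_eq_of_lt (F.lt' (by omega))
  have hlen := length_adjList_le (G := G) (w := w) x
  have hm1 : 1 % 2 ^ (env b G w []).wordBits = 1 := Nat.mod_eq_of_lt (F.lt' (by omega))
  have hnbr : ∀ i, ((env b G w []).nbrs x).getD i 0 = (((adjList G w x)[i]?).map Fin.val).getD 0 := by
    intro i; rw [env_nbrs]; simp
  unfold advanceProg
  refine WP_loop (φ := 100 * ((adjList G w x).length - arr 𝓔 s 6 x))
    (fun s₁ φ => arr 𝓔 s 6 x ≤ arr 𝓔 s₁ 6 x ∧
      arr 𝓔 s₁ 6 = Function.update (arr 𝓔 s 6) x (arr 𝓔 s₁ 6 x) ∧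
      DInv G w r D (arr 𝓔 s₁ 4) (arr 𝓔 s₁ 5) (arr 𝓔 s₁ 6) (s₁.reals 0) ∧
      φ = 100 * ((adjList G w x).length - arr 𝓔 s₁ 6 x) ∧ Frame 𝓔 [6] s s₁ ∧
      s₁.reals = s.reals) ?_ ?_ ?_
  · rintro s₁ φ ⟨h1, h2, h3, rfl, h5, h6⟩ hb
    have hx1 : arr 𝓔 s₁ 22 0 = x := by rw [h5 22 (by simp), hx]
    have hlt : arr 𝓔 s₁ 6 x < (adjList G w x).length := by
      have := hb.1
      simp only [holds_wlt, eval_cell, eval_lit, Nat.zero_mod, hx1, eval_deg, env_nbrs,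
        List.length_map] at this
      rwa [hm _ hlen] at this
    have hin : (adjList G w x)[arr 𝓔 s₁ 6 x] ∈ D := by
      have := hb.2
      simp only [holds_weq, eval_cell, eval_lit, Nat.zero_mod, hx1, eval_nbr, hnbr, hm1,
        List.getElem?_eq_getElem hlt, Option.map_some, Option.getD_some] at this
      rw [hm _ (by omega)] at this
      by_contra h7
      rw [h3.not_mem_disc _ h7] at this
      omega
    simp only [WP_setW]
    have e6 : arr 𝓔 (s₁.setW 6 ((WExpr.var 22).eval 𝓔 s₁)
        ((WExpr.op .add (.cell 6 (.var 22)) (.lit 1)).eval 𝓔 s₁)) 6 =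
        Function.update (arr 𝓔 s 6) x (arr 𝓔 s₁ 6 x + 1) := by
      simp only [arr_setW, eval_cell, eval_lit, Nat.zero_mod, hx1, eval_add, hm1, Nat.mod_mod,
        if_true]
      rw [hm _ (by omega), h2]
      simp
    refine ⟨_, ⟨?_, ?_, ?_, rfl, ?_, ?_⟩, ?_⟩
    · rw [e6]; simp; omega
    · rw [e6]; simp
    · rw [e6]
      refine ⟨?_, ?_, ?_, ?_, ?_, ?_, ?_⟩
      · simpa [arr_setW] using h3.mem_disc
      · simpa [arr_setW] using h3.not_mem_disc
      · simpa [arr_setW] using h3.tree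
      · simpa using h3.exact
      · simpa using h3.far
      · intro z i hi
        by_cases e : z = x
        · subst e
          simp only [Function.update_self] at hi
          rcases Nat.lt_succ_iff_lt_or_eq.1 hi with h7 | h7
          · exact h3.ptr_mem z i h7
          · subst h7
            exact ⟨_, hin, List.getElem?_eq_getElem hlt⟩
        · have e' : (z : ℕ) ≠ x := by simpa [Fin.val_inj] using e
          rw [Function.update_of_ne e'] at hi
          refine h3.ptr_mem z i ?_
          rw [h2, Function.update_of_ne e']; exact hi
      · intro z hz
        have e' : (z : ℕ) ≠ x := by
          intro e; rw [Fin.val_inj] at e; subst e; exact hz hxD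
        rw [Function.update_of_ne e']
        have := h3.ptr_zero z hz
        rwa [h2, Function.update_of_ne e'] at this
    · refine h5.trans ?_
      intro a ha
      simp only [List.mem_cons, List.not_mem_nil, or_false] at ha
      simp [arr_setW, ha]
    · simp [h6]
    · rw [e6]; simp; omega
  · exact ⟨le_rfl, by simp, HD, rfl, Frame.refl _ _ _, rfl⟩
  · rintro t s₁ φ ⟨h1, h2, h3, rfl, h5, h6⟩ hb ht
    have hx1 : arr 𝓔 s₁ 22 0 = x := by rw [h5 22 (by simp), hx]
    have hle := h3.ptr_le x
    have hle0 := HD.ptr_le x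
    refine hQ s₁ _ t h1 h2 ?_ h3 ?_ h5 h6
    · rcases hle.eq_or_lt with h7 | h7
      · exact .inl h7
      right
      refine ⟨(adjList G w x)[arr 𝓔 s₁ 6 x], fun h8 => hb ⟨?_, ?_⟩, List.getElem?_eq_getElem h7⟩
      · simp only [holds_wlt, eval_cell, eval_lit, Nat.zero_mod, hx1, eval_deg, env_nbrs,
          List.length_map]
        rwa [hm _ hlen]
      · simp only [holds_weq, eval_cell, eval_lit, Nat.zero_mod, hx1, eval_nbr, hnbr, hm1,
          List.getElem?_eq_getElem h7, Option.map_some, Option.getD_some]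
        rw [hm _ (by omega)]
        exact h3.mem_disc _ h8
    · simp at ht; omega

end Search

/-! ### Letting a discovered vertex wait at its next undiscovered neighbour -/

section Search

variable {n : ℕ} {G : SimpleGraph (Fin n)} {w : Sym2 (Fin n) → ℝ}
variable {b β fr : ℕ} {s : State} {r : Fin n} {D P : List (Fin n)} {W : Fin n → List (Fin n)}
  {pl : ℕ → Place} {cr : ℕ → ℕ}

local notation "𝓔" => env b G w []

/-- This separates the invariants of the queue from the execution: the hypotheses are what
`relax_spec` provides. The vertex `x` leaves the list of pending vertices and is put in front of the
list of `y`. The vertices that waited at `y` before stay there rightfully, since the key of `y` can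
only drop. -/
theorem QInv.repark {s' : State} {x y : Fin n} {j fr' : ℕ} {pl' : ℕ → Place} {cr' : ℕ → ℕ}
    (H : QInv G w r 𝓔 s D (x :: P) W fr pl cr) (hxD : x ∈ D) (hxP : x ∉ P)
    (hj : (adjList G w x)[j]? = some y) (hy : y ∉ D)
    (hheap : HInv n (heapOf 𝓔 s') fr' pl' cr' []) (hcount : arr 𝓔 s' 18 0 = fr')
    (h6 : arr 𝓔 s' 6 = Function.update (arr 𝓔 s 6) x j)
    (h8 : arr 𝓔 s' 8 = Function.update (arr 𝓔 s 8) x (arr 𝓔 s 7 y))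
    (h7 : arr 𝓔 s' 7 = Function.update (arr 𝓔 s 7) y (x + 1))
    (h0 : s'.reals 0 = s.reals 0)
    (hother : ∀ y' : ℕ, y' ≠ y → arr 𝓔 s' 9 y' = arr 𝓔 s 9 y' ∧
      ((heapOf 𝓔 s').Has pl' y' ↔ (heapOf 𝓔 s).Has pl y') ∧
      ((heapOf 𝓔 s).Has pl y' → s'.reals 1 (arr 𝓔 s' 9 y') = s.reals 1 (arr 𝓔 s 9 y')))
    (h5 : ∀ y' : ℕ, y' ≠ y → arr 𝓔 s' 5 y' = arr 𝓔 s 5 y')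
    (hhas : (heapOf 𝓔 s').Has pl' y)
    (hkle : s'.reals 1 (arr 𝓔 s' 9 y) ≤ s.reals 0 x + w s(x, y))
    (hkey : (heapOf 𝓔 s).Has pl y ∧ s'.reals 1 (arr 𝓔 s' 9 y) = s.reals 1 (arr 𝓔 s 9 y) ∧
      arr 𝓔 s' 5 y = arr 𝓔 s 5 y ∨
      s'.reals 1 (arr 𝓔 s' 9 y) = s.reals 0 x + w s(x, y) ∧ arr 𝓔 s' 5 y = x)
    (hmono : (heapOf 𝓔 s).Has pl y → s'.reals 1 (arr 𝓔 s' 9 y) ≤ s.reals 1 (arr 𝓔 s 9 y)) :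
    QInv G w r 𝓔 s' D P (Function.update W y (x :: W y)) fr' pl' cr' := by
  have hD : D ≠ [] := List.ne_nil_of_mem hxD
  have hv : ∀ {a c : Fin n}, a ≠ c → (a : ℕ) ≠ c := fun h e => h (Fin.val_injective e)
  have hadj : G.Adj x y := mem_adjList.1 (List.mem_of_getElem? hj)
  refine ⟨hheap, hcount, ?_, ?_, ?_, ?_, fun h => absurd h hD⟩
  · intro y' hy'
    by_cases e : y' = y
    · subst e
      refine ⟨hy, .inr ?_⟩
      rw [h0]
      rcases hkey with ⟨k1, k2, k3⟩ | ⟨k1, k2⟩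
      · rcases (H.key _ k1).2 with ⟨-, h, -⟩ | ⟨x', h1, h2, h3, h4⟩
        · exact absurd h hD
        · exact ⟨x', h1, by rw [k3, h2], h3, by rw [k2, h4]⟩
      · exact ⟨x, hxD, k2, hadj, k1⟩
    · obtain ⟨o1, o2, o3⟩ := hother y' (hv e)
      have hh := o2.1 hy'
      rw [o3 hh, h5 y' (hv e), h0]
      exact H.key y' hh
  · intro y' hy' hc
    by_cases e : y' = y
    · subst e; exact hhas
    · obtain ⟨o1, o2, o3⟩ := hother y' (hv e)
      rw [o1] at hc
      exact o2.2 (H.cur y' hy' hc)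
  · intro x' hx'
    by_cases e : x' = x
    · subst e
      right; right
      rw [h6, Function.update_self, h0]
      exact ⟨y, hj, hy, hhas, hkle, by simp⟩
    · rw [h6, Function.update_of_ne (hv e), h0]
      rcases H.park x' hx' with h | h | ⟨y', k1, k2, k3, k4, k5⟩
      · left; simpa [e] using h
      · exact .inr (.inl h)
      · right; right
        refine ⟨y', k1, k2, ?_⟩
        by_cases e' : y' = y
        · subst e'
          exact ⟨hhas, (hmono k3).trans k4, by simp [k5]⟩
        · obtain ⟨o1, o2, o3⟩ := hother y' (hv e')
          rw [Function.update_of_ne e', o3 k3]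
          exact ⟨o2.2 k3, k4, k5⟩
  · intro y' hy'
    obtain ⟨c1, c2, c3⟩ := H.chain y' hy'
    have hxW : x ∉ W y' := fun h => (c3 x h).2.1 (by simp)
    have hold : Chain (arr 𝓔 s' 8) (arr 𝓔 s 7 y') (W y') := by
      refine c1.congr fun z hz => ?_
      have : z ≠ x := by rintro rfl; exact hxW hz
      rw [h8, Function.update_of_ne (hv this)]
    have hold' : ∀ z ∈ W y', z ∈ D ∧ z ∉ P ∧ (adjList G w z)[arr 𝓔 s' 6 z]? = some y' := by
      intro z hz
      obtain ⟨d1, d2, d3⟩ := c3 z hz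
      have : z ≠ x := by rintro rfl; exact hxW hz
      rw [h6, Function.update_of_ne (hv this)]
      exact ⟨d1, fun h => d2 (by simp [h]), d3⟩
    by_cases e : y' = y
    · subst e
      rw [Function.update_self, h7, Function.update_self]
      refine ⟨⟨rfl, ?_⟩, List.nodup_cons.2 ⟨hxW, c2⟩, ?_⟩
      · rw [h8, Function.update_self, ← h8]; exact hold
      · intro z hz
        rcases List.mem_cons.1 hz with rfl | hz
        · rw [h6, Function.update_self]; exact ⟨hxD, hxP, hj⟩
        · exact hold' z hz
    · rw [Function.update_of_ne e, h7, Function.update_of_ne (hv e)]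
      exact ⟨hold, c2, hold'⟩

/-- A vertex at the end of its adjacency list has no undiscovered neighbour left and never has to
wait again. -/
theorem QInv.finish {s' : State} {x : Fin n}
    (H : QInv G w r 𝓔 s D (x :: P) W fr pl cr)
    (h6 : arr 𝓔 s' 6 = Function.update (arr 𝓔 s 6) x (adjList G w x).length)
    (hf : Frame 𝓔 [6] s s') (hre : s'.reals = s.reals) :
    QInv G w r 𝓔 s' D P W fr pl cr := by
  have hv : ∀ {a c : Fin n}, a ≠ c → (a : ℕ) ≠ c := fun h e => h (Fin.val_injective e)
  have hh : heapOf 𝓔 s' = heapOf 𝓔 s := by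
    simp only [heapOf, hre]
    rw [hf 10 (by simp), hf 11 (by simp), hf 12 (by simp), hf 13 (by simp), hf 14 (by simp),
      hf 9 (by simp), hf 15 (by simp)]
  have h18 := hf 18 (by simp)
  have h9 := hf 9 (by simp)
  have h5 := hf 5 (by simp)
  have h7 := hf 7 (by simp)
  have h8 := hf 8 (by simp)
  refine ⟨by rw [hh]; exact H.heap, by rw [h18]; exact H.count, by rw [hh, h9, h5, hre]; exact H.key,
    by rw [hh, h9]; exact H.cur, ?_, ?_, by rw [hh]; exact H.start⟩
  · intro x' hx'
    rw [hh, h9, hre]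
    by_cases e : x' = x
    · subst e; right; left; rw [h6, Function.update_self]
    · rw [h6, Function.update_of_ne (hv e)]
      rcases H.park x' hx' with h | h
      · left; simpa [e] using h
      · exact .inr h
  · intro y hy
    obtain ⟨c1, c2, c3⟩ := H.chain y hy
    rw [h8, h7]
    refine ⟨c1, c2, fun z hz => ?_⟩
    obtain ⟨d1, d2, d3⟩ := c3 z hz
    have : z ≠ x := by rintro rfl; exact d2 (by simp)
    rw [h6, Function.update_of_ne (hv this)]
    exact ⟨d1, fun h => d2 (by simp [h]), d3⟩

/-- The word arrays that the processing of a vertex changes. -/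
abbrev processArrays : List ℕ := [5, 6, 7, 8, 23] ++ heapArrays

/-- Nodes are numbered from 1, so `cur` is 0 at `y` exactly if `y` has never been queued. In the
postcondition either the old candidate for the parent of `y` remains, with its key, or `x` becomes
the candidate with key `κ`; in both cases the key is at most `κ`. -/
theorem relax_spec (F : Fits 𝓔 n β) (hfr : fr + 1 ≤ 2 * n ^ 2 + 2 * n + 2) {x y : Fin n} {κ : ℝ}
    (H : HInv n (heapOf 𝓔 s) fr pl cr []) (hf18 : arr 𝓔 s 18 0 = fr) (hx : arr 𝓔 s 22 0 = x)
    (hy : arr 𝓔 s 23 0 = y) (hκ : s.reals 2 0 = κ)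
    (hcur : arr 𝓔 s 9 y ≠ 0 → (heapOf 𝓔 s).Has pl y) {Q : ℕ → State → Prop}
    (hQ : ∀ s' fr' pl' cr' t, fr' ≤ fr + 1 → HInv n (heapOf 𝓔 s') fr' pl' cr' [] →
      arr 𝓔 s' 18 0 = fr' →
      (∀ y' : ℕ, y' ≠ y → arr 𝓔 s' 9 y' = arr 𝓔 s 9 y' ∧
        ((heapOf 𝓔 s').Has pl' y' ↔ (heapOf 𝓔 s).Has pl y') ∧
        ((heapOf 𝓔 s).Has pl y' → s'.reals 1 (arr 𝓔 s' 9 y') = s.reals 1 (arr 𝓔 s 9 y'))) →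
      (∀ y' : ℕ, y' ≠ y → arr 𝓔 s' 5 y' = arr 𝓔 s 5 y') →
      (heapOf 𝓔 s').Has pl' y → s'.reals 1 (arr 𝓔 s' 9 y) ≤ κ →
      ((heapOf 𝓔 s).Has pl y ∧ s'.reals 1 (arr 𝓔 s' 9 y) = s.reals 1 (arr 𝓔 s 9 y) ∧
        arr 𝓔 s' 5 y = arr 𝓔 s 5 y ∨
        s'.reals 1 (arr 𝓔 s' 9 y) = κ ∧ arr 𝓔 s' 5 y = x) →
      ((heapOf 𝓔 s).Has pl y → s'.reals 1 (arr 𝓔 s' 9 y) ≤ s.reals 1 (arr 𝓔 s 9 y)) →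
      t + 200 * credits fr' cr' ≤ 200 * credits fr cr + 2100 →
      Frame 𝓔 (5 :: heapArrays) s s' → (∀ a, a ≠ 1 → s'.reals a = s.reals a) → Q t s') :
    WP 𝓔 relaxProg s Q := by
  have hmx : (x : ℕ) % 2 ^ (env b G w []).wordBits = x := Nat.mod_eq_of_lt (F.lt' (by omega))
  have hheap : heapOf 𝓔 (s.setW 5 y x) = heapOf 𝓔 s := by simp [heapOf, arr_setW]
  unfold relaxProg
  rw [WP_branch]
  constructor
  · intro hb
    simp [hy] at hb
    have hno : ¬ (heapOf 𝓔 s).Has pl y := by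
      rintro ⟨h1, -⟩
      have h2 := (H.node _ h1).1
      change 1 ≤ arr 𝓔 s 9 y at h2
      omega
    simp only [WP_seq, WP_setW, eval_cell, eval_lit, Nat.zero_mod, hx, hy]
    refine insert_spec F hfr (y := y) (κ := κ) (by rw [hheap]; exact H) (by simp [arr_setW, hf18])
      (by simp [arr_setW, hy]) y.2 (by simp [hκ]) (by simp [arr_setW, hb]) ?_
    intro s' pl' cr' t H' h18 hks ht hfr' hre
    rw [hheap] at hks
    obtain ⟨k1, k2, k3⟩ := hks
    refine hQ s' _ pl' cr' _ le_rfl H' h18 k1 ?_ k2 k3.le (.inr ⟨k3, ?_⟩) (fun h => absurd h hno)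
      ?_ ?_ ?_
    · intro y' hy'
      rw [hfr' 5 (by simp)]; simp [arr_setW, hy']
    · rw [hfr' 5 (by simp)]; simp [arr_setW, hmx]
    · simp; omega
    · intro a ha
      simp only [List.mem_cons, not_or] at ha
      rw [hfr' a (by simp; tauto)]
      simp [arr_setW, ha]
    · exact hre
  · intro hb
    simp [hy] at hb
    have hhas := hcur hb
    rw [WP_branch]
    constructor
    · intro hb2
      simp [hy, hκ] at hb2
      simp only [WP_seq, WP_setW, eval_cell, eval_lit, Nat.zero_mod, hx, hy]
      refine decrease_spec F hfr (y := y) (κ := κ) (pl := pl) (by rw [hheap]; exact H)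
        (by simp [arr_setW, hf18]) (by simp [arr_setW, hy]) (by simp [hκ]) (by rw [hheap]; exact hhas)
        (by rw [hheap]; exact hb2.le) ?_
      intro s' fr' pl' cr' t hle H' h18 hks ht hfr' hre
      rw [hheap] at hks
      obtain ⟨k1, k2, k3⟩ := hks
      change s'.reals 1 (arr 𝓔 s' 9 y) = κ at k3
      refine hQ s' _ pl' cr' _ hle H' h18 k1 ?_ k2 k3.le (.inr ⟨k3, ?_⟩)
        (fun _ => by rw [k3]; exact hb2.le) ?_ ?_ ?_
      · intro y' hy'
        rw [hfr' 5 (by simp)]; simp [arr_setW, hy']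
      · rw [hfr' 5 (by simp)]; simp [arr_setW, hmx]
      · simp; omega
      · intro a ha
        simp only [List.mem_cons, not_or] at ha
        rw [hfr' a (by simp; tauto)]
        simp [arr_setW, ha]
      · exact hre
    · intro hb2
      simp [hy, hκ] at hb2
      simp only [WP_skip]
      exact hQ s fr pl cr _ (by omega) H hf18 (fun _ _ => ⟨rfl, Iff.rfl, fun _ => rfl⟩)
        (fun _ _ => rfl) hhas hb2 (.inl ⟨hhas, rfl, rfl⟩) (fun _ => le_rfl) (by simp; omega)
        (Frame.refl _ _ _) (fun _ _ => rfl)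

/-- One call creates at most one heap node and has constant amortized cost apart from the scan. If
the pointer of `x` stood at a discovered vertex, it moves by at least one entry, so the caller can
charge the constant cost and the new node to that entry. -/
theorem process_spec (F : Fits 𝓔 n β) (hfr : fr + 1 ≤ 2 * n ^ 2 + 2 * n + 2) {x : Fin n}
    (hx : arr 𝓔 s 22 0 = x) (hxD : x ∈ D) (hxP : x ∉ P)
    (HD : DInv G w r D (arr 𝓔 s 4) (arr 𝓔 s 5) (arr 𝓔 s 6) (s.reals 0))
    (HQ : QInv G w r 𝓔 s D (x :: P) W fr pl cr) {Q : ℕ → State → Prop}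
    (hQ : ∀ s' W' fr' pl' cr' j t, fr' ≤ fr + 1 → arr 𝓔 s 6 x ≤ j →
      arr 𝓔 s' 6 = Function.update (arr 𝓔 s 6) x j →
      (∀ y ∈ D, (adjList G w x)[arr 𝓔 s 6 x]? = some y → arr 𝓔 s 6 x < j) →
      DInv G w r D (arr 𝓔 s' 4) (arr 𝓔 s' 5) (arr 𝓔 s' 6) (s'.reals 0) →
      QInv G w r 𝓔 s' D P W' fr' pl' cr' →
      t + 200 * credits fr' cr' + 100 * arr 𝓔 s 6 x ≤ 200 * credits fr cr + 100 * j + 3000 →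
      Frame 𝓔 processArrays s s' → (∀ z, z ≠ (x : ℕ) → arr 𝓔 s' 8 z = arr 𝓔 s 8 z) →
      s'.reals 0 = s.reals 0 → Q t s') :
    WP 𝓔 processProg s Q := by
  have hm : ∀ i ≤ n, i % 2 ^ (env b G w []).wordBits = i := fun i hi =>
    Nat.mod_eq_of_lt (F.lt' (by omega))
  have hlen := length_adjList_le (G := G) (w := w) x
  have hm1 : 1 % 2 ^ (env b G w []).wordBits = 1 := Nat.mod_eq_of_lt (F.lt' (by omega))
  unfold processProg
  simp only [WP_seq]
  refine advance_spec F hx hxD HD ?_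
  intro s₁ j t₁ hj1 h6 hj HD₁ ht₁ hfr₁ hre₁
  have hx1 : arr 𝓔 s₁ 22 0 = x := by rw [hfr₁ 22 (by simp), hx]
  have hadv : ∀ y ∈ D, (adjList G w x)[arr 𝓔 s 6 x]? = some y → arr 𝓔 s 6 x < j := by
    intro y hy hys
    rcases hj1.lt_or_eq with h | h
    · exact h
    exfalso
    rcases hj with hj | ⟨y', hy', hj⟩
    · have := (List.getElem?_eq_some_iff.1 hys).1
      omega
    · rw [← h, hys] at hj
      cases hj
      exact hy' hy
  rw [WP_branch]
  constructor
  · intro hb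
    have hlt : j < (adjList G w x).length := by
      simp only [holds_wlt, eval_cell, eval_lit, Nat.zero_mod, hx1, eval_deg, env_nbrs,
        List.length_map] at hb
      rw [hm _ hlen, h6, Function.update_self] at hb
      exact hb
    obtain ⟨y, hyD, hjy⟩ : ∃ y ∉ D, (adjList G w x)[j]? = some y := by
      rcases hj with hj | hj
      · omega
      · exact hj
    have hnbr : ((env b G w []).nbrs x)[j]?.getD 0 = y := by
      rw [env_nbrs]; simp [hjy]
    have hwt : ((env b G w []).wts x)[j]?.getD 0 = w s(x, y) := by
      rw [env_wts]; simp [hjy]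
    have hmy : (y : ℕ) % 2 ^ (env b G w []).wordBits = y := hm _ y.2.le
    have hmx1 : ((x : ℕ) + 1) % 2 ^ (env b G w []).wordBits = x + 1 := hm _ x.2
    have h6' : arr 𝓔 s₁ 6 x = j := by rw [h6, Function.update_self]
    unfold parkProg
    simp only [WP_seq, WP_setW, WP_setR]
    have hheap : heapOf 𝓔 s₁ = heapOf 𝓔 s := by
      simp only [heapOf, hre₁]
      rw [hfr₁ 10 (by simp), hfr₁ 11 (by simp), hfr₁ 12 (by simp), hfr₁ 13 (by simp),
        hfr₁ 14 (by simp), hfr₁ 9 (by simp), hfr₁ 15 (by simp)]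
    generalize hs₂ : State.setR _ _ _ _ = s₂
    have q9 : arr 𝓔 s₂ 9 = arr 𝓔 s 9 := by rw [← hs₂]; simp [arr_setW, hfr₁ 9]
    have q5 : arr 𝓔 s₂ 5 = arr 𝓔 s 5 := by rw [← hs₂]; simp [arr_setW, hfr₁ 5]
    have q1 : s₂.reals 1 = s.reals 1 := by rw [← hs₂]; simp [reals_setR, hre₁]
    have qh : heapOf 𝓔 s₂ = heapOf 𝓔 s := by
      rw [← hheap, ← hs₂]; simp [heapOf, arr_setW, reals_setR]
    refine relax_spec F (x := x) (y := y) (κ := s.reals 0 x + w s(x, y)) hfr (pl := pl)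
      (cr := cr) ?_ ?_ ?_ ?_ ?_ ?_ ?_
    · rw [qh]; exact HQ.heap
    · rw [← HQ.count, ← hfr₁ 18 (by simp), ← hs₂]; simp [arr_setW]
    · rw [← hs₂]; simp [arr_setW, hx1]
    · rw [← hs₂]; simp [arr_setW, hx1, h6', hnbr, hmy]
    · rw [← hs₂]; simp [reals_setR, arr_setW, hx1, h6', hwt, hre₁]
    · rw [qh, q9]; exact HQ.cur y hyD
    rw [qh, q9, q5, q1]
    intro s' fr' pl' cr' t hle H' h18 hother h5 hhas hkle hkey hmono ht hfr' hre
    rw [← hs₂] at hre hfr'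
    have hs0 : s'.reals 0 = s.reals 0 := by rw [hre 0 (by norm_num)]; simp [reals_setR, hre₁]
    have e6 : arr 𝓔 s' 6 = Function.update (arr 𝓔 s 6) x j := by
      rw [hfr' 6 (by simp)]; simp [arr_setW, h6]
    have e8 : arr 𝓔 s' 8 = Function.update (arr 𝓔 s 8) x (arr 𝓔 s 7 y) := by
      rw [hfr' 8 (by simp)]
      simp [arr_setW, hx1, h6', hnbr, hmy, hfr₁ 8, hfr₁ 7]
    have e7 : arr 𝓔 s' 7 = Function.update (arr 𝓔 s 7) y (x + 1) := by
      rw [hfr' 7 (by simp)]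
      simp [arr_setW, hx1, h6', hnbr, hmy, hm1, hmx1, hfr₁ 7]
    have e4 : arr 𝓔 s' 4 = arr 𝓔 s 4 := by
      rw [hfr' 4 (by simp)]; simp [arr_setW, hfr₁ 4]
    refine hQ s' _ fr' pl' cr' j _ hle hj1 e6 hadv ?_
      (HQ.repark hxD hxP hjy hyD H' h18 e6 e8 e7 hs0 hother h5 hhas hkle hkey hmono) ?_ ?_ ?_ hs0
    · rw [e6, ← h6]
      refine ⟨?_, ?_, ?_, ?_, ?_, HD₁.ptr_mem, HD₁.ptr_zero⟩
      · rw [e4]; exact HD.mem_disc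
      · rw [e4]; exact HD.not_mem_disc
      · rw [hs0]
        refine HD.tree.congr (fun z hz => ?_) (fun _ _ => rfl)
        refine h5 z ?_
        intro e; rw [Fin.val_inj] at e; subst e; exact hyD hz
      · rw [hs0]; exact HD.exact
      · rw [hs0]; exact HD.far
    · simp; omega
    · intro a ha
      simp only [List.cons_append, List.nil_append, List.mem_cons, List.not_mem_nil, or_false,
        not_or] at ha
      rw [hfr' a (by simp; tauto)]
      simp [arr_setW, ha, hfr₁ a]
    · intro z hz
      rw [e8, Function.update_of_ne hz]
  · intro hb
    have hlt : j = (adjList G w x).length := by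
      simp only [holds_wlt, eval_cell, eval_lit, Nat.zero_mod, hx1, eval_deg, env_nbrs,
        List.length_map] at hb
      rw [hm _ hlen, h6, Function.update_self] at hb
      have := HD₁.ptr_le x
      rw [h6, Function.update_self] at this
      omega
    simp only [WP_skip]
    refine hQ s₁ W fr pl cr j _ (by omega) hj1 h6 hadv HD₁ (HQ.finish (by rw [h6, hlt]) hfr₁ hre₁)
      ?_ (hfr₁.mono (by simp)) ?_ (by rw [hre₁])
    · simp; omega
    · intro z _; rw [hfr₁ 8 (by simp)]

end Search

/-! ### Extraction of the minimum -/

/-- Find the root with the least key. -/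
def scanProg : Prog :=
  .seq (.assign 19 (.lit 0)) <| .seq (.assign 21 (.lit 0)) <|
  .loop (.wlt (.var 21) (.var 1))
    (.seq (.branch (.both (.neg (.weq (.cell 15 (.var 21)) (.lit 0)))
        (.neg (.both (.neg (.weq (.var 19) (.lit 0)))
          (.neg (.rlt (.cell 1 (.cell 15 (.var 21))) (.cell 1 (.var 19)))))))
      (.assign 19 (.cell 15 (.var 21))) .skip)
    (.assign 21 (.op .add (.var 21) (.lit 1))))

/-- Push the children of the node in variable `19`, whose item is in variable `2`. -/
def pushProg : Prog :=
  .seq (.assign 17 (.lit 0)) <|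
  .loop (.wlt (.var 17) (.cell 11 (.var 19)))
    (.seq (.setW 16 (.var 17) (.cell 14 (.op .add (.var 2) (.op .mul .order (.var 17)))))
      (.assign 17 (.op .add (.var 17) (.lit 1))))

/-- Pop a node; make it a root if it is full and push its children otherwise. -/
def popProg : Prog :=
  .seq (.assign 17 (.op .sub (.var 17) (.lit 1))) <|
  .seq (.assign 19 (.cell 16 (.var 17))) <|
  .branch (.weq (.cell 9 (.cell 10 (.var 19))) (.var 19)) addRoot
    (.seq (.branch (.wlt (.lit 0) (.cell 11 (.var 19)))
        (.seq (.setW 16 (.var 17) (.cell 12 (.var 19)))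
          (.assign 17 (.op .add (.var 17) (.lit 1)))) .skip)
      (.branch (.wlt (.lit 1) (.cell 11 (.var 19)))
        (.seq (.setW 16 (.var 17) (.cell 13 (.var 19)))
          (.assign 17 (.op .add (.var 17) (.lit 1)))) .skip))

/-- Pop all nodes. -/
def releaseProg : Prog := .loop (.wlt (.lit 0) (.var 17)) popProg

/-- The stack in the memory, top first. -/
def stackOf (E : Env) (s : State) : List ℕ :=
  ((List.range (arr E s 17 0)).map (arr E s 16)).reverse

section

variable {E : Env} {n β fr : ℕ} {s : State} {pl : ℕ → Place} {cr : ℕ → ℕ}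

theorem stackOf_push {s s' : State} {x : ℕ} (h16 : arr E s' 16 =
    Function.update (arr E s 16) (arr E s 17 0) x) (h17 : arr E s' 17 0 = arr E s 17 0 + 1) :
    stackOf E s' = x :: stackOf E s := by
  unfold stackOf
  rw [h17, List.range_succ, List.map_append, List.reverse_append, h16]
  simp only [List.map_cons, List.map_nil, Function.update_self, List.reverse_cons,
    List.reverse_nil, List.nil_append, List.singleton_append, List.cons.injEq, true_and]
  congr 1
  refine List.map_congr_left fun i hi => Function.update_of_ne ?_ _ _
  have := List.mem_range.1 hi
  omega

theorem stackOf_pop {s s' : State} (h16 : arr E s' 16 = arr E s 16)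
    (h17 : arr E s 17 0 = arr E s' 17 0 + 1) :
    stackOf E s = arr E s 16 (arr E s' 17 0) :: stackOf E s' := by
  refine stackOf_push (s := s') (s' := s) ?_ h17
  rw [h16]; simp

/-- No node has the number 0, so 0 in variable `19` means that no root has been seen yet. Otherwise
this variable holds the best root among the ranks inspected so far. -/
theorem scan_spec (F : Fits E n β) (hβ : arr E s 1 0 = β) {Q : ℕ → State → Prop}
    (hQ : ∀ s' z t, arr E s' 19 0 = z →
      (z = 0 ∧ (∀ i < β, arr E s 15 i = 0) ∨ z ≠ 0 ∧ (∃ i < β, arr E s 15 i = z) ∧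
        ∀ i < β, arr E s 15 i ≠ 0 → s.reals 1 z ≤ s.reals 1 (arr E s 15 i)) →
      t ≤ 60 * β + 60 → Frame E [19, 21] s s' → s'.reals = s.reals → Q t s') :
    WP E scanProg s Q := by
  have hm1 : 1 % 2 ^ E.wordBits = 1 := Nat.mod_eq_of_lt (F.lt' (by omega))
  unfold scanProg
  simp only [WP_seq, WP_setW]
  refine WP_loop (φ := 60 * β)
    (fun s₁ φ => arr E s₁ 21 0 ≤ β ∧ φ = 60 * (β - arr E s₁ 21 0) ∧
      (arr E s₁ 19 0 = 0 ∧ (∀ i < arr E s₁ 21 0, arr E s 15 i = 0) ∨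
        arr E s₁ 19 0 ≠ 0 ∧ (∃ i < arr E s₁ 21 0, arr E s 15 i = arr E s₁ 19 0) ∧
        ∀ i < arr E s₁ 21 0, arr E s 15 i ≠ 0 →
          s.reals 1 (arr E s₁ 19 0) ≤ s.reals 1 (arr E s 15 i)) ∧
      Frame E [19, 21] s s₁ ∧ s₁.reals = s.reals) ?_ ?_ ?_
  · rintro s₁ φ ⟨h1, rfl, h3, h4, h5⟩ hb
    have h15 : arr E s₁ 15 = arr E s 15 := h4 15 (by simp)
    have hb1 : arr E s₁ 1 0 = β := by rw [h4 1 (by simp), hβ]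
    simp [hb1] at hb
    have hmi : (arr E s₁ 21 0 + 1) % 2 ^ E.wordBits = arr E s₁ 21 0 + 1 :=
      Nat.mod_eq_of_lt (F.lt' (by omega))
    have hex : ∀ {P : ℕ → Prop}, (∀ i < arr E s₁ 21 0, P i) → P (arr E s₁ 21 0) →
        ∀ i ≤ arr E s₁ 21 0, P i := by
      intro P k1 k2 i hi
      rcases Nat.lt_or_eq_of_le hi with h | rfl
      · exact k1 i h
      · exact k2
    simp only [WP_seq]
    rw [WP_branch]
    constructor
    · intro hb2
      simp only [WP_setW]
      simp [h15, h5] at hb2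
      refine ⟨_, ⟨?_, rfl, ?_, ?_, ?_⟩, ?_⟩
      · simp [arr_setW, hm1, hmi]; omega
      · right
        simp [arr_setW, hm1, hmi, h15]
        refine ⟨hb2.1, ⟨arr E s₁ 21 0, by omega, rfl⟩, hex (P := fun i => ¬arr E s 15 i = 0 →
          s.reals 1 (arr E s 15 (arr E s₁ 21 0)) ≤ s.reals 1 (arr E s 15 i)) ?_ (fun _ => le_rfl)⟩
        intro i hi hA
        rcases h3 with ⟨h3, h3'⟩ | ⟨h3, h3', h3''⟩
        · exact absurd (h3' i hi) hA
        · exact (hb2.2 h3).le.trans (h3'' i hi hA)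
      · refine h4.trans ?_
        intro a ha
        simp only [List.mem_cons, List.not_mem_nil, or_false, not_or] at ha
        simp [arr_setW, ha]
      · simp [h5]
      · simp [arr_setW, hm1, hmi]; omega
    · intro hb2
      simp only [WP_skip, WP_setW]
      simp [h15, h5] at hb2
      refine ⟨_, ⟨?_, rfl, ?_, ?_, ?_⟩, ?_⟩
      · simp [arr_setW, hm1, hmi]; omega
      · simp [arr_setW, hm1, hmi]
        rcases h3 with ⟨h3, h3'⟩ | ⟨h3, ⟨i, hi, hi'⟩, h3''⟩
        · left
          refine ⟨h3, hex h3' ?_⟩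
          by_contra hA
          exact (hb2 hA).1 h3
        · right
          exact ⟨h3, ⟨i, by omega, hi'⟩, hex h3'' (fun hA => (hb2 hA).2)⟩
      · refine h4.trans ?_
        intro a ha
        simp only [List.mem_cons, List.not_mem_nil, or_false, not_or] at ha
        simp [arr_setW, ha]
      · simp [h5]
      · simp [arr_setW, hm1, hmi]; omega
  · refine ⟨by simp [arr_setW], by simp [arr_setW], by simp [arr_setW], ?_, by simp⟩
    intro a ha
    simp only [List.mem_cons, List.not_mem_nil, or_false, not_or] at ha
    simp [arr_setW, ha]
  · rintro t s₁ φ ⟨h1, rfl, h3, h4, h5⟩ hb ht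
    have hb1 : arr E s₁ 1 0 = β := by rw [h4 1 (by simp), hβ]
    simp [hb1] at hb
    have e : arr E s₁ 21 0 = β := by omega
    rw [e] at h3
    refine hQ s₁ _ _ rfl h3 ?_ h4 h5
    simp at ht ⊢; omega

theorem push_spec (F : Fits E n β) {z y r : ℕ} (hz : arr E s 19 0 = z) (hy : arr E s 2 0 = y)
    (hyn : y < n) (hr : arr E s 11 z = r) (hrβ : r ≤ β) {Q : ℕ → State → Prop}
    (hQ : ∀ s' t, stackOf E s' = ((List.range r).map (fun i => arr E s 14 (y + n * i))).reverse →
      t ≤ 30 * r + 30 → Frame E [16, 17] s s' → s'.reals = s.reals → Q t s') :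
    WP E pushProg s Q := by
  have hm1 : 1 % 2 ^ E.wordBits = 1 := Nat.mod_eq_of_lt (F.lt' (by omega))
  have hm0 : n % 2 ^ E.wordBits = n := Nat.mod_eq_of_lt (F.lt' (by omega))
  unfold pushProg
  simp only [WP_seq, WP_setW]
  refine WP_loop (φ := 30 * r)
    (fun s₁ φ => arr E s₁ 17 0 ≤ r ∧ φ = 30 * (r - arr E s₁ 17 0) ∧
      stackOf E s₁ =
        ((List.range (arr E s₁ 17 0)).map (fun i => arr E s 14 (y + n * i))).reverse ∧
      Frame E [16, 17] s s₁ ∧ s₁.reals = s.reals) ?_ ?_ ?_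
  · rintro s₁ φ ⟨h1, rfl, h3, h4, h5⟩ hb
    have e19 : arr E s₁ 19 0 = z := by rw [h4 19 (by simp), hz]
    have e2 : arr E s₁ 2 0 = y := by rw [h4 2 (by simp), hy]
    have e11 : arr E s₁ 11 z = r := by rw [h4 11 (by simp), hr]
    have e14 : arr E s₁ 14 = arr E s 14 := h4 14 (by simp)
    simp [e19, e11] at hb
    have hmul : n * arr E s₁ 17 0 ≤ n * β := Nat.mul_le_mul_left _ (by omega)
    have hmi : (arr E s₁ 17 0 + 1) % 2 ^ E.wordBits = arr E s₁ 17 0 + 1 :=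
      Nat.mod_eq_of_lt (F.lt' (by omega))
    have hm3 : n * arr E s₁ 17 0 % 2 ^ E.wordBits = n * arr E s₁ 17 0 :=
      Nat.mod_eq_of_lt (F.lt (by nlinarith))
    have hm4 : (y + n * arr E s₁ 17 0) % 2 ^ E.wordBits = y + n * arr E s₁ 17 0 :=
      Nat.mod_eq_of_lt (F.lt (by nlinarith))
    simp only [WP_seq, WP_setW]
    refine ⟨_, ⟨?_, rfl, ?_, ?_, ?_⟩, ?_⟩
    · simp [arr_setW, hm1, hmi]; omega
    · rw [stackOf_push (s := s₁) (x := arr E s 14 (y + n * arr E s₁ 17 0)), h3]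
      · simp [arr_setW, hm1, hmi, List.range_succ]
      · simp [arr_setW, e2, F.order, hm0, hm3, hm4, e14]
      · simp [arr_setW, hm1, hmi]
    · refine h4.trans ?_
      intro a ha
      simp only [List.mem_cons, List.not_mem_nil, or_false, not_or] at ha
      simp [arr_setW, ha]
    · simp [h5]
    · simp [arr_setW, hm1, hmi]; omega
  · refine ⟨by simp [arr_setW], by simp [arr_setW], by simp [stackOf, arr_setW], ?_, by simp⟩
    intro a ha
    simp only [List.mem_cons, List.not_mem_nil, or_false, not_or] at ha
    simp [arr_setW, ha]
  · rintro t s₁ φ ⟨h1, rfl, h3, h4, h5⟩ hb ht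
    have e19 : arr E s₁ 19 0 = z := by rw [h4 19 (by simp), hz]
    have e11 : arr E s₁ 11 z = r := by rw [h4 11 (by simp), hr]
    simp [e19, e11] at hb
    have e : arr E s₁ 17 0 = r := by omega
    rw [e] at h3
    refine hQ s₁ _ h3 ?_ h4 h5
    simp at ht ⊢; omega

theorem HInv.length_le {h : Heap} {L : List ℕ} (H : HInv n h fr pl cr L) : L.length ≤ fr := by
  rw [← List.toFinset_card_of_nodup H.nodup]
  have : L.toFinset ⊆ Finset.Icc 1 fr := by
    intro z hz
    have h1 := (H.stk z).2 (List.mem_toFinset.1 hz)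
    have := H.node z (by simp [h1])
    simp; omega
  simpa using Finset.card_le_card this

/-- The word arrays that the release of waiting nodes changes. -/
abbrev releaseArrays : List ℕ := [11, 14, 15, 16, 17, 19, 20, 25, 26]

/-- A full node is handed to `addRoot`. A hollow node is removed: its own two credits pay for this,
and its children, which now wait, have held two credits each since the decrease that made the node
hollow. That is why `HInv.hollow1` and `HInv.hollow2` reserve credits. -/
theorem pop_spec (F : Fits E n β) (hfr : fr ≤ 2 * n ^ 2 + 2 * n + 2)
    (H : HInv n (heapOf E s) fr pl cr (stackOf E s)) (h0 : 0 < arr E s 17 0)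
    {Q : ℕ → State → Prop}
    (hQ : ∀ s' pl' cr' t, HInv n (heapOf E s') fr pl' cr' (stackOf E s') →
      (∀ y, (heapOf E s').Has pl' y ↔ (heapOf E s).Has pl y) →
      t + 20 + 200 * credits fr cr' ≤ 200 * credits fr cr →
      Frame E releaseArrays s s' → s'.reals = s.reals → Q t s') :
    WP E popProg s Q := by
  have hm1 : 1 % 2 ^ E.wordBits = 1 := Nat.mod_eq_of_lt (F.lt' (by omega))
  unfold popProg
  simp only [WP_seq, WP_setW]
  generalize hs₁ : State.setW _ _ _ _ = s₁
  obtain ⟨z, hz⟩ : ∃ z, arr E s 16 (arr E s 17 0 - 1) = z := ⟨_, rfl⟩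
  have hmz : z % 2 ^ E.wordBits = z := by rw [← hz]; simp
  have e17' : (arr E s 17 0 - 1) % 2 ^ E.wordBits = arr E s 17 0 - 1 :=
    Nat.mod_eq_of_lt (lt_of_le_of_lt (Nat.sub_le _ _) (arr_lt _ _))
  have e17 : arr E s₁ 17 0 = arr E s 17 0 - 1 := by rw [← hs₁]; simp [arr_setW, hm1, e17']
  have e16 : arr E s₁ 16 = arr E s 16 := by rw [← hs₁]; simp [arr_setW]
  have e19 : arr E s₁ 19 0 = z := by rw [← hs₁]; simp [arr_setW, hm1, e17', hz, hmz]
  have er : s₁.reals = s.reals := by rw [← hs₁]; simp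
  have eh : heapOf E s₁ = heapOf E s := by rw [← hs₁]; simp [heapOf, arr_setW]
  have ef : Frame E releaseArrays s s₁ := by
    intro a ha
    simp only [List.mem_cons, List.not_mem_nil, or_false, not_or] at ha
    rw [← hs₁]; simp [arr_setW, ha]
  have est := stackOf_pop (E := E) (s := s) (s' := s₁) e16 (by omega)
  rw [e17, hz] at est
  rw [est] at H
  rw [← eh] at H
  have hzs := (H.stk z).2 (by simp)
  have hzd : pl z ≠ .dead := by simp [hzs]
  rw [WP_branch]
  constructor
  · intro hb
    have hf : (heapOf E s₁).Full z := by simp [e19] at hb; exact hb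
    refine addRoot_spec F hfr H e19 hf ?_
    intro s' pl' cr' t H' hdd ht hfr' hre'
    have e9 : arr E s' 9 = arr E s₁ 9 := hfr' 9 (by simp)
    have e10 : arr E s' 10 = arr E s₁ 10 := hfr' 10 (by simp)
    refine hQ s' pl' cr' _ ?_ ?_ ?_ (ef.trans (hfr'.mono (by simp))) (hre'.trans er)
    · have : stackOf E s' = stackOf E s₁ := by
        unfold stackOf; rw [hfr' 17 (by simp), hfr' 16 (by simp)]
      rw [this]; exact H'
    · intro y
      rw [← eh]
      show pl' (arr E s' 9 y) ≠ _ ∧ arr E s' 10 (arr E s' 9 y) = y ↔ _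
      rw [e9, e10, Ne, hdd]; rfl
    · simp; omega
  · intro hb
    have hf : ¬ (heapOf E s₁).Full z := by simp [e19] at hb; exact hb
    obtain ⟨r, hr⟩ : ∃ r, arr E s₁ 11 z = r := ⟨_, rfl⟩
    have hlen : arr E s 17 0 ≤ fr := by
      have := H.length_le
      simp [stackOf, e17] at this; omega
    have hm17 : (arr E s 17 0 - 1 + 1) % 2 ^ E.wordBits = arr E s 17 0 - 1 + 1 :=
      Nat.mod_eq_of_lt (F.lt_nodes (by omega))
    have hm17' : (arr E s 17 0 - 1 + 1 + 1) % 2 ^ E.wordBits = arr E s 17 0 - 1 + 1 + 1 := by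
      refine Nat.mod_eq_of_lt (F.lt ?_)
      have : n ^ 2 ≤ (n + β + 1) ^ 2 := Nat.pow_le_pow_left (by omega) 2
      have : n + β + 1 ≤ (n + β + 1) ^ 2 := Nat.le_self_pow (by norm_num) _
      omega
    -- The three shapes of a hollow node, with two, one or no children, differ only in the list of
    -- nodes that are pushed.
    have key : ∀ (s' : State) (L₁ : List ℕ) (t : ℕ), L₁.Nodup → (∀ c, c ∈ L₁ ↔ pl c = .kid z) →
        stackOf E s' = L₁ ++ stackOf E s₁ → (∀ a, a ≠ 16 → a ≠ 17 → arr E s' a = arr E s₁ a) →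
        s'.reals = s₁.reals → t ≤ 200 → Q t s' := by
      intro s' L₁ t hL₁ hk hst hfr' hre ht
      obtain ⟨pl', H', hzd', hdd⟩ := H.remove (L := stackOf E s₁) (A' := (heapOf E s₁).A)
        (cr' := Function.update cr z 0) (.inr ⟨rfl, rfl⟩) hL₁ hk
        (by intro c hc; rw [Function.update_of_ne hc])
        (by
          intro c hc
          have h1 : c ≠ z := by rintro rfl; rw [hzs] at hc; cases hc
          rw [Function.update_of_ne h1]
          obtain ⟨-, -, h2⟩ := H.kid c z hc
          rcases h2 hf with ⟨h3, rfl⟩ | ⟨h3, rfl⟩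
          · exact (H.hollow1 z hzd hf h3).2.2.2
          · exact (H.hollow2 z hzd hf h3).2.2.2)
      have eh' : heapOf E s' = heapOf E s₁ := by
        simp only [heapOf, hre]
        rw [hfr' 10 (by simp) (by simp), hfr' 11 (by simp) (by simp), hfr' 12 (by simp) (by simp),
          hfr' 13 (by simp) (by simp), hfr' 14 (by simp) (by simp), hfr' 9 (by simp) (by simp),
          hfr' 15 (by simp) (by simp)]
      refine hQ s' pl' (Function.update cr z 0) t ?_ ?_ ?_ ?_ (hre.trans er)
      · rw [eh', hst]; exact H'
      · intro y
        rw [eh', ← eh]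
        unfold Heap.Has
        by_cases hy : (heapOf E s₁).cur y = z
        · rw [hy]
          have : (heapOf E s₁).item z ≠ y := by
            rintro rfl; exact hf hy
          simp [this]
        · rw [Ne, hdd _ hy]
      · have h1 := credits_update (v := 0) cr (H.node z hzd).2.1
        have h2 := H.stk_cr z (by simp)
        omega
      · refine ef.trans ?_
        intro a ha
        simp only [List.mem_cons, List.not_mem_nil, or_false, not_or] at ha
        exact hfr' a (by tauto) (by tauto)
    have hkids : ∀ c, pl c = .kid z ↔
        (1 ≤ r ∧ arr E s₁ 12 z = c) ∨ (2 ≤ r ∧ arr E s₁ 13 z = c) := by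
      intro c
      constructor
      · intro hc
        have := (H.kid c z hc).2.2 hf
        rw [← hr]; exact this
      · rintro (⟨h1, rfl⟩ | ⟨h1, rfl⟩)
        · exact (H.hollow1 z hzd hf (by show 1 ≤ arr E s₁ 11 z; omega)).1
        · exact (H.hollow2 z hzd hf (by show 2 ≤ arr E s₁ 11 z; omega)).1
    simp only [WP_seq]
    rw [WP_branch]
    constructor
    · intro hb1
      simp [e19, hr] at hb1
      simp only [WP_seq, WP_setW]
      rw [WP_branch]
      constructor
      · intro hb2
        simp [e19, hr, arr_setW, hm1] at hb2
        simp only [WP_seq, WP_setW]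
        refine key _ [arr E s₁ 13 z, arr E s₁ 12 z] _ ?_ ?_ ?_ ?_ ?_ ?_
        · have h1 := (H.hollow1 z hzd hf (by show 1 ≤ arr E s₁ 11 z; omega)).2.1
          have h2 := (H.hollow2 z hzd hf (by show 2 ≤ arr E s₁ 11 z; omega)).2.1
          change (heapOf E s₁).rank (arr E s₁ 12 z) + 1 = arr E s₁ 11 z at h1
          change (heapOf E s₁).rank (arr E s₁ 13 z) + 2 = arr E s₁ 11 z at h2
          have : arr E s₁ 13 z ≠ arr E s₁ 12 z := by
            intro e; rw [e] at h2; omega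
          simp [this]
        · intro c
          rw [hkids]
          simp only [List.mem_cons, List.not_mem_nil, or_false]
          constructor
          · rintro (rfl | rfl)
            · exact .inr ⟨by omega, rfl⟩
            · exact .inl ⟨by omega, rfl⟩
          · rintro (⟨-, rfl⟩ | ⟨-, rfl⟩) <;> simp
        · generalize hs₂ : ((s₁.setW 16 _ _).setW 17 _ _) = s₂
          have h1 : stackOf E s₂ = arr E s₁ 12 z :: stackOf E s₁ := by
            rw [← hs₂]
            refine stackOf_push ?_ ?_
            · simp [arr_setW, e19]
            · simp [arr_setW, e17, hm1, hm17]
          have h17 : arr E s₂ 17 0 = arr E s 17 0 - 1 + 1 := by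
            rw [← hs₂]; simp [arr_setW, e17, hm1, hm17]
          have h13 : arr E s₂ 13 = arr E s₁ 13 := by rw [← hs₂]; simp [arr_setW]
          have h19 : arr E s₂ 19 0 = z := by rw [← hs₂]; simp [arr_setW, e19]
          rw [List.cons_append, List.cons_append, List.nil_append, ← h1]
          refine stackOf_push ?_ ?_
          · simp [arr_setW, h19, h13]
          · simp [arr_setW, h17, hm1, hm17']
        · intro a h1 h2
          simp [arr_setW, h1, h2]
        · simp
        · simp
      · intro hb2
        simp [e19, hr, arr_setW, hm1] at hb2
        simp only [WP_skip]
        refine key _ [arr E s₁ 12 z] _ (by simp) ?_ ?_ ?_ ?_ ?_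
        · intro c
          rw [hkids]
          simp only [List.mem_cons, List.not_mem_nil, or_false]
          constructor
          · rintro rfl
            exact .inl ⟨by omega, rfl⟩
          · rintro (⟨-, rfl⟩ | ⟨h, rfl⟩)
            · rfl
            · omega
        · refine stackOf_push ?_ ?_
          · simp [arr_setW, e19]
          · simp [arr_setW, e17, hm1, hm17]
        · intro a h1 h2
          simp [arr_setW, h1, h2]
        · simp
        · simp
    · intro hb1
      simp [e19, hr] at hb1
      simp only [WP_skip]
      rw [WP_branch]
      constructor
      · intro hb2
        simp [e19, hr, hm1] at hb2
        omega
      · intro hb2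
        simp only [WP_skip]
        refine key _ [] _ (by simp) ?_ (by simp) (fun _ _ _ => rfl) rfl (by simp)
        intro c
        rw [hkids]
        simp; omega

theorem release_spec (F : Fits E n β) (hfr : fr ≤ 2 * n ^ 2 + 2 * n + 2)
    (H : HInv n (heapOf E s) fr pl cr (stackOf E s)) {Q : ℕ → State → Prop}
    (hQ : ∀ s' pl' cr' t, HInv n (heapOf E s') fr pl' cr' [] →
      (∀ y, (heapOf E s').Has pl' y ↔ (heapOf E s).Has pl y) →
      t + 200 * credits fr cr' ≤ 200 * credits fr cr + 20 →
      Frame E releaseArrays s s' → s'.reals = s.reals → Q t s') :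
    WP E releaseProg s Q := by
  unfold releaseProg
  refine WP_loop (φ := 200 * credits fr cr)
    (fun s₁ φ => ∃ pl₁ cr₁, HInv n (heapOf E s₁) fr pl₁ cr₁ (stackOf E s₁) ∧
      (∀ y, (heapOf E s₁).Has pl₁ y ↔ (heapOf E s).Has pl y) ∧
      φ = 200 * credits fr cr₁ ∧ Frame E releaseArrays s s₁ ∧ s₁.reals = s.reals) ?_ ?_ ?_
  · rintro s₁ φ ⟨pl₁, cr₁, H₁, hh₁, rfl, hf₁, hr₁⟩ hb
    refine pop_spec F hfr H₁ (by simpa using hb) ?_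
    intro s₂ pl₂ cr₂ t H₂ hh₂ ht hf₂ hr₂
    exact ⟨_, ⟨pl₂, cr₂, H₂, fun y => (hh₂ y).trans (hh₁ y), rfl, hf₁.trans hf₂,
      hr₂.trans hr₁⟩, by simp; omega⟩
  · exact ⟨pl, cr, H, fun _ => Iff.rfl, rfl, Frame.refl _ _ _, rfl⟩
  · rintro t s₁ φ ⟨pl₁, cr₁, H₁, hh₁, rfl, hf₁, hr₁⟩ hb ht
    have h17 : arr E s₁ 17 0 = 0 := by simpa using hb
    have : stackOf E s₁ = [] := by simp [stackOf, h17]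
    rw [this] at H₁
    exact hQ s₁ pl₁ cr₁ t H₁ hh₁ (by simp at ht; omega) hf₁ hr₁

end

/-- Remove the root in variable `19`, whose item is in variable `2`, from the heap. -/
def extractProg : Prog :=
  .seq (.setW 15 (.cell 11 (.var 19)) (.lit 0)) (.seq pushProg releaseProg)

-- The children of the extracted root are the only nodes that need new credits, two each, and their
-- number is the rank of the root, at most β. All further work on hollow nodes and links is paid by
-- credits that exist already. Among the heap operations only this one has an amortized cost that
-- grows with β.
open Classical in
theorem extract_spec {E : Env} {n β fr : ℕ} {s : State} {pl : ℕ → Place} {cr : ℕ → ℕ}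
    (F : Fits E n β) (hfr : fr ≤ 2 * n ^ 2 + 2 * n + 2)
    (H : HInv n (heapOf E s) fr pl cr []) {z y : ℕ} (hz : arr E s 19 0 = z) (hy : arr E s 2 0 = y)
    (hzr : pl z = .root) (hzy : arr E s 10 z = y) {Q : ℕ → State → Prop}
    (hQ : ∀ s' pl' cr' t, HInv n (heapOf E s') fr pl' cr' [] →
      (∀ y', (heapOf E s').Has pl' y' ↔ (heapOf E s).Has pl y' ∧ y' ≠ y) →
      t + 200 * credits fr cr' ≤ 200 * credits fr cr + 500 * β + 100 →
      Frame E releaseArrays s s' → s'.reals = s.reals → Q t s') :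
    WP E extractProg s Q := by
  have hzd : pl z ≠ .dead := by simp [hzr]
  obtain ⟨-, hzf, hzn⟩ := H.node z hzd
  obtain ⟨hzA, hzF, hzc⟩ := H.root z hzr
  change arr E s 10 z < n at hzn
  rw [hzy] at hzn
  have hcy : (heapOf E s).cur y = z := by
    have : arr E s 9 (arr E s 10 z) = z := hzF
    rw [hzy] at this; exact this
  obtain ⟨rk, hrk⟩ : ∃ rk, arr E s 11 z = rk := ⟨_, rfl⟩
  have hrβ : rk ≤ β := by
    have h1 := H.rank_le hzd
    have h2 := F.nodes fr hfr
    change arr E s 11 z ≤ _ at h1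
    omega
  set L₁ := ((List.range rk).map (fun i => arr E s 14 (y + n * i))).reverse with hL₁
  have hfull : ∀ i < rk, pl (arr E s 14 (y + n * i)) = .kid z ∧
      (heapOf E s).rank (arr E s 14 (y + n * i)) = i := by
    intro i hi
    have h1 := H.full z i hzd hzF (by show i < arr E s 11 z; omega)
    change pl (arr E s 14 (arr E s 10 z + n * i)) = _ ∧
      (heapOf E s).rank (arr E s 14 (arr E s 10 z + n * i)) = _ ∧ _ at h1
    rw [hzy] at h1
    exact ⟨h1.1, h1.2.1⟩
  have hnd : L₁.Nodup := by
    rw [hL₁, List.nodup_reverse]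
    refine List.Nodup.map_on ?_ List.nodup_range
    intro i hi j hj e
    rw [← (hfull i (List.mem_range.1 hi)).2, ← (hfull j (List.mem_range.1 hj)).2, e]
  have hkid : ∀ c, c ∈ L₁ ↔ pl c = .kid z := by
    intro c
    simp only [hL₁, List.mem_reverse, List.mem_map, List.mem_range]
    constructor
    · rintro ⟨i, hi, rfl⟩; exact (hfull i hi).1
    · intro hc
      obtain ⟨h1, h2⟩ := (H.kid c z hc).2.1 hzF
      change arr E s 14 (arr E s 10 z + n * _) = c at h2
      rw [hzy] at h2
      exact ⟨_, by rw [← hrk]; exact h1, h2⟩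
  set cr₁ : ℕ → ℕ := fun c => cr c + if pl c = .kid z then 2 else 0 with hcr₁
  have hcc : credits fr cr₁ ≤ credits fr cr + 2 * rk := by
    unfold credits
    rw [hcr₁, Finset.sum_add_distrib, ← Finset.sum_filter]
    simp only [Finset.sum_const, smul_eq_mul]
    have : ({c ∈ Finset.range (fr + 1) | pl c = .kid z} : Finset ℕ) ⊆ L₁.toFinset := by
      intro c hc
      rw [List.mem_toFinset, hkid]
      exact (Finset.mem_filter.1 hc).2
    have h1 := Finset.card_le_card this
    rw [List.toFinset_card_of_nodup hnd] at h1
    simp only [hL₁, List.length_reverse, List.length_map, List.length_range] at h1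
    omega
  obtain ⟨pl₁, H₁, hd₁, hdd₁⟩ := H.remove (z := z) (L := []) (L₁ := L₁) (cr' := cr₁)
    (.inl ⟨hzr, rfl, rfl⟩) hnd hkid (by intro c _; simp [hcr₁])
    (by intro c hc; simp [hcr₁, hc])
  unfold extractProg
  simp only [WP_seq, WP_setW]
  generalize hs₁ : State.setW _ _ _ _ = s₁
  have e15 : arr E s₁ 15 = Function.update (arr E s 15) rk 0 := by
    rw [← hs₁]; simp [arr_setW, hz, hrk]
  have eo : ∀ a, a ≠ 15 → arr E s₁ a = arr E s a := by
    intro a ha; rw [← hs₁]; simp [arr_setW, ha]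
  have er : s₁.reals = s.reals := by rw [← hs₁]; rfl
  have eh : heapOf E s₁ =
      { heapOf E s with A := Function.update (heapOf E s).A ((heapOf E s).rank z) 0 } := by
    simp only [heapOf, er, e15, ← hrk]
    rw [eo 10 (by simp), eo 11 (by simp), eo 12 (by simp), eo 13 (by simp), eo 14 (by simp),
      eo 9 (by simp)]
  rw [← eh] at H₁
  refine push_spec F (z := z) (y := y) (r := rk) ?_ ?_ hzn ?_ hrβ ?_
  · rw [eo 19 (by simp), hz]
  · rw [eo 2 (by simp), hy]
  · rw [eo 11 (by simp), hrk]
  intro s₂ t₂ hst ht₂ hf₂ hr₂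
  rw [eo 14 (by simp), ← hL₁] at hst
  have eh₂ : heapOf E s₂ = heapOf E s₁ := by
    simp only [heapOf, hr₂]
    rw [hf₂ 10 (by simp), hf₂ 11 (by simp), hf₂ 12 (by simp), hf₂ 13 (by simp), hf₂ 14 (by simp),
      hf₂ 9 (by simp), hf₂ 15 (by simp)]
  refine release_spec F hfr (pl := pl₁) (cr := cr₁) ?_ ?_
  · rw [eh₂, hst]; simpa using H₁
  intro s₃ pl₃ cr₃ t₃ H₃ hh₃ ht₃ hf₃ hr₃
  refine hQ s₃ pl₃ cr₃ _ H₃ ?_ ?_ ?_ ?_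
  · intro y'
    rw [hh₃, eh₂, eh]
    show pl₁ ((heapOf E s).cur y') ≠ _ ∧ (heapOf E s).item ((heapOf E s).cur y') = y' ↔ _
    by_cases e : (heapOf E s).cur y' = z
    · rw [e]
      refine ⟨fun h => absurd hd₁ h.1, ?_⟩
      rintro ⟨h1, h2⟩
      have h3 := h1.2
      rw [e] at h3
      change arr E s 10 z = y' at h3
      rw [hzy] at h3
      exact absurd h3.symm h2
    · rw [Ne, hdd₁ _ e]
      refine ⟨fun h => ⟨h, ?_⟩, fun h => h.1⟩
      rintro rfl; exact e hcy
  · simp at *; omega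
  · refine Frame.trans (s' := s₁) ?_ ((hf₂.mono (by simp)).trans hf₃)
    intro a ha
    simp only [List.mem_cons, List.not_mem_nil, or_false, not_or] at ha
    exact eo a (by tauto)
  · rw [hr₃, hr₂, er]

/-! ### Discovery of a vertex in Dijkstra's algorithm -/

/-- Let all vertices of the list with first entry in variable `24` wait again. -/
def reparkProg : Prog :=
  .loop (.neg (.weq (.var 24) (.lit 0)))
    (.seq (.assign 22 (.op .sub (.var 24) (.lit 1))) <|
      .seq (.assign 24 (.cell 8 (.var 22))) processProg)

/-- Discover the item of the root in variable `19`. -/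
def visitProg : Prog :=
  .seq (.assign 2 (.cell 10 (.var 19))) <|
  .seq (.setW 4 (.var 2) (.lit 1)) <|
  .seq (.setR 0 (.var 2) (.cell 1 (.var 19))) <|
  .seq extractProg <|
  .seq (.setW 8 (.var 2) (.cell 7 (.var 2))) <|
  .seq (.assign 24 (.op .add (.var 2) (.lit 1))) reparkProg

/-- One round of Dijkstra's algorithm. -/
def dijkstraProg : Prog :=
  .seq scanProg (.branch (.weq (.var 19) (.lit 0)) (.assign 3 (.lit 1)) visitProg)

/-- Start Dijkstra's algorithm. -/
def dijkstraInit : Prog :=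
  .seq (.assign 23 (.var 0)) (.seq (.setR 2 (.lit 0) .zero) insertProg)

section Search

variable {n : ℕ} {G : SimpleGraph (Fin n)} {w : Sym2 (Fin n) → ℝ}
variable {b β fr : ℕ} {s : State} {r : Fin n} {D P : List (Fin n)} {W : Fin n → List (Fin n)}
  {pl : ℕ → Place} {cr : ℕ → ℕ}

local notation "𝓔" => env b G w []

/-- The number of adjacency list entries that the search has passed. -/
def scanned (n : ℕ) (E : Env) (s : State) : ℕ := ∑ x : Fin n, arr E s 6 x

theorem scanned_update {E : Env} {s s' : State} {x : Fin n} {j : ℕ}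
    (h : arr E s' 6 = Function.update (arr E s 6) x j) :
    scanned n E s' + arr E s 6 x = scanned n E s + j := by
  unfold scanned
  have h1 : ∀ f : Fin n → ℕ, ∑ z, f z = f x + ∑ z ∈ Finset.univ.erase x, f z := fun f =>
    (Finset.add_sum_erase _ f (Finset.mem_univ x)).symm
  rw [h1, h1 (fun z => arr E s 6 z), h, Function.update_self,
    Finset.sum_congr rfl (g := fun z : Fin n => arr E s 6 z)]
  · omega
  · intro z hz
    rw [Function.update_of_ne]
    simpa [Fin.val_inj] using (Finset.mem_erase.1 hz).1

/-- This crude bound keeps the number of heap nodes, and with it all addresses, in the range of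
`Fits.nodes`. It also allows n² minus the number of scanned entries to serve as part of a budget. -/
theorem DInv.scanned_le {par dist disc} (H : DInv G w r D disc par (arr 𝓔 s 6) dist) :
    scanned n 𝓔 s ≤ n ^ 2 := by
  unfold scanned
  refine (Finset.sum_le_card_nsmul _ _ n fun x _ => (H.ptr_le x).trans
    (length_adjList_le x)).trans ?_
  simp [sq]

theorem DInv.length_le {par dist disc ptr} (H : DInv G w r D disc par ptr dist) :
    D.length ≤ n := by
  simpa using H.tree.nodup.length_le_card

/-- The word arrays that reparking changes. -/
abbrev reparkArrays : List ℕ := processArrays ++ [22, 24]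

/-- A vertex that waited at `y` now passes at least the entry `y`, and this entry pays for its
processing and for the heap node it may create. Only `y` itself may be processed without passing an
entry. So the total cost is proportional to the newly scanned entries, up to one constant. -/
theorem repark_spec (F : Fits 𝓔 n β) {y : Fin n}
    (HD : DInv G w r D (arr 𝓔 s 4) (arr 𝓔 s 5) (arr 𝓔 s 6) (s.reals 0))
    (HQ : QInv G w r 𝓔 s D P W fr pl cr) (hch : Chain (arr 𝓔 s 8) (arr 𝓔 s 24 0) P)
    (hP : P.Nodup) (hPD : ∀ x ∈ P, x ∈ D) (hyD : y ∈ D)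
    (hPy : ∀ x ∈ P, x = y ∨ (adjList G w x)[arr 𝓔 s 6 x]? = some y)
    (hfr : fr + 1 ≤ scanned n 𝓔 s + D.length + 1) {Q : ℕ → State → Prop}
    (hQ : ∀ s' W' fr' pl' cr' t,
      DInv G w r D (arr 𝓔 s' 4) (arr 𝓔 s' 5) (arr 𝓔 s' 6) (s'.reals 0) →
      QInv G w r 𝓔 s' D [] W' fr' pl' cr' → fr' ≤ scanned n 𝓔 s' + D.length + 1 →
      t + 200 * credits fr' cr' + 4000 * scanned n 𝓔 s ≤
        200 * credits fr cr + 4000 * scanned n 𝓔 s' + 3300 →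
      Frame 𝓔 reparkArrays s s' → Q t s') :
    WP 𝓔 reparkProg s Q := by
  classical
  have hm1 : 1 % 2 ^ (env b G w []).wordBits = 1 := Nat.mod_eq_of_lt (F.lt' (by omega))
  unfold reparkProg
  refine WP_loop (φ := 200 * credits fr cr + 4000 * (n ^ 2 - scanned n 𝓔 s) + 3200)
    (fun s₁ φ => ∃ P₁ W₁ fr₁ pl₁ cr₁,
      DInv G w r D (arr 𝓔 s₁ 4) (arr 𝓔 s₁ 5) (arr 𝓔 s₁ 6) (s₁.reals 0) ∧
      QInv G w r 𝓔 s₁ D P₁ W₁ fr₁ pl₁ cr₁ ∧ Chain (arr 𝓔 s₁ 8) (arr 𝓔 s₁ 24 0) P₁ ∧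
      P₁.Nodup ∧ (∀ x ∈ P₁, x ∈ D) ∧
      (∀ x ∈ P₁, x = y ∨ (adjList G w x)[arr 𝓔 s₁ 6 x]? = some y) ∧
      -- The number `e` is the reserve for `y`, which is used up when `y` is processed; `D.length`
      -- in the bound on the heap nodes provides this one extra node per discovered vertex.
      ∃ e, (y ∈ P₁ → e = 1) ∧ fr₁ + e ≤ scanned n 𝓔 s₁ + D.length + 1 ∧
      φ = 200 * credits fr₁ cr₁ + 4000 * (n ^ 2 - scanned n 𝓔 s₁) + 3200 * e ∧
      Frame 𝓔 reparkArrays s s₁) ?_ ?_ ?_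
  · rintro s₁ φ ⟨P₁, W₁, fr₁, pl₁, cr₁, HD₁, HQ₁, hch₁, hP₁, hPD₁, hPy₁, e, he, hfr₁, rfl, hf₁⟩ hb
    simp at hb
    cases P₁ with
    | nil => exact absurd hch₁ hb
    | cons x P₂ =>
      obtain ⟨h24, hch₂⟩ := hch₁
      obtain ⟨hxP, hP₂⟩ := List.nodup_cons.1 hP₁
      have hsc := HD₁.scanned_le
      have hDn := HD₁.length_le
      simp only [WP_seq, WP_setW]
      generalize hs₂ : State.setW _ 24 _ _ = s₂
      have hmx : (x : ℕ) % 2 ^ (env b G w []).wordBits = x :=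
        Nat.mod_eq_of_lt (F.lt' (by omega))
      have e22 : arr 𝓔 s₂ 22 0 = x := by
        rw [← hs₂]; simp [arr_setW, h24, hm1, hmx]
      have e24 : arr 𝓔 s₂ 24 0 = arr 𝓔 s₁ 8 x := by
        rw [← hs₂]; simp [arr_setW, h24, hm1, hmx]
      have eo : ∀ a, a ≠ 22 → a ≠ 24 → arr 𝓔 s₂ a = arr 𝓔 s₁ a := by
        intro a h1 h2; rw [← hs₂]; simp [arr_setW, h1, h2]
      have er : s₂.reals = s₁.reals := by rw [← hs₂]; simp
      have esc : scanned n 𝓔 s₂ = scanned n 𝓔 s₁ := by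
        unfold scanned; rw [eo 6 (by simp) (by simp)]
      have HQ₂ : QInv G w r 𝓔 s₂ D (x :: P₂) W₁ fr₁ pl₁ cr₁ := by
        have eh : heapOf 𝓔 s₂ = heapOf 𝓔 s₁ := by
          simp only [heapOf, er]
          rw [eo 10 (by simp) (by simp), eo 11 (by simp) (by simp), eo 12 (by simp) (by simp),
            eo 13 (by simp) (by simp), eo 14 (by simp) (by simp), eo 9 (by simp) (by simp),
            eo 15 (by simp) (by simp)]
        refine ⟨?_, ?_, ?_, ?_, ?_, ?_, ?_⟩
        · rw [eh]; exact HQ₁.heap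
        · rw [eo 18 (by simp) (by simp)]; exact HQ₁.count
        · rw [eh, er, eo 9 (by simp) (by simp), eo 5 (by simp) (by simp)]; exact HQ₁.key
        · rw [eh, eo 9 (by simp) (by simp)]; exact HQ₁.cur
        · rw [eh, er, eo 9 (by simp) (by simp), eo 6 (by simp) (by simp)]; exact HQ₁.park
        · rw [eo 8 (by simp) (by simp), eo 7 (by simp) (by simp), eo 6 (by simp) (by simp)]
          exact HQ₁.chain
        · rw [eh]; exact HQ₁.start
      have he1 : e ≤ 1 ∨ 1 < e := by omega
      refine process_spec F ?_ e22 (hPD₁ x (by simp)) hxP ?_ HQ₂ ?_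
      · nlinarith
      · rw [er, eo 4 (by simp) (by simp), eo 5 (by simp) (by simp), eo 6 (by simp) (by simp)]
        exact HD₁
      intro s₃ W₃ fr₃ pl₃ cr₃ j t hfr₃ hj h6 hadv HD₃ HQ₃ ht hf₃ h8 hr₃
      have hsu := scanned_update h6
      have hsc₃ := HD₃.scanned_le
      rw [eo 6 (by simp) (by simp)] at hj h6 hadv ht hsu
      rw [esc] at hsu
      have hne : ∀ x' ∈ P₂, (x' : ℕ) ≠ x := by
        intro x' hx' h; rw [Fin.val_inj] at h; subst h; exact hxP hx'
      have hpot : ∃ e', (y ∈ P₂ → e' = 1) ∧ fr₃ + e' ≤ scanned n 𝓔 s₃ + D.length + 1 ∧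
          t + 100 + 200 * credits fr₃ cr₃ + 4000 * (n ^ 2 - scanned n 𝓔 s₃) + 3200 * e' ≤
          200 * credits fr₁ cr₁ + 4000 * (n ^ 2 - scanned n 𝓔 s₁) + 3200 * e := by
        by_cases hxy : x = y
        · have := he (by simp [hxy])
          refine ⟨0, fun h => absurd (hxy ▸ h) hxP, ?_, ?_⟩ <;> omega
        · have := hadv y hyD ((hPy₁ x (by simp)).resolve_left hxy)
          refine ⟨e, fun h => he (by simp [h]), ?_, ?_⟩ <;> omega
      obtain ⟨e', he', hfr', hpot⟩ := hpot
      refine ⟨_, ⟨P₂, W₃, fr₃, pl₃, cr₃, HD₃, HQ₃, ?_, hP₂, fun x' hx' => hPD₁ x' (by simp [hx']),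
        ?_, e', he', hfr', rfl, ?_⟩, ?_⟩
      · rw [hf₃ 24 (by simp), e24]
        refine hch₂.congr fun x' hx' => ?_
        rw [h8 _ (hne x' hx'), eo 8 (by simp) (by simp)]
      · intro x' hx'
        rw [h6, Function.update_of_ne (hne x' hx')]
        exact hPy₁ x' (by simp [hx'])
      · refine hf₁.trans ?_
        intro a ha
        simp only [reparkArrays, List.mem_append, not_or, List.mem_cons, List.not_mem_nil,
          or_false] at ha
        rw [hf₃ a (by simp; tauto), eo a (by tauto) (by tauto)]
      · simp; omega
  · exact ⟨P, W, fr, pl, cr, HD, HQ, hch, hP, hPD, hPy, 1, fun _ => rfl, hfr, by omega,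
      Frame.refl _ _ _⟩
  · rintro t s₁ φ ⟨P₁, W₁, fr₁, pl₁, cr₁, HD₁, HQ₁, hch₁, hP₁, hPD₁, hPy₁, e, he, hfr₁, rfl, hf₁⟩
      hb ht
    simp at hb
    cases P₁ with
    | cons x P₂ => have := hch₁.1; omega
    | nil =>
      have h1 := HD.scanned_le
      have h2 := HD₁.scanned_le
      refine hQ s₁ W₁ fr₁ pl₁ cr₁ t HD₁ HQ₁ (by omega) ?_ hf₁
      simp at ht; omega

end Search

/-! ### Correctness and amortized cost of a round of Dijkstra's algorithm -/

section Search

variable {n : ℕ} {G : SimpleGraph (Fin n)} {w : Sym2 (Fin n) → ℝ}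
variable {b β fr : ℕ} {s : State} {r : Fin n} {D P : List (Fin n)} {W : Fin n → List (Fin n)}
  {pl : ℕ → Place} {cr : ℕ → ℕ}

local notation "𝓔" => env b G w []

/-- The invariant of a search between two rounds. -/
structure RoundInv (G : SimpleGraph (Fin n)) (w : Sym2 (Fin n) → ℝ) (r : Fin n) (b β : ℕ)
    (s : State) (D : List (Fin n)) : Prop where
  dinv : DInv G w r D (arr (env b G w []) s 4) (arr (env b G w []) s 5)
    (arr (env b G w []) s 6) (s.reals 0)
  ranks : arr (env b G w []) s 1 0 = β

/-- A round discovers a vertex or finds out that all vertices of the component are discovered. The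
amortized cost of a round is `K * β`, plus `K` for each scanned entry of an adjacency list. -/
def RoundPost (G : SimpleGraph (Fin n)) (w : Sym2 (Fin n) → ℝ) (b β K : ℕ)
    (I : State → List (Fin n) → ℕ → Prop) (s : State) (D : List (Fin n)) (φ t : ℕ) (s' : State) :
    Prop :=
  (∃ y ∉ D, ∃ φ', I s' (y :: D) φ' ∧ arr (env b G w []) s' 2 0 = y ∧
    arr (env b G w []) s' 3 0 = arr (env b G w []) s 3 0 ∧
    t + φ' + K * scanned n (env b G w []) s ≤ φ + K * scanned n (env b G w []) s' + K * β) ∨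
  (D ≠ [] ∧ (∀ x ∈ D, ∀ y, G.Adj x y → y ∈ D) ∧ (∃ φ', I s' D φ') ∧ arr (env b G w []) s' 3 0 = 1 ∧
    t + K * scanned n (env b G w []) s ≤ φ + K * scanned n (env b G w []) s' + K * β)

/-- The invariant of Dijkstra's algorithm between two rounds, with the budget `φ`. -/
def DijkstraInv (G : SimpleGraph (Fin n)) (w : Sym2 (Fin n) → ℝ) (r : Fin n) (b β : ℕ)
    (s : State) (D : List (Fin n)) (φ : ℕ) : Prop :=
  RoundInv G w r b β s D ∧ ∃ W fr pl cr, QInv G w r (env b G w []) s D [] W fr pl cr ∧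
    fr ≤ scanned n (env b G w []) s + D.length + 1 ∧ φ = 200 * credits fr cr

/-- The least key in the queue is a lower bound for the distances of undiscovered vertices. -/
theorem QInv.min_le (hw : ∀ e ∈ G.edgeSet, 0 ≤ w e)
    (HD : DInv G w r D (arr 𝓔 s 4) (arr 𝓔 s 5) (arr 𝓔 s 6) (s.reals 0))
    (HQ : QInv G w r 𝓔 s D [] W fr pl cr) {κ : ℝ}
    (hκ : ∀ y : Fin n, (heapOf 𝓔 s).Has pl y → κ ≤ s.reals 1 (arr 𝓔 s 9 y)) {z : Fin n}
    (hz : z ∉ D) (p : G.Walk r z) : κ ≤ walkWeight w p := by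
  by_cases hD : D = []
  · refine (hκ r (HQ.start hD)).trans ?_
    rcases (HQ.key r (HQ.start hD)).2 with ⟨-, -, h⟩ | ⟨x, hx, -⟩
    · rw [h]; exact walkWeight_nonneg hw p
    · simp [hD] at hx
  obtain ⟨a, ha, c, hc, q, hac, hq⟩ := exists_exit hw D p (HD.tree.root_mem hD) hz
  obtain ⟨i, hi, hic⟩ := List.mem_iff_getElem.1 (mem_adjList (w := w).2 hac)
  -- All entries in front of the pointer of `a` are discovered, so the entry of `c` is not among
  -- them. The list is sorted, hence the place `y` where `a` waits is reached by an edge no heavier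
  -- than the one to `c`.
  have hge : arr 𝓔 s 6 a ≤ i := by
    by_contra h
    obtain ⟨y, hy, hy'⟩ := HD.ptr_mem a i (by omega)
    rw [List.getElem?_eq_getElem hi, hic] at hy'
    cases hy'
    exact hc hy
  rcases HQ.park a ha with h | h | ⟨y, h1, h2, h3, h4, -⟩
  · simp at h
  · omega
  · have hj := (List.getElem?_eq_some_iff.1 h1)
    obtain ⟨hj, hjy⟩ := hj
    have hle : w s(a, y) ≤ w s(a, c) := by
      rcases hge.eq_or_lt with e | e
      · have : y = c := by rw [← hjy, ← hic]; simp [e]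
        rw [this]
      · have := List.pairwise_iff_getElem.1 (adjList_sorted (G := G) (w := w) a) _ _ hj hi e
        rwa [hjy, hic] at this
    have := hκ y h3
    have h5 := HD.exact a ha q
    linarith

/-- By `QInv.min_le` the least key is a lower bound for the distances of all undiscovered vertices,
and the stored parent shows that it is attained. After the discovery, the vertices without a waiting
place are exactly `y` and those that waited at `y`; putting `y` in front of its own list yields the
list to be reparked. -/
theorem visit_spec (F : Fits 𝓔 n β) (hw : ∀ e ∈ G.edgeSet, 0 ≤ w e)
    (HD : DInv G w r D (arr 𝓔 s 4) (arr 𝓔 s 5) (arr 𝓔 s 6) (s.reals 0))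
    (HQ : QInv G w r 𝓔 s D [] W fr pl cr) (hβ : arr 𝓔 s 1 0 = β)
    (hfr : fr ≤ scanned n 𝓔 s + D.length + 1) {z : ℕ} (hz : arr 𝓔 s 19 0 = z)
    (hzr : pl z = .root)
    (hmin : ∀ y : Fin n, (heapOf 𝓔 s).Has pl y → s.reals 1 z ≤ s.reals 1 (arr 𝓔 s 9 y))
    {Q : ℕ → State → Prop}
    (hQ : ∀ s' t, ∀ y ∉ D, ∀ φ', DijkstraInv G w r b β s' (y :: D) φ' →
      arr 𝓔 s' 2 0 = y → arr 𝓔 s' 3 0 = arr 𝓔 s 3 0 →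
      t + φ' + 4000 * scanned n 𝓔 s ≤ 200 * credits fr cr + 4000 * scanned n 𝓔 s' +
        500 * β + 3500 → Q t s') :
    WP 𝓔 visitProg s Q := by
  have hzd : pl z ≠ .dead := by simp [hzr]
  obtain ⟨-, hzf, hzn⟩ := HQ.heap.node z hzd
  obtain ⟨hzA, hzF, hzc⟩ := HQ.heap.root z hzr
  obtain ⟨y, hy⟩ : ∃ y : Fin n, arr 𝓔 s 10 z = y := ⟨⟨arr 𝓔 s 10 z, hzn⟩, rfl⟩
  have hcy : arr 𝓔 s 9 y = z := by rw [← hy]; exact hzF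
  have hhas : (heapOf 𝓔 s).Has pl y := by
    constructor
    · show pl (arr 𝓔 s 9 y) ≠ _; rw [hcy]; exact hzd
    · show arr 𝓔 s 10 (arr 𝓔 s 9 y) = y; rw [hcy, hy]
  obtain ⟨hyD, hky⟩ := HQ.key y hhas
  rw [hcy] at hky
  have hm1 : 1 % 2 ^ (env b G w []).wordBits = 1 := Nat.mod_eq_of_lt (F.lt' (by omega))
  have hmy : (y : ℕ) % 2 ^ (env b G w []).wordBits = y := Nat.mod_eq_of_lt (F.lt' (by omega))
  have hmy1 : ((y : ℕ) + 1) % 2 ^ (env b G w []).wordBits = y + 1 :=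
    Nat.mod_eq_of_lt (F.lt' (by omega))
  have hsc := HD.scanned_le
  have hDn := HD.length_le
  have hfr2 : fr + 1 ≤ 2 * n ^ 2 + 2 * n + 2 := by nlinarith
  unfold visitProg
  simp only [WP_seq, WP_setW, WP_setR]
  generalize hs₁ : State.setR _ _ _ _ = s₁
  have a2 : arr 𝓔 s₁ 2 0 = y := by rw [← hs₁]; simp [arr_setW, hz, hy, hmy]
  have a4 : arr 𝓔 s₁ 4 = Function.update (arr 𝓔 s 4) y 1 := by
    rw [← hs₁]; simp [arr_setW, hz, hy, hmy, hm1]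
  have ao : ∀ a, a ≠ 2 → a ≠ 4 → arr 𝓔 s₁ a = arr 𝓔 s a := by
    intro a h1 h2; rw [← hs₁]; simp [arr_setW, h1, h2]
  have ar : s₁.reals 0 = Function.update (s.reals 0) y (s.reals 1 z) := by
    rw [← hs₁]; simp [arr_setW, reals_setR, hz, hy, hmy]
  have ar1 : s₁.reals 1 = s.reals 1 := by rw [← hs₁]; simp [reals_setR]
  have ah : heapOf 𝓔 s₁ = heapOf 𝓔 s := by
    simp only [heapOf, ar1]
    rw [ao 10 (by simp) (by simp), ao 11 (by simp) (by simp), ao 12 (by simp) (by simp),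
      ao 13 (by simp) (by simp), ao 14 (by simp) (by simp), ao 9 (by simp) (by simp),
      ao 15 (by simp) (by simp)]
  refine extract_spec F (fr := fr) (by omega) (pl := pl) (cr := cr) (z := z) (y := y) (by rw [ah]; exact HQ.heap)
    (by rw [ao 19 (by simp) (by simp), hz]) a2 hzr (by rw [ao 10 (by simp) (by simp), hy]) ?_
  rw [ah]
  intro s₂ pl₂ cr₂ t₂ H₂ hh₂ ht₂ hf₂ hr₂
  generalize hs₃ : State.setW _ 24 _ _ = s₃
  have c2 : arr 𝓔 s₂ 2 0 = y := by rw [hf₂ 2 (by simp), a2]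
  have c7 : arr 𝓔 s₂ 7 = arr 𝓔 s 7 := by rw [hf₂ 7 (by simp), ao 7 (by simp) (by simp)]
  have c8 : arr 𝓔 s₂ 8 = arr 𝓔 s 8 := by rw [hf₂ 8 (by simp), ao 8 (by simp) (by simp)]
  have b8 : arr 𝓔 s₃ 8 = Function.update (arr 𝓔 s 8) y (arr 𝓔 s 7 y) := by
    rw [← hs₃]; simp [arr_setW, c2, c7, c8]
  have b24 : arr 𝓔 s₃ 24 0 = y + 1 := by
    rw [← hs₃]; simp [arr_setW, c2, hm1, hmy1]
  have bo : ∀ a, a ≠ 8 → a ≠ 24 → arr 𝓔 s₃ a = arr 𝓔 s₂ a := by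
    intro a h1 h2; rw [← hs₃]; simp [arr_setW, h1, h2]
  have br : s₃.reals = s₁.reals := by rw [← hs₃, ← hr₂]; simp
  have bh : heapOf 𝓔 s₃ = heapOf 𝓔 s₂ := by
    simp only [heapOf, br, hr₂]
    rw [bo 10 (by simp) (by simp), bo 11 (by simp) (by simp), bo 12 (by simp) (by simp),
      bo 13 (by simp) (by simp), bo 14 (by simp) (by simp), bo 9 (by simp) (by simp),
      bo 15 (by simp) (by simp)]
  have bs : ∀ a ∉ [2, 4, 8, 24] ++ releaseArrays, arr 𝓔 s₃ a = arr 𝓔 s a := by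
    intro a ha
    simp only [List.cons_append, List.nil_append, List.mem_cons, List.not_mem_nil, or_false,
      not_or] at ha
    rw [bo a (by tauto) (by tauto), hf₂ a (by simp; tauto), ao a (by tauto) (by tauto)]
  have b4 : arr 𝓔 s₃ 4 = Function.update (arr 𝓔 s 4) y 1 := by
    rw [bo 4 (by simp) (by simp), hf₂ 4 (by simp), a4]
  have b0 : s₃.reals 0 = Function.update (s.reals 0) y (s.reals 1 z) := by rw [br, ar]
  have b1 : s₃.reals 1 = s.reals 1 := by rw [br, ar1]
  have bsc : scanned n 𝓔 s₃ = scanned n 𝓔 s := by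
    unfold scanned; rw [bs 6 (by simp)]
  have hne : ∀ {x : Fin n}, x ∈ D → (x : ℕ) ≠ y := by
    intro x hx e; rw [Fin.val_inj] at e; subst e; exact hyD hx
  have hd : ∀ x ∈ D, s₃.reals 0 x = s.reals 0 x := by
    intro x hx; rw [b0, Function.update_of_ne (hne hx)]
  have hdy : s₃.reals 0 y = s.reals 1 z := by rw [b0, Function.update_self]
  have HD₃ : DInv G w r (y :: D) (arr 𝓔 s₃ 4) (arr 𝓔 s₃ 5) (arr 𝓔 s₃ 6) (s₃.reals 0) := by
    rw [bs 5 (by simp)]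
    refine HD.extend hyD b4 ?_ hd (bs 6 (by simp)) ?_
    · rcases hky with ⟨rfl, rfl, h⟩ | ⟨x, h1, h2, h3, h4⟩
      · exact .one (by rw [hdy, h])
      · exact .cons (HD.tree.congr (fun _ _ => rfl) hd) hyD h1 h2 h3 (by rw [hdy, h4, hd x h1])
    · intro z' hz' p
      rw [hdy]
      exact HQ.min_le hw HD hmin hz' p
  have hWy := HQ.chain y hyD
  have hyW : ∀ {y' : Fin n}, y' ∉ D → y ∉ W y' := fun h h' => hyD ((HQ.chain _ h).2.2 y h').1
  have HQ₃ : QInv G w r 𝓔 s₃ (y :: D) (y :: W y) W fr pl₂ cr₂ := by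
    have e9 : arr 𝓔 s₃ 9 = arr 𝓔 s 9 := bs 9 (by simp)
    refine ⟨?_, ?_, ?_, ?_, ?_, ?_, by simp⟩
    · rw [bh]; exact H₂
    · rw [bs 18 (by simp)]; exact HQ.count
    · intro y' hy'
      rw [bh, hh₂] at hy'
      obtain ⟨h1, h2⟩ := hy'
      have h2' : y' ≠ y := fun e => h2 (by rw [e])
      obtain ⟨h3, h4⟩ := HQ.key y' h1
      refine ⟨by simp [h2', h3], .inr ?_⟩
      rw [e9, b1, bs 5 (by simp)]
      rcases h4 with ⟨rfl, rfl, -⟩ | ⟨x, k1, k2, k3, k4⟩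
      · rcases hky with ⟨rfl, -⟩ | ⟨x, hx, -⟩
        · exact absurd rfl h2'
        · simp at hx
      · exact ⟨x, by simp [k1], k2, k3, by rw [k4, hd x k1]⟩
    · intro y' hy' hc
      simp only [List.mem_cons, not_or] at hy'
      rw [e9] at hc
      rw [bh, hh₂]
      exact ⟨HQ.cur y' hy'.2 hc, fun e => hy'.1 (Fin.val_injective e)⟩
    · intro x hx
      rcases List.mem_cons.1 hx with rfl | hx
      · left; simp
      rw [bs 6 (by simp), e9, b1, hd x hx]
      rcases HQ.park x hx with h | h | ⟨y', k1, k2, k3, k4, k5⟩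
      · simp at h
      · exact .inr (.inl h)
      · by_cases e : y' = y
        · subst e; left; simp [k5]
        · right; right
          refine ⟨y', k1, by simp [e, k2], ?_, k4, k5⟩
          rw [bh, hh₂]
          exact ⟨k3, fun h => e (Fin.val_injective h)⟩
    · intro y' hy'
      simp only [List.mem_cons, not_or] at hy'
      obtain ⟨k1, k2, k3⟩ := HQ.chain y' hy'.2
      refine ⟨?_, k2, ?_⟩
      · rw [bs 7 (by simp)]
        refine k1.congr fun x hx => ?_
        rw [b8, Function.update_of_ne (hne (k3 x hx).1)]
      · intro x hx
        obtain ⟨k4, -, k5⟩ := k3 x hx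
        refine ⟨by simp [k4], ?_, by rw [bs 6 (by simp)]; exact k5⟩
        simp only [List.mem_cons, not_or]
        refine ⟨fun e => hyD (e ▸ k4), fun h => ?_⟩
        have := (hWy.2.2 x h).2.2
        rw [k5] at this
        cases this
        exact hy'.1 rfl
  refine repark_spec F (y := y) HD₃ HQ₃ ⟨b24, ?_⟩ (List.nodup_cons.2 ⟨hyW hyD, hWy.2.1⟩) ?_
    (by simp) ?_ ?_ ?_
  · rw [b8, Function.update_self]
    refine hWy.1.congr fun x hx => ?_
    rw [Function.update_of_ne (hne (hWy.2.2 x hx).1)]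
  · intro x hx
    rcases List.mem_cons.1 hx with rfl | hx
    · simp
    · simp [(hWy.2.2 x hx).1]
  · intro x hx
    rcases List.mem_cons.1 hx with rfl | hx
    · simp
    · right; rw [bs 6 (by simp)]; exact (hWy.2.2 x hx).2.2
  · rw [bsc]; simp; omega
  intro s₄ W₄ fr₄ pl₄ cr₄ t₄ HD₄ HQ₄ hfr₄ ht₄ hf₄
  refine hQ s₄ _ y hyD _ ⟨⟨HD₄, ?_⟩, W₄, fr₄, pl₄, cr₄, HQ₄, hfr₄, rfl⟩ ?_ ?_ ?_
  · rw [hf₄ 1 (by simp), bs 1 (by simp), hβ]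
  · rw [hf₄ 2 (by simp), bo 2 (by simp) (by simp), c2]
  · rw [hf₄ 3 (by simp), bs 3 (by simp)]
  · rw [bsc] at ht₄
    simp; omega

/-- If there is no root, the heap is empty, so no discovered vertex waits anywhere. Then all lists
have been read to their ends, and the discovered vertices are closed under adjacency. -/
theorem dijkstra_round (F : Fits 𝓔 n β) (hw : ∀ e ∈ G.edgeSet, 0 ≤ w e) {φ : ℕ}
    (H : DijkstraInv G w r b β s D φ) :
    WP 𝓔 dijkstraProg s
      (RoundPost G w b β 4000 (DijkstraInv G w r b β) s D φ) := by
  obtain ⟨⟨HD, hβ⟩, W, fr, pl, cr, HQ, hfr, rfl⟩ := H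
  have hm1 : 1 % 2 ^ (env b G w []).wordBits = 1 := Nat.mod_eq_of_lt (F.lt' (by omega))
  have hsc := HD.scanned_le
  have hDn := HD.length_le
  have hb4 := F.beta
  have hrank : ∀ r', arr 𝓔 s 15 r' ≠ 0 → r' < β := by
    intro r' h
    obtain ⟨h1, h2⟩ := HQ.heap.rootA r' h
    have h3 := HQ.heap.rank_le (z := arr 𝓔 s 15 r') (by rw [show pl (arr 𝓔 s 15 r') = _ from h1]; simp)
    have h4 := F.nodes fr (by nlinarith)
    change (heapOf 𝓔 s).rank (arr 𝓔 s 15 r') = r' at h2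
    omega
  unfold dijkstraProg
  simp only [WP_seq]
  refine scan_spec F hβ ?_
  intro s₁ z t₁ hz hcase ht₁ hf₁ hr₁
  have e : ∀ a, a ≠ 19 → a ≠ 21 → arr 𝓔 s₁ a = arr 𝓔 s a := by
    intro a h1 h2; exact hf₁ a (by simp [h1, h2])
  have bsc : scanned n 𝓔 s₁ = scanned n 𝓔 s := by
    unfold scanned; rw [e 6 (by simp) (by simp)]
  have HD₁ : DInv G w r D (arr 𝓔 s₁ 4) (arr 𝓔 s₁ 5) (arr 𝓔 s₁ 6) (s₁.reals 0) := by
    rw [hr₁, e 4 (by simp) (by simp), e 5 (by simp) (by simp), e 6 (by simp) (by simp)]; exact HD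
  have eh : heapOf 𝓔 s₁ = heapOf 𝓔 s := by
    simp only [heapOf, hr₁]
    rw [e 10 (by simp) (by simp), e 11 (by simp) (by simp), e 12 (by simp) (by simp),
      e 13 (by simp) (by simp), e 14 (by simp) (by simp), e 9 (by simp) (by simp),
      e 15 (by simp) (by simp)]
  have HQ₁ : QInv G w r 𝓔 s₁ D [] W fr pl cr := by
    refine ⟨?_, ?_, ?_, ?_, ?_, ?_, ?_⟩
    · rw [eh]; exact HQ.heap
    · rw [e 18 (by simp) (by simp)]; exact HQ.count
    · rw [eh, hr₁, e 9 (by simp) (by simp), e 5 (by simp) (by simp)]; exact HQ.key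
    · rw [eh, e 9 (by simp) (by simp)]; exact HQ.cur
    · rw [eh, hr₁, e 9 (by simp) (by simp), e 6 (by simp) (by simp)]; exact HQ.park
    · rw [e 8 (by simp) (by simp), e 7 (by simp) (by simp), e 6 (by simp) (by simp)]
      exact HQ.chain
    · rw [eh]; exact HQ.start
  rw [WP_branch]
  constructor
  · intro hb
    simp [hz] at hb
    rcases hcase with ⟨-, h0⟩ | ⟨h0, -⟩
    swap
    · exact absurd hb h0
    have hnone : ∀ y : Fin n, ¬ (heapOf 𝓔 s).Has pl y := by
      intro y hy
      obtain ⟨r', h1, -⟩ := HQ.heap.exists_root_le hy.1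
      exact h1 (h0 r' (hrank r' h1))
    simp only [WP_setW]
    right
    refine ⟨fun h => hnone r (HQ.start h), ?_, ⟨_, ⟨⟨?_, ?_⟩, W, fr, pl, cr, ?_, ?_, rfl⟩⟩, ?_, ?_⟩
    · intro x hx y hxy
      rcases HQ.park x hx with h | h | ⟨y', -, -, h, -⟩
      · simp at h
      · obtain ⟨i, hi, hiy⟩ := List.mem_iff_getElem.1 (mem_adjList (w := w).2 hxy)
        obtain ⟨y', hy', h'⟩ := HD.ptr_mem x i (by omega)
        rw [List.getElem?_eq_getElem hi, hiy] at h'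
        cases h'
        exact hy'
      · exact absurd h (hnone y')
    · simpa [arr_setW] using HD₁
    · simp [arr_setW, e, hβ]
    · have : heapOf 𝓔 (s₁.setW 3 ((WExpr.lit 0).eval 𝓔 s₁) ((WExpr.lit 1).eval 𝓔 s₁)) =
          heapOf 𝓔 s₁ := by simp [heapOf, arr_setW]
      refine ⟨?_, ?_, ?_, ?_, ?_, ?_, ?_⟩
      · rw [this]; exact HQ₁.heap
      · simpa [arr_setW] using HQ₁.count
      · rw [this]; simpa [arr_setW] using HQ₁.key
      · rw [this]; simpa [arr_setW] using HQ₁.cur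
      · rw [this]; simpa [arr_setW] using HQ₁.park
      · simpa [arr_setW] using HQ₁.chain
      · rw [this]; exact HQ₁.start
    · simpa [scanned, arr_setW, e] using hfr
    · simp [arr_setW, hm1]
    · simp [scanned, arr_setW, e]; omega
  · intro hb
    simp [hz] at hb
    rcases hcase with ⟨h0, -⟩ | ⟨-, ⟨i, hi, hiz⟩, hmin⟩
    · exact absurd h0 hb
    have hzr : pl z = .root := by
      rw [← hiz]; exact (HQ.heap.rootA i (by show arr 𝓔 s 15 i ≠ 0; rw [hiz]; exact hb)).1
    refine visit_spec F hw HD₁ HQ₁ (by rw [e 1 (by simp) (by simp), hβ]) (by rw [bsc]; exact hfr)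
      hz hzr ?_ ?_
    · intro y hy
      rw [eh] at hy
      rw [e 9 (by simp) (by simp), hr₁]
      obtain ⟨r', h1, h2⟩ := HQ.heap.exists_root_le hy.1
      exact (hmin r' (hrank r' h1) h1).trans h2
    intro s' t y hyD φ' H' h2 h3 ht
    left
    refine ⟨y, hyD, φ', H', h2, by rw [h3, e 3 (by simp) (by simp)], ?_⟩
    rw [bsc] at ht
    simp; omega

/-- The memory in which a search from `r` starts. -/
def searchStart (r β : ℕ) : State where
  words := Function.update (Function.update (fun _ _ => 0) 0 (Function.update (fun _ => 0) 0 r)) 1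
    (Function.update (fun _ => 0) 0 β)
  reals := fun _ _ => 0
  out := []

/-- The root of the search is queued with key 0 while nothing is discovered; the first round then
discovers it like any other vertex. This is the exceptional case in `QInv.key` and `QInv.start`. -/
theorem dijkstra_init (F : Fits 𝓔 n β) :
    WP 𝓔 dijkstraInit (searchStart r β) (fun t s' => ∃ φ, DijkstraInv G w r b β s' [] φ ∧
      arr 𝓔 s' 3 0 = 0 ∧ scanned n 𝓔 s' = 0 ∧ t + φ ≤ 4000) := by
  have hmr : (r : ℕ) % 2 ^ (env b G w []).wordBits = r := Nat.mod_eq_of_lt (F.lt' (by omega))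
  have hmβ : β % 2 ^ (env b G w []).wordBits = β := Nat.mod_eq_of_lt (F.lt' (by omega))
  have ha : ∀ a, a ≠ 0 → a ≠ 1 → arr 𝓔 (searchStart r β) a = fun _ => 0 := by
    intro a h0 h1; funext i; simp [arr, searchStart, h0, h1]
  have ha0 : arr 𝓔 (searchStart r β) 0 0 = r := by simp [arr, searchStart, hmr]
  have ha1 : arr 𝓔 (searchStart r β) 1 0 = β := by simp [arr, searchStart, hmβ]
  have hre : ∀ a, (searchStart r β).reals a = fun _ => 0 := fun a => rfl
  unfold dijkstraInit
  simp only [WP_seq, WP_setW, WP_setR]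
  generalize hs₁ : State.setR _ _ _ _ = s₁
  have e : ∀ a, a ≠ 23 → arr 𝓔 s₁ a = arr 𝓔 (searchStart r β) a := by
    intro a h; rw [← hs₁]; simp [arr_setW, h]
  have eh : heapOf 𝓔 s₁ = heapOf 𝓔 (searchStart r β) := by
    rw [← hs₁]; simp [heapOf, arr_setW, reals_setR]
  have H0 : HInv n (heapOf 𝓔 s₁) 0 (fun _ => .dead) (fun _ => 0) [] := by
    rw [eh]
    refine ⟨by simp, ?_, by simp, by simp, by simp, by simp, by simp, by simp, by simp, by simp⟩
    intro r' h
    simp [heapOf, ha 15] at h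
  refine insert_spec F (fr := 0) (y := r) (κ := 0) (by omega) H0 ?_ ?_ r.2 ?_ ?_ ?_
  · rw [e 18 (by simp), ha 18 (by simp) (by simp)]
  · rw [← hs₁]; simp [arr_setW, ha0, hmr]
  · rw [← hs₁]; simp [reals_setR]
  · rw [e 9 (by simp), ha 9 (by simp) (by simp)]
  intro s' pl' cr' t H' h18 hk ht hf hr
  have e' : ∀ a, a ∉ 23 :: heapArrays → arr 𝓔 s' a = arr 𝓔 (searchStart r β) a := by
    intro a h
    rw [hf a (fun h' => h (by simp only [List.mem_cons] at *; tauto)), e a (by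
      simp only [List.mem_cons] at h; tauto)]
  have esc : scanned n 𝓔 s' = 0 := by
    unfold scanned; rw [e' 6 (by simp), ha 6 (by simp) (by simp)]; simp
  have hnh : ∀ y : ℕ, ¬ (heapOf 𝓔 s₁).Has (fun _ => .dead) y := fun y h => h.1 rfl
  refine ⟨200 * credits 1 cr', ⟨⟨?_, ?_⟩, fun _ => [], 1, pl', cr', ?_, ?_, rfl⟩, ?_, esc, ?_⟩
  · rw [e' 4 (by simp), e' 5 (by simp), e' 6 (by simp), ha 4 (by simp) (by simp),
      ha 5 (by simp) (by simp), ha 6 (by simp) (by simp)]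
    exact ⟨by simp, by simp, .nil, by simp, by simp, by simp, by simp⟩
  · rw [e' 1 (by simp), ha1]
  · obtain ⟨k1, k2, k3⟩ := hk
    have hnot : ∀ y : Fin n, y ≠ r → ¬ (heapOf 𝓔 s').Has pl' y := by
      intro y hy h
      exact hnh y ((k1 y (fun h => hy (Fin.val_injective h))).2.1.1 h)
    refine ⟨H', h18, ?_, ?_, by simp, ?_, fun _ => k2⟩
    · intro y hy
      by_cases hyr : y = r
      · subst hyr; exact ⟨by simp, .inl ⟨rfl, rfl, k3⟩⟩
      · exact absurd hy (hnot y hyr)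
    · intro y _ hc
      by_cases hyr : y = r
      · subst hyr; exact k2
      · have := (k1 y (fun h => hyr (Fin.val_injective h))).1
        change arr 𝓔 s' 9 y = arr 𝓔 s₁ 9 y at this
        rw [this, e 9 (by simp), ha 9 (by simp) (by simp)] at hc
        exact absurd rfl hc
    · intro y _
      refine ⟨?_, by simp, by simp⟩
      rw [e' 7 (by simp), ha 7 (by simp) (by simp)]
      rfl
  · simp
  · rw [e' 3 (by simp), ha 3 (by simp) (by simp)]
  · have : credits 0 (fun _ => 0) = 0 := by simp [credits]
    rw [this] at ht
    simp at ht ⊢; omega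

end Search

/-! ### Breadth-first search

Arrays `26`-`28`: the queue, the position of its first vertex, and its length. -/

/-- The first vertex of the queue. -/
abbrev headExpr : WExpr := .cell 26 (.var 27)

/-- Advance to the next undiscovered neighbour of the first vertex of the queue. -/
def bfsAdvance : Prog :=
  .loop (.both (.wlt (.var 27) (.var 28)) (.neg (.both
      (.wlt (.cell 6 headExpr) (.deg headExpr))
      (.weq (.cell 4 (.nbr headExpr (.cell 6 headExpr))) (.lit 0)))))
    (.branch (.wlt (.cell 6 headExpr) (.deg headExpr))
      (.setW 6 headExpr (.op .add (.cell 6 headExpr) (.lit 1)))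
      (.assign 27 (.op .add (.var 27) (.lit 1))))

/-- Discover the current neighbour of the first vertex of the queue. -/
def bfsVisit : Prog :=
  .seq (.assign 22 headExpr) <|
  .seq (.assign 23 (.nbr (.var 22) (.cell 6 (.var 22)))) <|
  .seq (.setW 4 (.var 23) (.lit 1)) <|
  .seq (.setW 5 (.var 23) (.var 22)) <|
  .seq (.setR 0 (.var 23) (.add (.cell 0 (.var 22)) (.wt (.var 22) (.cell 6 (.var 22))))) <|
  .seq (.setW 26 (.var 28) (.var 23)) <|
  .seq (.assign 28 (.op .add (.var 28) (.lit 1)))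
    (.assign 2 (.var 23))

/-- One round of breadth-first search. -/
def bfsProg : Prog :=
  .seq bfsAdvance (.branch (.wlt (.var 27) (.var 28)) bfsVisit (.assign 3 (.lit 1)))

/-- Start breadth-first search. -/
def bfsInit : Prog :=
  .seq (.assign 26 (.var 0)) <| .seq (.assign 28 (.lit 1)) <|
  .seq (.setW 4 (.var 0) (.lit 1)) (.assign 2 (.var 0))

section Search

variable {n : ℕ} {G : SimpleGraph (Fin n)} {w : Sym2 (Fin n) → ℝ}
variable {b β β₁ : ℕ} {s : State} {r : Fin n} {D : List (Fin n)}

local notation "𝓔" => env b G w []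

/-- The invariants of the queue of breadth-first search. -/
structure BfsQueue (G : SimpleGraph (Fin n)) (w : Sym2 (Fin n) → ℝ) (E : Env) (s : State)
    (D : List (Fin n)) : Prop where
  count : arr E s 28 0 = D.length
  head : arr E s 27 0 ≤ D.length
  queue : ∀ i (x : Fin n), D.reverse[i]? = some x → arr E s 26 i = x
  finished : ∀ i (x : Fin n), i < arr E s 27 0 → D.reverse[i]? = some x →
    arr E s 6 x = (adjList G w x).length
  sorted : D.Pairwise (fun x y : Fin n => s.reals 0 y ≤ s.reals 0 x)

/-- The invariant of breadth-first search between two rounds, with the budget `φ`. -/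
def BfsInv (G : SimpleGraph (Fin n)) (w : Sym2 (Fin n) → ℝ) (r : Fin n) (b β : ℕ)
    (s : State) (D : List (Fin n)) (φ : ℕ) : Prop :=
  RoundInv G w r b β s D ∧ BfsQueue G w (env b G w []) s D ∧
    φ = 300 * (D.length - arr (env b G w []) s 27 0)

/-- The pointer of a discovered vertex can pass a discovered vertex. -/
theorem DInv.pass {disc par ptr ptr' : ℕ → ℕ} {dist : ℕ → ℝ}
    (H : DInv G w r D disc par ptr dist) {x y : Fin n} (hx : x ∈ D)
    (hy : (adjList G w x)[ptr x]? = some y) (hyD : y ∈ D)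
    (hp : ptr' = Function.update ptr x (ptr x + 1)) : DInv G w r D disc par ptr' dist := by
  refine ⟨H.mem_disc, H.not_mem_disc, H.tree, H.exact, H.far, ?_, ?_⟩
  · intro z i hi
    rw [hp] at hi
    by_cases e : z = x
    · subst e
      simp only [Function.update_self] at hi
      rcases Nat.lt_succ_iff_lt_or_eq.1 hi with h | rfl
      · exact H.ptr_mem z i h
      · exact ⟨y, hyD, hy⟩
    · rw [Function.update_of_ne (by simpa [Fin.val_inj] using e)] at hi
      exact H.ptr_mem z i hi
  · intro z hz
    rw [hp, Function.update_of_ne]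
    · exact H.ptr_zero z hz
    · intro e; rw [Fin.val_inj] at e; subst e; exact hz hx

/-- Each round of the loop passes a list entry or removes the first vertex of the queue. The former
is charged to the scan, the latter to the budget of 300 steps that every queued vertex brings along.
-/
theorem bfsAdvance_spec (F : Fits 𝓔 n β₁)
    (HD : DInv G w r D (arr 𝓔 s 4) (arr 𝓔 s 5) (arr 𝓔 s 6) (s.reals 0))
    (HQ : BfsQueue G w 𝓔 s D) {Q : ℕ → State → Prop}
    (hQ : ∀ s' t, DInv G w r D (arr 𝓔 s' 4) (arr 𝓔 s' 5) (arr 𝓔 s' 6) (s'.reals 0) →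
      BfsQueue G w 𝓔 s' D →
      (arr 𝓔 s' 27 0 = D.length ∨ ∃ x y, D.reverse[arr 𝓔 s' 27 0]? = some x ∧
        (adjList G w x)[arr 𝓔 s' 6 x]? = some y ∧ y ∉ D) →
      t + 300 * (D.length - arr 𝓔 s' 27 0) + 300 * scanned n 𝓔 s ≤
        300 * (D.length - arr 𝓔 s 27 0) + 300 * scanned n 𝓔 s' + 100 →
      scanned n 𝓔 s ≤ scanned n 𝓔 s' → Frame 𝓔 [6, 27] s s' → s'.reals = s.reals → Q t s') :
    WP 𝓔 bfsAdvance s Q := by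
  have hm : ∀ i ≤ n, i % 2 ^ (env b G w []).wordBits = i := fun i hi =>
    Nat.mod_eq_of_lt (F.lt' (by omega))
  have hn1 := F.pos
  have hnbr : ∀ (x : Fin n) i, ((env b G w []).nbrs x).getD i 0 =
      (((adjList G w x)[i]?).map Fin.val).getD 0 := by
    intro x i; rw [env_nbrs]; simp
  unfold bfsAdvance
  refine WP_loop (φ := 300 * (D.length - arr 𝓔 s 27 0) + 300 * (n ^ 2 - scanned n 𝓔 s))
    (fun s₁ φ => DInv G w r D (arr 𝓔 s₁ 4) (arr 𝓔 s₁ 5) (arr 𝓔 s₁ 6) (s₁.reals 0) ∧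
      BfsQueue G w 𝓔 s₁ D ∧
      φ = 300 * (D.length - arr 𝓔 s₁ 27 0) + 300 * (n ^ 2 - scanned n 𝓔 s₁) ∧
      scanned n 𝓔 s ≤ scanned n 𝓔 s₁ ∧ Frame 𝓔 [6, 27] s s₁ ∧ s₁.reals = s.reals) ?_ ?_ ?_
  · rintro s₁ φ ⟨HD₁, HQ₁, rfl, hss, hf₁, hr₁⟩ hb
    obtain ⟨hb1, hb2⟩ := hb
    simp only [holds_wlt, eval_cell, eval_lit, Nat.zero_mod, HQ₁.count] at hb1
    obtain ⟨x, hx⟩ : ∃ x, D.reverse[arr 𝓔 s₁ 27 0]? = some x :=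
      ⟨_, List.getElem?_eq_getElem (by simpa using hb1)⟩
    have hxD : x ∈ D := List.mem_reverse.1 (List.mem_of_getElem? hx)
    have hqx := HQ₁.queue _ _ hx
    have hsc := HD₁.scanned_le
    have hDn := HD₁.length_le
    rw [WP_branch]
    simp only [holds_wlt, holds_neg, holds_both, holds_weq, eval_cell, eval_deg, eval_lit,
      eval_nbr, Nat.zero_mod, hqx, hnbr] at hb2 ⊢
    simp only [env_nbrs, List.length_map] at hb2 ⊢
    rw [hm _ (length_adjList_le x)] at hb2 ⊢
    constructor
    · intro hlt
      obtain ⟨y, hy⟩ : ∃ y, (adjList G w x)[arr 𝓔 s₁ 6 x]? = some y :=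
        ⟨_, List.getElem?_eq_getElem hlt⟩
      rw [hy] at hb2
      have hyD : y ∈ D := by
        by_contra h
        refine hb2 ⟨hlt, ?_⟩
        simp only [Option.map_some, Option.getD_some]
        rw [hm _ y.2.le, HD₁.not_mem_disc y h]
      have hl := length_adjList_le (G := G) (w := w) x
      simp only [WP_setW]
      generalize hs₂ : State.setW _ _ _ _ = s₂
      have e6 : arr 𝓔 s₂ 6 = Function.update (arr 𝓔 s₁ 6) x (arr 𝓔 s₁ 6 x + 1) := by
        rw [← hs₂]
        simp [arr_setW, hqx, hm 1 hn1, hm (arr 𝓔 s₁ 6 x + 1) (by omega)]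
      have eo : ∀ a, a ≠ 6 → arr 𝓔 s₂ a = arr 𝓔 s₁ a := by
        intro a ha; rw [← hs₂]; simp [arr_setW, ha]
      have er : s₂.reals = s₁.reals := by rw [← hs₂]; simp
      have hsu := scanned_update e6
      have HD₂ : DInv G w r D (arr 𝓔 s₂ 4) (arr 𝓔 s₂ 5) (arr 𝓔 s₂ 6) (s₂.reals 0) := by
        rw [eo 4 (by simp), eo 5 (by simp), er]
        exact HD₁.pass hxD hy hyD e6
      have hsc₂ := HD₂.scanned_le
      refine ⟨_, ⟨HD₂, ?_, rfl, by omega, ?_, ?_⟩, ?_⟩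
      · refine ⟨?_, ?_, ?_, ?_, ?_⟩
        · rw [eo 28 (by simp)]; exact HQ₁.count
        · rw [eo 27 (by simp)]; exact HQ₁.head
        · rw [eo 26 (by simp)]; exact HQ₁.queue
        · intro i z hi hz
          rw [eo 27 (by simp)] at hi
          have h1 := HQ₁.finished i z hi hz
          have : (z : ℕ) ≠ x := by
            intro e; rw [Fin.val_inj] at e; subst e; omega
          rw [e6, Function.update_of_ne this, h1]
        · rw [er]; exact HQ₁.sorted
      · refine hf₁.trans ?_
        intro a ha
        simp only [List.mem_cons, List.not_mem_nil, or_false, not_or] at ha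
        exact eo a ha.1
      · rw [er, hr₁]
      · rw [eo 27 (by simp)]; simp; omega
    · intro hlt
      have hle := HD₁.ptr_le x
      simp only [WP_setW]
      generalize hs₂ : State.setW _ _ _ _ = s₂
      have e27 : arr 𝓔 s₂ 27 0 = arr 𝓔 s₁ 27 0 + 1 := by
        rw [← hs₂]
        simp [arr_setW, hm 1 hn1, hm (arr 𝓔 s₁ 27 0 + 1) (by omega)]
      have eo : ∀ a, a ≠ 27 → arr 𝓔 s₂ a = arr 𝓔 s₁ a := by
        intro a ha; rw [← hs₂]; simp [arr_setW, ha]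
      have er : s₂.reals = s₁.reals := by rw [← hs₂]; simp
      have esc : scanned n 𝓔 s₂ = scanned n 𝓔 s₁ := by
        unfold scanned; rw [eo 6 (by simp)]
      refine ⟨_, ⟨?_, ?_, rfl, by omega, ?_, ?_⟩, ?_⟩
      · rw [eo 4 (by simp), eo 5 (by simp), eo 6 (by simp), er]; exact HD₁
      · refine ⟨?_, ?_, ?_, ?_, ?_⟩
        · rw [eo 28 (by simp)]; exact HQ₁.count
        · rw [e27]; omega
        · rw [eo 26 (by simp)]; exact HQ₁.queue
        · intro i z hi hz
          rw [eo 6 (by simp)]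
          rw [e27] at hi
          rcases Nat.lt_succ_iff_lt_or_eq.1 hi with h | rfl
          · exact HQ₁.finished i z h hz
          · rw [hx] at hz; cases hz; omega
        · rw [er]; exact HQ₁.sorted
      · refine hf₁.trans ?_
        intro a ha
        simp only [List.mem_cons, List.not_mem_nil, or_false, not_or] at ha
        exact eo a ha.2
      · rw [er, hr₁]
      · rw [e27, esc]; simp; omega
  · exact ⟨HD, HQ, rfl, le_rfl, Frame.refl _ _ _, rfl⟩
  · rintro t s₁ φ ⟨HD₁, HQ₁, rfl, hss, hf₁, hr₁⟩ hb ht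
    have h1 := HD.scanned_le
    have h2 := HD₁.scanned_le
    refine hQ s₁ t HD₁ HQ₁ ?_ ?_ hss hf₁ hr₁
    · rcases HQ₁.head.eq_or_lt with h | h
      · exact .inl h
      right
      obtain ⟨x, hx⟩ : ∃ x, D.reverse[arr 𝓔 s₁ 27 0]? = some x :=
        ⟨_, List.getElem?_eq_getElem (by simpa using h)⟩
      have hqx := HQ₁.queue _ _ hx
      simp only [holds_wlt, holds_neg, holds_both, holds_weq, eval_cell, eval_deg, eval_lit,
        eval_nbr, Nat.zero_mod, hqx, hnbr, HQ₁.count, h, true_and, not_not] at hb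
      simp only [env_nbrs, List.length_map] at hb
      rw [hm _ (length_adjList_le x)] at hb
      obtain ⟨hb1, hb2⟩ := hb
      obtain ⟨y, hy⟩ : ∃ y, (adjList G w x)[arr 𝓔 s₁ 6 x]? = some y :=
        ⟨_, List.getElem?_eq_getElem hb1⟩
      refine ⟨x, y, hx, hy, ?_⟩
      intro hyD
      rw [hy] at hb2
      simp only [Option.map_some, Option.getD_some] at hb2
      rw [hm _ y.2.le, HD₁.mem_disc y hyD] at hb2
      omega
    · simp at ht; omega

/-- The distances of the discovered vertices increase along the queue. With unit weights, the
cheapest way out of the discovered set therefore starts at the first vertex that still has an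
undiscovered neighbour. -/
theorem bfs_round (F : Fits 𝓔 n β₁) (hw : ∀ e ∈ G.edgeSet, w e = 1) (hβ : 1 ≤ β) {φ : ℕ} (hD : D ≠ [])
    (H : BfsInv G w r b β s D φ) :
    WP 𝓔 bfsProg s (RoundPost G w b β 4000 (BfsInv G w r b β) s D φ) := by
  obtain ⟨⟨HD, hβs⟩, HQ, rfl⟩ := H
  have hm : ∀ i ≤ n, i % 2 ^ (env b G w []).wordBits = i := fun i hi =>
    Nat.mod_eq_of_lt (F.lt' (by omega))
  have hn1 := F.pos
  unfold bfsProg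
  simp only [WP_seq]
  refine bfsAdvance_spec F HD HQ ?_
  intro s₁ t₁ HD₁ HQ₁ hcase ht₁ hss hf₁ hr₁
  have hhd := HQ.head
  have hhd₁ := HQ₁.head
  have hDn := HD₁.length_le
  have hβ₁ : arr 𝓔 s₁ 1 0 = β := by rw [hf₁ 1 (by simp), hβs]
  rw [WP_branch]
  simp only [holds_wlt, eval_cell, eval_lit, Nat.zero_mod, HQ₁.count]
  constructor
  · intro hlt
    rcases hcase with h | ⟨x, y, hx, hy, hyD⟩
    · omega
    have hxD : x ∈ D := List.mem_reverse.1 (List.mem_of_getElem? hx)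
    have hqx := HQ₁.queue _ _ hx
    have hadj : G.Adj x y := mem_adjList.1 (List.mem_of_getElem? hy)
    have hnbr : ((env b G w []).nbrs x)[arr 𝓔 s₁ 6 x]?.getD 0 = y := by
      rw [env_nbrs]; simp [hy]
    have hwt : ((env b G w []).wts x)[arr 𝓔 s₁ 6 x]?.getD 0 = w s(x, y) := by
      rw [env_wts]; simp [hy]
    have hmy := hm y y.2.le
    have hmx := hm x x.2.le
    have hlt' : D.length < n := by
      have := (List.nodup_cons.2 ⟨hyD, HD₁.tree.nodup⟩).length_le_card
      simpa using this
    have hmc := hm (D.length + 1) hlt'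
    unfold bfsVisit
    simp only [WP_seq, WP_setW, WP_setR]
    generalize hs₂ : State.setW _ _ _ _ = s₂
    have e4 : arr 𝓔 s₂ 4 = Function.update (arr 𝓔 s₁ 4) y 1 := by
      rw [← hs₂]; simp [arr_setW, hqx, hmx, hmy, hnbr, hm 1 hn1]
    have e5 : arr 𝓔 s₂ 5 = Function.update (arr 𝓔 s₁ 5) y x := by
      rw [← hs₂]; simp [arr_setW, hqx, hmx, hmy, hnbr]
    have e0 : s₂.reals 0 = Function.update (s₁.reals 0) y (s₁.reals 0 x + w s(x, y)) := by
      rw [← hs₂]; simp [arr_setW, reals_setR, hqx, hmx, hmy, hnbr, hwt]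
    have e26 : arr 𝓔 s₂ 26 = Function.update (arr 𝓔 s₁ 26) D.length y := by
      rw [← hs₂]; simp [arr_setW, hqx, hmx, hmy, hnbr, HQ₁.count]
    have e28 : arr 𝓔 s₂ 28 0 = D.length + 1 := by
      rw [← hs₂]; simp [arr_setW, HQ₁.count, hm 1 hn1, hmc]
    have e2 : arr 𝓔 s₂ 2 0 = y := by
      rw [← hs₂]; simp [arr_setW, hqx, hmx, hmy, hnbr]
    have eo : ∀ a ∉ [2, 4, 5, 22, 23, 26, 28], arr 𝓔 s₂ a = arr 𝓔 s₁ a := by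
      intro a ha
      simp only [List.mem_cons, List.not_mem_nil, or_false, not_or] at ha
      rw [← hs₂]; simp [arr_setW, ha]
    have hne : ∀ {z : Fin n}, z ∈ D → (z : ℕ) ≠ y := by
      intro z hz e; rw [Fin.val_inj] at e; subst e; exact hyD hz
    have hd : ∀ z : Fin n, z ∈ D → s₂.reals 0 z = s₁.reals 0 z := by
      intro z hz; rw [e0, Function.update_of_ne (hne hz)]
    have hdy : s₂.reals 0 y = s₁.reals 0 x + w s(x, y) := by rw [e0, Function.update_self]
    have hwp : ∀ e ∈ G.edgeSet, 0 ≤ w e := fun e he => by rw [hw e he]; norm_num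
    have esc : scanned n 𝓔 s₂ = scanned n 𝓔 s₁ := by unfold scanned; rw [eo 6 (by simp)]
    left
    refine ⟨y, hyD, _, ⟨⟨?_, ?_⟩, ⟨?_, ?_, ?_, ?_, ?_⟩, rfl⟩, e2, ?_, ?_⟩
    · have ht := HD₁.tree.congr (par' := arr 𝓔 s₂ 5) (dist' := s₁.reals 0)
        (fun z hz => by rw [e5, Function.update_of_ne (hne hz)]) (fun _ _ => rfl)
      have HD₂ : DInv G w r D (arr 𝓔 s₁ 4) (arr 𝓔 s₂ 5) (arr 𝓔 s₁ 6) (s₁.reals 0) :=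
        ⟨HD₁.mem_disc, HD₁.not_mem_disc, ht, HD₁.exact, HD₁.far, HD₁.ptr_mem, HD₁.ptr_zero⟩
      refine HD₂.extend hyD e4 ?_ hd (eo 6 (by simp)) ?_
      · exact .cons (ht.congr (fun _ _ => rfl) hd) hyD hxD (by rw [e5, Function.update_self])
          hadj (by rw [hdy, hd x hxD])
      · intro z hz p
        obtain ⟨a, ha, c, hc, q, hac, hq⟩ := exists_exit hwp D p
          (HD₁.tree.root_mem (List.ne_nil_of_mem hxD)) hz
        obtain ⟨j, hj, hja⟩ := List.mem_iff_getElem.1 (List.mem_reverse.2 ha)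
        -- The vertex `a` cannot stand in front of the head of the queue: there all lists are
        -- exhausted, but its neighbour `c` is undiscovered.
        have hle : s₁.reals 0 x ≤ s₁.reals 0 a := by
          obtain ⟨hi, hix⟩ := List.getElem?_eq_some_iff.1 hx
          rcases lt_trichotomy j (arr 𝓔 s₁ 27 0) with h | h | h
          · exfalso
            have h1 := HQ₁.finished j a h (by rw [List.getElem?_eq_getElem hj, hja])
            obtain ⟨l, hl, hlc⟩ := List.mem_iff_getElem.1 (mem_adjList (w := w).2 hac)
            obtain ⟨y', hy', h'⟩ := HD₁.ptr_mem a l (by omega)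
            rw [List.getElem?_eq_getElem hl, hlc] at h'
            cases h'
            exact hc hy'
          · subst h
            rw [← hix, ← hja]
          · have := List.pairwise_iff_getElem.1 (List.pairwise_reverse.2 HQ₁.sorted) _ _ hi hj h
            rwa [hix, hja] at this
        have h2 := HD₁.exact a ha q
        rw [hdy, hw _ (G.mem_edgeSet.2 hadj)]
        rw [hw _ (G.mem_edgeSet.2 hac)] at hq
        linarith
    · rw [eo 1 (by simp), hβ₁]
    · simpa using e28
    · rw [eo 27 (by simp)]; simp; omega
    · intro i z hz
      rw [e26]
      simp only [List.reverse_cons] at hz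
      rw [List.getElem?_append] at hz
      split_ifs at hz with h
      · rw [Function.update_of_ne (by simp at h; omega)]
        exact HQ₁.queue i z hz
      · have : i = D.length ∧ y = z := by
          have h' := List.getElem?_eq_some_iff.1 hz
          obtain ⟨h1, h2⟩ := h'
          simp at h h1 h2
          exact ⟨by omega, h2⟩
        rw [this.1, Function.update_self, this.2]
    · intro i z hi hz
      rw [eo 27 (by simp)] at hi
      rw [eo 6 (by simp)]
      simp only [List.reverse_cons] at hz
      rw [List.getElem?_append_left (by simp; omega)] at hz
      exact HQ₁.finished i z hi hz
    · refine List.pairwise_cons.2 ⟨?_, ?_⟩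
      · intro z hz
        rw [hd z hz, hdy]
        obtain ⟨p, hp⟩ := HD₁.tree.exists_walk hxD
        have := HD₁.far z hz y hyD (p.append (.cons hadj .nil))
        simpa [hp] using this
      · refine HQ₁.sorted.imp_of_mem ?_
        intro a c ha hc h
        rw [hd a ha, hd c hc]; exact h
    · rw [eo 3 (by simp), hf₁ 3 (by simp)]
    · rw [eo 27 (by simp), esc]
      simp; omega
  · intro hlt
    simp only [WP_setW]
    generalize hs₂ : State.setW _ _ _ _ = s₂
    have eo : ∀ a, a ≠ 3 → arr 𝓔 s₂ a = arr 𝓔 s₁ a := by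
      intro a ha; rw [← hs₂]; simp [arr_setW, ha]
    have er : s₂.reals = s₁.reals := by rw [← hs₂]; simp
    have esc : scanned n 𝓔 s₂ = scanned n 𝓔 s₁ := by unfold scanned; rw [eo 6 (by simp)]
    right
    refine ⟨hD, ?_, ⟨_, ⟨⟨?_, ?_⟩, ⟨?_, ?_, ?_, ?_, ?_⟩, rfl⟩⟩, ?_, ?_⟩
    · intro x hx y hxy
      obtain ⟨i, hi, hix⟩ := List.mem_iff_getElem.1 (List.mem_reverse.2 hx)
      have h1 := HQ₁.finished i x (by simp at hi; omega) (by rw [List.getElem?_eq_getElem hi, hix])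
      obtain ⟨j, hj, hjy⟩ := List.mem_iff_getElem.1 (mem_adjList (w := w).2 hxy)
      obtain ⟨y', hy', h'⟩ := HD₁.ptr_mem x j (by omega)
      rw [List.getElem?_eq_getElem hj, hjy] at h'
      cases h'
      exact hy'
    · rw [eo 4 (by simp), eo 5 (by simp), eo 6 (by simp), er]; exact HD₁
    · rw [eo 1 (by simp), hβ₁]
    · rw [eo 28 (by simp)]; exact HQ₁.count
    · rw [eo 27 (by simp)]; exact HQ₁.head
    · rw [eo 26 (by simp)]; exact HQ₁.queue
    · rw [eo 27 (by simp), eo 6 (by simp)]; exact HQ₁.finished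
    · rw [er]; exact HQ₁.sorted
    · rw [← hs₂]; simp [arr_setW, hm 1 hn1]
    · rw [esc]; simp; omega

end Search

/-! ### Arboricity -/

section Arboricity

variable {n : ℕ} (G : SimpleGraph (Fin n))

/-- The edges inside `U`. -/
def within (U : Finset (Fin n)) : SimpleGraph (Fin n) where
  Adj x y := G.Adj x y ∧ x ∈ U ∧ y ∈ U
  symm := ⟨fun _ _ h => ⟨h.1.symm, h.2.2, h.2.1⟩⟩
  loopless := ⟨fun _ h => G.irrefl h.1⟩

theorem within_edgeSet (U : Finset (Fin n)) :
    (within G U).edgeSet = {e ∈ G.edgeSet | ∀ x ∈ e, x ∈ U} := by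
  ext e
  induction e with
  | _ x y => simp [within]

/-- A single vertex spans no edge, so the inequality that defines the arboricity also holds for |U|
= 1; a search begins with such a set. -/
theorem ncard_edges_le (U : Finset (Fin n)) (hU : 1 ≤ U.card) :
    ({e ∈ G.edgeSet | ∀ x ∈ e, x ∈ U}.ncard : ℝ) ≤ arboricity G * (U.card - 1) := by
  rcases hU.eq_or_lt with h | h
  · obtain ⟨a, rfl⟩ := Finset.card_eq_one.1 h.symm
    have : {e ∈ G.edgeSet | ∀ x ∈ e, x ∈ ({a} : Finset (Fin n))} = ∅ := by
      rw [← within_edgeSet]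
      ext e
      induction e with
      | _ x y =>
        simp only [within, Finset.mem_singleton, SimpleGraph.mem_edgeSet, Set.mem_empty_iff_false,
          iff_false]
        rintro ⟨h1, rfl, rfl⟩
        exact G.irrefl h1
    rw [this]; simp
  · have h1 := le_ciSup (f := fun U : {U : Finset (Fin n) // 2 ≤ U.card} =>
      (({e ∈ G.edgeSet | ∀ x ∈ e, x ∈ U.1}.ncard : ℕ) : ℝ) / ((U.1.card : ℝ) - 1))
      (Set.finite_range _).bddAbove ⟨U, h⟩
    have h2 : (0 : ℝ) < (U.card : ℝ) - 1 := by
      have : (2 : ℝ) ≤ U.card := by exact_mod_cast h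
      linarith
    exact (div_le_iff₀ h2).1 h1

variable {G}

theorem one_le_arboricity (hG : G ≠ ⊥) : 1 ≤ arboricity G := by
  classical
  obtain ⟨a, c, hac⟩ := SimpleGraph.ne_bot_iff_exists_adj.1 hG
  have hc : ({a, c} : Finset (Fin n)).card = 2 := Finset.card_pair hac.ne
  have h1 := ncard_edges_le G {a, c} (by omega)
  have h2 : 1 ≤ {e ∈ G.edgeSet | ∀ x ∈ e, x ∈ ({a, c} : Finset (Fin n))}.ncard := by
    rw [Nat.one_le_iff_ne_zero, Ne, Set.ncard_eq_zero (Set.toFinite _), ← Ne,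
      ← Set.nonempty_iff_ne_empty]
    exact ⟨s(a, c), by simpa using hac⟩
  rw [hc] at h1
  have h3 : (1 : ℝ) ≤ ({e ∈ G.edgeSet | ∀ x ∈ e, x ∈ ({a, c} : Finset (Fin n))}.ncard : ℝ) := by
    exact_mod_cast h2
  push_cast at h1
  linarith

/-- The pointer of a vertex passes only discovered vertices, and undiscovered vertices have not been
scanned. So the scanned entries are darts of the graph induced by `D`, and there are at most twice
as many as edges inside `D`. This is where the arboricity, rather than the degrees, enters the
running time. -/
theorem DInv.scanned_le_arboricity {w : Sym2 (Fin n) → ℝ} {r : Fin n} {D : List (Fin n)}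
    {disc par : ℕ → ℕ} {dist : ℕ → ℝ} {b : ℕ} {s : State}
    (H : DInv G w r D disc par (arr (env b G w []) s 6) dist) (hD : D ≠ []) :
    (scanned n (env b G w []) s : ℝ) ≤ 2 * (arboricity G * (D.length - 1)) := by
  classical
  have hcard : D.toFinset.card = D.length := List.toFinset_card_of_nodup H.tree.nodup
  have h1 := ncard_edges_le G D.toFinset (by
    rw [hcard]; exact List.length_pos_iff.2 hD)
  rw [← within_edgeSet, hcard] at h1
  have h2 : scanned n (env b G w []) s ≤ ∑ x, (within G D.toFinset).degree x := by
    unfold scanned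
    refine Finset.sum_le_sum fun x _ => ?_
    by_cases hx : x ∈ D
    · have hsub : ((adjList G w x).take (arr (env b G w []) s 6 x)).toFinset ⊆
          (within G D.toFinset).neighborFinset x := by
        intro y hy
        rw [List.mem_toFinset] at hy
        obtain ⟨i, hi, rfl⟩ := List.mem_iff_getElem.1 hy
        rw [List.length_take] at hi
        obtain ⟨y, hy, h⟩ := H.ptr_mem x i (by omega)
        obtain ⟨h4, h5⟩ := List.getElem?_eq_some_iff.1 h
        rw [List.getElem_take, h5]
        rw [SimpleGraph.mem_neighborFinset]
        exact ⟨mem_adjList.1 (h5 ▸ List.getElem_mem h4), List.mem_toFinset.2 hx,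
          List.mem_toFinset.2 hy⟩
      have h3 := Finset.card_le_card hsub
      rw [List.toFinset_card_of_nodup ((adjList_nodup x).sublist (List.take_sublist _ _)),
        List.length_take, min_eq_left (H.ptr_le x), SimpleGraph.card_neighborFinset_eq_degree] at h3
      exact h3
    · rw [H.ptr_zero x hx]; exact Nat.zero_le _
  rw [SimpleGraph.sum_degrees_eq_twice_card_edges] at h2
  have h3 : (within G D.toFinset).edgeFinset.card = (within G D.toFinset).edgeSet.ncard := by
    rw [← SimpleGraph.coe_edgeFinset, Set.ncard_coe_finset]
  have h4 : (scanned n (env b G w []) s : ℝ) ≤ 2 * ((within G D.toFinset).edgeSet.ncard : ℝ) := by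
    rw [← h3]; exact_mod_cast h2
  linarith

end Arboricity

/-! ### Runs of the search -/

/-- Start the search that the number of ranks asks for. -/
def initProg : Prog := .branch (.weq (.var 1) (.lit 1)) bfsInit (.seq dijkstraInit dijkstraProg)

/-- A round of the search that the number of ranks asks for. -/
def roundProg : Prog := .branch (.weq (.var 1) (.lit 1)) bfsProg dijkstraProg

theorem initProg_silent : initProg.Silent := by
  simp [initProg, bfsInit, dijkstraInit, dijkstraProg, insertProg, addRoot, linkProg, swapProg,
    scanProg, visitProg, extractProg, pushProg, releaseProg, popProg, reparkProg, processProg,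
    advanceProg, parkProg, relaxProg, decreaseProg, replaceProg, Prog.Silent, Test.TableFree,
    WExpr.TableFree, RExpr.TableFree]

theorem roundProg_silent : roundProg.Silent := by
  simp [roundProg, bfsProg, bfsAdvance, bfsVisit, dijkstraProg, insertProg, addRoot, linkProg,
    swapProg, scanProg, visitProg, extractProg, pushProg, releaseProg, popProg, reparkProg,
    processProg, advanceProg, parkProg, relaxProg, decreaseProg, replaceProg, Prog.Silent,
    Test.TableFree, WExpr.TableFree, RExpr.TableFree]

section Run

variable {n : ℕ} {G : SimpleGraph (Fin n)} {w : Sym2 (Fin n) → ℝ} {r : Fin n}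
variable {b β : ℕ}

local notation "𝓔" => env b G w []

/-- The search terminates correctly for the number `β` of ranks. -/
def Suits (G : SimpleGraph (Fin n)) (w : Sym2 (Fin n) → ℝ) (b β : ℕ) : Prop :=
  (∃ β₁, Fits (env b G w []) n β₁) ∧ (∀ e ∈ G.edgeSet, 0 ≤ w e) ∧
    (β = 1 ∧ (∀ e ∈ G.edgeSet, w e = 1) ∨ Fits (env b G w []) n β)

/-- A complete run of the search from `r`: after `i` rounds, the discovered vertices are
`x 0, …, x i`; round `m` finds out that the component of `r` is exhausted. -/
structure SearchRun (G : SimpleGraph (Fin n)) (w : Sym2 (Fin n) → ℝ) (r : Fin n) (b β : ℕ) where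
  m : ℕ
  st : ℕ → State
  x : ℕ → Fin n
  D : ℕ → List (Fin n)
  t₀ : ℕ
  t : ℕ → ℕ
  init : Exec (env b G w []) initProg (searchStart r β) t₀ (st 0)
  round : ∀ i ≤ m, Exec (env b G w []) roundProg (st i) (t i) (st (i + 1))
  dinv : ∀ i ≤ m, DInv G w r (D i) (arr (env b G w []) (st i) 4) (arr (env b G w []) (st i) 5)
    (arr (env b G w []) (st i) 6) ((st i).reals 0)
  last : ∀ i ≤ m, arr (env b G w []) (st i) 2 0 = x i
  running : ∀ i ≤ m, arr (env b G w []) (st i) 3 0 = 0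
  done : arr (env b G w []) (st (m + 1)) 3 0 = 1
  zero : D 0 = [r] ∧ x 0 = r
  succ : ∀ i < m, D (i + 1) = x (i + 1) :: D i
  closed : ∀ a ∈ D m, ∀ c, G.Adj a c → c ∈ D m
  time : ∀ i ≤ m + 1, (t₀ + ∑ j ∈ Finset.range i, t j : ℝ) ≤
    8000 * (arboricity G * i) + 4100 * (β * (i + 2))

/-- The invariant of the search between two rounds. -/
def SearchInv (G : SimpleGraph (Fin n)) (w : Sym2 (Fin n) → ℝ) (r : Fin n) (b β : ℕ) :
    State → List (Fin n) → ℕ → Prop :=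
  if β = 1 then BfsInv G w r b β else DijkstraInv G w r b β

theorem Suits.pos (h : Suits G w b β) : 1 ≤ β := by
  obtain ⟨-, -, ⟨h, -⟩ | h⟩ := h
  · omega
  · have := h.beta; omega

theorem SearchInv.roundInv {s : State} {D : List (Fin n)} {φ : ℕ}
    (H : SearchInv G w r b β s D φ) : RoundInv G w r b β s D := by
  unfold SearchInv at H
  split_ifs at H
  · exact H.1
  · exact H.1

theorem Suits.one_eq (h : Suits G w b β) : (1 : ℕ) % 2 ^ (env b G w []).wordBits = 1 := by
  obtain ⟨⟨β₁, F⟩, -, -⟩ := h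
  exact Nat.mod_eq_of_lt (F.lt' (by omega))

theorem search_round (h : Suits G w b β) {s : State} {D : List (Fin n)} {φ : ℕ} (hD : D ≠ [])
    (H : SearchInv G w r b β s D φ) :
    WP 𝓔 roundProg s (fun t s' => ∃ t', t ≤ t' + 10 ∧
      RoundPost G w b β 4000 (SearchInv G w r b β) s D φ t' s') := by
  have h1 := h.one_eq
  have hβ := H.roundInv.ranks
  obtain ⟨⟨β₁, F₁⟩, hw, hc⟩ := h
  unfold roundProg
  rw [WP_branch]
  simp only [holds_weq, eval_cell, eval_lit, Nat.zero_mod, hβ, h1]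
  unfold SearchInv at H ⊢
  constructor
  · rintro rfl
    simp only [if_true] at H ⊢
    have hu : ∀ e ∈ G.edgeSet, w e = 1 := by
      rcases hc with h | h
      · exact h.2
      · have := h.beta; omega
    exact (bfs_round F₁ hu le_rfl hD H).mono fun t s' h' => ⟨t, by simp; omega, h'⟩
  · intro hb
    simp only [if_neg hb] at H ⊢
    have F : Fits 𝓔 n β := by
      rcases hc with h | h
      · exact absurd h.1 hb
      · exact h
    exact (dijkstra_round F hw H).mono fun t s' h' => ⟨t, by simp; omega, h'⟩

theorem bfs_init {β₁ : ℕ} (F : Fits 𝓔 n β₁) (hβ : β % 2 ^ (env b G w []).wordBits = β)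
    (hw : ∀ e ∈ G.edgeSet, 0 ≤ w e) :
    WP 𝓔 bfsInit (searchStart r β) (fun t s' => t ≤ 100 ∧ BfsInv G w r b β s' [r] 300 ∧
      arr 𝓔 s' 2 0 = r ∧ arr 𝓔 s' 3 0 = 0 ∧ scanned n 𝓔 s' = 0) := by
  have hmr : (r : ℕ) % 2 ^ (env b G w []).wordBits = r := Nat.mod_eq_of_lt (F.lt' (by omega))
  have hm1 : 1 % 2 ^ (env b G w []).wordBits = 1 := Nat.mod_eq_of_lt (F.lt' (by omega))
  have ha : ∀ a, a ≠ 0 → a ≠ 1 → arr 𝓔 (searchStart r β) a = fun _ => 0 := by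
    intro a h0 h1; funext i; simp [arr, searchStart, h0, h1]
  have ha0 : arr 𝓔 (searchStart r β) 0 0 = r := by simp [arr, searchStart, hmr]
  have ha1 : arr 𝓔 (searchStart r β) 1 0 = β := by simp [arr, searchStart, hβ]
  unfold bfsInit
  simp only [WP_seq, WP_setW]
  generalize hs₂ : State.setW _ _ _ _ = s₂
  have e4 : arr 𝓔 s₂ 4 = Function.update (fun _ => 0) (r : ℕ) 1 := by
    rw [← hs₂]; simp [arr_setW, ha0, hm1, ha]
  have er : s₂.reals 0 = fun _ => 0 := by rw [← hs₂]; rfl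
  have eo : ∀ a ∉ [0, 1, 2, 4, 26, 28], arr 𝓔 s₂ a = fun _ => 0 := by
    intro a h
    simp only [List.mem_cons, List.not_mem_nil, or_false, not_or] at h
    rw [← hs₂]; simp [arr_setW, h, ha]
  refine ⟨by simp, ⟨⟨⟨?_, ?_, ?_, ?_, ?_, ?_, ?_⟩, ?_⟩, ⟨?_, ?_, ?_, ?_, ?_⟩, ?_⟩, ?_, ?_, ?_⟩
  · intro x hx
    rw [List.mem_singleton.1 hx, e4, Function.update_self]
  · intro x hx
    rw [e4, Function.update_of_ne]
    rw [Ne, Fin.val_inj]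
    simpa using hx
  · exact .one (by rw [er])
  · intro x _ p; rw [er]; exact walkWeight_nonneg hw p
  · intro x _ z _ p; rw [er]; exact walkWeight_nonneg hw p
  · intro x i hi
    simp [eo 6 (by simp)] at hi
  · intro x _; rw [eo 6 (by simp)]
  · rw [← hs₂]; simp [arr_setW, ha1]
  · rw [← hs₂]; simp [arr_setW, hm1]
  · rw [eo 27 (by simp)]; simp
  · intro i x hx
    have hi := (List.getElem?_eq_some_iff.1 hx).1
    simp at hi
    subst hi
    simp at hx
    subst hx
    rw [← hs₂]; simp [arr_setW, ha0, hmr]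
  · intro i x hi
    simp [eo 27 (by simp)] at hi
  · simp
  · rw [eo 27 (by simp)]; simp
  · rw [← hs₂]; simp [arr_setW, ha0, hmr]
  · rw [eo 3 (by simp)]
  · unfold scanned; rw [eo 6 (by simp)]; simp

/-- The start of Dijkstra's algorithm includes its first round, so that both kinds of search start
with the root as the only discovered vertex. -/
theorem search_init (h : Suits G w b β) :
    WP 𝓔 initProg (searchStart r β) (fun t s' => ∃ φ, SearchInv G w r b β s' [r] φ ∧
      arr 𝓔 s' 2 0 = r ∧ arr 𝓔 s' 3 0 = 0 ∧
      t + φ ≤ 4000 * scanned n 𝓔 s' + 4100 * (2 * β)) := by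
  have h1 := h.one_eq
  have hp := h.pos
  obtain ⟨⟨β₁, F₁⟩, hw, hc⟩ := h
  have hβ : β % 2 ^ (env b G w []).wordBits = β := by
    rcases hc with h | h
    · rw [h.1]; exact h1
    · exact Nat.mod_eq_of_lt (h.lt' (by omega))
  have ha1 : arr 𝓔 (searchStart r β) 1 0 = β := by simp [arr, searchStart, hβ]
  unfold initProg
  rw [WP_branch]
  simp only [holds_weq, eval_cell, eval_lit, Nat.zero_mod, ha1, h1]
  unfold SearchInv
  constructor
  · intro hb
    simp only [if_pos hb]
    refine (bfs_init F₁ hβ hw).mono ?_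
    rintro t s' ⟨k1, k2, k3, k4, k5⟩
    exact ⟨_, k2, k3, k4, by simp; omega⟩
  · intro hb
    simp only [if_neg hb]
    have F : Fits 𝓔 n β := by
      rcases hc with h | h
      · exact absurd h.1 hb
      · exact h
    rw [WP_seq]
    refine (dijkstra_init F).mono ?_
    rintro t s' ⟨φ, k1, k2, k3, k4⟩
    refine (dijkstra_round F hw k1).mono ?_
    have hb4 := F.beta
    rintro t' s'' (⟨y, -, φ', k5, k6, k7, k8⟩ | ⟨k5, -⟩)
    · have hyr : y = r := by
        cases k5.1.dinv.tree with
        | one => rfl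
        | cons _ _ h => simp at h
      subst hyr
      exact ⟨φ', k5, k6, by rw [k7, k2], by simp; omega⟩
    · exact absurd rfl k5

/-- The state of the search after a number of rounds. -/
structure SearchConfig (G : SimpleGraph (Fin n)) (w : Sym2 (Fin n) → ℝ) (r : Fin n) (b β : ℕ)
    (s : State) (D : List (Fin n)) (x : Fin n) (T : ℕ) : Prop where
  inv : ∃ φ, SearchInv G w r b β s D φ ∧
    T + φ ≤ 4000 * scanned n (env b G w []) s + 4100 * (β * (D.length + 1))
  nonempty : D ≠ []
  last : arr (env b G w []) s 2 0 = x
  running : arr (env b G w []) s 3 0 = 0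

theorem SearchConfig.next (h : Suits G w b β) {s : State} {D : List (Fin n)} {x : Fin n} {T : ℕ}
    (H : SearchConfig G w r b β s D x T) :
    ∃ t s', Exec 𝓔 roundProg s t s' ∧
      ((∃ y ∉ D, SearchConfig G w r b β s' (y :: D) y (T + t)) ∨
      ((∀ a ∈ D, ∀ c, G.Adj a c → c ∈ D) ∧ arr 𝓔 s' 3 0 = 1 ∧ (∃ φ, SearchInv G w r b β s' D φ) ∧
        T + t ≤ 4000 * scanned n 𝓔 s' + 4100 * (β * (D.length + 2)))) := by
  obtain ⟨φ, h1, h2⟩ := H.inv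
  have hp := h.pos
  obtain ⟨t, s', h3, t', h4, h5⟩ := search_round h H.nonempty h1
  refine ⟨t, s', h3, ?_⟩
  rcases h5 with ⟨y, k1, φ', k2, k3, k4, k5⟩ | ⟨-, k1, k2, k3, k4⟩
  · left
    refine ⟨y, k1, ⟨φ', k2, ?_⟩, by simp, k3, by rw [k4, H.running]⟩
    simp only [List.length_cons]
    have : β * (D.length + 1 + 1) = β * (D.length + 1) + β := by ring
    omega
  · right
    refine ⟨k1, k3, k2, ?_⟩
    have : β * (D.length + 2) = β * (D.length + 1) + β := by ring
    omega

/-- Every round that does not finish the search adds a new vertex to a list without repetitions, so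
the number of undiscovered vertices serves as the induction parameter. The run is assembled
backwards, by putting the first round in front of the run that remains. -/
theorem SearchConfig.exists_run (h : Suits G w b β) (k : ℕ) : ∀ {s : State} {D : List (Fin n)}
    {x : Fin n} {T : ℕ}, SearchConfig G w r b β s D x T → n - D.length = k →
    ∃ (m : ℕ) (st : ℕ → State) (Ds : ℕ → List (Fin n)) (t Ts : ℕ → ℕ)
      (ys : ℕ → Fin n), st 0 = s ∧ Ds 0 = D ∧ ys 0 = x ∧ Ts 0 = T ∧
      (∀ i ≤ m, SearchConfig G w r b β (st i) (Ds i) (ys i) (Ts i)) ∧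
      (∀ i ≤ m, Exec 𝓔 roundProg (st i) (t i) (st (i + 1)) ∧ Ts (i + 1) = Ts i + t i) ∧
      (∀ i < m, Ds (i + 1) = ys (i + 1) :: Ds i) ∧
      (∀ a ∈ Ds m, ∀ c, G.Adj a c → c ∈ Ds m) ∧ arr 𝓔 (st (m + 1)) 3 0 = 1 ∧
      (∃ φ, SearchInv G w r b β (st (m + 1)) (Ds m) φ) ∧
      Ts (m + 1) ≤ 4000 * scanned n 𝓔 (st (m + 1)) + 4100 * (β * ((Ds m).length + 2)) := by
  induction k using Nat.strong_induction_on with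
  | _ k ih =>
    intro s D x T H hk
    obtain ⟨t₀, s', h1, ⟨y, hy, H'⟩ | ⟨h2, h3, h4, h5⟩⟩ := H.next h
    · obtain ⟨φ, h2, -⟩ := H'.inv
      have h3 := h2.roundInv.dinv.length_le
      simp only [List.length_cons] at h3
      obtain ⟨m, st, Ds, t, Ts, ys, a1, a2, a3, a4, a5, a6, a7, a8, a9, a10, a11⟩ :=
        ih (k - 1) (by omega) H' (by simp only [List.length_cons]; omega)
      refine ⟨m + 1, fun i => Nat.casesOn i s st, fun i => Nat.casesOn i D Ds,
        fun i => Nat.casesOn i t₀ t, fun i => Nat.casesOn i T Ts, fun i => Nat.casesOn i x ys,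
        rfl, rfl, rfl, rfl, ?_, ?_, ?_, a8, a9, a10, a11⟩
      · rintro (_ | i) hi
        · exact H
        · exact a5 i (by omega)
      · rintro (_ | i) hi
        · exact ⟨by simpa [a1] using h1, a4⟩
        · exact a6 i (by omega)
      · rintro (_ | i) hi
        · show Ds 0 = ys 0 :: D
          rw [a2, a3]
        · exact a7 i (by omega)
    · refine ⟨0, fun i => Nat.casesOn i s (fun _ => s'), fun _ => D, fun _ => t₀,
        fun i => Nat.casesOn i T (fun _ => T + t₀), fun _ => x,
        rfl, rfl, rfl, rfl, ?_, ?_, by simp, h2, h3, h4, h5⟩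
      · intro i hi
        obtain rfl : i = 0 := by omega
        exact H
      · intro i hi
        obtain rfl : i = 0 := by omega
        exact ⟨h1, rfl⟩

theorem exists_searchRun (h : Suits G w b β) (r : Fin n) : Nonempty (SearchRun G w r b β) := by
  obtain ⟨t₀, s₀, h0, φ, h1, h2, h3, h4⟩ := search_init (r := r) h
  have H : SearchConfig G w r b β s₀ [r] r t₀ :=
    ⟨⟨φ, h1, by simp only [List.length_singleton]; rw [Nat.mul_comm β]; omega⟩, by simp, h2, h3⟩
  obtain ⟨m, st, Ds, t, Ts, ys, a1, a2, a3, a4, a5, a6, a7, a8, a9, ⟨φ', a10⟩, a11⟩ :=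
    SearchConfig.exists_run h _ H rfl
  have hlen : ∀ i ≤ m, (Ds i).length = i + 1 := by
    intro i
    induction i with
    | zero => intro _; simp [a2]
    | succ i ih => intro hi; rw [a7 i (by omega), List.length_cons, ih (by omega)]
  have hT : ∀ i ≤ m + 1, t₀ + ∑ j ∈ Finset.range i, t j = Ts i := by
    intro i
    induction i with
    | zero => intro _; simp [a4]
    | succ i ih =>
      intro hi
      rw [Finset.sum_range_succ, ← add_assoc, ih (by omega), (a6 i (by omega)).2]
  refine ⟨⟨m, st, ys, Ds, t₀, t, by rw [a1]; exact h0, fun i hi => (a6 i hi).1, ?_,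
    fun i hi => (a5 i hi).last, fun i hi => (a5 i hi).running, a9, ⟨a2, a3⟩, a7, a8, ?_⟩⟩
  · intro i hi
    obtain ⟨φ, h5, -⟩ := (a5 i hi).inv
    exact h5.roundInv.dinv
  · intro i hi
    have hcast : (t₀ + ∑ j ∈ Finset.range i, t j : ℝ) = (Ts i : ℝ) := by
      rw [← hT i hi]; push_cast; rfl
    rw [hcast]
    have hlam : 0 ≤ arboricity G := by
      refine Real.iSup_nonneg fun U => div_nonneg (Nat.cast_nonneg _) ?_
      have : (2 : ℝ) ≤ U.1.card := by exact_mod_cast U.2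
      linarith
    rcases hi.lt_or_eq with hi | rfl
    · obtain ⟨φ, h5, h6⟩ := (a5 i (by omega)).inv
      have h7 := h5.roundInv.dinv.scanned_le_arboricity (a5 i (by omega)).nonempty
      rw [hlen i (by omega)] at h6 h7
      have h8 : (Ts i : ℝ) ≤ 4000 * scanned n 𝓔 (st i) + 4100 * (β * (i + 1 + 1)) := by
        exact_mod_cast (Nat.le_add_right _ φ).trans h6
      push_cast at h7
      have h9 : arboricity G * ((i : ℝ) + 1 - 1) = arboricity G * i := by ring
      rw [h9] at h7
      have h10 : (β : ℝ) * (i + 1 + 1) = β * (i + 2) := by ring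
      rw [h10] at h8
      linarith
    · have h7 := a10.roundInv.dinv.scanned_le_arboricity (a5 m le_rfl).nonempty
      rw [hlen m le_rfl] at a11 h7
      have h8 : (Ts (m + 1) : ℝ) ≤ 4000 * scanned n 𝓔 (st (m + 1)) +
          4100 * (β * (m + 1 + 2)) := by
        exact_mod_cast a11
      push_cast at h7 ⊢
      have h9 : arboricity G * ((m : ℝ) + 1 - 1) ≤ arboricity G * (m + 1) :=
        mul_le_mul_of_nonneg_left (by linarith) hlam
      linarith

namespace SearchRun

variable (R : SearchRun G w r b β)

theorem mem_D {i : ℕ} (hi : i ≤ R.m) (v : Fin n) : v ∈ R.D i ↔ ∃ j ≤ i, R.x j = v := by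
  induction i with
  | zero => simp [R.zero.1, R.zero.2, eq_comm]
  | succ i ih =>
    rw [R.succ i (by omega), List.mem_cons, ih (by omega)]
    constructor
    · rintro (rfl | ⟨j, h1, h2⟩)
      · exact ⟨i + 1, le_rfl, rfl⟩
      · exact ⟨j, by omega, h2⟩
    · rintro ⟨j, h1, h2⟩
      rcases h1.lt_or_eq with h | rfl
      · exact .inr ⟨j, by omega, h2⟩
      · exact .inl h2.symm

theorem x_injOn : Set.InjOn R.x {i | i ≤ R.m} := by
  suffices H : ∀ i j, i < j → j ≤ R.m → R.x i ≠ R.x j by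
    intro i hi j hj h
    rcases lt_trichotomy i j with h1 | h1 | h1
    · exact absurd h (H i j h1 hj)
    · exact h1
    · exact absurd h.symm (H j i h1 hi)
  intro i j hij hj h
  obtain ⟨j, rfl⟩ : ∃ j', j = j' + 1 := ⟨j - 1, by omega⟩
  have h1 := (R.dinv _ hj).tree.nodup
  rw [R.succ j (by omega), List.nodup_cons] at h1
  exact h1.1 ((R.mem_D (by omega) _).2 ⟨i, by omega, h⟩)

theorem m_lt : R.m < n := by
  have h1 : (R.D R.m).length = R.m + 1 := by
    have : ∀ i ≤ R.m, (R.D i).length = i + 1 := by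
      intro i
      induction i with
      | zero => intro _; simp [R.zero.1]
      | succ i ih => intro hi; rw [R.succ i (by omega), List.length_cons, ih (by omega)]
    exact this _ le_rfl
  have := (R.dinv R.m le_rfl).length_le
  omega

theorem exists_x {v : Fin n} (hv : G.Reachable r v) : ∃ j ≤ R.m, R.x j = v := by
  rw [← R.mem_D le_rfl]
  have h0 : r ∈ R.D R.m := (R.mem_D le_rfl _).2 ⟨0, by omega, R.zero.2⟩
  have : ∀ {u v : Fin n} (p : G.Walk u v), u ∈ R.D R.m → v ∈ R.D R.m := by
    intro u v p
    induction p with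
    | nil => exact id
    | cons h p ih => exact fun hu => ih (R.closed _ hu _ h)
  obtain ⟨p⟩ := hv
  exact this p h0

theorem reachable {i : ℕ} (hi : i ≤ R.m) : G.Reachable r (R.x i) := by
  obtain ⟨p, -⟩ := (R.dinv i hi).tree.exists_walk ((R.mem_D hi _).2 ⟨i, le_rfl, rfl⟩)
  exact ⟨p⟩

end SearchRun

end Run

/-! ### Spanners with few edges -/

section Spanner

variable {n : ℕ}

/-- No edge can be bypassed by a walk with fewer than `l` edges. -/
def NoBypass (H : SimpleGraph (Fin n)) (l : ℕ) : Prop :=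
  ∀ a c, H.Adj a c → ∀ p : H.Walk a c, s(a, c) ∉ p.edges → l ≤ p.length

theorem NoBypass.mono {H K : SimpleGraph (Fin n)} {l : ℕ} (h : NoBypass H l) (hK : K ≤ H) :
    NoBypass K l := by
  intro a c hac p hp
  have := h a c (hK hac) (p.mapLe hK) (by simpa using hp)
  simpa using this

open Classical in
/-- The ball of radius `j` around `v`. -/
def gball (K : SimpleGraph (Fin n)) (v : Fin n) : ℕ → Finset (Fin n)
  | 0 => {v}
  | j + 1 => gball K v j ∪ Finset.univ.filter (fun y => ∃ x ∈ gball K v j, K.Adj x y)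

variable {K : SimpleGraph (Fin n)} {v : Fin n}

theorem gball_succ {j : ℕ} : gball K v j ⊆ gball K v (j + 1) := by
  classical
  exact Finset.subset_union_left

theorem gball_mono {i j : ℕ} (h : i ≤ j) : gball K v i ⊆ gball K v j := by
  induction h with
  | refl => exact Finset.Subset.refl _
  | step _ ih => exact ih.trans gball_succ

theorem mem_gball_succ {j : ℕ} {x y : Fin n} (hx : x ∈ gball K v j) (h : K.Adj x y) :
    y ∈ gball K v (j + 1) := by
  classical
  exact Finset.mem_union_right _ (by simp; exact ⟨x, hx, h⟩)

/-- All vertices of the walk except the last one lie in smaller balls. This keeps the walks in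
`NoBypass.false_of_two` away from the vertex `z`. -/
theorem exists_walk_gball {j : ℕ} : ∀ {z : Fin n}, z ∈ gball K v j →
    ∃ p : K.Walk v z, p.length ≤ j ∧ ∀ u ∈ p.support, u = z ∨ ∃ i < j, u ∈ gball K v i := by
  classical
  induction j with
  | zero =>
    intro z hz
    have : z = v := by simpa [gball] using hz
    subst this
    exact ⟨.nil, by simp, by simp⟩
  | succ j ih =>
    intro z hz
    rcases Finset.mem_union.1 hz with h | h
    · obtain ⟨p, h1, h2⟩ := ih h
      refine ⟨p, by omega, fun u hu => ?_⟩
      rcases h2 u hu with h | ⟨i, hi, h⟩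
      · exact .inl h
      · exact .inr ⟨i, by omega, h⟩
    · simp only [Finset.mem_filter, Finset.mem_univ, true_and] at h
      obtain ⟨x, hx, hxz⟩ := h
      obtain ⟨p, h1, h2⟩ := ih hx
      refine ⟨p.concat hxz, by simp; omega, fun u hu => ?_⟩
      rw [SimpleGraph.Walk.support_concat, List.mem_append] at hu
      rcases hu with hu | hu
      · right
        rcases h2 u hu with rfl | ⟨i, hi, h⟩
        · exact ⟨j, by omega, hx⟩
        · exact ⟨i, by omega, h⟩
      · exact .inl (by simpa using hu)

/-- The layer of radius `j` around `v`. -/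
def layer (K : SimpleGraph (Fin n)) (v : Fin n) : ℕ → Finset (Fin n)
  | 0 => {v}
  | j + 1 => gball K v (j + 1) \ gball K v j

theorem layer_subset : ∀ {j : ℕ}, layer K v j ⊆ gball K v j
  | 0 => Finset.Subset.refl _
  | _ + 1 => Finset.sdiff_subset

theorem not_mem_gball_of_lt {j i : ℕ} {x : Fin n} (hx : x ∈ layer K v j) (hi : i < j) :
    x ∉ gball K v i := by
  cases j with
  | zero => omega
  | succ j => exact fun h => (Finset.mem_sdiff.1 hx).2 (gball_mono (by omega) h)

/-- The walk from `z` to `q`, back to the centre and on to `p` has at most 2j + 1 < l edges. It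
bypasses the edge between `z` and `p`, because the two walks in the ball avoid `z`. -/
theorem NoBypass.false_of_two {l j : ℕ} (hK : NoBypass K l) (hj : 2 * j + 1 < l) {z p q : Fin n}
    (hpq : p ≠ q) (hp : K.Adj z p) (hq : K.Adj z q) (hpj : p ∈ gball K v j) (hqj : q ∈ gball K v j)
    (hz : ∀ i < j, z ∉ gball K v i) : False := by
  obtain ⟨a, ha, ha'⟩ := exists_walk_gball hpj
  obtain ⟨c, hc, hc'⟩ := exists_walk_gball hqj
  have hza : z ∉ a.support := by
    intro h
    rcases ha' z h with h | ⟨i, hi, h⟩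
    · exact hp.ne h
    · exact hz i hi h
  have hzc : z ∉ c.support := by
    intro h
    rcases hc' z h with h | ⟨i, hi, h⟩
    · exact hq.ne h
    · exact hz i hi h
  have := hK z p hp (.cons hq (c.reverse.append a)) (by
    simp only [SimpleGraph.Walk.edges_cons, SimpleGraph.Walk.edges_append,
      SimpleGraph.Walk.edges_reverse, List.mem_cons, List.mem_append, List.mem_reverse, not_or]
    refine ⟨?_, fun h => hzc (c.fst_mem_support_of_mem_edges h),
      fun h => hza (a.fst_mem_support_of_mem_edges h)⟩
    intro h
    rw [Sym2.eq_iff] at h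
    rcases h with ⟨-, h⟩ | ⟨h, -⟩
    · exact hpq h
    · exact hq.ne h)
  simp at this
  omega

open Classical in
/-- Layers grow by a factor of at least `t` if all degrees are greater than `t`. -/
theorem NoBypass.mul_card_layer_le {l j t : ℕ} (hK : NoBypass K l) (hj : 2 * j + 1 < l)
    (hdeg : ∀ x, K.degree x ≠ 0 → t + 1 ≤ K.degree x) (hv : K.degree v ≠ 0) :
    t * (layer K v j).card ≤ (layer K v (j + 1)).card := by
  have hsub : (layer K v j).biUnion (fun x => K.neighborFinset x \ gball K v j) ⊆
      layer K v (j + 1) := by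
    intro y hy
    simp only [Finset.mem_biUnion, Finset.mem_sdiff, SimpleGraph.mem_neighborFinset] at hy
    obtain ⟨x, hx, hxy, hy⟩ := hy
    exact Finset.mem_sdiff.2 ⟨mem_gball_succ (layer_subset hx) hxy, hy⟩
  refine le_trans ?_ (Finset.card_le_card hsub)
  rw [Finset.card_biUnion]
  · rw [mul_comm, ← smul_eq_mul]
    refine Finset.card_nsmul_le_sum _ _ _ fun x hx => ?_
    have hdx : K.degree x ≠ 0 := by
      obtain ⟨p, -, -⟩ := exists_walk_gball (layer_subset hx)
      by_cases hxv : v = x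
      · rwa [← hxv]
      · intro h0
        have := p.reverse.not_nil_of_ne (Ne.symm hxv)
        have h1 := (p.reverse.adj_snd this)
        rw [← SimpleGraph.mem_neighborFinset] at h1
        rw [← SimpleGraph.card_neighborFinset_eq_degree, Finset.card_eq_zero] at h0
        rw [h0] at h1
        simp at h1
    have h1 := hdeg x hdx
    -- Two neighbours of `x` inside the ball would give a short bypass, so all neighbours of `x` but
    -- one lie in the next layer.
    have h2 : (K.neighborFinset x ∩ gball K v j).card ≤ 1 := by
      rw [Finset.card_le_one]
      intro p hp q hq
      simp only [Finset.mem_inter, SimpleGraph.mem_neighborFinset] at hp hq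
      by_contra hpq
      exact hK.false_of_two hj hpq hp.1 hq.1 hp.2 hq.2 fun i hi => not_mem_gball_of_lt hx hi
    have h3 := Finset.card_sdiff_add_card_inter (K.neighborFinset x) (gball K v j)
    rw [SimpleGraph.card_neighborFinset_eq_degree] at h3
    show t ≤ (K.neighborFinset x \ gball K v j).card
    omega
  -- A common neighbour of two vertices of the layer outside the ball would give a short bypass too,
  -- so their neighbourhoods in the next layer are disjoint.
  · intro x hx x' hx' hne
    rw [Function.onFun, Finset.disjoint_left]
    intro y h1 h2
    simp only [Finset.mem_sdiff, SimpleGraph.mem_neighborFinset] at h1 h2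
    exact hK.false_of_two hj hne h1.1.symm h2.1.symm (layer_subset hx) (layer_subset hx')
      fun i hi h => h1.2 (gball_mono hi.le h)

open Classical in
theorem NoBypass.pow_card_layer {k t : ℕ} (hK : NoBypass K (2 * k))
    (hdeg : ∀ x, K.degree x ≠ 0 → t + 1 ≤ K.degree x) (hv : K.degree v ≠ 0) (j : ℕ) (hj : j ≤ k) :
    t ^ j ≤ (layer K v j).card := by
  induction j with
  | zero => simp [layer]
  | succ j ih =>
    have h1 := hK.mul_card_layer_le (j := j) (by omega) hdeg hv
    calc t ^ (j + 1) = t * t ^ j := by ring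
      _ ≤ _ := (Nat.mul_le_mul_left _ (ih (by omega))).trans h1

open Classical in
/-- A graph without short cycles that is not too large has vertices of small degree. -/
theorem NoBypass.exists_degree_le {H : SimpleGraph (Fin n)} {k t : ℕ} (hk : 1 ≤ k)
    (hH : NoBypass H (2 * k)) {U : Finset (Fin n)} (hU : U.Nonempty) (ht : U.card ≤ t ^ k) :
    ∃ x ∈ U, (within H U).degree x ≤ t := by
  by_contra hcon
  push Not at hcon
  have hK : NoBypass (within H U) (2 * k) := hH.mono fun _ _ h => h.1
  have hin : ∀ x, (within H U).degree x ≠ 0 → x ∈ U := by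
    intro x hx
    rw [← SimpleGraph.card_neighborFinset_eq_degree, Finset.card_ne_zero] at hx
    obtain ⟨y, hy⟩ := hx
    rw [SimpleGraph.mem_neighborFinset] at hy
    exact hy.2.1
  obtain ⟨v, hv⟩ := hU
  have h1 := hK.pow_card_layer (fun x hx => hcon x (hin x hx)) (v := v)
    (by have := hcon v hv; omega) k le_rfl
  -- As k ≥ 1, the layer omits `v`. So t^k ≤ |U| - 1, which contradicts |U| ≤ t^k.
  have h2 : layer (within H U) v k ⊆ U.erase v := by
    intro x hx
    obtain ⟨j, rfl⟩ : ∃ j, k = j + 1 := ⟨k - 1, by omega⟩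
    have hxv : v ≠ x := by
      rintro rfl
      exact not_mem_gball_of_lt hx (Nat.succ_pos j) (by simp [gball])
    obtain ⟨p, -, -⟩ := exists_walk_gball (layer_subset hx)
    have h3 := p.reverse.adj_snd (p.reverse.not_nil_of_ne hxv.symm)
    exact Finset.mem_erase.2 ⟨hxv.symm, h3.2.1⟩
  have h3 := Finset.card_le_card h2
  rw [Finset.card_erase_of_mem hv] at h3
  have h4 : 0 < U.card := Finset.card_pos.2 ⟨v, hv⟩
  omega

-- Remove vertices of degree at most `t` one after the other. The smaller sets still satisfy the
-- bound t^k, so `NoBypass.exists_degree_le` applies at each step, and each removal deletes at most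
-- `t` edges.
open Classical in
theorem NoBypass.ncard_edges_le {H : SimpleGraph (Fin n)} {k t : ℕ} (hk : 1 ≤ k)
    (hH : NoBypass H (2 * k)) (m : ℕ) : ∀ U : Finset (Fin n), U.card = m → m ≤ t ^ k →
    (within H U).edgeSet.ncard ≤ t * m := by
  induction m with
  | zero =>
    intro U hU _
    rw [Finset.card_eq_zero.1 hU]
    have : (within H (∅ : Finset (Fin n))).edgeSet = ∅ := by
      rw [SimpleGraph.edgeSet_eq_empty]
      ext x y; simp [within]
    simp [this]
  | succ m ih =>
    intro U hU hm
    obtain ⟨x, hx, hd⟩ := hH.exists_degree_le hk (Finset.card_pos.1 (by omega)) (hU.le.trans hm)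
    have h1 := ih (U.erase x) (by rw [Finset.card_erase_of_mem hx, hU]; rfl)
      ((Nat.le_succ m).trans hm)
    have h2 : (within H U).edgeSet ⊆ (within H (U.erase x)).edgeSet ∪
        ((within H U).neighborFinset x).image (fun y => s(x, y)) := by
      intro e
      induction e with
      | _ a c =>
        intro he
        rw [SimpleGraph.mem_edgeSet] at he
        simp only [Set.mem_union, SimpleGraph.mem_edgeSet, Finset.coe_image, Set.mem_image,
          Finset.mem_coe, SimpleGraph.mem_neighborFinset]
        by_cases ha : a = x
        · subst ha; exact .inr ⟨c, he, rfl⟩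
        by_cases hc : c = x
        · subst hc; exact .inr ⟨a, he.symm, Sym2.eq_swap⟩
        · exact .inl ⟨he.1, Finset.mem_erase.2 ⟨ha, he.2.1⟩, Finset.mem_erase.2 ⟨hc, he.2.2⟩⟩
    have h3 := (Set.ncard_le_ncard h2 (Set.toFinite _)).trans (Set.ncard_union_le _ _)
    rw [Set.ncard_coe_finset] at h3
    have h4 : (((within H U).neighborFinset x).image (fun y => s(x, y))).card ≤ t :=
      Finset.card_image_le.trans (by rwa [SimpleGraph.card_neighborFinset_eq_degree])
    rw [Nat.mul_succ]
    omega

/-- Adding an edge between vertices of large distance creates no bypass. -/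
theorem NoBypass.sup_edge {H : SimpleGraph (Fin n)} {l : ℕ} (hH : NoBypass H l) {x y : Fin n}
    (hxy : ∀ p : H.Walk x y, l ≤ p.length) : NoBypass (H ⊔ SimpleGraph.edge x y) l := by
  classical
  set K := H ⊔ SimpleGraph.edge x y with hKdef
  have hle : H ≤ K := le_sup_left
  have hKadj : ∀ {a c}, K.Adj a c → s(a, c) ≠ s(x, y) → H.Adj a c := by
    intro a c h h1
    rcases h with h | h
    · exact h
    · exfalso
      rw [SimpleGraph.edge_adj] at h
      apply h1
      rw [Sym2.eq_iff]
      tauto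
  have htr : ∀ {a c} (p : K.Walk a c), s(x, y) ∉ p.edges →
      ∃ q : H.Walk a c, q.length = p.length ∧ q.edges = p.edges := by
    intro a c p
    induction p with
    | nil => exact fun _ => ⟨.nil, rfl, rfl⟩
    | cons h p ih =>
      intro hp
      simp only [SimpleGraph.Walk.edges_cons, List.mem_cons, not_or] at hp
      obtain ⟨q, h1, h2⟩ := ih hp.2
      exact ⟨.cons (hKadj h (Ne.symm hp.1)) q, by simp [h1], by simp [h2]⟩
  have hxy' : ∀ p : H.Walk y x, l ≤ p.length := by
    intro p; simpa using hxy p.reverse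
  intro a c hac p hp
  by_cases he : s(a, c) = s(x, y)
  · obtain ⟨q, h1, -⟩ := htr p (he ▸ hp)
    rw [← h1]
    rw [Sym2.eq_iff] at he
    rcases he with ⟨rfl, rfl⟩ | ⟨rfl, rfl⟩
    · exact hxy q
    · exact hxy' q
  have hac' := hKadj hac he
  -- pass to a path
  have key : ∀ {a c : Fin n}, H.Adj a c → ∀ (p : K.Walk a c), p.IsTrail → s(a, c) ∉ p.edges →
      l ≤ p.length := by
    intro a c hac' p ht hp
    by_cases hxyp : s(x, y) ∈ p.edges
    · obtain ⟨u, z, q₁, q₂, hq⟩ : ∃ u z, ∃ (q₁ : K.Walk a u) (q₂ : K.Walk z c), s(u, z) = s(x, y) ∧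
          p.edges = q₁.edges ++ s(u, z) :: q₂.edges := by
        clear ht hp hac'
        induction p with
        | nil => simp at hxyp
        | @cons a a' c h p ih =>
          by_cases h1 : s(a, a') = s(x, y)
          · exact ⟨a, a', .nil, p, h1, by simp⟩
          · simp only [SimpleGraph.Walk.edges_cons, List.mem_cons] at hxyp
            obtain ⟨u, z, q₁, q₂, h2, h3⟩ := ih (hxyp.resolve_left (Ne.symm h1))
            exact ⟨u, z, .cons h q₁, q₂, h2, by simp [h3]⟩
      obtain ⟨hq1, hq2⟩ := hq
      have hnd := ht.edges_nodup
      rw [hq2, hq1, List.nodup_append, List.nodup_cons] at hnd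
      obtain ⟨r₁, h3, -⟩ := htr q₁ (fun h => hnd.2.2 _ h _ (by simp) rfl)
      obtain ⟨r₂, h4, -⟩ := htr q₂ hnd.2.1.1
      have hlen : p.length = q₁.length + 1 + q₂.length := by
        rw [← SimpleGraph.Walk.length_edges, hq2]; simp; omega
      -- If the bypass of the old edge uses the new edge, exchange their roles: the rest of the
      -- bypass together with the old edge connects `x` and `y` in `H` and has the same number of
      -- edges.
      have hw : l ≤ (r₁.reverse.append (.cons hac' r₂.reverse)).length := by
        rw [Sym2.eq_iff] at hq1
        rcases hq1 with ⟨rfl, rfl⟩ | ⟨rfl, rfl⟩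
        · exact hxy _
        · exact hxy' _
      simp at hw
      omega
    · obtain ⟨q, h1, h2⟩ := htr p hxyp
      rw [← h1]
      exact hH _ _ hac' q (by rw [h2]; exact hp)
  exact (key hac' p.bypass p.bypass_isPath.isTrail
    (fun h => hp (p.edges_bypass_subset_edges h))).trans p.length_bypass_le_length

/-- The greedy spanner for pairs in the order of the list `l` (last pair first). -/
theorem exists_spanner_list (d : Fin n → Fin n → ℝ) (hd : ∀ a c, d a c = d c a) {k : ℕ}
    (hk : 1 ≤ k) (l : List (Fin n × Fin n)) (hl : l.Pairwise (fun p q => d q.1 q.2 ≤ d p.1 p.2)) :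
    ∃ H : SimpleGraph (Fin n), NoBypass H (2 * k) ∧
      (∀ a c, H.Adj a c → (a, c) ∈ l ∨ (c, a) ∈ l) ∧
      ∀ q ∈ l, ∃ p : H.Walk q.1 q.2, p.length ≤ 2 * k - 1 ∧
        ∀ a c, s(a, c) ∈ p.edges → d a c ≤ d q.1 q.2 := by
  induction l with
  | nil => exact ⟨⊥, fun a c h => h.elim, fun a c h => h.elim, by simp⟩
  | cons q l ih =>
    rw [List.pairwise_cons] at hl
    obtain ⟨H, h1, h2, h3⟩ := ih hl.2
    have hH : ∀ a c, H.Adj a c → d a c ≤ d q.1 q.2 := by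
      intro a c h
      rcases h2 a c h with h | h
      · exact hl.1 _ h
      · rw [hd]; exact hl.1 _ h
    -- All edges chosen so far are at most as long as the pair `q`, so any walk of at most 2k - 1 of
    -- them serves `q` well enough.
    by_cases hq : ∃ p : H.Walk q.1 q.2, p.length ≤ 2 * k - 1
    · obtain ⟨p, hp⟩ := hq
      refine ⟨H, h1, fun a c h => ?_, ?_⟩
      · rcases h2 a c h with h | h <;> simp [h]
      · intro q' hq'
        rcases List.mem_cons.1 hq' with rfl | hq'
        · exact ⟨p, hp, fun a c h => hH a c (p.adj_of_mem_edges h)⟩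
        · exact h3 q' hq'
    · push Not at hq
      have hne : q.1 ≠ q.2 := by
        intro e
        have := hq (e ▸ .nil)
        have h0 : ((e ▸ .nil : H.Walk q.1 q.2)).length = 0 := by
          have : ∀ {a c : Fin n} (e : a = c), (e ▸ .nil : H.Walk a c).length = 0 := by
            rintro a _ rfl; rfl
          exact this e
        omega
      refine ⟨H ⊔ SimpleGraph.edge q.1 q.2, h1.sup_edge fun p => ?_, ?_, ?_⟩
      · have := hq p; omega
      · intro a c h
        rcases h with h | h
        · rcases h2 a c h with h | h <;> simp [h]
        · rw [SimpleGraph.edge_adj] at h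
          rcases h.1 with ⟨rfl, rfl⟩ | ⟨rfl, rfl⟩ <;> simp
      · intro q' hq'
        rcases List.mem_cons.1 hq' with rfl | hq'
        · have hadj : (H ⊔ SimpleGraph.edge q'.1 q'.2).Adj q'.1 q'.2 :=
            .inr ((SimpleGraph.edge_adj ..).2 ⟨.inl ⟨rfl, rfl⟩, hne⟩)
          refine ⟨.cons hadj .nil, by simp; omega, ?_⟩
          intro a c h
          simp only [SimpleGraph.Walk.edges_cons, SimpleGraph.Walk.edges_nil,
            List.mem_singleton] at h
          rw [Sym2.eq_iff] at h
          rcases h with ⟨rfl, rfl⟩ | ⟨rfl, rfl⟩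
          · exact le_rfl
          · exact (hd _ _).le
        · obtain ⟨p, h4, h5⟩ := h3 q' hq'
          exact ⟨p.mapLe le_sup_left, by simpa using h4, fun a c h => h5 a c (by simpa using h)⟩

open Classical in
/-- A spanner of the pairs in `S` that satisfy `R`. -/
theorem exists_spanner (d : Fin n → Fin n → ℝ) (hd : ∀ a c, d a c = d c a) {k t : ℕ}
    (hk : 1 ≤ k) (S : Finset (Fin n)) (R : Fin n → Fin n → Prop) (ht : S.card ≤ t ^ k)
    (hR : ∀ a c, R a c → R c a) :
    ∃ H : SimpleGraph (Fin n), H.edgeSet.ncard ≤ t * S.card ∧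
      (∀ a c, H.Adj a c → a ∈ S ∧ c ∈ S ∧ R a c) ∧
      ∀ a ∈ S, ∀ c ∈ S, R a c → ∃ p : H.Walk a c, p.length ≤ 2 * k - 1 ∧
        ∀ x y, s(x, y) ∈ p.edges → d x y ≤ d a c := by
  -- Decreasing order, since the recursion in `exists_spanner_list` treats the tail of the list
  -- first.
  set l := (((S ×ˢ S).filter (fun q => R q.1 q.2)).toList).insertionSort
    (fun p q => d q.1 q.2 ≤ d p.1 p.2) with hl
  have hmem : ∀ a c, (a, c) ∈ l ↔ a ∈ S ∧ c ∈ S ∧ R a c := by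
    intro a c
    rw [hl, List.mem_insertionSort]
    simp [and_assoc]
  have hsort : l.Pairwise (fun p q => d q.1 q.2 ≤ d p.1 p.2) := by
    have : IsTrans (Fin n × Fin n) (fun p q => d q.1 q.2 ≤ d p.1 p.2) :=
      ⟨fun a b c h1 h2 => le_trans h2 h1⟩
    have : Std.Total (fun p q : Fin n × Fin n => d q.1 q.2 ≤ d p.1 p.2) :=
      ⟨fun a b => le_total _ _⟩
    exact List.pairwise_insertionSort _ _
  obtain ⟨H, h1, h2, h3⟩ := exists_spanner_list d hd hk l hsort
  have h2' : ∀ a c, H.Adj a c → a ∈ S ∧ c ∈ S ∧ R a c := by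
    intro a c h
    rcases h2 a c h with h | h
    · exact (hmem a c).1 h
    · obtain ⟨h4, h5, h6⟩ := (hmem c a).1 h
      exact ⟨h5, h4, hR _ _ h6⟩
  refine ⟨H, ?_, h2', fun a ha c hc hac => h3 (a, c) ((hmem a c).2 ⟨ha, hc, hac⟩)⟩
  have hw : within H S = H := by
    ext a c
    exact ⟨fun h => h.1, fun h => ⟨h, (h2' a c h).1, (h2' a c h).2.1⟩⟩
  have := h1.ncard_edges_le hk S.card S rfl ht
  rwa [hw] at this

end Spanner

/-! ### Unique shortest paths -/

section Canonical

variable {n : ℕ} {G : SimpleGraph (Fin n)} {w : Sym2 (Fin n) → ℝ}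

/-- The binary code of the edges of a walk. -/
def edgeCode {a c : Fin n} (p : G.Walk a c) : ℕ :=
  (p.edges.map (fun e => 2 ^ (Fintype.equivFin (Sym2 (Fin n)) e : ℕ))).sum

/-- The weight of a walk, with ties broken by the code of its edges. -/
def lexCost (w : Sym2 (Fin n) → ℝ) {a c : Fin n} (p : G.Walk a c) : ℝ ×ₗ ℕ :=
  toLex (walkWeight w p, edgeCode p)

theorem lexCost_append {a c d : Fin n} (p : G.Walk a c) (q : G.Walk c d) :
    lexCost w (p.append q) = lexCost w p + lexCost w q := by
  simp [lexCost, edgeCode, walkWeight, ← toLex_add]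

theorem lexCost_reverse {a c : Fin n} (p : G.Walk a c) :
    lexCost w p.reverse = lexCost w p := by
  simp [lexCost, edgeCode, walkWeight]

theorem edgeCode_eq {a c : Fin n} {p : G.Walk a c} (hp : p.edges.Nodup) :
    edgeCode p = ∑ i ∈ p.edges.toFinset.map
      ((Fintype.equivFin (Sym2 (Fin n))).toEmbedding.trans Fin.valEmbedding), 2 ^ i := by
  rw [Finset.sum_map, List.sum_toFinset _ hp]
  rfl

/-- Without repeated edges, the code is the number whose binary digits mark the edges of the walk,
and a number determines its digits. -/
theorem mem_edges_of_edgeCode_eq {a c a' c' : Fin n} {p : G.Walk a c} {q : G.Walk a' c'}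
    (hp : p.edges.Nodup) (hq : q.edges.Nodup) (h : edgeCode p = edgeCode q) {e : Sym2 (Fin n)} :
    e ∈ p.edges ↔ e ∈ q.edges := by
  rw [edgeCode_eq hp, edgeCode_eq hq] at h
  have h1 := Finset.map_injective _ (Finset.geomSum_injective le_rfl h)
  rw [← List.mem_toFinset, h1, List.mem_toFinset]

/-- A path that is shortest, with ties broken by the code of its edges. -/
def IsCanon (w : Sym2 (Fin n) → ℝ) {a c : Fin n} (p : G.Walk a c) : Prop :=
  p.IsPath ∧ ∀ q : G.Walk a c, lexCost w p ≤ lexCost w q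

theorem lexCost_bypass_le (hw : ∀ e ∈ G.edgeSet, 0 ≤ w e) {a c : Fin n} (p : G.Walk a c) :
    lexCost w p.bypass ≤ lexCost w p := by
  have hsub : p.bypass.edges.Sublist p.edges := p.edges_bypass_sublist_edges
  have h1 : walkWeight w p.bypass ≤ walkWeight w p := by
    refine List.Sublist.sum_le_sum (hsub.map w) fun x hx => ?_
    obtain ⟨e, he, rfl⟩ := List.mem_map.1 hx
    exact hw e (p.edges_subset_edgeSet he)
  have h2 : edgeCode p.bypass ≤ edgeCode p :=
    List.Sublist.sum_le_sum (hsub.map _) fun x _ => Nat.zero_le x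
  rw [Prod.Lex.le_iff]
  rcases h1.lt_or_eq with h | h
  · exact .inl h
  · exact .inr ⟨h, h2⟩

/-- There are finitely many paths, so one of them has least cost. Making a walk into a path only
deletes edges, which increases neither the weight nor the code, so this path is minimal among all
walks. -/
theorem exists_isCanon (hw : ∀ e ∈ G.edgeSet, 0 ≤ w e) {a c : Fin n} (h : G.Reachable a c) :
    ∃ p : G.Walk a c, IsCanon w p := by
  classical
  obtain ⟨q⟩ := h
  have : Nonempty (G.Path a c) := ⟨⟨q.bypass, q.bypass_isPath⟩⟩
  obtain ⟨p, hp⟩ := Finite.exists_min (fun p : G.Path a c => lexCost w p.1)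
  exact ⟨p.1, p.2, fun q => (hp ⟨q.bypass, q.bypass_isPath⟩).trans (lexCost_bypass_le hw q)⟩

theorem IsCanon.walkWeight_le {a c : Fin n} {p : G.Walk a c} (hp : IsCanon w p)
    (q : G.Walk a c) : walkWeight w p ≤ walkWeight w q := by
  have := hp.2 q
  rw [Prod.Lex.le_iff] at this
  rcases this with h | h
  · exact h.le
  · exact h.1.le

/-- The cost is additive and the order is compatible with addition, so a better middle part would
improve the whole walk. -/
theorem IsCanon.middle {a c x z : Fin n} {A : G.Walk a x} {B : G.Walk x z} {C : G.Walk z c}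
    (h : IsCanon w (A.append (B.append C))) : IsCanon w B := by
  refine ⟨h.1.of_append_right.of_append_left, fun q => ?_⟩
  have := h.2 (A.append (q.append C))
  simpa [lexCost_append] using this

theorem IsCanon.reverse {a c : Fin n} {p : G.Walk a c} (h : IsCanon w p) :
    IsCanon w p.reverse :=
  ⟨h.1.reverse, fun q => by
    rw [lexCost_reverse]
    simpa [lexCost_reverse] using h.2 q.reverse⟩

/-- This is the purpose of the tie-breaking: two canonical paths with the same ends have the same
code, hence the same edges. -/
theorem IsCanon.edges_eq {x z : Fin n} {p q : G.Walk x z} (hp : IsCanon w p) (hq : IsCanon w q)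
    {e : Sym2 (Fin n)} : e ∈ p.edges ↔ e ∈ q.edges := by
  have h : lexCost w p = lexCost w q := le_antisymm (hp.2 q) (hq.2 p)
  have h2 : edgeCode p = edgeCode q := congrArg (fun t => (ofLex t).2) h
  exact mem_edges_of_edgeCode_eq hp.1.isTrail.edges_nodup hq.1.isTrail.edges_nodup h2

/-- A canonical path between two vertices of another one runs inside it. -/
theorem IsCanon.edges_subset {a c x z : Fin n} {P : G.Walk a c} (hP : IsCanon w P)
    {B : G.Walk x z} (hB : IsCanon w B) (hx : x ∈ P.support) (hz : z ∈ P.support) :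
    ∀ e ∈ B.edges, e ∈ P.edges := by
  classical
  intro e he
  have hs := P.take_spec hx
  rw [← hs, SimpleGraph.Walk.mem_support_append_iff] at hz
  rcases hz with hz | hz
  · have hs' := (P.takeUntil x hx).take_spec hz
    rw [← hs', ← SimpleGraph.Walk.append_assoc] at hs
    have h1 : IsCanon w ((P.takeUntil x hx).dropUntil z hz) := by
      rw [← hs] at hP; exact hP.middle
    have h2 := (h1.reverse.edges_eq hB).2 he
    rw [← hs]
    simp only [SimpleGraph.Walk.edges_reverse, List.mem_reverse] at h2
    simp only [SimpleGraph.Walk.edges_append, List.mem_append]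
    tauto
  · have hs' := (P.dropUntil x hx).take_spec hz
    rw [← hs'] at hs
    have h1 : IsCanon w ((P.dropUntil x hx).takeUntil z hz) := by
      rw [← hs] at hP; exact hP.middle
    have h2 := (h1.edges_eq hB).2 he
    rw [← hs]
    simp only [SimpleGraph.Walk.edges_append, List.mem_append]
    tauto

/-- A walk that meets `X` can be split where it first does so. -/
theorem exists_first (X : Finset (Fin n)) {a c : Fin n} (p : G.Walk a c)
    (h : ∃ x ∈ X, x ∈ p.support) : ∃ x ∈ X, ∃ (A : G.Walk a x) (B : G.Walk x c),
      p = A.append B ∧ ∀ y ∈ A.support, y ∈ X → y = x := by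
  induction p with
  | @nil u =>
    obtain ⟨x, hx, h⟩ := h
    obtain rfl : x = u := by simpa using h
    exact ⟨x, hx, .nil, .nil, rfl, by simp⟩
  | @cons u v z h' p ih =>
    by_cases hu : u ∈ X
    · exact ⟨u, hu, .nil, .cons h' p, rfl, by simp⟩
    · obtain ⟨x, hx, h⟩ := h
      have hxp : x ∈ p.support := by
        rcases List.mem_cons.1 h with rfl | h
        · exact absurd hx hu
        · exact h
      obtain ⟨x', hx', A, B, rfl, h2⟩ := ih ⟨x, hx, hxp⟩
      refine ⟨x', hx', .cons h' A, B, rfl, fun y hy hyX => ?_⟩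
      rcases List.mem_cons.1 hy with rfl | hy
      · exact absurd hyX hu
      · exact h2 y hy hyX

open Classical in
/-- The vertices of two paths at which the second one leaves the first one. -/
def splits {a c a' c' : Fin n} (P : G.Walk a c) (Q : G.Walk a' c') : Finset (Fin n) :=
  P.support.toFinset.filter (fun x => ∃ e ∈ Q.edges, x ∈ e ∧ e ∉ P.edges)

/-- Let `x` and `z` be the first and the last split along `Q`. The part of `Q` between them is
canonical and joins two vertices of `P`, so it runs inside `P`. Hence an edge of `Q` outside `P`
lies before `x` or after `z`, where no other split occurs. -/
theorem card_splits_le {a c a' c' : Fin n} {P : G.Walk a c} {Q : G.Walk a' c'}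
    (hP : IsCanon w P) (hQ : IsCanon w Q) : (splits P Q).card ≤ 2 := by
  classical
  have hmem : ∀ x ∈ splits P Q, x ∈ P.support ∧ ∃ e ∈ Q.edges, x ∈ e ∧ e ∉ P.edges := by
    intro x hx
    simpa [splits] using hx
  have hsup : ∀ {u v : Fin n} (q : G.Walk u v) {x : Fin n} {e}, e ∈ q.edges → x ∈ e →
      x ∈ q.support := by
    intro u v q x e he hx
    obtain ⟨y, rfl⟩ := hx
    exact q.fst_mem_support_of_mem_edges he
  rcases (splits P Q).eq_empty_or_nonempty with h | ⟨x₀, hx₀⟩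
  · simp [h]
  obtain ⟨x, hx, A, Q', rfl, hA⟩ := exists_first (splits P Q) Q (by
    obtain ⟨-, e, he, hxe, -⟩ := hmem x₀ hx₀
    exact ⟨x₀, hx₀, hsup Q he hxe⟩)
  obtain ⟨z, hz, C, B, hCB, hC⟩ := exists_first (splits P (A.append Q')) Q'.reverse
    ⟨x, hx, by simp⟩
  have hQ' : Q' = B.reverse.append C.reverse := by
    rw [← SimpleGraph.Walk.reverse_append, ← hCB, SimpleGraph.Walk.reverse_reverse]
  have hBc : IsCanon w B.reverse := by
    rw [hQ'] at hQ
    exact hQ.middle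
  have hBP := hP.edges_subset hBc (hmem x hx).1 (hmem z hz).1
  refine (Finset.card_le_card (t := {x, z}) fun y hy => ?_).trans Finset.card_le_two
  rw [Finset.mem_insert, Finset.mem_singleton]
  by_contra hne
  push Not at hne
  obtain ⟨-, e, he, hye, heP⟩ := hmem y hy
  rw [hQ', SimpleGraph.Walk.edges_append, SimpleGraph.Walk.edges_append, List.mem_append,
    List.mem_append] at he
  rcases he with he | he | he
  · exact hne.1 (hA y (hsup A he hye) hy)
  · exact heP (hBP e he)
  · refine hne.2 (hC y ?_ hy)
    rw [SimpleGraph.Walk.edges_reverse, List.mem_reverse] at he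
    exact hsup C he hye

end Canonical

/-! ### Routing along canonical paths -/

section Routing

variable {n : ℕ} {G : SimpleGraph (Fin n)} {w : Sym2 (Fin n) → ℝ}

theorem mem_edges_iff_getVert {a c : Fin n} (p : G.Walk a c) {e : Sym2 (Fin n)} :
    e ∈ p.edges ↔ ∃ i < p.length, e = s(p.getVert i, p.getVert (i + 1)) := by
  induction p with
  | nil => simp
  | @cons u v z h p ih =>
    rw [SimpleGraph.Walk.edges_cons, List.mem_cons, ih]
    constructor
    · rintro (rfl | ⟨i, hi, rfl⟩)
      · exact ⟨0, by simp, by simp⟩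
      · exact ⟨i + 1, by simpa using hi, by simp⟩
    · rintro ⟨i, hi, rfl⟩
      cases i with
      | zero => left; simp
      | succ i => right; exact ⟨i, by simpa using hi, by simp⟩

/-- The edges of a path at an inner vertex. -/
theorem edge_of_path {a c : Fin n} {p : G.Walk a c} (hp : p.IsPath) {i : ℕ} (hi : i + 1 < p.length)
    {e : Sym2 (Fin n)} (he : e ∈ p.edges) (hx : p.getVert (i + 1) ∈ e) :
    e = s(p.getVert i, p.getVert (i + 1)) ∨ e = s(p.getVert (i + 1), p.getVert (i + 2)) := by
  obtain ⟨j, hj, rfl⟩ := (mem_edges_iff_getVert p).1 he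
  rw [Sym2.mem_iff] at hx
  rcases hx with h | h
  · have := hp.getVert_injOn (by simp; omega) (by simp; omega) h
    subst this
    exact .inr rfl
  · have := hp.getVert_injOn (by simp; omega) (by simp; omega) h
    obtain rfl : i = j := by omega
    exact .inl rfl

variable {ι : Type} [Fintype ι] {src tgt : ι → Fin n} (P : ∀ q, G.Walk (src q) (tgt q))
  (S : Finset (Fin n))

/-- A vertex at which the routes differ, or a pivot. -/
def IsBranch (x : Fin n) : Prop :=
  x ∈ S ∨ ¬ ∀ p q, x ∈ (P p).support → x ∈ (P q).support → ∀ e, x ∈ e →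
    (e ∈ (P p).edges ↔ e ∈ (P q).edges)

/-- The position of `y` in the adjacency list of `x`. -/
def nbrIndex (G : SimpleGraph (Fin n)) (w : Sym2 (Fin n) → ℝ) (x y : Fin n) : ℕ :=
  (adjList G w x).idxOf y

theorem getElem?_nbrIndex {x y : Fin n} (h : G.Adj x y) :
    (adjList G w x)[nbrIndex G w x y]? = some y :=
  List.getElem?_idxOf (mem_adjList.2 h)

theorem nbrIndex_lt {x y : Fin n} (h : G.Adj x y) : nbrIndex G w x y < n :=
  (List.idxOf_lt_length_iff.2 (mem_adjList.2 h)).trans_le (length_adjList_le x)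

open Classical in
/-- The positions of the next vertices at the branch vertices, from the `i`-th vertex on. -/
def routeCode (w : Sym2 (Fin n) → ℝ) (br : Fin n → Prop) {a c : Fin n} (p : G.Walk a c) (i : ℕ) :
    List ℕ :=
  ((List.range' i (p.length - i)).filter (fun j => br (p.getVert j))).map
    (fun j => nbrIndex G w (p.getVert j) (p.getVert (j + 1)))

theorem routeCode_of_branch {br : Fin n → Prop} {a c : Fin n} {p : G.Walk a c} {i : ℕ}
    (hi : i < p.length) (h : br (p.getVert i)) :
    routeCode w br p i = nbrIndex G w (p.getVert i) (p.getVert (i + 1)) ::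
      routeCode w br p (i + 1) := by
  unfold routeCode
  obtain ⟨l, hl⟩ : ∃ l, p.length - i = l + 1 := ⟨p.length - i - 1, by omega⟩
  rw [hl, show p.length - (i + 1) = l by omega, List.range'_succ]
  simp [h]

theorem routeCode_of_not_branch {br : Fin n → Prop} {a c : Fin n} {p : G.Walk a c} {i : ℕ}
    (hi : i < p.length) (h : ¬ br (p.getVert i)) :
    routeCode w br p i = routeCode w br p (i + 1) := by
  unfold routeCode
  obtain ⟨l, hl⟩ : ∃ l, p.length - i = l + 1 := ⟨p.length - i - 1, by omega⟩
  rw [hl, show p.length - (i + 1) = l by omega, List.range'_succ]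
  simp [h]

variable {P S}

/-- If two routes through a vertex disagree about an edge there, then the route `p` disagrees about
it with one of the two. So every branch vertex of `p` outside `S` is a split of `p` with some route,
in one of the two directions, and each direction contributes at most two vertices. -/
theorem length_routeCode_le (hP : ∀ q, IsCanon w (P q)) (p : ι) :
    (routeCode w (IsBranch P S) (P p) 0).length ≤ S.card + 4 * Fintype.card ι := by
  classical
  set B : Finset (Fin n) := S ∪ Finset.univ.biUnion (fun q =>
    splits (P p) (P q) ∪ splits (P q) (P p)) with hB
  have hBc : B.card ≤ S.card + 4 * Fintype.card ι := by
    refine (Finset.card_union_le _ _).trans (Nat.add_le_add_left ?_ _)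
    rw [Nat.mul_comm]
    refine Finset.card_biUnion_le_card_mul _ _ _ fun q hq => (Finset.card_union_le _ _).trans ?_
    have h1 := card_splits_le (hP p) (hP q)
    have h2 := card_splits_le (hP q) (hP p)
    omega
  refine le_trans ?_ hBc
  unfold routeCode
  rw [List.length_map, ← List.length_map (f := (P p).getVert)]
  have hnd : (((List.range' 0 ((P p).length - 0)).filter
      (fun j => IsBranch P S ((P p).getVert j))).map (P p).getVert).Nodup := by
    refine List.Nodup.map_on ?_ (List.Nodup.filter _ List.nodup_range')
    intro i hi j hj h
    simp only [List.mem_filter, List.mem_range'_1] at hi hj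
    exact (hP p).1.getVert_injOn (by simp; omega) (by simp; omega) h
  rw [← List.toFinset_card_of_nodup hnd]
  refine Finset.card_le_card fun x hx => ?_
  simp only [List.mem_toFinset, List.mem_map, List.mem_filter, decide_eq_true_eq] at hx
  obtain ⟨i, ⟨-, hbr⟩, rfl⟩ := hx
  have hxs : (P p).getVert i ∈ (P p).support := (P p).getVert_mem_support i
  rw [hB, Finset.mem_union, Finset.mem_biUnion]
  rcases hbr with h | h
  · exact .inl h
  right
  simp only [Finset.mem_union, splits, Finset.mem_filter, List.mem_toFinset]
  push Not at h
  obtain ⟨q₁, q₂, h1, h2, e, he, h3⟩ := h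
  have key : ∀ q q', (P p).getVert i ∈ (P q').support → e ∈ (P q).edges → e ∉ (P q').edges →
      ∃ q, ((P p).getVert i ∈ (P p).support ∧ ∃ e ∈ (P q).edges, (P p).getVert i ∈ e ∧
        e ∉ (P p).edges) ∨ ((P p).getVert i ∈ (P q).support ∧ ∃ e ∈ (P p).edges,
        (P p).getVert i ∈ e ∧ e ∉ (P q).edges) := by
    intro q q' h4 h5 h6
    by_cases h7 : e ∈ (P p).edges
    · exact ⟨q', .inr ⟨h4, e, h7, he, h6⟩⟩
    · exact ⟨q, .inl ⟨hxs, e, h5, he, h7⟩⟩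
  simp only [Finset.mem_univ, true_and]
  rcases h3 with ⟨h3, h4⟩ | ⟨h3, h4⟩
  · exact key q₁ q₂ h2 h3 h4
  · exact key q₂ q₁ h1 h4 h3

/-- The two neighbours of an inner vertex of the routes that is not a branch. -/
theorem exists_neighbours (hP : ∀ q, (P q).IsPath) (x : Fin n) (hx : ¬ IsBranch P S x) :
    ∃ y z : Fin n, ∀ q i, i + 1 < (P q).length → (P q).getVert (i + 1) = x →
      (G.Adj x y ∧ G.Adj x z) ∧ y ≠ z ∧
        ((P q).getVert i = y ∧ (P q).getVert (i + 2) = z ∨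
          (P q).getVert i = z ∧ (P q).getVert (i + 2) = y) := by
  by_cases h : ∃ q i, i + 1 < (P q).length ∧ (P q).getVert (i + 1) = x
  swap
  · exact ⟨x, x, fun q i hi he => absurd ⟨q, i, hi, he⟩ h⟩
  obtain ⟨q, i, hi, rfl⟩ := h
  have hxy : G.Adj ((P q).getVert (i + 1)) ((P q).getVert i) :=
    ((P q).adj_getVert_succ (by omega)).symm
  have hxz : G.Adj ((P q).getVert (i + 1)) ((P q).getVert (i + 2)) := (P q).adj_getVert_succ hi
  have hyz : ∀ (q : ι) i, i + 1 < (P q).length → (P q).getVert i ≠ (P q).getVert (i + 2) := by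
    intro q i hi e
    have := (hP q).getVert_injOn (by simp; omega) (by simp; omega) e
    omega
  refine ⟨(P q).getVert i, (P q).getVert (i + 2), fun q' j hj he =>
    ⟨⟨hxy, hxz⟩, hyz q i hi, ?_⟩⟩
  have hag : ∀ e, (P q).getVert (i + 1) ∈ e → (e ∈ (P q').edges ↔ e ∈ (P q).edges) := by
    unfold IsBranch at hx
    push Not at hx
    exact hx.2 q' q (by rw [← he]; exact (P q').getVert_mem_support _)
      ((P q).getVert_mem_support _)
  -- Since `x` is no branch, both edges of the other route at `x` are edges of the first one, which
  -- has only two there. So the routes agree at `x` up to direction.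
  have h1 : s((P q').getVert j, (P q').getVert (j + 1)) ∈ (P q).edges := by
    rw [← hag _ (by rw [he]; simp)]
    exact (mem_edges_iff_getVert _).2 ⟨j, by omega, rfl⟩
  have h2 : s((P q').getVert (j + 1), (P q').getVert (j + 2)) ∈ (P q).edges := by
    rw [← hag _ (by rw [he]; simp)]
    exact (mem_edges_iff_getVert _).2 ⟨j + 1, by omega, rfl⟩
  have h3 := edge_of_path (hP q) hi h1 (by rw [he]; simp)
  have h4 := edge_of_path (hP q) hi h2 (by rw [he]; simp)
  have h7 := hyz q' j hj
  rw [he] at h3 h4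
  simp only [Sym2.eq_iff] at h3 h4
  have h5 := hxy.ne
  have h6 := hxz.ne
  grind

end Routing

/-! ### The query program

The search from `v` uses the arrays `3 a + 1`, the search from `u` the arrays `3 a + 2`. The other
arrays: `0` the query, `3` the current vertex, `6` the vertex before it, `9` the position in a
record, `12` the end of a route, `15` a position in an adjacency list, `18` and `21` a stack, `24` a
position in the table, `27` the last vertex of the search from `v`. -/

/-- The array names of the `j`-th search. -/
def blockName (j a : ℕ) : ℕ := 3 * a + j

/-- Search from the vertex in cell `i` of the query until the vertex in cell `i'`, a pivot, or the
end of the component is found. -/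
def searchProg (j i i' : ℕ) : Prog :=
  .seq (.assign j (.cell 0 (.lit i))) <| .seq (.assign (3 + j) (.table (.lit 0))) <|
  .seq (initProg.relabel (blockName j)) <|
  .loop (.both (.neg (.weq (.var (6 + j)) (.cell 0 (.lit i'))))
    (.both (.weq (.table (.op .add (.lit 2) (.var (6 + j)))) (.lit 0))
      (.neg (.weq (.var (9 + j)) (.lit 1))))) (roundProg.relabel (blockName j))

/-- Report the path from the current vertex to the root in cell `i` of the query. -/
def tailProg (j i : ℕ) : Prog :=
  .seq (.setR 0 (.lit 0) (.add (.cell 0 (.lit 0)) (.cell j (.var 3)))) <|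
  .loop (.neg (.weq (.var 3) (.cell 0 (.lit i))))
    (.seq (.assign 3 (.cell (15 + j) (.var 3))) (.emit (.var 3)))

/-- Report the path from the root in cell `i` of the query to the current vertex. -/
def headProg (j i : ℕ) : Prog :=
  .seq (.setR 0 (.lit 0) (.cell j (.var 3))) <|
  .seq (.assign 18 (.lit 0)) <|
  .seq (.assign 6 (.var 3)) <|
  .seq (.loop (.neg (.weq (.var 6) (.cell 0 (.lit i))))
    (.seq (.setW 21 (.var 18) (.var 6)) <|
      .seq (.assign 18 (.op .add (.var 18) (.lit 1))) (.assign 6 (.cell (15 + j) (.var 6))))) <|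
  .seq (.emit (.var 6)) <|
  .loop (.wlt (.lit 0) (.var 18))
    (.seq (.assign 18 (.op .sub (.var 18) (.lit 1))) (.emit (.cell 21 (.var 18))))

/-- The entry at offset `o` of the tables that are indexed by vertices. -/
def vertexEntry (o : ℕ) (x : WExpr) : WExpr :=
  .table (.op .add (.lit 2) (.op .add (.op .mul (.lit o) .order) x))

/-- Report the route whose record starts at the position in variable `24`. -/
def legProg : Prog :=
  .seq (.assign 12 (.table (.var 24))) <|
  .seq (.assign 9 (.op .add (.var 24) (.lit 1))) <|
  .loop (.neg (.weq (.var 3) (.var 12)))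
    (.seq (.branch (.weq (vertexEntry 1 (.var 3)) (.lit 0))
        (.seq (.assign 15 (.table (.var 9))) (.assign 9 (.op .add (.var 9) (.lit 1))))
        (.seq (.assign 15 (.op .sub (vertexEntry 1 (.var 3)) (.lit 1)))
          (.branch (.weq (.nbr (.var 3) (.var 15)) (.var 6))
            (.assign 15 (.op .sub (vertexEntry 2 (.var 3)) (.lit 1))) .skip))) <|
    .seq (.setR 0 (.lit 0) (.add (.cell 0 (.lit 0)) (.wt (.var 3) (.var 15)))) <|
    .seq (.assign 6 (.var 3)) <|
    .seq (.assign 3 (.nbr (.var 3) (.var 15))) (.emit (.var 3)))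

/-- Load the matrix entry for the route from the current vertex to the pivot in variable `27`. -/
def loadProg : Prog :=
  .assign 24 (.table (.op .add (.op .add (.lit 2) (.op .mul (.lit 3) .order))
    (.op .add (.op .mul (.op .sub (vertexEntry 0 (.var 3)) (.lit 1)) (.table (.lit 1)))
      (.op .sub (vertexEntry 0 (.var 27)) (.lit 1)))))

/-- Report a route from the current vertex to the pivot in variable `27`. -/
def middleProg : Prog :=
  .loop (.neg (.weq (.var 3) (.var 27))) (.seq loadProg legProg)

/-- The query program. -/
def queryProg : Prog :=
  .seq (searchProg 1 1 0) <|
  .branch (.weq (.var 10) (.lit 1)) .skip <|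
  .seq (.assign 27 (.var 7)) <|
  .branch (.weq (.var 27) (.cell 0 (.lit 0)))
    (.seq (.assign 3 (.var 27)) (.seq (.emit (.var 3)) (tailProg 1 1))) <|
  .seq (searchProg 2 0 1) <|
  .branch (.weq (.var 11) (.lit 1)) .skip <|
  .seq (.assign 3 (.var 8)) <|
  .branch (.weq (.var 3) (.cell 0 (.lit 1))) (headProg 2 0) <|
  .seq loadProg <|
  .branch (.weq (.var 24) (.lit 0)) .skip <|
  .seq (headProg 2 0) (.seq middleProg (tailProg 1 1))

section Query

variable {n : ℕ} {G : SimpleGraph (Fin n)} {w : Sym2 (Fin n) → ℝ} {b : ℕ} {M : List ℕ}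

/-- The record at the position `e` of the table describes the path `p`. -/
def LegAt (G : SimpleGraph (Fin n)) (w : Sym2 (Fin n) → ℝ) (M : List ℕ) (e : ℕ) {a c : Fin n}
    (p : G.Walk a c) : Prop :=
  p.IsPath ∧ M.getD e 0 = c ∧ ∃ pos : ℕ → ℕ, pos 0 = e + 1 ∧ ∀ i < p.length,
    (M.getD (2 + (n + p.getVert i)) 0 = 0 ∧ pos (i + 1) = pos i + 1 ∧ pos i < M.length ∧
      M.getD (pos i) 0 = nbrIndex G w (p.getVert i) (p.getVert (i + 1))) ∨
    (pos (i + 1) = pos i ∧ ∃ i', i = i' + 1 ∧ p.getVert i' ≠ p.getVert (i + 1) ∧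
      G.Adj (p.getVert i) (p.getVert i') ∧
      (M.getD (2 + (n + p.getVert i)) 0 = nbrIndex G w (p.getVert i) (p.getVert i') + 1 ∧
      M.getD (2 + (2 * n + p.getVert i)) 0 = nbrIndex G w (p.getVert i) (p.getVert (i + 1)) + 1 ∨
      M.getD (2 + (n + p.getVert i)) 0 = nbrIndex G w (p.getVert i) (p.getVert (i + 1)) + 1 ∧
      M.getD (2 + (2 * n + p.getVert i)) 0 = nbrIndex G w (p.getVert i) (p.getVert i') + 1))

/-- The table guides from the pivot `a` to the pivot `c` along a walk of weight `W`. The matrix has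
`m` columns and the pivots have the indices `ind`. -/
inductive MidRoute (G : SimpleGraph (Fin n)) (w : Sym2 (Fin n) → ℝ) (M : List ℕ) (m : ℕ)
    (ind : Fin n → ℕ) (S : Finset (Fin n)) (c : Fin n) : Fin n → ℝ → Prop
  | done : MidRoute G w M m ind S c c 0
  | step {a a' : Fin n} {W : ℝ} {e : ℕ} (p : G.Walk a a') : a ∈ S → a ≠ c → a ≠ a' →
      M.getD (2 + 3 * n + (ind a * m + ind c)) 0 = e → e < M.length → LegAt G w M e p →
      MidRoute G w M m ind S c a' W → MidRoute G w M m ind S c a (walkWeight w p + W)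

/-- The table `M` is an oracle with the pivots `S`. -/
structure OracleFor (G : SimpleGraph (Fin n)) (w : Sym2 (Fin n) → ℝ) (S : Finset (Fin n))
    (k b β : ℕ) (M : List ℕ) (ind : Fin n → ℕ) : Prop where
  small : ∀ x ∈ M, x < 2 ^ (env b G w M).wordBits
  length : M.length + 20 * n + 20 + S.card * S.card < 2 ^ (env b G w M).wordBits
  ranks : M.getD 0 0 = β
  size : M.getD 1 0 = S.card
  mark : ∀ x : Fin n, M.getD (2 + (0 + x)) 0 = if x ∈ S then ind x + 1 else 0
  ind_lt : ∀ x ∈ S, ind x < S.card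
  unreachable : ∀ a ∈ S, ∀ c ∈ S, ¬ G.Reachable a c →
    M.getD (2 + 3 * n + (ind a * S.card + ind c)) 0 = 0
  route : ∀ a ∈ S, ∀ c ∈ S, G.Reachable a c →
    M.getD (2 + 3 * n + (ind a * S.card + ind c)) 0 ≠ 0 ∧
    ∃ W, MidRoute G w M S.card ind S c a W ∧ W ≤ (2 * k - 1) * wdist G w a c

local notation "𝓜" => env b G w M

@[simp] theorem arr_mk {E : Env} (s : State) (r : ℕ → ℕ → ℝ) (l : List ℕ) (a : ℕ) :
    arr E ⟨s.words, r, l⟩ a = arr E s a := rfl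

/-! ### Reporting walks -/

/-- The first `i` vertices of a walk after its start. -/
def firstVertices {a c : Fin n} (p : G.Walk a c) (i : ℕ) : List ℕ :=
  (p.support.tail.take i).map Fin.val

theorem firstVertices_succ {a c : Fin n} (p : G.Walk a c) {i : ℕ} (hi : i < p.length) :
    firstVertices p (i + 1) = firstVertices p i ++ [(p.getVert (i + 1) : ℕ)] := by
  unfold firstVertices
  have h : p.support.tail[i]? = some (p.getVert (i + 1)) := by
    rw [List.getElem?_tail, ← p.getVert_eq_support_getElem? (by omega)]
  rw [List.take_add_one, h]
  simp

theorem firstVertices_length {a c : Fin n} (p : G.Walk a c) :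
    firstVertices p p.length = p.support.tail.map Fin.val := by
  unfold firstVertices
  rw [List.take_of_length_le (by simp)]

/-- No vertex of the chain before its end is the root, so a loop that follows the parents until it
meets the root runs through the entire chain. -/
theorem Tree.exists_chain {r : Fin n} {par : ℕ → ℕ} {dist : ℕ → ℝ} {D : List (Fin n)}
    (h : Tree G w r par dist D) {x : Fin n} (hx : x ∈ D) :
    ∃ c : G.Walk x r, walkWeight w c = dist x ∧ c.length < D.length ∧ ∀ i < c.length,
      par (c.getVert i) = c.getVert (i + 1) ∧ c.getVert i ≠ r := by
  induction h generalizing x with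
  | nil => simp at hx
  | one h =>
    obtain rfl : x = r := by simpa using hx
    exact ⟨.nil, by simp [h], by simp, by simp⟩
  | @cons x' y D ht hx' hy hp ha ed ih =>
    rcases List.mem_cons.1 hx with rfl | hx
    · obtain ⟨c, h1, h2, h3⟩ := ih hy
      refine ⟨.cons ha.symm c, ?_, by simpa using h2, ?_⟩
      · rw [ed, walkWeight_cons, h1, Sym2.eq_swap, add_comm]
      · rintro (_ | i) hi
        · refine ⟨by simpa using hp, ?_⟩
          rintro e
          simp only [SimpleGraph.Walk.getVert_zero] at e
          exact hx' (e ▸ ht.root_mem (List.ne_nil_of_mem hy))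
        · simpa using h3 i (by simpa using hi)
    · obtain ⟨c, h1, h2, h3⟩ := ih hx
      exact ⟨c, h1, by simp; omega, h3⟩

variable {s : State}

/-- The real arrays other than the first one are the same. -/
def RFrame (s s' : State) : Prop := ∀ a, a ≠ 0 → s'.reals a = s.reals a

theorem tail_spec (hn : n ≤ 2 ^ (env b G w M).wordBits) {j i : ℕ} (hj : 1 ≤ j ∧ j ≤ 2)
    (hi : i % 2 ^ (env b G w M).wordBits = i) {r x : Fin n}
    {D : List (Fin n)} (ht : Tree G w r (arr 𝓜 s (15 + j)) (s.reals j) D)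
    (hr : arr 𝓜 s 0 i = r) (hx : arr 𝓜 s 3 0 = x) (hxD : x ∈ D) {Q : ℕ → State → Prop}
    (hQ : ∀ s' t, ∀ c : G.Walk x r, walkWeight w c = s.reals j x →
      s'.out = s.out ++ c.support.tail.map Fin.val → s'.reals 0 0 = s.reals 0 0 + walkWeight w c →
      t ≤ 50 * c.length + 50 → Q t s') : WP 𝓜 (tailProg j i) s Q := by
  have hm : ∀ y : Fin n, (y : ℕ) % 2 ^ (env b G w M).wordBits = y := fun y =>
    Nat.mod_eq_of_lt (y.2.trans_le hn)
  obtain ⟨c, h1, h2, h3⟩ := ht.exists_chain hxD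
  have hj3 : 15 + j ≠ 3 := by omega
  unfold tailProg
  simp only [WP_seq, WP_setR]
  refine WP_loop (φ := 50 * c.length) (fun s₁ φ => ∃ l ≤ c.length, arr 𝓜 s₁ 3 0 = c.getVert l ∧
      s₁.out = s.out ++ firstVertices c l ∧ s₁.reals 0 0 = s.reals 0 0 + walkWeight w c ∧
      Frame 𝓜 [3] s s₁ ∧ φ = 50 * (c.length - l)) ?_ ?_ ?_
  · rintro s₁ φ ⟨l, hl, e3, eo, er, ef, rfl⟩ hb
    simp only [holds_neg, holds_weq, eval_cell, eval_lit, Nat.zero_mod, hi, e3,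
      ef 0 (by simp), hr, Fin.val_inj] at hb
    have hl' : l < c.length := by
      rcases hl.lt_or_eq with h | rfl
      · exact h
      · rw [SimpleGraph.Walk.getVert_length] at hb; exact absurd rfl hb
    simp only [WP_seq, WP_setW, WP_emit]
    refine ⟨_, ⟨l + 1, hl', ?_, ?_, ?_, ?_, rfl⟩, ?_⟩
    · simp [arr_setW, e3, ef (15 + j) (by simp; omega), (h3 l hl').1, hm]
    · simp [arr_setW, e3, ef (15 + j) (by simp; omega), (h3 l hl').1, hm, eo,
        firstVertices_succ c hl']
    · simpa using er
    · refine ef.trans ?_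
      intro a ha
      simp only [List.mem_cons, List.not_mem_nil, or_false] at ha
      simp [arr_setW, ha]
    · simp; omega
  · refine ⟨0, Nat.zero_le _, by simpa using hx, by simp [firstVertices], ?_, fun a _ => rfl,
      by simp⟩
    simp [reals_setR, hx, h1]
  · rintro t s₁ φ ⟨l, hl, e3, eo, er, ef, rfl⟩ hb ht
    simp only [holds_neg, holds_weq, eval_cell, eval_lit, Nat.zero_mod, hi, e3,
      ef 0 (by simp), hr, Fin.val_inj, not_not] at hb
    have hl' : l = c.length := by
      by_contra h
      exact (h3 l (by omega)).2 hb
    subst hl'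
    refine hQ s₁ _ c h1 (by rw [eo, firstVertices_length]) er ?_
    simp at ht ⊢; omega

/-- The parents lead from the pivot to the root of the search, but this part of the answer must be
written from the root on. So the vertices pass through a stack. -/
theorem head_spec (hn : 2 * n ≤ 2 ^ (env b G w M).wordBits) {j i : ℕ} (hj : 1 ≤ j ∧ j ≤ 2)
    (hi : i % 2 ^ (env b G w M).wordBits = i) {r x : Fin n}
    {D : List (Fin n)} (ht : Tree G w r (arr 𝓜 s (15 + j)) (s.reals j) D)
    (hr : arr 𝓜 s 0 i = r) (hx : arr 𝓜 s 3 0 = x) (hxD : x ∈ D) {Q : ℕ → State → Prop}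
    (hQ : ∀ s' t, ∀ c : G.Walk r x, walkWeight w c = s.reals j x →
      s'.out = s.out ++ c.support.map Fin.val → s'.reals 0 0 = walkWeight w c → RFrame s s' →
      Frame 𝓜 [6, 18, 21] s s' → t ≤ 100 * c.length + 100 → Q t s') :
    WP 𝓜 (headProg j i) s Q := by
  have hm : ∀ y : Fin n, (y : ℕ) % 2 ^ (env b G w M).wordBits = y := fun y =>
    Nat.mod_eq_of_lt (by omega)
  have hn1 : 0 < n := x.pos
  have hm1 : 1 % 2 ^ (env b G w M).wordBits = 1 := Nat.mod_eq_of_lt (by omega)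
  obtain ⟨c, h1, h2, h3⟩ := ht.exists_chain hxD
  have hcn : c.length < n := by
    have : D.length ≤ n := by simpa using ht.nodup.length_le_card
    omega
  have h1' : walkWeight w c.reverse = s.reals j x := by
    rw [← h1]; simp [walkWeight]
  unfold headProg
  simp only [WP_seq, WP_setR, WP_setW]
  refine WP_loop (φ := 50 * c.length) (fun s₁ φ => ∃ l ≤ c.length, arr 𝓜 s₁ 6 0 = c.getVert l ∧
      arr 𝓜 s₁ 18 0 = l ∧ (∀ q < l, arr 𝓜 s₁ 21 q = c.getVert q) ∧
      s₁.out = s.out ∧ s₁.reals 0 0 = walkWeight w c ∧ RFrame s s₁ ∧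
      Frame 𝓜 [6, 18, 21] s s₁ ∧ φ = 50 * (c.length - l)) ?_ ?_ ?_
  · rintro s₁ φ ⟨l, hl, e6, e18, e21, eo, er, erf, ef, rfl⟩ hb
    simp only [holds_neg, holds_weq, eval_cell, eval_lit, Nat.zero_mod, hi, e6,
      ef 0 (by simp), hr, Fin.val_inj] at hb
    have hl' : l < c.length := by
      rcases hl.lt_or_eq with h | rfl
      · exact h
      · rw [SimpleGraph.Walk.getVert_length] at hb; exact absurd rfl hb
    have hml : (l + 1) % 2 ^ (env b G w M).wordBits = l + 1 := Nat.mod_eq_of_lt (by omega)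
    simp only [WP_seq, WP_setW]
    refine ⟨_, ⟨l + 1, hl', ?_, ?_, ?_, by simpa using eo, by simpa using er,
      fun a ha => by simpa using erf a ha, ?_, rfl⟩, ?_⟩
    · have : 15 + j ≠ 21 ∧ 15 + j ≠ 18 := by omega
      simp [arr_setW, e6, this, ef (15 + j) (by simp; omega), (h3 l hl').1, hm]
    · simp [arr_setW, e18, hm1, hml]
    · intro q hq
      simp [arr_setW, e18, e6, Function.update_apply, hm]
      split_ifs with h
      · rw [h]
      · exact e21 q (by omega)
    · refine ef.trans ?_
      intro a ha
      simp only [List.mem_cons, List.not_mem_nil, or_false, not_or] at ha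
      simp [arr_setW, ha]
    · simp; omega
  · refine ⟨0, Nat.zero_le _, ?_, by simp [arr_setW], by simp, by simp, ?_, ?_, ?_, by simp⟩
    · simp [arr_setW, hx, hm]
    · simp [reals_setR, hx, h1]
    · intro a ha; simp [reals_setR, ha]
    · intro a ha
      simp only [List.mem_cons, List.not_mem_nil, or_false, not_or] at ha
      simp [arr_setW, ha]
  · rintro t s₁ φ ⟨l, hl, e6, e18, e21, eo, er, erf, ef, rfl⟩ hb ht
    simp only [holds_neg, holds_weq, eval_cell, eval_lit, Nat.zero_mod, hi, e6,
      ef 0 (by simp), hr, Fin.val_inj, not_not] at hb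
    have hl' : l = c.length := by
      by_contra h
      exact (h3 l (by omega)).2 hb
    subst hl'
    simp only [WP_emit]
    refine WP_loop (φ := 50 * c.length) (fun s₂ φ => ∃ l ≤ c.length, arr 𝓜 s₂ 18 0 = l ∧
        s₂.out = s.out ++ (r : ℕ) :: firstVertices c.reverse (c.length - l) ∧
        s₂.reals 0 0 = walkWeight w c ∧ RFrame s s₂ ∧ arr 𝓜 s₂ 21 = arr 𝓜 s₁ 21 ∧
        Frame 𝓜 [6, 18, 21] s s₂ ∧ φ = 50 * l) ?_ ?_ ?_
    · rintro s₂ φ ⟨l, hl, k18, ko, kr, krf, k21, kf, rfl⟩ hb2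
      simp [k18] at hb2
      have hml : l % 2 ^ (env b G w M).wordBits = l := Nat.mod_eq_of_lt (by omega)
      have hml' : (l - 1) % 2 ^ (env b G w M).wordBits = l - 1 := Nat.mod_eq_of_lt (by omega)
      simp only [WP_seq, WP_setW, WP_emit]
      refine ⟨_, ⟨l - 1, by omega, ?_, ?_, by simpa using kr,
        fun a ha => by simpa using krf a ha, ?_, ?_, rfl⟩, ?_⟩
      · simp [arr_setW, k18, hm1, hml']
      · have h5 : c.length - (l - 1) = c.length - l + 1 := by omega
        have h6 : c.length - (c.length - l + 1) = l - 1 := by omega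
        rw [h5, firstVertices_succ _ (by simp; omega), SimpleGraph.Walk.getVert_reverse, h6]
        simp [arr_setW, k18, hm1, hml', k21, ko, e21 (l - 1) (by omega)]
      · simp [arr_setW, k21]
      · refine kf.trans ?_
        intro a ha
        simp only [List.mem_cons, List.not_mem_nil, or_false, not_or] at ha
        simp [arr_setW, ha]
      · simp; omega
    · exact ⟨c.length, le_rfl, e18, by simp [firstVertices, eo, e6], er, erf, rfl, ef, rfl⟩
    · rintro t' s₂ φ ⟨l, hl, k18, ko, kr, krf, k21, kf, rfl⟩ hb2 ht'
      simp [k18] at hb2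
      subst hb2
      refine hQ s₂ _ c.reverse h1' ?_ (by rw [kr, h1, h1']) krf kf ?_
      · have := firstVertices_length c.reverse
        rw [SimpleGraph.Walk.length_reverse] at this
        rw [ko, Nat.sub_zero, this, ← c.reverse.cons_tail_support]
        simp
      · simp at ht ht' ⊢; omega

end Query

/-! ### Correctness of the routes -/

section Routes

variable {n : ℕ} {G : SimpleGraph (Fin n)} {w : Sym2 (Fin n) → ℝ} {b : ℕ} {M : List ℕ}
variable {s : State} {Q : ℕ → State → Prop}

local notation "𝓜" => env b G w M

theorem walkWeight_eq_sum {a c : Fin n} (p : G.Walk a c) :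
    walkWeight w p = ∑ j ∈ Finset.range p.length, w s(p.getVert j, p.getVert (j + 1)) := by
  induction p with
  | nil => simp
  | cons h p ih =>
    rw [walkWeight_cons, ih, SimpleGraph.Walk.length_cons, Finset.sum_range_succ']
    simpa using add_comm _ _

/-- The table consists of words, and addresses in it fit into words. -/
structure TableFits (G : SimpleGraph (Fin n)) (w : Sym2 (Fin n) → ℝ) (b : ℕ) (M : List ℕ) :
    Prop where
  small : ∀ x ∈ M, x < 2 ^ (env b G w M).wordBits
  order : 20 * n + 20 ≤ 2 ^ (env b G w M).wordBits
  length : M.length < 2 ^ (env b G w M).wordBits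

theorem TableFits.getD_mod (F : TableFits G w b M) (i : ℕ) :
    M.getD i 0 % 2 ^ (env b G w M).wordBits = M.getD i 0 := by
  apply Nat.mod_eq_of_lt
  by_cases h : i < M.length
  · rw [List.getD_eq_getElem _ _ h]
    exact F.small _ (List.getElem_mem h)
  · rw [List.getD_eq_default _ _ (by omega)]
    positivity

theorem TableFits.lt_of_le (F : TableFits G w b M) {x : ℕ} (h : x ≤ 20 * n + 19) :
    x % 2 ^ (env b G w M).wordBits = x :=
  Nat.mod_eq_of_lt (by have := F.order; omega)

theorem TableFits.vertexEntry_eval (F : TableFits G w b M) {o : ℕ} (ho : o ≤ 2) {x : WExpr}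
    {v : Fin n} (hx : x.eval 𝓜 s = v) :
    (vertexEntry o x).eval 𝓜 s = M.getD (2 + (o * n + v)) 0 := by
  have h1 : o * n ≤ 2 * n := Nat.mul_le_mul_right _ ho
  have hv := v.2
  unfold vertexEntry
  simp only [eval_table, eval_add, eval_mul, eval_lit, eval_order, hx]
  show M.getD _ 0 % _ = _
  rw [F.getD_mod]
  rw [F.lt_of_le (x := 2) (by omega), F.lt_of_le (x := o) (by omega),
    show (env b G w M).order % 2 ^ (env b G w M).wordBits = n from F.lt_of_le (x := n) (by omega),
    F.lt_of_le (x := o * n) (by omega), F.lt_of_le (x := o * n + v) (by omega),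
    F.lt_of_le (x := 2 + (o * n + v)) (by omega)]

theorem TableFits.nbr_eval (F : TableFits G w b M) {x y : Fin n} (h : G.Adj x y) {e i : WExpr}
    (he : e.eval 𝓜 s = x) (hi : i.eval 𝓜 s = nbrIndex G w x y) :
    (WExpr.nbr e i).eval 𝓜 s = y := by
  have := y.2
  simp only [eval_nbr, he, hi, env_nbrs]
  rw [List.getD_eq_getElem?_getD, List.getElem?_map, getElem?_nbrIndex h]
  exact F.lt_of_le (by simp; omega)

theorem wt_eval {x y : Fin n} (h : G.Adj x y) {e i : WExpr}
    (he : e.eval 𝓜 s = x) (hi : i.eval 𝓜 s = nbrIndex G w x y) :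
    (RExpr.wt e i).eval 𝓜 s = w s(x, y) := by
  simp only [reval_wt, he, hi, env_wts]
  rw [List.getD_eq_getElem?_getD, List.getElem?_map, getElem?_nbrIndex h]
  rfl

/-- A step of a route to a neighbour whose position is determined. -/
theorem move_spec (F : TableFits G w b M) {x y : Fin n} (h : G.Adj x y) (hx : arr 𝓜 s 3 0 = x)
    (hy : arr 𝓜 s 15 0 = nbrIndex G w x y)
    (hQ : ∀ t s', arr 𝓜 s' 3 0 = y → arr 𝓜 s' 6 0 = x → Frame 𝓜 [3, 6] s s' → RFrame s s' →
      s'.out = s.out ++ [(y : ℕ)] → s'.reals 0 0 = s.reals 0 0 + w s(x, y) → t ≤ 30 → Q t s') :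
    WP 𝓜 (.seq (.setR 0 (.lit 0) (.add (.cell 0 (.lit 0)) (.wt (.var 3) (.var 15)))) <|
    .seq (.assign 6 (.var 3)) <|
    .seq (.assign 3 (.nbr (.var 3) (.var 15))) (.emit (.var 3))) s Q := by
  have hmx := F.lt_of_le (show (x : ℕ) ≤ 20 * n + 19 by have := x.2; omega)
  have hmy := F.lt_of_le (show (y : ℕ) ≤ 20 * n + 19 by have := y.2; omega)
  simp only [WP_seq, WP_setR, WP_setW, WP_emit]
  generalize hs₁ : State.setR _ _ _ _ = s₁
  have e1 : ∀ a, arr 𝓜 s₁ a = arr 𝓜 s a := by intro a; rw [← hs₁]; rfl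
  generalize hs₂ : State.setW s₁ _ _ _ = s₂
  have e2 : ∀ a, a ≠ 6 → arr 𝓜 s₂ a = arr 𝓜 s a := by
    intro a ha; rw [← hs₂, ← e1]; simp [arr_setW, ha]
  have e26 : arr 𝓜 s₂ 6 0 = x := by rw [← hs₂]; simp [arr_setW, e1, hx, hmx]
  have hv : (WExpr.nbr (.var 3) (.var 15)).eval 𝓜 s₂ = y :=
    F.nbr_eval h (by simp [e2, hx]) (by simp [e2, hy])
  rw [hv]
  have er : s₂.reals = s₁.reals := by rw [← hs₂]; rfl
  have hw : (RExpr.wt (.var 3) (.var 15)).eval 𝓜 s = w s(x, y) :=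
    wt_eval h (by simp [hx]) (by simp [hy])
  refine hQ _ _ ?_ ?_ ?_ ?_ ?_ ?_ (by simp)
  · simp [arr_setW, hmy]
  · simp [arr_setW, e26]
  · intro a ha
    simp only [List.mem_cons, List.not_mem_nil, or_false, not_or] at ha
    simp [arr_setW, ha, e2]
  · intro a ha
    simp [er, ← hs₁, reals_setR, ha]
  · simp [arr_setW, hmy, ← hs₂, ← hs₁]
  · simp [er, ← hs₁, reals_setR, -reval_wt, hw]

/-- Find the position of the next vertex of a route. -/
theorem next_spec (F : TableFits G w b M) {a c : Fin n} {p : G.Walk a c} {pos : ℕ → ℕ}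
    {i : ℕ} (hi : i < p.length) (hx : arr 𝓜 s 3 0 = p.getVert i)
    (hprev : ∀ i', i = i' + 1 → arr 𝓜 s 6 0 = p.getVert i') (hpos : arr 𝓜 s 9 0 = pos i)
    (H : (M.getD (2 + (n + p.getVert i)) 0 = 0 ∧ pos (i + 1) = pos i + 1 ∧ pos i < M.length ∧
      M.getD (pos i) 0 = nbrIndex G w (p.getVert i) (p.getVert (i + 1))) ∨
    (pos (i + 1) = pos i ∧ ∃ i', i = i' + 1 ∧ p.getVert i' ≠ p.getVert (i + 1) ∧
      G.Adj (p.getVert i) (p.getVert i') ∧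
      (M.getD (2 + (n + p.getVert i)) 0 = nbrIndex G w (p.getVert i) (p.getVert i') + 1 ∧
      M.getD (2 + (2 * n + p.getVert i)) 0 = nbrIndex G w (p.getVert i) (p.getVert (i + 1)) + 1 ∨
      M.getD (2 + (n + p.getVert i)) 0 = nbrIndex G w (p.getVert i) (p.getVert (i + 1)) + 1 ∧
      M.getD (2 + (2 * n + p.getVert i)) 0 = nbrIndex G w (p.getVert i) (p.getVert i') + 1)))
    (hQ : ∀ t s', arr 𝓜 s' 15 0 = nbrIndex G w (p.getVert i) (p.getVert (i + 1)) →
      arr 𝓜 s' 9 0 = pos (i + 1) → Frame 𝓜 [9, 15] s s' → s'.reals = s.reals → s'.out = s.out →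
      t ≤ 70 → Q t s') :
    WP 𝓜 (.branch (.weq (vertexEntry 1 (.var 3)) (.lit 0))
        (.seq (.assign 15 (.table (.var 9))) (.assign 9 (.op .add (.var 9) (.lit 1))))
        (.seq (.assign 15 (.op .sub (vertexEntry 1 (.var 3)) (.lit 1)))
          (.branch (.weq (.nbr (.var 3) (.var 15)) (.var 6))
            (.assign 15 (.op .sub (vertexEntry 2 (.var 3)) (.lit 1))) .skip))) s Q := by
  have hadj := p.adj_getVert_succ hi
  have hv1 : (vertexEntry 1 (.var 3)).eval 𝓜 s = M.getD (2 + (n + p.getVert i)) 0 := by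
    rw [F.vertexEntry_eval (by omega) (v := p.getVert i) (by simp [hx]), one_mul]
  have hm1 := F.lt_of_le (show 1 ≤ 20 * n + 19 by omega)
  have hmi : ∀ z, nbrIndex G w (p.getVert i) z < n →
      nbrIndex G w (p.getVert i) z % 2 ^ (env b G w M).wordBits = nbrIndex G w (p.getVert i) z :=
    fun z h => F.lt_of_le (by omega)
  rcases H with ⟨h1, h2, h3, h4⟩ | ⟨h2, i', rfl, hne, hadj', H⟩
  · refine WP_branch_pos (by rw [holds_weq, hv1, h1]; simp) ?_
    simp only [WP_seq, WP_setW]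
    have hp : (pos i + 1) % 2 ^ (env b G w M).wordBits = pos i + 1 :=
      Nat.mod_eq_of_lt (by have := F.length; omega)
    have h5 : M.getD (pos i) 0 % 2 ^ (env b G w M).wordBits = M.getD (pos i) 0 := F.getD_mod _
    refine hQ _ _ ?_ ?_ ?_ rfl rfl (by simp [vertexEntry])
    · have : (env b G w M).table = M := rfl
      simp only [arr_setW, eval_table, eval_cell, eval_lit, Nat.zero_mod, hpos, this]
      rw [h5, h4]; simp [hmi _ (nbrIndex_lt hadj)]
    · simp [arr_setW, hpos, hm1, hp, h2]
    · intro a ha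
      simp only [List.mem_cons, List.not_mem_nil, or_false, not_or] at ha
      simp [arr_setW, ha]
  · have h0 : M.getD (2 + (n + p.getVert (i' + 1))) 0 ≠ 0 := by
      rcases H with ⟨H, -⟩ | ⟨H, -⟩ <;> omega
    refine WP_branch_neg (by rw [holds_weq, hv1]; simpa using h0) ?_
    simp only [WP_seq, WP_setW]
    rw [eval_sub, hv1, eval_lit 1, hm1]
    generalize hs₁ : State.setW _ _ _ _ = s₁
    have e1 : Frame 𝓜 [15] s s₁ := by
      intro a ha
      simp only [List.mem_cons, List.not_mem_nil, or_false] at ha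
      rw [← hs₁]; simp [arr_setW, ha]
    have e3 : arr 𝓜 s₁ 3 0 = p.getVert (i' + 1) := by rw [e1 3 (by simp), hx]
    have e6 : arr 𝓜 s₁ 6 0 = p.getVert i' := by rw [e1 6 (by simp), hprev i' rfl]
    have e9 : arr 𝓜 s₁ 9 0 = pos (i' + 1 + 1) := by rw [e1 9 (by simp), hpos, h2]
    have er : s₁.reals = s.reals ∧ s₁.out = s.out := by rw [← hs₁]; exact ⟨rfl, rfl⟩
    have e15 : arr 𝓜 s₁ 15 0 = (M.getD (2 + (n + p.getVert (i' + 1))) 0 - 1) %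
        2 ^ (env b G w M).wordBits := by rw [← hs₁]; simp [arr_setW]
    -- The first stored neighbour is taken tentatively and replaced by the second one if the route
    -- has come from it. In the other case it is the next vertex, and `hne` makes the test fail.
    rcases H with ⟨Ha, Hb⟩ | ⟨Ha, Hb⟩
    · rw [Ha, Nat.add_sub_cancel, hmi _ (nbrIndex_lt hadj')] at e15
      have hv := F.nbr_eval (s := s₁) hadj' (e := .var 3) (i := .var 15) (by simp [e3])
        (by simp [e15])
      refine WP_branch_pos (by rw [holds_weq, hv]; simp [e6]) ?_
      rw [WP_setW, eval_sub, F.vertexEntry_eval (by omega) (v := p.getVert (i' + 1)) (by simp [e3]),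
        Hb]
      refine hQ _ _ ?_ ?_ ?_ er.1 er.2 (by simp [vertexEntry])
      · simp [arr_setW, hm1, hmi _ (nbrIndex_lt hadj)]
      · simp [arr_setW, e9]
      · refine (e1.mono (by simp)).trans ?_
        intro a ha
        simp only [List.mem_cons, List.not_mem_nil, or_false, not_or] at ha
        simp [arr_setW, ha]
    · rw [Ha, Nat.add_sub_cancel, hmi _ (nbrIndex_lt hadj)] at e15
      have hv := F.nbr_eval (s := s₁) hadj (e := .var 3) (i := .var 15) (by simp [e3])
        (by simp [e15])
      refine WP_branch_neg (by rw [holds_weq, hv]; simpa [e6, Fin.val_inj] using Ne.symm hne) ?_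
      rw [WP_skip]
      exact hQ _ _ e15 e9 (e1.mono (by simp)) er.1 er.2 (by simp [vertexEntry])

/-- The route is a path, so it meets its end `c` only once, and the comparison with `c` is a correct
test for stopping. -/
theorem leg_spec (F : TableFits G w b M) {e : ℕ} {a c : Fin n} {p : G.Walk a c}
    (H : LegAt G w M e p) (he : e < M.length) (hx : arr 𝓜 s 3 0 = a) (h24 : arr 𝓜 s 24 0 = e)
    (hQ : ∀ s' t, arr 𝓜 s' 3 0 = c → s'.out = s.out ++ p.support.tail.map Fin.val →
      s'.reals 0 0 = s.reals 0 0 + walkWeight w p → RFrame s s' →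
      Frame 𝓜 [3, 6, 9, 12, 15] s s' → t ≤ 110 * p.length + 20 → Q t s') :
    WP 𝓜 legProg s Q := by
  obtain ⟨hp, hc, pos, hpos0, hpos⟩ := H
  have hm1 := F.lt_of_le (show 1 ≤ 20 * n + 19 by omega)
  have hmc := F.lt_of_le (show (c : ℕ) ≤ 20 * n + 19 by have := c.2; omega)
  have hme : (e + 1) % 2 ^ (env b G w M).wordBits = e + 1 :=
    Nat.mod_eq_of_lt (by have := F.length; omega)
  have hT : (env b G w M).table = M := rfl
  unfold legProg
  simp only [WP_seq, WP_setW]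
  refine WP_loop (φ := 110 * p.length) (fun s₁ φ => ∃ l ≤ p.length, arr 𝓜 s₁ 3 0 = p.getVert l ∧
      (∀ l', l = l' + 1 → arr 𝓜 s₁ 6 0 = p.getVert l') ∧ arr 𝓜 s₁ 9 0 = pos l ∧
      arr 𝓜 s₁ 12 0 = c ∧ s₁.out = s.out ++ firstVertices p l ∧
      s₁.reals 0 0 = s.reals 0 0 + ∑ j ∈ Finset.range l, w s(p.getVert j, p.getVert (j + 1)) ∧
      RFrame s s₁ ∧ Frame 𝓜 [3, 6, 9, 12, 15] s s₁ ∧ φ = 110 * (p.length - l)) ?_ ?_ ?_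
  · rintro s₁ φ ⟨l, hl, e3, e6, e9, e12, eo, er, erf, ef, rfl⟩ hb
    simp only [holds_neg, holds_weq, eval_cell, eval_lit, Nat.zero_mod, e3, e12, Fin.val_inj] at hb
    have hl' : l < p.length := by
      rcases hl.lt_or_eq with h | rfl
      · exact h
      · rw [SimpleGraph.Walk.getVert_length] at hb; exact absurd rfl hb
    rw [WP_seq]
    refine next_spec F hl' e3 e6 e9 (hpos l hl') ?_
    intro t s₂ f15 f9 ff fr fo ht
    refine move_spec F (p.adj_getVert_succ hl') (by rw [ff 3 (by simp), e3]) f15 ?_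
    intro t' s₃ g3 g6 gf grf go gr ht'
    refine ⟨_, ⟨l + 1, hl', g3, ?_, ?_, ?_, ?_, ?_, ?_, ?_, rfl⟩, ?_⟩
    · intro l' h; obtain rfl : l = l' := by omega
      exact g6
    · rw [gf 9 (by simp), f9]
    · rw [gf 12 (by simp), ff 12 (by simp), e12]
    · rw [go, fo, eo, firstVertices_succ p hl']; simp
    · rw [gr, fr, er, Finset.sum_range_succ]; ring
    · intro a ha; rw [grf a ha, fr, erf a ha]
    · exact ef.trans ((ff.mono (by simp)).trans (gf.mono (by simp)))
    · simp; omega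
  · have h5 : M.getD e 0 % 2 ^ (env b G w M).wordBits = c := by rw [F.getD_mod, hc]
    refine ⟨0, Nat.zero_le _, by simp [arr_setW, hx], by simp, ?_, ?_, by simp [firstVertices],
      by simp, fun a _ => rfl, ?_, by simp⟩
    · simp [arr_setW, h24, hm1, hme, hpos0]
    · simp only [arr_setW, eval_table, eval_cell, eval_lit, Nat.zero_mod, h24, hT, h5]
      simp [hmc]
    · intro a ha
      simp only [List.mem_cons, List.not_mem_nil, or_false, not_or] at ha
      simp [arr_setW, ha]
  · rintro t s₁ φ ⟨l, hl, e3, e6, e9, e12, eo, er, erf, ef, rfl⟩ hb ht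
    simp only [holds_neg, holds_weq, eval_cell, eval_lit, Nat.zero_mod, e3, e12, Fin.val_inj,
      not_not] at hb
    have hl' : l = p.length := by
      refine hp.getVert_injOn hl (le_refl p.length) ?_
      rw [hb, SimpleGraph.Walk.getVert_length]
    subst hl'
    refine hQ s₁ _ (by rw [e3, hb]) (by rw [eo, firstVertices_length])
      (by rw [er, walkWeight_eq_sum]) erf ef ?_
    simp at ht ⊢; omega

theorem load_eval (F : TableFits G w b M) {ind : Fin n → ℕ} {m : ℕ} {S : Finset (Fin n)}
    (hM : 3 * n + m * m + 2 < 2 ^ (env b G w M).wordBits) (h1 : M.getD 1 0 = m)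
    (hmark : ∀ x : Fin n, M.getD (2 + (0 + x)) 0 = if x ∈ S then ind x + 1 else 0)
    (hind : ∀ x ∈ S, ind x < m) {a c : Fin n} (ha : a ∈ S) (hc : c ∈ S)
    (h3 : arr 𝓜 s 3 0 = a) (h27 : arr 𝓜 s 27 0 = c) :
    (WExpr.table (.op .add (.op .add (.lit 2) (.op .mul (.lit 3) .order))
    (.op .add (.op .mul (.op .sub (vertexEntry 0 (.var 3)) (.lit 1)) (.table (.lit 1)))
      (.op .sub (vertexEntry 0 (.var 27)) (.lit 1))))).eval 𝓜 s =
    M.getD (2 + 3 * n + (ind a * m + ind c)) 0 := by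
  have hva := F.vertexEntry_eval (s := s) (o := 0) (by omega) (x := .var 3) (v := a) (by simp [h3])
  have hvc := F.vertexEntry_eval (s := s) (o := 0) (by omega) (x := .var 27) (v := c)
    (by simp [h27])
  rw [zero_mul, hmark, if_pos ha] at hva
  rw [zero_mul, hmark, if_pos hc] at hvc
  have hm1 := F.lt_of_le (show 1 ≤ 20 * n + 19 by omega)
  have hT : (env b G w M).table = M := rfl
  have hO : (env b G w M).order = n := rfl
  have hlt : ind a * m + ind c < m * m := by
    have h1 := hind a ha
    have h2 := hind c hc
    nlinarith
  have hmod : ∀ {x}, x ≤ 3 * n + m * m + 2 → x % 2 ^ (env b G w M).wordBits = x :=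
    fun h => Nat.mod_eq_of_lt (by omega)
  simp only [eval_table, eval_add, eval_mul, eval_sub, eval_lit, eval_order, hva, hvc, hm1,
    Nat.add_sub_cancel, hT, hO]
  rw [F.getD_mod, F.getD_mod, h1]
  rw [F.lt_of_le (x := 2) (by omega), F.lt_of_le (x := 3) (by omega),
    F.lt_of_le (x := n) (by omega), F.lt_of_le (x := 3 * n) (by omega),
    F.lt_of_le (x := 2 + 3 * n) (by omega), hmod (x := ind a * m) (by omega),
    hmod (x := ind a * m + ind c) (by omega),
    hmod (x := 2 + 3 * n + (ind a * m + ind c)) (by omega)]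

/-- A leg joins two different pivots, so it has an edge, and the constant overhead of a leg is paid
by its length. Hence the whole middle part is charged to the reported path. -/
theorem middle_spec (F : TableFits G w b M) {ind : Fin n → ℕ} {m : ℕ} {S : Finset (Fin n)}
    (hM : 3 * n + m * m + 2 < 2 ^ (env b G w M).wordBits) (h1 : M.getD 1 0 = m)
    (hmark : ∀ x : Fin n, M.getD (2 + (0 + x)) 0 = if x ∈ S then ind x + 1 else 0)
    (hind : ∀ x ∈ S, ind x < m) {a c : Fin n} (hc : c ∈ S) {W : ℝ}
    (H : MidRoute G w M m ind S c a W)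
    (h3 : arr 𝓜 s 3 0 = a) (h27 : arr 𝓜 s 27 0 = c)
    (hQ : ∀ s' t, ∀ p : G.Walk a c, walkWeight w p = W → arr 𝓜 s' 3 0 = c →
      s'.out = s.out ++ p.support.tail.map Fin.val →
      s'.reals 0 0 = s.reals 0 0 + walkWeight w p → RFrame s s' →
      Frame 𝓜 [3, 6, 9, 12, 15, 24] s s' → t ≤ 300 * p.length + 10 → Q t s') :
    WP 𝓜 middleProg s Q := by
  unfold middleProg
  induction H generalizing s Q with
  | done =>
    refine ⟨_, s, .loop_done _ (by simp [h3, h27]), hQ s _ .nil ?_ ?_ ?_ ?_ ?_ ?_ ?_⟩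
    · simp
    · exact h3
    · simp
    · simp
    · exact fun _ _ => rfl
    · exact Frame.refl _ _ _
    · simp
  | @step a a' W e p ha hac haa he hel hleg hr ih =>
    have hL := F.length
    have hstep : WP 𝓜 (.seq loadProg legProg) s (fun t s' =>
        WP 𝓜 (.loop (.neg (.weq (.var 3) (.var 27))) (.seq loadProg legProg)) s'
          (fun t' s'' => Q ((Test.neg (.weq (.var 3) (.var 27))).cost + t + t' + 1) s'')) := by
      rw [WP_seq]
      unfold loadProg
      rw [WP_setW, load_eval F hM h1 hmark hind ha hc h3 h27, he]
      have hme : e % 2 ^ (env b G w M).wordBits = e := Nat.mod_eq_of_lt (by omega)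
      generalize hs₁ : State.setW _ _ _ _ = s₁
      have e1 : Frame 𝓜 [24] s s₁ := by
        intro a ha
        simp only [List.mem_cons, List.not_mem_nil, or_false] at ha
        rw [← hs₁]; simp [arr_setW, ha]
      have e24 : arr 𝓜 s₁ 24 0 = e := by rw [← hs₁]; simp [arr_setW, hme]
      have er : s₁.reals = s.reals ∧ s₁.out = s.out := by rw [← hs₁]; exact ⟨rfl, rfl⟩
      refine leg_spec F hleg hel (by rw [e1 3 (by simp), h3]) e24 ?_
      intro s₂ t f3 fo fr frf ff ht
      refine ih f3 (by rw [ff 27 (by simp), e1 27 (by simp), h27]) ?_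
      intro s₃ t' q hq g3 go gr grf gf ht'
      have hlen : 1 ≤ p.length := by
        rw [Nat.one_le_iff_ne_zero]
        exact fun h => haa (SimpleGraph.Walk.eq_of_length_eq_zero h)
      refine hQ s₃ _ (p.append q) ?_ g3 ?_ ?_ ?_ ?_ ?_
      · rw [walkWeight_append, hq]
      · rw [go, fo, er.2, SimpleGraph.Walk.tail_support_append]; simp
      · rw [gr, fr, er.1, walkWeight_append]; ring
      · intro a ha; rw [grf a ha, frf a ha, er.1]
      · exact (e1.mono (by simp)).trans ((ff.mono (by simp)).trans gf)
      · rw [SimpleGraph.Walk.length_append]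
        simp [vertexEntry] at ht' ⊢; omega
    obtain ⟨t, s', h4, t', s'', h5, h6⟩ := hstep
    refine ⟨_, s'', .loop_step ?_ h4 h5, h6⟩
    simpa [h3, h27, Fin.val_inj] using hac

end Routes

/-! ### Correctness of the query program -/

theorem blockName_injective (j : ℕ) : (blockName j).Injective := by
  intro a c h
  simpa [blockName] using h

section Search

variable {n : ℕ} {G : SimpleGraph (Fin n)} {w : Sym2 (Fin n) → ℝ} {b β : ℕ} {M : List ℕ}
variable {s : State} {Q : ℕ → State → Prop}

local notation "𝓜" => env b G w M

open Classical in
/-- The number of rounds after which no pivot is discovered. -/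
def SearchRun.delay {r : Fin n} (R : SearchRun G w r b β) (S : Finset (Fin n)) : ℕ :=
  ((Finset.range (R.m + 1)).filter (fun l => ∀ l' ≤ l, R.x l' ∉ S)).card

theorem SearchRun.le_delay {r : Fin n} (R : SearchRun G w r b β) {S : Finset (Fin n)} {i : ℕ}
    (hi : i ≤ R.m + 1) (h : ∀ l < i, R.x l ∉ S) : i ≤ R.delay S := by
  unfold delay
  conv_lhs => rw [← Finset.card_range i]
  apply Finset.card_le_card
  intro l hl
  rw [Finset.mem_range] at hl
  simp only [Finset.mem_filter, Finset.mem_range]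
  exact ⟨by omega, fun l' hl' => h l' (by omega)⟩

/-- The `j`-th search has stopped before round `i` of the run `R` was done. -/
structure Stopped {r : Fin n} (R : SearchRun G w r b β) (S : Finset (Fin n)) (tgt : Fin n)
    (E : Env) (j i : ℕ) (s : State) : Prop where
  le : i ≤ R.m + 1
  before : ∀ l < i, R.x l ≠ tgt ∧ R.x l ∉ S
  running : i ≤ R.m → arr E s (9 + j) 0 = 0
  finished : i = R.m + 1 → arr E s (9 + j) 0 = 1
  last : i ≤ R.m → arr E s (6 + j) 0 = R.x i
  found : i ≤ R.m → R.x i = tgt ∨ R.x i ∈ S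
  tree : i ≤ R.m → Tree G w r (arr E s (15 + j)) (s.reals j) (R.D i)
  exact : i ≤ R.m → ∀ x ∈ R.D i, ∀ p : G.Walk r x, s.reals j x ≤ walkWeight w p
  far : i ≤ R.m → ∀ x ∈ R.D i, ∀ z ∉ R.D i, ∀ p : G.Walk r z, s.reals j x ≤ walkWeight w p

theorem Stopped.congr {r tgt : Fin n} {R : SearchRun G w r b β} {S : Finset (Fin n)} {E : Env}
    {j i : ℕ} {s' : State} (h : Stopped R S tgt E j i s)
    (ha : arr E s' (9 + j) = arr E s (9 + j) ∧ arr E s' (6 + j) = arr E s (6 + j) ∧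
      arr E s' (15 + j) = arr E s (15 + j)) (hr : s'.reals j = s.reals j) :
    Stopped R S tgt E j i s' := by
  obtain ⟨h1, h2, h3, h4, h5, h6, h7, h8, h9⟩ := h
  constructor
  all_goals (try rw [ha.1]); (try rw [ha.2.1]); (try rw [ha.2.2]); (try rw [hr]); assumption

/-- The flag is set only after the complete run, which has found the whole component of `r` and not
`tgt`. -/
theorem Stopped.not_reachable {r tgt : Fin n} {R : SearchRun G w r b β} {S : Finset (Fin n)}
    {E : Env} {j i : ℕ} (h : Stopped R S tgt E j i s) (h1 : arr E s (9 + j) 0 = 1) :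
    ¬ G.Reachable r tgt := by
  intro hr
  obtain ⟨l, hl, e⟩ := R.exists_x hr
  have hi : ¬ i ≤ R.m := fun hi => by have := h.running hi; omega
  exact (h.before l (by omega)).1 e

theorem Stopped.index_le {r tgt : Fin n} {R : SearchRun G w r b β} {S : Finset (Fin n)}
    {E : Env} {j i : ℕ} (h : Stopped R S tgt E j i s) (h1 : arr E s (9 + j) 0 ≠ 1) : i ≤ R.m := by
  by_contra hi
  exact h1 (h.finished (by have := h.le; omega))

theorem Stopped.mem {r tgt : Fin n} {R : SearchRun G w r b β} {S : Finset (Fin n)}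
    {E : Env} {j i : ℕ} (_ : Stopped R S tgt E j i s) (hi : i ≤ R.m) : R.x i ∈ R.D i :=
  (R.mem_D hi _).2 ⟨i, le_rfl, rfl⟩

theorem Stopped.not_mem {r tgt : Fin n} {R : SearchRun G w r b β} {S : Finset (Fin n)}
    {E : Env} {j i : ℕ} (h : Stopped R S tgt E j i s) (hi : i ≤ R.m) (hx : R.x i ≠ tgt) :
    tgt ∉ R.D i := by
  rw [R.mem_D hi]
  rintro ⟨l, hl, e⟩
  rcases hl.lt_or_eq with hl | rfl
  · exact (h.before l hl).1 e
  · exact hx e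

/-- The table supplies the number of ranks and decides when the loop stops; between these points the
copy of the search follows the given run `R`. The time is therefore that of the first `i` rounds of
`R`, plus the tests of the loop. -/
theorem search_spec (F : TableFits G w b M) {ind : Fin n → ℕ} {S : Finset (Fin n)}
    (hβ : M.getD 0 0 = β)
    (hmark : ∀ x : Fin n, M.getD (2 + (0 + x)) 0 = if x ∈ S then ind x + 1 else 0)
    {j c c' : ℕ} (hj : 1 ≤ j ∧ j ≤ 2) {r tgt : Fin n} (R : SearchRun G w r b β)
    (hc : c % 2 ^ (env b G w M).wordBits = c) (hc' : c' % 2 ^ (env b G w M).wordBits = c')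
    (hr : arr 𝓜 s 0 c = r) (ht : arr 𝓜 s 0 c' = tgt)
    (hz : ∀ a, s.words (blockName j a) = (fun _ => 0) ∧ s.reals (blockName j a) = (fun _ => 0))
    (hQ : ∀ t i s', SameOff (blockName j) s s' → Stopped R S tgt 𝓜 j i s' →
      t ≤ R.t₀ + ∑ l ∈ Finset.range i, R.t l + 50 * (i + 2) → Q t s') :
    WP 𝓜 (searchProg j c c') s Q := by
  have hm2 := F.lt_of_le (x := 2) (by omega)
  have hm1 := F.lt_of_le (x := 1) (by omega)
  have hmv : ∀ x : Fin n, (x : ℕ) % 2 ^ (env b G w M).wordBits = x := fun x =>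
    F.lt_of_le (by omega)
  have hmx : ∀ x : Fin n, (2 + x : ℕ) % 2 ^ (env b G w M).wordBits = 2 + x := fun x =>
    F.lt_of_le (by omega)
  have hT : (env b G w M).table = M := rfl
  have hMβ : β % 2 ^ (env b G w M).wordBits = β := by rw [← hβ, F.getD_mod]
  have h0 : 0 ∉ Set.range (blockName j) := by
    rintro ⟨a, h⟩; simp only [blockName] at h; omega
  unfold searchProg
  simp only [WP_seq, WP_setW]
  generalize hs₁ : State.setW (State.setW _ _ _ _) _ _ _ = s₁
  have hoff₁ : SameOff (blockName j) s s₁ := by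
    have h0 : ∀ s i x, SameOff (blockName j) s (s.setW j i x) := fun s i x => by
      simpa [blockName] using SameOff.setW (f := blockName j) (S := s) 0 i x
    have h1 : ∀ s i x, SameOff (blockName j) s (s.setW (3 + j) i x) := fun s i x => by
      simpa [blockName] using SameOff.setW (f := blockName j) (S := s) 1 i x
    rw [← hs₁]
    exact (h0 _ _ _).trans (h1 _ _ _)
  have hemb₁ : Embeds (blockName j) (searchStart r β) s₁ := by
    refine ⟨fun a => ?_, fun a => by rw [← hs₁]; exact (hz a).2⟩
    have e0 := (hz 0).1
    have e1 := (hz 1).1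
    have ea := (hz a).1
    have hβ' : (WExpr.table (.lit 0)).eval 𝓜 (s.setW j (0 % 2 ^ (env b G w M).wordBits) r) = β := by
      simp only [eval_table, eval_lit, Nat.zero_mod, hT, hβ, hMβ]
    rw [← hs₁, eval_lit, eval_lit, eval_cell, eval_lit, hc, hr, hβ']
    simp only [blockName, Nat.zero_mod] at e0 e1 ea ⊢
    rcases a with _ | _ | a
    · simp only [mul_zero, zero_add] at e0 ⊢
      simp [State.setW, searchStart, e0]
    · simp only [mul_one, zero_add] at e1 ⊢
      simp [State.setW, searchStart, e1]
    · have h1 : 3 * (a + 1 + 1) + j ≠ 3 + j := by omega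
      have h2 : 3 * (a + 1 + 1) + j ≠ j := by omega
      simp [State.setW, searchStart, ea]
  obtain ⟨s₂, hx₂, hemb₂, hoff₂⟩ := R.init.relabel M (blockName_injective j) initProg_silent hemb₁
  refine ⟨_, s₂, hx₂, ?_⟩
  have hcell : ∀ {i : ℕ} {s' : State}, Embeds (blockName j) (R.st i) s' → ∀ a,
      arr 𝓜 s' (blockName j a) = arr (env b G w []) (R.st i) a := by
    intro i s' h a
    funext q
    unfold arr
    rw [h.1]
    rfl
  have e6 : 6 + j = blockName j 2 := by simp [blockName]
  have e9 : 9 + j = blockName j 3 := by simp [blockName]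
  have e15 : 15 + j = blockName j 5 := by simp [blockName]
  have ej : ∀ s' : State, s'.reals j = s'.reals (blockName j 0) := by simp [blockName]
  -- The budget is the time of all remaining rounds, although the loop may stop earlier; the unused
  -- part is subtracted in the end.
  refine WP_loop (φ := ∑ l ∈ Finset.Ico 0 (R.m + 1), (R.t l + 50)) (fun s' φ => ∃ i ≤ R.m + 1,
    Embeds (blockName j) (R.st i) s' ∧ SameOff (blockName j) s s' ∧
    (∀ l < i, R.x l ≠ tgt ∧ R.x l ∉ S) ∧ φ = ∑ l ∈ Finset.Ico i (R.m + 1), (R.t l + 50)) ?_ ?_ ?_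
  · rintro s' φ ⟨i, hi, hemb, hoff, hbef, rfl⟩ hb
    simp only [holds_both, holds_neg, holds_weq, eval_cell, eval_lit, eval_table, eval_add,
      Nat.zero_mod, e6, e9, hcell hemb, hc', hm1, hm2, hT] at hb
    have hi' : i ≤ R.m := by
      by_contra h
      obtain rfl : i = R.m + 1 := by omega
      exact hb.2.2 R.done
    rw [R.last i hi', show arr 𝓜 s' 0 c' = tgt by
      rw [← ht]; unfold arr; rw [(hoff.1 0 h0).1], Fin.val_inj, hmx, F.getD_mod,
      ← zero_add (R.x i : ℕ), hmark] at hb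
    obtain ⟨s'', hx'', hemb'', hoff''⟩ := (R.round i hi').relabel M (blockName_injective j)
      roundProg_silent hemb
    refine ⟨_, s'', hx'', _, ⟨i + 1, by omega, hemb'', hoff.trans hoff'', ?_, rfl⟩, ?_⟩
    · intro l hl
      rcases (Nat.lt_succ_iff.1 hl).lt_or_eq with hl | rfl
      · exact hbef l hl
      · refine ⟨hb.1, fun h => ?_⟩
        have := hb.2.1
        simp [h] at this
    · rw [Finset.sum_eq_sum_Ico_succ_bot (show i < R.m + 1 by omega)]
      simp; omega
  · exact ⟨0, by omega, hemb₂, hoff₁.trans hoff₂, by simp, rfl⟩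
  · rintro t s' φ ⟨i, hi, hemb, hoff, hbef, rfl⟩ hb htm
    simp only [holds_both, holds_neg, holds_weq, eval_cell, eval_lit, eval_table, eval_add,
      Nat.zero_mod, e6, e9, hcell hemb, hc', hm1, hm2, hT] at hb
    refine hQ _ i s' hoff ⟨hi, hbef, ?_, ?_, ?_, ?_, ?_, ?_, ?_⟩ ?_
    · intro h; rw [e9, hcell hemb]; exact R.running i h
    · rintro rfl; rw [e9, hcell hemb]; exact R.done
    · intro h; rw [e6, hcell hemb]; exact R.last i h
    · intro hi'
      rw [R.last i hi', show arr 𝓜 s' 0 c' = tgt by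
        rw [← ht]; unfold arr; rw [(hoff.1 0 h0).1], Fin.val_inj, hmx, F.getD_mod,
        ← zero_add (R.x i : ℕ), hmark, R.running i hi'] at hb
      by_contra hcon
      push Not at hcon
      exact hb ⟨hcon.1, by simp [hcon.2], by simp⟩
    · intro h; rw [e15, hcell hemb, ej, hemb.2]; exact (R.dinv i h).tree
    · intro h; rw [ej, hemb.2]; exact (R.dinv i h).exact
    · intro h; rw [ej, hemb.2]; exact (R.dinv i h).far
    · have h1 := Finset.sum_Ico_consecutive (fun l => R.t l + 50) (Nat.zero_le i) hi
      have h2 : ∑ l ∈ Finset.Ico 0 i, (R.t l + 50) = ∑ l ∈ Finset.range i, R.t l + 50 * i := by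
        rw [← Finset.range_eq_Ico, Finset.sum_add_distrib]
        simp [mul_comm]
      rw [← h1, h2] at htm
      simp only [Test.cost, WExpr.cost] at htm ⊢
      omega

end Search

/-! ### Stretch and running time of a query -/

section Answer

variable {n : ℕ} {G : SimpleGraph (Fin n)} {w : Sym2 (Fin n) → ℝ} {b β : ℕ} {M : List ℕ}
variable {s : State}

local notation "𝓜" => env b G w M

theorem SameOff.arr_eq {E : Env} {j a : ℕ} {s s' : State} (h : SameOff (blockName j) s s')
    (ha : a % 3 ≠ j % 3) : s'.words a = s.words a ∧ s'.reals a = s.reals a ∧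
      arr E s' a = arr E s a := by
  have h1 := h.1 a (by rintro ⟨a', rfl⟩; apply ha; simp only [blockName]; omega)
  exact ⟨h1.1, h1.2, by unfold arr; rw [h1.1]⟩

theorem correctAnswer_of_walk {u v : Fin n} {α : ℝ} (hα : 0 ≤ α) (p : G.Walk u v)
    (h : ∀ q : G.Walk u v, walkWeight w p ≤ α * walkWeight w q) {π : List ℕ} {δ : ℝ}
    (hπ : π = p.support.map Fin.val) (hδ : δ = walkWeight w p) :
    CorrectAnswer G w α u v π δ := by
  refine ⟨fun _ => ⟨p, hπ, hδ, ?_⟩, fun h => absurd ⟨p⟩ h⟩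
  have : Nonempty (G.Walk u v) := ⟨p⟩
  rw [wdist, Real.mul_iInf_of_nonneg hα]
  exact le_ciInf h

/-- Before the search stops it sees no pivot, so the number of its rounds is at most the delay. All
constants are absorbed with the help of λ ≥ 1. -/
theorem SearchRun.cost_le {r : Fin n} (R : SearchRun G w r b β) (hG : 1 ≤ arboricity G)
    {S : Finset (Fin n)} {i t : ℕ} (hi : i ≤ R.m + 1) (hb : ∀ l < i, R.x l ∉ S)
    (ht : t ≤ R.t₀ + ∑ l ∈ Finset.range i, R.t l + 50 * (i + 2)) :
    (t : ℝ) ≤ 8100 * ((arboricity G + β) * (R.delay S + 2)) := by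
  have h1 := R.time i hi
  have h2 : (i : ℝ) ≤ R.delay S := by exact_mod_cast R.le_delay hi hb
  have h3 : (t : ℝ) ≤ R.t₀ + ∑ l ∈ Finset.range i, (R.t l : ℝ) + 50 * (i + 2) := by
    exact_mod_cast ht
  have h4 : (arboricity G + β) * (i + 2) ≤ (arboricity G + β) * (R.delay S + 2) :=
    mul_le_mul_of_nonneg_left (by linarith) (by positivity)
  have h5 : (0 : ℝ) ≤ β * (i + 2) := by positivity
  have h6 : (0 : ℝ) ≤ (arboricity G - 1) * (i + 2) := mul_nonneg (by linarith) (by positivity)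
  have h7 : (0 : ℝ) ≤ arboricity G * i := by positivity
  push_cast at h1 h3
  linarith

theorem hops_support {u v : Fin n} (p : G.Walk u v) : hops (p.support.map Fin.val) = p.length := by
  simp [hops]

/-- Both time and stretch come from the stopping rule: the number of rounds is at most the delay,
and a pivot met before the other endpoint is at most as far away as that endpoint. -/
theorem query_spec (hw : ∀ e ∈ G.edgeSet, 0 ≤ w e) (hG : 1 ≤ arboricity G) {k : ℕ} (hk : 1 ≤ k)
    {S : Finset (Fin n)} {ind : Fin n → ℕ} (hO : OracleFor G w S k b β M ind) (u v : Fin n)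
    (Ru : SearchRun G w u b β) (Rv : SearchRun G w v b β) :
    WP 𝓜 queryProg (start u v) (fun t s' =>
      CorrectAnswer G w (6 * k - 1) u v s'.out (s'.reals 0 0) ∧
      (t : ℝ) ≤ 10000 * ((arboricity G + β) * (Rv.delay S + Ru.delay S + 4)) +
        10000 * hops s'.out) := by
  have hk1 : (1 : ℝ) ≤ k := by exact_mod_cast hk
  have hα : (0 : ℝ) ≤ 6 * k - 1 := by linarith
  have hα1 : (1 : ℝ) ≤ 6 * k - 1 := by linarith
  have hOl := hO.length
  have F : TableFits G w b M := ⟨hO.small, by omega, by omega⟩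
  have hm0 := F.lt_of_le (x := 0) (by omega)
  have hm1 := F.lt_of_le (x := 1) (by omega)
  have hmv : ∀ x : Fin n, (x : ℕ) % 2 ^ (env b G w M).wordBits = x := fun x =>
    F.lt_of_le (by omega)
  have hyv : (0 : ℝ) ≤ 8100 * ((arboricity G + β) * (Rv.delay S + 2)) := by positivity
  have hyu : (0 : ℝ) ≤ 8100 * ((arboricity G + β) * (Ru.delay S + 2)) := by positivity
  have hfin : ∀ {t t₁ t₂ l : ℕ}, (t₁ : ℝ) ≤ 8100 * ((arboricity G + β) * (Rv.delay S + 2)) →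
      (t₂ : ℝ) ≤ 8100 * ((arboricity G + β) * (Ru.delay S + 2)) →
      t ≤ t₁ + t₂ + 1000 * l + 1000 →
      (t : ℝ) ≤ 10000 * ((arboricity G + β) * (Rv.delay S + Ru.delay S + 4)) + 10000 * l := by
    intro t t₁ t₂ l h1 h2 h3
    have h4 : (t : ℝ) ≤ t₁ + t₂ + 1000 * l + 1000 := by exact_mod_cast h3
    have h5 : 1 * 4 ≤ (arboricity G + β) * (Rv.delay S + Ru.delay S + 4) :=
      mul_le_mul (by have := Nat.cast_nonneg (α := ℝ) β; linarith)
        (le_add_of_nonneg_left (by positivity)) (by norm_num) (by positivity)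
    have h6 : (0 : ℝ) ≤ l := Nat.cast_nonneg l
    nlinarith
  have hnil : ¬ G.Reachable u v → ∀ δ, CorrectAnswer G w (6 * k - 1) u v [] δ := fun h δ =>
    ⟨fun h' => absurd h' h, fun _ => rfl⟩
  have hsu : arr 𝓜 (start u v) 0 0 = u := by simp [arr, start, hmv]
  have hsv : arr 𝓜 (start u v) 0 1 = v := by simp [arr, start, hmv]
  unfold queryProg
  rw [WP_seq]
  refine search_spec F hO.ranks hO.mark (by omega) Rv hm1 hm0 hsv hsu ?_ ?_
  · intro a; exact ⟨by simp [start, blockName], rfl⟩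
  intro t₁ i s₁ hoff₁ hst₁ ht₁
  replace ht₁ := Rv.cost_le hG hst₁.le (fun l hl => (hst₁.before l hl).2) ht₁
  have ho₁ : s₁.out = [] := hoff₁.2
  have hr₁ : s₁.reals 0 0 = 0 := by
    rw [(hoff₁.arr_eq (E := 𝓜) (a := 0) (by simp)).2.1]; rfl
  have h0₁ : arr 𝓜 s₁ 0 = arr 𝓜 (start u v) 0 := (hoff₁.arr_eq (by simp)).2.2
  rw [WP_branch]
  refine ⟨fun hb => ?_, fun hb => ?_⟩
  · simp only [holds_weq, eval_cell, eval_lit, Nat.zero_mod, hm1] at hb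
    rw [WP_skip, ho₁]
    refine ⟨hnil (fun h => hst₁.not_reachable hb h.symm) _,
      hfin (t₂ := 0) (l := 0) ht₁ (by simpa using hyu) ?_⟩
    simp
  simp only [holds_weq, eval_cell, eval_lit, Nat.zero_mod, hm1] at hb
  have hi := hst₁.index_le hb
  have hlast₁ : arr 𝓜 s₁ 7 0 = Rv.x i := hst₁.last hi
  have hmem₁ := hst₁.mem hi
  simp only [WP_seq, WP_setW]
  rw [eval_lit, eval_cell, eval_lit, hm0, hlast₁]
  generalize hs₂ : State.setW s₁ _ _ _ = s₂
  have hf₂ : Frame 𝓜 [27] s₁ s₂ := by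
    intro a ha
    simp only [List.mem_cons, List.not_mem_nil, or_false] at ha
    rw [← hs₂]; simp [arr_setW, ha]
  have h27 : arr 𝓜 s₂ 27 0 = Rv.x i := by rw [← hs₂]; simp [arr_setW, hmv]
  have her : s₂.reals = s₁.reals ∧ s₂.out = s₁.out := by rw [← hs₂]; exact ⟨rfl, rfl⟩
  have h0₂ : arr 𝓜 s₂ 0 = arr 𝓜 (start u v) 0 := by rw [hf₂ 0 (by simp), h0₁]
  have hst₂ : Stopped Rv S u 𝓜 1 i s₂ := hst₁.congr
    ⟨hf₂ _ (by simp), hf₂ _ (by simp), hf₂ _ (by simp)⟩ (by rw [her.1])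
  rw [WP_branch]
  refine ⟨fun hb2 => ?_, fun hb2 => ?_⟩
  · simp only [holds_weq, eval_cell, eval_lit, Nat.zero_mod, h27, h0₂, hsu, Fin.val_inj] at hb2
    simp only [WP_seq, WP_setW, WP_emit]
    rw [eval_lit, eval_cell, eval_lit, hm0, h27]
    generalize hs₃ : State.setW s₂ _ _ _ = s₃
    have hf₃ : Frame 𝓜 [3] s₂ s₃ := by
      intro a ha
      simp only [List.mem_cons, List.not_mem_nil, or_false] at ha
      rw [← hs₃]; simp [arr_setW, ha]
    have h3 : arr 𝓜 s₃ 3 0 = Rv.x i := by rw [← hs₃]; simp [arr_setW, hmv]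
    have her₃ : s₃.reals = s₁.reals ∧ s₃.out = s₁.out := by rw [← hs₃]; exact her
    refine tail_spec (j := 1) (r := v) (x := Rv.x i) (D := Rv.D i) (by have := F.order; omega) (by omega)
      hm1 ?_ ?_ (by rw [arr_mk]; exact h3) hmem₁ ?_
    · have := hst₂.tree hi
      rw [← hf₃ _ (by simp), her.1, ← her₃.1] at this
      exact this
    · rw [arr_mk, hf₃ 0 (by simp), h0₂, hsv]
    · intro s' t c hc ho hr ht
      have hex := hst₁.exact hi (Rv.x i) hmem₁
      obtain rfl := hb2
      have hπ : s'.out = c.support.map Fin.val := by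
        rw [ho, eval_cell, eval_lit, hm0, h3, her₃.2, ho₁]
        conv_rhs => rw [← c.cons_tail_support]
        rfl
      refine ⟨correctAnswer_of_walk hα c (fun q => ?_) hπ ?_, ?_⟩
      · have h1 := hex q.reverse
        rw [walkWeight_reverse] at h1
        have h2 := walkWeight_nonneg hw q
        rw [hc]
        show s₃.reals 1 _ ≤ _
        rw [her₃.1]
        nlinarith
      · rw [hr]
        show s₃.reals 0 0 + _ = _
        rw [her₃.1, hr₁, zero_add]
      · rw [hπ, hops_support]
        refine hfin (t₂ := 0) ht₁ (by simpa using hyu) ?_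
        simp; omega
  simp only [holds_weq, eval_cell, eval_lit, Nat.zero_mod, h27, h0₂, hsu, Fin.val_inj] at hb2
  have hpv : Rv.x i ∈ S := (hst₁.found hi).resolve_left hb2
  have hfar₁ := hst₁.far hi (Rv.x i) hmem₁ u (hst₁.not_mem hi hb2)
  rw [WP_seq]
  refine search_spec F hO.ranks hO.mark (by omega) Ru hm0 hm1 (by rw [h0₂, hsu])
    (by rw [h0₂, hsv]) ?_ ?_
  · intro a
    have h1 := hoff₁.arr_eq (E := 𝓜) (a := blockName 2 a) (by simp only [blockName]; omega)
    have h2 : blockName 2 a ≠ 27 := by simp only [blockName]; omega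
    refine ⟨?_, by rw [her.1, h1.2.1]; rfl⟩
    rw [← hs₂]
    simp only [State.setW, Function.update_of_ne h2, h1.1]
    simp [start, blockName]
  intro t₂ i' s₃ hoff₃ hst₃ ht₂
  replace ht₂ := Ru.cost_le hG hst₃.le (fun l hl => (hst₃.before l hl).2) ht₂
  have ho₃ : s₃.out = [] := by rw [hoff₃.2, her.2, ho₁]
  have hr₃ : s₃.reals 0 0 = 0 := by
    rw [(hoff₃.arr_eq (E := 𝓜) (a := 0) (by simp)).2.1, her.1, hr₁]
  have h0₃ : arr 𝓜 s₃ 0 = arr 𝓜 (start u v) 0 := by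
    rw [(hoff₃.arr_eq (a := 0) (by simp)).2.2, h0₂]
  have h27₃ : arr 𝓜 s₃ 27 0 = Rv.x i := by
    rw [(hoff₃.arr_eq (a := 27) (by simp)).2.2, h27]
  have hst₁₃ : Stopped Rv S u 𝓜 1 i s₃ := hst₂.congr
    ⟨(hoff₃.arr_eq (by simp)).2.2, (hoff₃.arr_eq (by simp)).2.2, (hoff₃.arr_eq (by simp)).2.2⟩
    (hoff₃.arr_eq (E := 𝓜) (by simp)).2.1
  rw [WP_branch]
  refine ⟨fun hb3 => ?_, fun hb3 => ?_⟩
  · simp only [holds_weq, eval_cell, eval_lit, Nat.zero_mod, hm1] at hb3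
    rw [WP_skip, ho₃]
    refine ⟨hnil (fun h => hst₃.not_reachable hb3 h) _, hfin (l := 0) ht₁ ht₂ ?_⟩
    simp
    omega
  simp only [holds_weq, eval_cell, eval_lit, Nat.zero_mod, hm1] at hb3
  have hi' := hst₃.index_le hb3
  have hlast₃ : arr 𝓜 s₃ 8 0 = Ru.x i' := hst₃.last hi'
  have hmem₃ := hst₃.mem hi'
  simp only [WP_seq, WP_setW]
  rw [eval_lit, eval_cell, eval_lit, hm0, hlast₃]
  generalize hs₄ : State.setW s₃ _ _ _ = s₄
  have hf₄ : Frame 𝓜 [3] s₃ s₄ := by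
    intro a ha
    simp only [List.mem_cons, List.not_mem_nil, or_false] at ha
    rw [← hs₄]; simp [arr_setW, ha]
  have h3 : arr 𝓜 s₄ 3 0 = Ru.x i' := by rw [← hs₄]; simp [arr_setW, hmv]
  have her₄ : s₄.reals = s₃.reals ∧ s₄.out = s₃.out := by rw [← hs₄]; exact ⟨rfl, rfl⟩
  have h0₄ : arr 𝓜 s₄ 0 = arr 𝓜 (start u v) 0 := by rw [hf₄ 0 (by simp), h0₃]
  have hst₄ : Stopped Ru S v 𝓜 2 i' s₄ := hst₃.congr
    ⟨hf₄ _ (by simp), hf₄ _ (by simp), hf₄ _ (by simp)⟩ (by rw [her₄.1])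
  have hst₁₄ : Stopped Rv S u 𝓜 1 i s₄ := hst₁₃.congr
    ⟨hf₄ _ (by simp), hf₄ _ (by simp), hf₄ _ (by simp)⟩ (by rw [her₄.1])
  have h2n : 2 * n ≤ 2 ^ (env b G w M).wordBits := by have := F.order; omega
  rw [WP_branch]
  refine ⟨fun hb4 => ?_, fun hb4 => ?_⟩
  · simp only [holds_weq, eval_cell, eval_lit, Nat.zero_mod, hm1, h3, h0₄, hsv, Fin.val_inj] at hb4
    refine head_spec (r := u) h2n (by omega) hm0 (hst₄.tree hi') (by rw [h0₄, hsu]) h3 hmem₃ ?_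
    intro s' t c hc ho hr _ _ ht
    have hex := hst₄.exact hi' (Ru.x i') hmem₃
    obtain rfl := hb4
    have hπ : s'.out = c.support.map Fin.val := by rw [ho, her₄.2, ho₃, List.nil_append]
    refine ⟨correctAnswer_of_walk hα c (fun q => ?_) hπ hr, ?_⟩
    · have h1 := hex q
      have h2 := walkWeight_nonneg hw q
      rw [hc]
      nlinarith
    · rw [hπ, hops_support]
      refine hfin ht₁ ht₂ ?_
      simp; omega
  simp only [holds_weq, eval_cell, eval_lit, Nat.zero_mod, hm1, h3, h0₄, hsv, Fin.val_inj] at hb4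
  have hpu : Ru.x i' ∈ S := (hst₃.found hi').resolve_left hb4
  have hfar₃ := hst₄.far hi' (Ru.x i') hmem₃ v (hst₃.not_mem hi' hb4)
  have hreach : G.Reachable u v → G.Reachable (Ru.x i') (Rv.x i) := fun h =>
    ((Ru.reachable hi').symm.trans h).trans (Rv.reachable hi)
  have hMl : 3 * n + S.card * S.card + 2 < 2 ^ (env b G w M).wordBits := by omega
  rw [WP_seq]
  unfold loadProg
  rw [WP_setW, load_eval F hMl hO.size hO.mark hO.ind_lt hpu hpv h3
    (by rw [hf₄ 27 (by simp), h27₃])]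
  rw [eval_lit, hm0]
  have hme := F.getD_mod (2 + 3 * n + (ind (Ru.x i') * S.card + ind (Rv.x i)))
  generalize hs₅ : State.setW s₄ _ _ _ = s₅
  have hf₅ : Frame 𝓜 [24] s₄ s₅ := by
    intro a ha
    simp only [List.mem_cons, List.not_mem_nil, or_false] at ha
    rw [← hs₅]; simp [arr_setW, ha]
  have h24 : arr 𝓜 s₅ 24 0 = M.getD (2 + 3 * n + (ind (Ru.x i') * S.card + ind (Rv.x i))) 0 := by
    rw [← hs₅]; simp only [arr_setW, if_true, Function.update_self, hme]
  have her₅ : s₅.reals = s₄.reals ∧ s₅.out = s₄.out := by rw [← hs₅]; exact ⟨rfl, rfl⟩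
  rw [WP_branch]
  -- Both searches may stop at pivots although the endpoints lie in different components. A zero in
  -- the matrix reveals this case.
  refine ⟨fun hb5 => ?_, fun hb5 => ?_⟩
  · simp only [holds_weq, eval_cell, eval_lit, Nat.zero_mod, h24] at hb5
    rw [WP_skip, her₅.2, her₄.2, ho₃]
    refine ⟨hnil (fun h => (hO.route _ hpu _ hpv (hreach h)).1 hb5) _, hfin (l := 0) ht₁ ht₂ ?_⟩
    simp [vertexEntry]
    omega
  simp only [holds_weq, eval_cell, eval_lit, Nat.zero_mod, h24] at hb5
  have hre : G.Reachable (Ru.x i') (Rv.x i) := by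
    by_contra h
    exact hb5 (hO.unreachable _ hpu _ hpv h)
  obtain ⟨-, W, hW, hWd⟩ := hO.route _ hpu _ hpv hre
  have hst₅ : Stopped Ru S v 𝓜 2 i' s₅ := hst₄.congr
    ⟨hf₅ _ (by simp), hf₅ _ (by simp), hf₅ _ (by simp)⟩ (by rw [her₅.1])
  rw [WP_seq]
  refine head_spec (r := u) h2n (by omega) hm0 (hst₅.tree hi')
    (by rw [hf₅ 0 (by simp), h0₄, hsu]) (by rw [hf₅ 3 (by simp), h3]) hmem₃ ?_
  intro s₆ t₆ c hc ho₆ hr₆ hrf₆ hf₆ ht₆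
  rw [WP_seq]
  refine middle_spec F hMl hO.size hO.mark hO.ind_lt hpv hW
    (by rw [hf₆ 3 (by simp), hf₅ 3 (by simp), h3])
    (by rw [hf₆ 27 (by simp), hf₅ 27 (by simp), hf₄ 27 (by simp), h27₃]) ?_
  intro s₇ t₇ p hp h3₇ ho₇ hr₇ hrf₇ hf₇ ht₇
  have hre7 : s₇.reals 1 = s₄.reals 1 := by
    rw [hrf₇ 1 (by simp), hrf₆ 1 (by simp), her₅.1]
  have htree : Tree G w v (arr 𝓜 s₇ (15 + 1)) (s₇.reals 1) (Rv.D i) := by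
    rw [hf₇ _ (by simp), hf₆ _ (by simp), hf₅ _ (by simp), hre7]
    exact hst₁₄.tree hi
  refine tail_spec (r := v) (by omega) (by omega) hm1 htree
    (by rw [hf₇ 0 (by simp), hf₆ 0 (by simp), hf₅ 0 (by simp), h0₄, hsv]) h3₇ hmem₁ ?_
  intro s₈ t₈ q hq ho₈ hr₈ ht₈
  have hπ : s₈.out = ((c.append p).append q).support.map Fin.val := by
    rw [ho₈, ho₇, ho₆, her₅.2, her₄.2, ho₃, SimpleGraph.Walk.support_append,
      SimpleGraph.Walk.support_append]
    simp
  refine ⟨correctAnswer_of_walk hα _ (fun z => ?_) hπ ?_, ?_⟩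
  · have h1 := hfar₁ z.reverse
    have h2 := hfar₃ z
    rw [walkWeight_reverse] at h1
    rw [hre7, her₄.1, (hoff₃.arr_eq (E := 𝓜) (by simp)).2.1, her.1] at hq
    rw [her₅.1] at hc
    -- Going back from the first pivot to `u`, along `z` to `v` and on to the second pivot shows
    -- that the pivots have distance at most three times the weight of `z`. The total is then at
    -- most 1 + 3(2k-1) + 1 = 6k - 1 times this weight.
    have h4 := wdist_le hw ((c.reverse.append z).append q.reverse)
    simp only [walkWeight_append, walkWeight_reverse] at h4 ⊢
    rw [hp]
    have h5 : (0 : ℝ) ≤ 2 * k - 1 := by linarith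
    have h6 : (2 * k - 1 : ℝ) * wdist G w (Ru.x i') (Rv.x i) ≤ (2 * k - 1) * (3 * walkWeight w z) :=
      mul_le_mul_of_nonneg_left (by linarith) h5
    linarith
  · rw [hr₈, hr₇, hr₆]; simp
  · rw [hπ, hops_support]
    refine hfin ht₁ ht₂ ?_
    simp [vertexEntry]
    omega

end Answer

/-! ### Construction of the oracle -/

section Table

variable {n : ℕ} {G H : SimpleGraph (Fin n)} {w : Sym2 (Fin n) → ℝ} {b β : ℕ} {M : List ℕ}

/-- Following `hop` leads from the given vertex to `c` along a walk of `H` of the given weight. -/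
inductive Hops (H : SimpleGraph (Fin n)) (w : Sym2 (Fin n) → ℝ) (hop : Fin n → Fin n) (c : Fin n) :
    Fin n → ℝ → Prop
  | done : Hops H w hop c c 0
  | step {a : Fin n} {W : ℝ} : a ≠ c → H.Adj a (hop a) → Hops H w hop c (hop a) W →
      Hops H w hop c a (w s(a, hop a) + W)

theorem Tree.hops {c : Fin n} {par : ℕ → ℕ} {dist : ℕ → ℝ} {D : List (Fin n)}
    (h : Tree G w c par dist D) {hop : Fin n → Fin n}
    (hhop : ∀ x y : Fin n, par x = y → hop x = y) {x : Fin n} (hx : x ∈ D) :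
    Hops G w hop c x (dist x) := by
  induction h generalizing x with
  | nil => simp at hx
  | one h =>
    obtain rfl : x = c := by simpa using hx
    rw [h]; exact .done
  | @cons x' y D ht hx' hy hp ha ed ih =>
    rcases List.mem_cons.1 hx with rfl | hx
    · obtain rfl := hhop _ _ hp
      rw [ed, Sym2.eq_swap, add_comm]
      exact .step (fun e => hx' (e ▸ ht.root_mem (List.ne_nil_of_mem hy))) ha.symm (ih hy)
    · exact ih hx

/-- A complete run of the verified search from `c` supplies a tree of shortest paths, and the
parents in it are the hops. One function serves all starting points, so for every target it suffices
to store one next hop per vertex. -/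
theorem exists_hops (h : Suits G w b β) (c : Fin n) : ∃ hop : Fin n → Fin n, ∀ a,
    ∀ p : G.Walk a c, ∃ W ≤ walkWeight w p, Hops G w hop c a W := by
  obtain ⟨R⟩ := exists_searchRun h c
  have hD := R.dinv R.m le_rfl
  refine ⟨fun x => if hx : _ < n then ⟨arr (env b G w []) (R.st R.m) 5 x, hx⟩ else x,
    fun a p => ?_⟩
  have ha : a ∈ R.D R.m := (R.mem_D le_rfl _).2 (R.exists_x ⟨p.reverse⟩)
  refine ⟨_, ?_, hD.tree.hops (fun x y e => ?_) ha⟩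
  · rw [← walkWeight_reverse]
    exact hD.exact a ha p.reverse
  · simp [e]

theorem Hops.reachable {hop : Fin n → Fin n} {c a : Fin n} {W : ℝ} (h : Hops G w hop c a W) :
    G.Reachable a c := by
  induction h with
  | done => rfl
  | step _ ha _ ih => exact ha.reachable.trans ih

theorem reachable_of_adj (h : ∀ a c, H.Adj a c → G.Reachable a c) {a c : Fin n}
    (hr : H.Reachable a c) : G.Reachable a c := by
  obtain ⟨p⟩ := hr
  induction p with
  | nil => rfl
  | cons ha _ ih => exact (h _ _ ha).trans ih

/-- Each edge that the hops traverse is replaced by its stored path of `G`, which is no heavier than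
the edge. -/
theorem Hops.midRoute {m : ℕ} {ind : Fin n → ℕ} {S : Finset (Fin n)} {c : Fin n}
    {hop : Fin n → Fin n} {d : Sym2 (Fin n) → ℝ}
    (hS : ∀ a a', H.Adj a a' → a ∈ S)
    (he : ∀ a, H.Reachable a c → H.Adj a (hop a) → ∃ e, ∃ p : G.Walk a (hop a),
      M.getD (2 + 3 * n + (ind a * m + ind c)) 0 = e ∧ e < M.length ∧ LegAt G w M e p ∧
      walkWeight w p ≤ d s(a, hop a)) {a : Fin n} {W : ℝ} (h : Hops H d hop c a W) :
    ∃ W' ≤ W, MidRoute G w M m ind S c a W' := by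
  induction h with
  | done => exact ⟨0, le_rfl, .done⟩
  | step hac ha hr ih =>
    obtain ⟨W', h1, h2⟩ := ih
    obtain ⟨e, p, h3, h4, h5, h6⟩ := he _ (ha.reachable.trans hr.reachable) ha
    exact ⟨_, add_le_add h6 h1, .step p (hS _ _ ha) hac ha.ne h3 h4 h5 h2⟩

theorem exists_offsets {ι : Type} (rec : ι → List ℕ) (l : List ι) : ∃ off : ι → ℕ, ∀ q ∈ l,
    ∀ i < (rec q).length, off q + i < (l.map rec).flatten.length ∧
      (l.map rec).flatten.getD (off q + i) 0 = (rec q).getD i 0 := by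
  classical
  induction l with
  | nil => exact ⟨fun _ => 0, by simp⟩
  | cons a l ih =>
    obtain ⟨off, h⟩ := ih
    refine ⟨fun q => if q = a then 0 else (rec a).length + off q, fun q hq i hi => ?_⟩
    rw [List.map_cons, List.flatten_cons]
    beta_reduce
    by_cases hqa : q = a
    · subst hqa
      rw [if_pos rfl, zero_add, List.length_append, List.getD_append _ _ _ _ hi]
      exact ⟨by omega, rfl⟩
    · have h1 := h q ((List.mem_cons.1 hq).resolve_left hqa) i hi
      rw [if_neg hqa, List.length_append, List.getD_append_right _ _ _ _ (by omega)]
      exact ⟨by omega, by rw [← h1.2]; congr 1; omega⟩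

theorem routeCode_suffix {br : Fin n → Prop} {a c : Fin n} {p : G.Walk a c} {i : ℕ}
    (hi : i ≤ p.length) : ∃ pre, routeCode w br p 0 = pre ++ routeCode w br p i := by
  induction i with
  | zero => exact ⟨[], rfl⟩
  | succ i ih =>
    obtain ⟨pre, h⟩ := ih (by omega)
    by_cases hb : br (p.getVert i)
    · rw [routeCode_of_branch (by omega) hb] at h
      exact ⟨pre ++ [nbrIndex G w (p.getVert i) (p.getVert (i + 1))], by rw [h]; simp⟩
    · rw [routeCode_of_not_branch (by omega) hb] at h
      exact ⟨pre, h⟩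

/-- A position in the record is consumed at branch vertices only. So the position at the i-th vertex
is the start of the code plus the length of the part that is already consumed, and the rest of the
code is a suffix. -/
theorem legAt_of_record {ι : Type} [Fintype ι] {src tgt : ι → Fin n}
    {P : ∀ q, G.Walk (src q) (tgt q)} {S : Finset (Fin n)} {q : ι} {e : ℕ}
    (hP : ∀ q, (P q).IsPath) (hS : src q ∈ S) {y z : Fin n → Fin n}
    (hyz : ∀ x, ¬ IsBranch P S x → ∀ q i, i + 1 < (P q).length → (P q).getVert (i + 1) = x →
      (G.Adj x (y x) ∧ G.Adj x (z x)) ∧ y x ≠ z x ∧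
        ((P q).getVert i = y x ∧ (P q).getVert (i + 2) = z x ∨
          (P q).getVert i = z x ∧ (P q).getVert (i + 2) = y x))
    (h0 : ∀ x, IsBranch P S x → M.getD (2 + (n + x)) 0 = 0)
    (h1 : ∀ x, ¬ IsBranch P S x → M.getD (2 + (n + x)) 0 = nbrIndex G w x (y x) + 1)
    (h2 : ∀ x, ¬ IsBranch P S x → M.getD (2 + (2 * n + x)) 0 = nbrIndex G w x (z x) + 1)
    (hr : ∀ i < ((tgt q : ℕ) :: routeCode w (IsBranch P S) (P q) 0).length, e + i < M.length ∧
      M.getD (e + i) 0 = ((tgt q : ℕ) :: routeCode w (IsBranch P S) (P q) 0).getD i 0) :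
    LegAt G w M e (P q) := by
  refine ⟨hP q, by simpa using (hr 0 (by simp)).2, fun i => e + 1 +
    ((routeCode w (IsBranch P S) (P q) 0).length - (routeCode w (IsBranch P S) (P q) i).length),
    by simp, fun i hi => ?_⟩
  obtain ⟨pre, hpre⟩ := routeCode_suffix (w := w) (br := IsBranch P S) hi.le
  beta_reduce
  by_cases hb : IsBranch P S ((P q).getVert i)
  · left
    rw [routeCode_of_branch hi hb] at hpre ⊢
    have h3 := hr (pre.length + 1) (by simp [hpre])
    rw [List.getD_cons_succ, hpre, List.getD_append_right _ _ _ _ le_rfl, Nat.sub_self,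
      List.getD_cons_zero] at h3
    have h4 : e + 1 + ((routeCode w (IsBranch P S) (P q) 0).length -
        (nbrIndex G w ((P q).getVert i) ((P q).getVert (i + 1)) ::
          routeCode w (IsBranch P S) (P q) (i + 1)).length) = e + (pre.length + 1) := by
      rw [hpre, List.length_append]; omega
    rw [h4]
    refine ⟨h0 _ hb, ?_, h3.1, h3.2⟩
    rw [hpre, List.length_append, List.length_cons]
    omega
  · right
    rw [routeCode_of_not_branch hi hb]
    refine ⟨rfl, ?_⟩
    -- The first vertex is a pivot, hence a branch. So every vertex at which the walker relies on
    -- the stored neighbours has a predecessor.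
    rcases i with _ | i
    · exact absurd (.inl (by simpa using hS)) hb
    · obtain ⟨⟨h3, h4⟩, h5, h6⟩ := hyz _ hb q i hi rfl
      refine ⟨i, rfl, ?_⟩
      rw [h1 _ hb, h2 _ hb]
      rcases h6 with ⟨h6, h7⟩ | ⟨h6, h7⟩
      · rw [h6, h7]; exact ⟨h5, h3, .inl ⟨rfl, rfl⟩⟩
      · rw [h6, h7]; exact ⟨h5.symm, h4, .inr ⟨rfl, rfl⟩⟩

theorem nbrIndex_le (x y : Fin n) : nbrIndex G w x y ≤ n :=
  List.idxOf_le_length.trans (length_adjList_le x)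

theorem getD_ofFn_append {m : ℕ} (f : Fin m → ℕ) (l : List ℕ) (i : Fin m) :
    (List.ofFn f ++ l).getD i 0 = f i := by
  rw [List.getD_append _ _ _ _ (by simp)]
  simp

theorem getD_length_append {l l' : List ℕ} {m : ℕ} (h : l.length = m) (i : ℕ) :
    (l ++ l').getD (m + i) 0 = l'.getD i 0 := by
  rw [List.getD_append_right _ _ _ _ (by omega)]
  congr 1; omega

/-- The table consists of β and |S|, three blocks of length n with the indices of the pivots and the
two neighbours at each vertex, the matrix of addresses, and the records. There is one record for
each dart of `H`, since an edge may be used in both directions. Indices and positions are stored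
plus one where 0 has the meaning of a missing entry. -/
theorem exists_table (hw : ∀ e ∈ G.edgeSet, 0 ≤ w e) {S : Finset (Fin n)}
    (hH : ∀ a c, H.Adj a c → a ∈ S ∧ c ∈ S ∧ G.Reachable a c) (hop : Fin n → Fin n → Fin n)
    (β : ℕ) : ∃ (M : List ℕ) (ind : Fin n → ℕ),
      M.length ≤ 2 + 3 * n + S.card * S.card +
        2 * H.edgeSet.ncard * (1 + S.card + 8 * H.edgeSet.ncard) ∧
      (∀ x ∈ M, x ≤ β + n + 1 + M.length) ∧ M.getD 0 0 = β ∧ M.getD 1 0 = S.card ∧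
      (∀ x : Fin n, M.getD (2 + (0 + x)) 0 = if x ∈ S then ind x + 1 else 0) ∧
      (∀ x ∈ S, ind x < S.card) ∧
      ∀ a ∈ S, ∀ c ∈ S,
        (¬ G.Reachable a c → M.getD (2 + 3 * n + (ind a * S.card + ind c)) 0 = 0) ∧
        (G.Reachable a c → M.getD (2 + 3 * n + (ind a * S.card + ind c)) 0 ≠ 0 ∧
          (H.Adj a (hop c a) → ∃ e, ∃ p : G.Walk a (hop c a),
            M.getD (2 + 3 * n + (ind a * S.card + ind c)) 0 = e ∧ e < M.length ∧
            LegAt G w M e p ∧ walkWeight w p ≤ wdist G w a (hop c a))) := by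
  classical
  have hex : ∀ q : H.Dart, ∃ p : G.Walk q.fst q.snd, IsCanon w p := fun q =>
    exists_isCanon hw (hH _ _ q.adj).2.2
  choose P hP using hex
  have hnb : ∀ x, ∃ y z : Fin n, ¬ IsBranch P S x → ∀ q i, i + 1 < (P q).length →
      (P q).getVert (i + 1) = x → (G.Adj x y ∧ G.Adj x z) ∧ y ≠ z ∧
        ((P q).getVert i = y ∧ (P q).getVert (i + 2) = z ∨
          (P q).getVert i = z ∧ (P q).getVert (i + 2) = y) := by
    intro x
    by_cases hx : IsBranch P S x
    · exact ⟨x, x, fun h => absurd hx h⟩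
    · obtain ⟨y, z, h⟩ := exists_neighbours (fun q => (hP q).1) x hx
      exact ⟨y, z, fun _ => h⟩
  choose y z hyz using hnb
  set rec : H.Dart → List ℕ := fun q => (q.snd : ℕ) :: routeCode w (IsBranch P S) (P q) 0 with hrec
  set l : List H.Dart := Finset.univ.toList with hl
  obtain ⟨off, hoff⟩ := exists_offsets rec l
  set ind : Fin n → ℕ := fun x => if h : x ∈ S then (S.equivFin ⟨x, h⟩ : ℕ) else 0 with hind
  set addr : H.Dart → ℕ := fun q => 2 + (n + (n + (n + (S.card * S.card + off q)))) with haddr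
  -- The value 1 stands for pairs in one component without a hop, such as equal pivots; it must only
  -- differ from 0, the sign for different components.
  set entry : Fin n → Fin n → ℕ := fun a c => if G.Reachable a c then
    (if h : H.Adj a (hop c a) then addr ⟨(a, hop c a), h⟩ else 1) else 0 with hentry
  set mark : List ℕ := List.ofFn (fun x : Fin n => if x ∈ S then ind x + 1 else 0) with hmark
  set nb₁ : List ℕ := List.ofFn
    (fun x : Fin n => if IsBranch P S x then 0 else nbrIndex G w x (y x) + 1) with hnb₁
  set nb₂ : List ℕ := List.ofFn (fun x : Fin n => nbrIndex G w x (z x) + 1) with hnb₂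
  set mat : List ℕ := List.ofFn (fun q : Fin (S.card * S.card) =>
    entry (S.equivFin.symm (finProdFinEquiv.symm q).1) (S.equivFin.symm (finProdFinEquiv.symm q).2))
    with hmat
  set F : List ℕ := (l.map rec).flatten with hF
  set M : List ℕ := [β, S.card] ++ (mark ++ (nb₁ ++ (nb₂ ++ (mat ++ F)))) with hM
  have hlen : M.length = 2 + (n + (n + (n + (S.card * S.card + F.length)))) := by
    simp [hM, hmark, hnb₁, hnb₂, hmat]; omega
  have hF1 : ∀ i, M.getD (2 + (n + (n + (n + (S.card * S.card + i))))) 0 = F.getD i 0 := by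
    intro i
    rw [hM, getD_length_append (m := 2) rfl, getD_length_append (by simp [hmark]),
      getD_length_append (by simp [hnb₁]), getD_length_append (by simp [hnb₂]),
      getD_length_append (by simp [hmat])]
  have hind_lt : ∀ x ∈ S, ind x < S.card := by
    intro x hx; simp only [hind, dif_pos hx]; exact Fin.is_lt _
  have hmat1 : ∀ a ∈ S, ∀ c ∈ S, M.getD (2 + 3 * n + (ind a * S.card + ind c)) 0 = entry a c := by
    intro a ha c hc
    have h1 : 2 + 3 * n + (ind a * S.card + ind c) =
        2 + (n + (n + (n + (finProdFinEquiv (S.equivFin ⟨a, ha⟩, S.equivFin ⟨c, hc⟩) :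
          Fin (S.card * S.card))))) := by
      simp only [hind, dif_pos ha, dif_pos hc, finProdFinEquiv_apply_val]
      rw [mul_comm S.card]
      omega
    rw [h1, hM, getD_length_append (m := 2) rfl, getD_length_append (by simp [hmark]),
      getD_length_append (by simp [hnb₁]), getD_length_append (by simp [hnb₂]), hmat,
      getD_ofFn_append, Equiv.symm_apply_apply]
    simp
  -- A record consists of its target and a code of length at most |S| plus four times the number of
  -- darts, that is, eight times the number of edges.
  have hFlen : F.length ≤ 2 * H.edgeSet.ncard * (1 + S.card + 8 * H.edgeSet.ncard) := by
    have h1 : Fintype.card H.Dart = 2 * H.edgeSet.ncard := by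
      rw [SimpleGraph.dart_card_eq_twice_card_edges, ← SimpleGraph.coe_edgeFinset,
        Set.ncard_coe_finset]
    have h2 : l.length = Fintype.card H.Dart := by simp [hl]
    rw [hF, List.length_flatten, List.map_map, ← h1, ← h2]
    have h3 := List.sum_le_card_nsmul (l.map (List.length ∘ rec)) (1 + S.card + 8 * H.edgeSet.ncard)
      (by
        intro x hx
        obtain ⟨q, -, rfl⟩ := List.mem_map.1 hx
        have := length_routeCode_le (S := S) hP q
        simp only [hrec, Function.comp_apply, List.length_cons]
        omega)
    simpa using h3
  have hoffl : ∀ q, off q < F.length := by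
    intro q
    have := (hoff q (by simp [hl]) 0 (by simp [hrec])).1
    simpa using this
  refine ⟨M, ind, by omega, ?_, rfl, rfl, ?_, hind_lt, ?_⟩
  · have hS : S.card ≤ n := by simpa using S.card_le_univ
    have hent : ∀ a c, entry a c ≤ M.length := by
      intro a c
      simp only [hentry]
      split_ifs with h1 h2
      · have := hoffl ⟨(a, hop c a), h2⟩
        simp only [haddr]; omega
      · omega
      · omega
    intro x hx
    simp only [hM, List.mem_append, List.mem_cons, List.not_mem_nil, or_false] at hx
    rcases hx with (rfl | rfl) | hx | hx | hx | hx | hx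
    · omega
    · omega
    · rw [hmark, List.mem_ofFn] at hx
      obtain ⟨v, rfl⟩ := hx
      split_ifs with h
      · have := hind_lt v h; omega
      · omega
    · rw [hnb₁, List.mem_ofFn] at hx
      obtain ⟨v, rfl⟩ := hx
      have := nbrIndex_le (G := G) (w := w) v (y v)
      split_ifs <;> omega
    · rw [hnb₂, List.mem_ofFn] at hx
      obtain ⟨v, rfl⟩ := hx
      have := nbrIndex_le (G := G) (w := w) v (z v)
      omega
    · rw [hmat, List.mem_ofFn] at hx
      obtain ⟨v, rfl⟩ := hx
      exact (hent _ _).trans (by omega)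
    · rw [hF, List.mem_flatten] at hx
      obtain ⟨l', hl', hx⟩ := hx
      obtain ⟨q, -, rfl⟩ := List.mem_map.1 hl'
      simp only [hrec, List.mem_cons, routeCode, List.mem_map] at hx
      rcases hx with rfl | ⟨i, -, rfl⟩
      · have := q.snd.2; omega
      · have := nbrIndex_le (G := G) (w := w) ((P q).getVert i) ((P q).getVert (i + 1))
        omega
  · intro x
    rw [zero_add, hM, getD_length_append (m := 2) rfl, hmark, getD_ofFn_append]
  · intro a ha c hc
    rw [hmat1 a ha c hc]
    refine ⟨fun h => by simp only [hentry, if_neg h], fun h => ⟨?_, fun hadj => ?_⟩⟩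
    · simp only [hentry, if_pos h, haddr]
      split_ifs <;> omega
    · refine ⟨addr ⟨(a, hop c a), hadj⟩, P ⟨(a, hop c a), hadj⟩, ?_, ?_, ?_, ?_⟩
      · simp only [hentry, if_pos h, dif_pos hadj]
      · have := hoffl ⟨(a, hop c a), hadj⟩
        simp only [haddr]; omega
      · refine legAt_of_record (fun q => (hP q).1) ha hyz ?_ ?_ ?_ ?_
        · intro x hx
          rw [hM, getD_length_append (m := 2) rfl, getD_length_append (by simp [hmark]), hnb₁,
            getD_ofFn_append, if_pos hx]
        · intro x hx
          rw [hM, getD_length_append (m := 2) rfl, getD_length_append (by simp [hmark]), hnb₁,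
            getD_ofFn_append, if_neg hx]
        · intro x _
          rw [show 2 + (2 * n + (x : ℕ)) = 2 + (n + (n + x)) by omega, hM, getD_length_append (m := 2) rfl,
            getD_length_append (by simp [hmark]), getD_length_append (by simp [hnb₁]), hnb₂,
            getD_ofFn_append]
        · intro i hi
          obtain ⟨h1, h2⟩ := hoff ⟨(a, hop c a), hadj⟩ (by simp [hl]) i hi
          have h3 : addr ⟨(a, hop c a), hadj⟩ + i = 2 + (n + (n + (n + (S.card * S.card +
            (off ⟨(a, hop c a), hadj⟩ + i))))) := by simp only [haddr]; omega
          rw [h3, hF1]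
          exact ⟨by omega, h2⟩
      · have : Nonempty (G.Walk a (hop c a)) := ⟨P ⟨(a, hop c a), hadj⟩⟩
        exact le_ciInf fun q => (hP ⟨(a, hop c a), hadj⟩).walkWeight_le q

theorem wdist_comm (a c : Fin n) : wdist G w a c = wdist G w c a := by
  unfold wdist
  exact Function.Surjective.iInf_congr SimpleGraph.Walk.reverse
    (fun p => ⟨p.reverse, p.reverse_reverse⟩) fun p => walkWeight_reverse p

theorem wdist_nonneg (hw : ∀ e ∈ G.edgeSet, 0 ≤ w e) (a c : Fin n) : 0 ≤ wdist G w a c :=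
  Real.iInf_nonneg fun p => walkWeight_nonneg hw p

/-- For every set of pivots there is an oracle that is small if the spanner is small. -/
theorem exists_oracle (hs : Suits G w b β) {k t : ℕ} (hk : 1 ≤ k) {S : Finset (Fin n)}
    (ht : S.card ≤ t ^ k)
    (hb : 23 * n + 30 + β + 2 * (S.card * S.card) + 2 * (t * S.card) *
      (1 + S.card + 8 * (t * S.card)) < 2 ^ wordLength b n) :
    ∃ M ind, OracleFor G w S k b β M ind ∧ M.length ≤ 2 + 3 * n + S.card * S.card +
        2 * (t * S.card) * (1 + S.card + 8 * (t * S.card)) := by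
  obtain ⟨⟨β₁, hF⟩, hw, -⟩ := hs
  -- Only pairs in one component are joined: between different components the infimum `wdist` is
  -- taken over no walk and has the value 0.
  obtain ⟨H, hH1, hH2, hH3⟩ := exists_spanner (wdist G w) wdist_comm hk S
    (fun a c => G.Reachable a c) ht (fun a c h => h.symm)
  set d : Sym2 (Fin n) → ℝ := Sym2.lift ⟨wdist G w, wdist_comm⟩ with hd
  -- The spanner, weighted with the distances of `G`, is itself a weighted graph to which the
  -- verified search applies. This gives the next hops in it.
  have hsH : Suits H d b β₁ := by
    have hF' : Fits (env b H d []) n β₁ := ⟨rfl, hF.pos, hF.beta, hF.nodes, hF.word⟩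
    refine ⟨⟨β₁, hF'⟩, fun e _ => ?_, .inr hF'⟩
    induction e with
    | _ a c => exact wdist_nonneg hw a c
  choose hop hhop using exists_hops hsH
  obtain ⟨M, ind, h1, h2, h3, h4, h5, h6, h7⟩ := exists_table hw hH2 hop β
  have hl : M.length ≤ 2 + 3 * n + S.card * S.card +
      2 * (t * S.card) * (1 + S.card + 8 * (t * S.card)) := by
    refine h1.trans (Nat.add_le_add_left ?_ _)
    gcongr
  have hbits : (env b G w M).wordBits = wordLength b n := rfl
  refine ⟨M, ind, ⟨?_, ?_, h3, h4, h5, h6, fun a ha c hc h => (h7 a ha c hc).1 h,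
    fun a ha c hc h => ⟨((h7 a ha c hc).2 h).1, ?_⟩⟩, hl⟩
  · intro x hx
    have := h2 x hx
    rw [hbits]; omega
  · rw [hbits]; omega
  · obtain ⟨p, hp1, hp2⟩ := hH3 a ha c hc h
    obtain ⟨W, hW, hhops⟩ := hhop c a p
    obtain ⟨W', hW', hmr⟩ := Hops.midRoute (G := G) (w := w) (M := M) (m := S.card) (ind := ind)
      (fun a a' h => (hH2 a a' h).1) (fun a' hr hadj => ((h7 a' (hH2 _ _ hadj).1 c hc).2
        (reachable_of_adj (fun x y h => (hH2 x y h).2.2) hr)).2 hadj) hhops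
    · refine ⟨W', hmr, hW'.trans (hW.trans ?_)⟩
      have h8 := List.sum_le_card_nsmul (p.edges.map d) (wdist G w a c) (by
        intro x hx
        obtain ⟨e, he, rfl⟩ := List.mem_map.1 hx
        induction e with
        | _ x y => exact hp2 x y he)
      rw [List.length_map, SimpleGraph.Walk.length_edges, nsmul_eq_mul] at h8
      refine h8.trans (mul_le_mul_of_nonneg_right ?_ (wdist_nonneg hw a c))
      have : (p.length : ℝ) ≤ (2 * k - 1 : ℕ) := by exact_mod_cast hp1
      rw [Nat.cast_sub (by omega)] at this
      simpa using this

end Table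

/-! ### Random pivots -/

section Random

theorem expect_map {α β : Type} (p : PMF α) (g : α → β) (F : β → ℝ≥0∞) :
    expect (p.map g) F = expect p (fun a => F (g a)) := by
  classical
  unfold expect
  simp only [PMF.map_apply, ← ENNReal.tsum_mul_right, ite_mul, zero_mul]
  rw [ENNReal.tsum_comm]
  exact tsum_congr fun a => tsum_ite_eq (g a) _

/-- For a uniform distribution the expectation is an average of finitely many real numbers, so
bounds on sums over all choices of the pivots suffice. -/
theorem expect_uniform {α : Type} [Fintype α] [Nonempty α] {F : α → ℝ≥0∞} {g : α → ℝ} {B : ℝ}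
    (hF : ∀ a, F a ≤ ENNReal.ofReal (g a)) (hg : ∀ a, 0 ≤ g a)
    (hB : ∑ a, g a ≤ B * Fintype.card α) :
    expect (PMF.uniformOfFintype α) F ≤ ENNReal.ofReal B := by
  have hc : (0 : ℝ) < Fintype.card α := by exact_mod_cast Fintype.card_pos
  unfold expect
  rw [tsum_fintype]
  calc ∑ a, PMF.uniformOfFintype α a * F a
      ≤ ∑ a, ENNReal.ofReal ((Fintype.card α : ℝ)⁻¹ * g a) := by
        refine Finset.sum_le_sum fun a _ => ?_
        rw [PMF.uniformOfFintype_apply, ENNReal.ofReal_mul (by positivity),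
          ENNReal.ofReal_inv_of_pos hc, ENNReal.ofReal_natCast]
        exact mul_le_mul_right (hF a) _
    _ = ENNReal.ofReal (∑ a, (Fintype.card α : ℝ)⁻¹ * g a) :=
        (ENNReal.ofReal_sum_of_nonneg fun a _ => mul_nonneg (by positivity) (hg a)).symm
    _ ≤ ENNReal.ofReal B := by
        apply ENNReal.ofReal_le_ofReal
        rw [← Finset.mul_sum, inv_mul_le_iff₀ hc]
        linarith

theorem whp_of_card_le {α : Type} [Fintype α] [Nonempty α] {n c : ℕ} (g : α → List ℕ)
    {S : Set (List ℕ)} (bad : Finset α) (h : ∀ a, a ∉ bad → g a ∈ S)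
    (hb : (bad.card : ℝ) ≤ Fintype.card α * (1 / (n : ℝ) ^ c)) :
    Whp n c ((PMF.uniformOfFintype α).map g) S := by
  classical
  have hc : (0 : ℝ) < Fintype.card α := by exact_mod_cast Fintype.card_pos
  unfold Whp
  rw [PMF.toOuterMeasure_map_apply]
  have h1 : ((badᶜ : Finset α) : Set α) ⊆ g ⁻¹' S := fun a ha => h a (by simpa using ha)
  refine le_trans ?_ (MeasureTheory.measure_mono h1)
  rw [PMF.toOuterMeasure_uniformOfFintype_apply]
  have h2 : Fintype.card ((badᶜ : Finset α) : Set α) = Fintype.card α - bad.card := by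
    rw [← Set.toFinset_card, Finset.toFinset_coe, Finset.card_compl]
  have h3 : (1 - 1 / (n : ℝ) ^ c) ≤ ((Fintype.card α - bad.card : ℕ) : ℝ) / Fintype.card α := by
    rw [le_div_iff₀ hc, Nat.cast_sub bad.card_le_univ]
    linarith
  rw [h2]
  refine (ENNReal.ofReal_le_ofReal h3).trans ?_
  rw [ENNReal.ofReal_div_of_pos hc, ENNReal.ofReal_natCast, ENNReal.ofReal_natCast]

/-- The discrete analogue of integrating x^m: each term satisfies (m+1) i^m ≤ (i+1)^(m+1) - i^(m+1),
and these differences telescope. -/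
theorem succ_mul_sum_pow_le (n m : ℕ) : (m + 1) * ∑ i ∈ Finset.range n, i ^ m ≤ n ^ (m + 1) := by
  have key : ∀ n m : ℕ, n ^ (m + 1) + (m + 1) * n ^ m ≤ (n + 1) ^ (m + 1) := by
    intro n m
    induction m with
    | zero => simp
    | succ m ih =>
      calc n ^ (m + 1 + 1) + (m + 1 + 1) * n ^ (m + 1)
          ≤ (n ^ (m + 1) + (m + 1) * n ^ m) * (n + 1) := by
            have : 0 ≤ (m + 1) * n ^ m := Nat.zero_le _
            rw [show (n ^ (m + 1) + (m + 1) * n ^ m) * (n + 1) =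
              n ^ (m + 1 + 1) + (m + 1 + 1) * n ^ (m + 1) + (m + 1) * n ^ m by ring]
            omega
        _ ≤ (n + 1) ^ (m + 1) * (n + 1) := Nat.mul_le_mul_right _ ih
        _ = _ := by ring
  induction n with
  | zero => simp
  | succ n ih =>
    rw [Finset.sum_range_succ, mul_add]
    have := key n m
    omega

variable {n : ℕ} {G : SimpleGraph (Fin n)} {w : Sym2 (Fin n) → ℝ} {b β : ℕ} {r : Fin n}

/-- The pivots. -/
def pivots {m : ℕ} (f : Fin m → Fin n) : Finset (Fin n) := Finset.univ.image f

-- The first l + 1 discovered vertices are distinct, so each of the m independent choices has n - 1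
-- - l values left.
open Classical in
theorem SearchRun.card_avoid (R : SearchRun G w r b β) (m : ℕ) {l : ℕ} (hl : l ≤ R.m) :
    (Finset.univ.filter (fun f : Fin m → Fin n => ∀ l' ≤ l, R.x l' ∉ pivots f)).card =
      (n - 1 - l) ^ m := by
  have h1 : Finset.univ.filter (fun f : Fin m → Fin n => ∀ l' ≤ l, R.x l' ∉ pivots f) =
      Fintype.piFinset (fun _ : Fin m => ((Finset.range (l + 1)).image R.x)ᶜ) := by
    ext f
    simp only [pivots, Finset.mem_filter, Finset.mem_univ, true_and, Finset.mem_image, not_exists,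
      Fintype.mem_piFinset, Finset.mem_compl, Finset.mem_range, not_and]
    exact ⟨fun h a l' hl' e => h l' (by omega) a e.symm,
      fun h l' hl' a e => h a l' (by omega) e.symm⟩
  rw [h1, Fintype.card_piFinset]
  simp only [Finset.prod_const, Finset.card_univ, Fintype.card_fin]
  rw [Finset.card_compl, Finset.card_image_of_injOn, Finset.card_range, Fintype.card_fin]
  · congr 1; omega
  · intro i hi j hj e
    simp only [Finset.coe_range, Set.mem_Iio] at hi hj
    exact R.x_injOn (show i ≤ R.m by omega) (show j ≤ R.m by omega) e

/-- The delay counts the indices up to which no pivot has been met. Exchanging the two sums turns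
the total delay into a sum of the powers from `SearchRun.card_avoid`. After division by the n^m
choices, the mean is at most n/(m+1). -/
theorem SearchRun.sum_delay_le (R : SearchRun G w r b β) (m : ℕ) :
    (m + 1) * ∑ f : Fin m → Fin n, R.delay (pivots f) ≤ n ^ (m + 1) := by
  classical
  refine le_trans (Nat.mul_le_mul_left _ ?_) (succ_mul_sum_pow_le n m)
  have h1 : ∀ f : Fin m → Fin n, R.delay (pivots f) = ∑ l ∈ Finset.range (R.m + 1),
      if ∀ l' ≤ l, R.x l' ∉ pivots f then 1 else 0 := by
    intro f
    unfold delay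
    rw [Finset.card_filter]
  simp only [h1]
  rw [Finset.sum_comm, ← Finset.sum_range_reflect (fun i => i ^ m) n]
  refine le_trans (Finset.sum_le_sum (g := fun l => (n - 1 - l) ^ m) fun l hl => ?_)
    (Finset.sum_le_sum_of_subset (Finset.range_mono R.m_lt))
  rw [← Finset.card_filter, ← R.card_avoid m (Nat.lt_succ_iff.1 (Finset.mem_range.1 hl))]

/-- The indices counted by the delay form an initial segment. If `J` were not among them, all of
them would be smaller than `J`, so there would be at most `J`. -/
theorem SearchRun.avoid_of_lt_delay (R : SearchRun G w r b β) {S : Finset (Fin n)} {J : ℕ}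
    (h : J < R.delay S) : J ≤ R.m ∧ ∀ l ≤ J, R.x l ∉ S := by
  classical
  unfold delay at h
  by_contra hcon
  have hsub : (Finset.range (R.m + 1)).filter (fun l => ∀ l' ≤ l, R.x l' ∉ S) ⊆
      Finset.range J := by
    intro l hl
    simp only [Finset.mem_filter, Finset.mem_range] at hl ⊢
    by_contra hJ
    exact hcon ⟨by omega, fun l' hl' => hl.2 l' (by omega)⟩
  have h2 := Finset.card_le_card hsub
  rw [Finset.card_range] at h2
  exact absurd h2 (not_le.2 (by convert h))

open Classical in
/-- Few choices of the pivots delay the search. -/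
theorem SearchRun.card_delayed_le (R : SearchRun G w r b β) {m J c : ℕ} (hn : 1 ≤ n)
    (hJ : (c + 1) * n * Real.log n ≤ (J + 1) * m) :
    ((Finset.univ.filter (fun f : Fin m → Fin n => J < R.delay (pivots f))).card : ℝ) ≤
      (n : ℝ) ^ m * (1 / (n : ℝ) ^ (c + 1)) := by
  have hn0 : (0 : ℝ) < n := by exact_mod_cast hn
  by_cases hJm : J ≤ R.m
  · have h1 : (Finset.univ.filter (fun f : Fin m → Fin n => J < R.delay (pivots f))).card ≤
        (n - 1 - J) ^ m := by
      rw [← R.card_avoid m hJm]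
      refine Finset.card_le_card fun f hf => ?_
      simp only [Finset.mem_filter, Finset.mem_univ, true_and] at hf ⊢
      exact (R.avoid_of_lt_delay hf).2
    have hlt := R.m_lt
    have h2 : ((n - 1 - J : ℕ) : ℝ) = n * (1 - (J + 1) / n) := by
      rw [Nat.sub_sub, Nat.cast_sub (by omega)]
      field_simp
      push_cast
      ring
    have h3 : (1 - (J + 1) / n : ℝ) ≤ Real.exp (-((J + 1) / n)) := by
      have := Real.add_one_le_exp (-((J + 1) / n : ℝ))
      linarith
    have h4 : (0 : ℝ) ≤ 1 - (J + 1) / n := by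
      have : (0 : ℝ) ≤ n * (1 - (J + 1) / n) := by rw [← h2]; positivity
      exact nonneg_of_mul_nonneg_right this hn0
    calc _ ≤ (((n - 1 - J) ^ m : ℕ) : ℝ) := by exact_mod_cast h1
      _ = (n : ℝ) ^ m * (1 - (J + 1) / n) ^ m := by rw [Nat.cast_pow, h2, mul_pow]
      _ ≤ (n : ℝ) ^ m * (1 / (n : ℝ) ^ (c + 1)) := by
        refine mul_le_mul_of_nonneg_left ?_ (by positivity)
        calc (1 - (J + 1) / n : ℝ) ^ m ≤ Real.exp (-((J + 1) / n)) ^ m := pow_le_pow_left₀ h4 h3 m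
          _ = Real.exp (-((J + 1) * m / n)) := by rw [← Real.exp_nat_mul]; congr 1; ring
          _ ≤ Real.exp (-((c + 1 : ℕ) * Real.log n)) := by
            apply Real.exp_le_exp.2
            rw [neg_le_neg_iff, le_div_iff₀ hn0]
            push_cast
            linarith
          _ = 1 / (n : ℝ) ^ (c + 1) := by
            rw [Real.exp_neg, Real.exp_nat_mul, Real.exp_log hn0, one_div]
  · rw [Finset.filter_false_of_mem fun f _ h => hJm (R.avoid_of_lt_delay h).1]
    simp
    positivity

end Random

/-! ### The parameters -/

section Parameters

/-- With N^(2k+2) = n, take m near N^k and t near 2N. Then m² is at most of order N^(2k) ≤ n, the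
product tm is of order N^(k+1) = √n, and n = N^(k+2) N^k, where N^(k+2) is the first factor of the
main term. The factor 2 in t compensates for rounding up m: m ≤ 2N^k ≤ (2N)^k. -/
theorem exists_parameters {n k : ℕ} (hn : 1 ≤ n) (hk : 1 ≤ k) : ∃ m t : ℕ, 1 ≤ m ∧ 1 ≤ t ∧
    m ≤ t ^ k ∧ m * m ≤ 4 * n ∧ t * m * (t * m) ≤ 36 * n ∧
    (n : ℝ) ≤ (n : ℝ) ^ ((1 : ℝ) / 2 + 1 / (2 * (k : ℝ) + 2)) * m := by
  have hn1 : (1 : ℝ) ≤ n := by exact_mod_cast hn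
  have hn0 : (0 : ℝ) < n := by linarith
  have hk0 : (0 : ℝ) < 2 * k + 2 := by positivity
  set N : ℝ := (n : ℝ) ^ (1 / (2 * (k : ℝ) + 2)) with hN
  have hN1 : 1 ≤ N := Real.one_le_rpow hn1 (by positivity)
  have hNn : N ^ (2 * k + 2) = n := by
    rw [hN, ← Real.rpow_natCast, ← Real.rpow_mul hn0.le]
    push_cast
    rw [one_div_mul_cancel hk0.ne', Real.rpow_one]
  have hNk : 1 ≤ N ^ k := one_le_pow₀ hN1
  have hm2 : (⌈N ^ k⌉₊ : ℝ) ≤ 2 * N ^ k := by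
    have := Nat.ceil_lt_add_one (show 0 ≤ N ^ k by positivity)
    linarith
  have ht3 : (⌈2 * N⌉₊ : ℝ) ≤ 3 * N := by
    have := Nat.ceil_lt_add_one (show 0 ≤ 2 * N by positivity)
    linarith
  have hNN : N ^ k * N ^ k * (N * N) = n := by rw [← hNn]; ring
  refine ⟨⌈N ^ k⌉₊, ⌈2 * N⌉₊, ?_, ?_, ?_, ?_, ?_, ?_⟩
  · exact Nat.one_le_ceil_iff.2 (by positivity)
  · exact Nat.one_le_ceil_iff.2 (by positivity)
  · have h1 : (2 * N) ^ k ≤ (⌈2 * N⌉₊ : ℝ) ^ k := pow_le_pow_left₀ (by positivity) (Nat.le_ceil _) _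
    have h2 : (2 : ℝ) * N ^ k ≤ (2 * N) ^ k := by
      rw [mul_pow]
      refine mul_le_mul_of_nonneg_right ?_ (by positivity)
      calc (2 : ℝ) = 2 ^ 1 := by norm_num
        _ ≤ 2 ^ k := pow_le_pow_right₀ (by norm_num) hk
    exact_mod_cast hm2.trans (h2.trans h1)
  · have h1 : (⌈N ^ k⌉₊ : ℝ) * ⌈N ^ k⌉₊ ≤ (2 * N ^ k) * (2 * N ^ k) :=
      mul_self_le_mul_self (by positivity) hm2
    have h2 : N ^ k * N ^ k * 1 ≤ N ^ k * N ^ k * (N * N) :=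
      mul_le_mul_of_nonneg_left (by nlinarith) (by positivity)
    have h3 : (⌈N ^ k⌉₊ : ℝ) * ⌈N ^ k⌉₊ ≤ 4 * n := by linarith
    exact_mod_cast h3
  · have h1 : (⌈2 * N⌉₊ : ℝ) * ⌈N ^ k⌉₊ ≤ 3 * N * (2 * N ^ k) :=
      mul_le_mul ht3 hm2 (by positivity) (by positivity)
    have h2 := mul_self_le_mul_self (by positivity) h1
    have h3 : (⌈2 * N⌉₊ : ℝ) * ⌈N ^ k⌉₊ * (⌈2 * N⌉₊ * ⌈N ^ k⌉₊) ≤ 36 * n := by linarith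
    exact_mod_cast h3
  · have h1 : (n : ℝ) ^ ((1 : ℝ) / 2 + 1 / (2 * (k : ℝ) + 2)) = N ^ (k + 2) := by
      rw [hN, ← Real.rpow_natCast, ← Real.rpow_mul hn0.le]
      congr 1
      push_cast
      field_simp
      ring
    rw [h1]
    calc (n : ℝ) = N ^ (k + 2) * N ^ k := by rw [← hNn]; ring
      _ ≤ _ := mul_le_mul_of_nonneg_left (Nat.le_ceil _) (by positivity)

/-- A number of ranks that suffices for the heap. -/
def ranks (n : ℕ) : ℕ := 4 * Nat.log 2 n + 9

/-- With L the integer part of the binary logarithm of n, at most 2n² + 2n + 2 < 2^(2L+4) heap nodes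
are created, so twice their logarithm plus 3 is at most 4L + 9. This is the origin of the constants
in `ranks`. -/
theorem fits_ranks {n : ℕ} (G : SimpleGraph (Fin n)) (w : Sym2 (Fin n) → ℝ) (hn : 2 ≤ n) :
    Fits (env 20 G w []) n (ranks n) := by
  have h1 : n < 2 ^ (Nat.log 2 n + 1) := Nat.lt_pow_succ_log_self (by norm_num) n
  have h2 : 1 ≤ Nat.log 2 n := Nat.le_log_of_pow_le (by norm_num) (by simpa using hn)
  have h3 : Nat.log 2 n < n := Nat.log_lt_self 2 (by omega)
  refine ⟨rfl, by omega, by unfold ranks; omega, fun fr hfr => ?_, ?_⟩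
  · have h4 : fr < 2 ^ (2 * Nat.log 2 n + 4) := by
      rw [show 2 * Nat.log 2 n + 4 = (Nat.log 2 n + 1) * 2 + 2 by ring, pow_add, pow_mul]
      nlinarith
    have h5 : Nat.log 2 fr < 2 * Nat.log 2 n + 4 := Nat.log_lt_of_lt_pow' (by omega) h4
    unfold ranks; omega
  · show _ ≤ 2 ^ (20 * (Nat.log 2 n + 1))
    have h4 : n + ranks n + 1 ≤ 2 ^ 4 * n := by unfold ranks; omega
    calc 100 * (n + ranks n + 1) ^ 2 ≤ 2 ^ 7 * (2 ^ 4 * 2 ^ (Nat.log 2 n + 1)) ^ 2 := by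
          gcongr
          · norm_num
          · exact h4.trans (Nat.mul_le_mul_left _ h1.le)
      _ = 2 ^ (15 + (Nat.log 2 n + 1) * 2) := by rw [mul_pow, ← pow_mul, ← pow_mul]; ring
      _ ≤ 2 ^ (20 * (Nat.log 2 n + 1)) := Nat.pow_le_pow_right (by norm_num) (by omega)

theorem ranks_le_log {n : ℕ} (hn : 2 ≤ n) : (ranks n : ℝ) ≤ 26 * Real.log n := by
  have h2 : 1 ≤ Nat.log 2 n := Nat.le_log_of_pow_le (by norm_num) (by simpa using hn)
  have h3 : (2 : ℝ) ^ Nat.log 2 n ≤ n := by exact_mod_cast Nat.pow_log_le_self 2 (by omega)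
  have h4 : Nat.log 2 n * Real.log 2 ≤ Real.log n := by
    rw [← Real.log_pow]
    exact Real.log_le_log (by positivity) h3
  have h5 := Real.log_two_gt_d9
  have h6 : (1 : ℝ) ≤ Nat.log 2 n := by exact_mod_cast h2
  unfold ranks
  push_cast
  nlinarith

/-- Every term is dominated by n, by s² or by (ts)², and the parameters make the last two linear in
n as well. -/
theorem parameters_fit {n m t s : ℕ} (hn : 2 ≤ n) (ht : 1 ≤ t) (hs : s ≤ m)
    (hm : m * m ≤ 4 * n) (htm : t * m * (t * m) ≤ 36 * n) :
    2 + 3 * n + s * s + 2 * (t * s) * (1 + s + 8 * (t * s)) ≤ 1000 * n ∧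
    23 * n + 30 + ranks n + 2 * (s * s) + 2 * (t * s) * (1 + s + 8 * (t * s)) <
      2 ^ wordLength 20 n := by
  have h1 : n < 2 ^ (Nat.log 2 n + 1) := Nat.lt_pow_succ_log_self (by norm_num) n
  have h2 : 1 ≤ Nat.log 2 n := Nat.le_log_of_pow_le (by norm_num) (by simpa using hn)
  have h3 : Nat.log 2 n < n := Nat.log_lt_self 2 (by omega)
  have h4 : s * s ≤ 4 * n := (Nat.mul_le_mul hs hs).trans hm
  have h5 : t * s * (t * s) ≤ 36 * n :=
    (Nat.mul_le_mul (Nat.mul_le_mul_left _ hs) (Nat.mul_le_mul_left _ hs)).trans htm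
  have h6 : s ≤ t * s := Nat.le_mul_of_pos_left _ ht
  have h7 : 2 * (t * s) * (1 + s + 8 * (t * s)) ≤ 20 * (t * s * (t * s)) := by
    have h8 := Nat.le_mul_self (t * s)
    have h9 : t * s * s ≤ t * s * (t * s) := Nat.mul_le_mul_left _ h6
    rw [show 2 * (t * s) * (1 + s + 8 * (t * s)) =
      2 * (t * s) + 2 * (t * s * s) + 16 * (t * s * (t * s)) by ring]
    omega
  refine ⟨by omega, ?_⟩
  calc _ < 2 ^ 10 * n := by unfold ranks; omega
    _ ≤ 2 ^ 10 * 2 ^ (Nat.log 2 n + 1) := Nat.mul_le_mul_left _ h1.le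
    _ = 2 ^ (10 + (Nat.log 2 n + 1)) := by rw [pow_add 2 10]
    _ ≤ 2 ^ wordLength 20 n := Nat.pow_le_pow_right (by norm_num) (by unfold wordLength; omega)

end Parameters

/-! ### The query time of the random oracle -/

section Final

/-- Running time and final state of the query program. -/
def answer (E : Env) (u v : ℕ) : ℕ × State :=
  open Classical in if h : ∃ p : ℕ × State, Exec E queryProg (start u v) p.1 p.2 then h.choose
  else (0, start u v)

/-- The machine is deterministic (`Exec.unique`), so the chosen execution is the one about which the
postcondition is known. -/
theorem answer_spec {E : Env} {u v : ℕ} {Q : ℕ → State → Prop}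
    (h : WP E queryProg (start u v) Q) :
    Exec E queryProg (start u v) (answer E u v).1 (answer E u v).2 ∧
      Q (answer E u v).1 (answer E u v).2 := by
  obtain ⟨t, s, h1, h2⟩ := h
  have h3 : ∃ p : ℕ × State, Exec E queryProg (start u v) p.1 p.2 := ⟨(t, s), h1⟩
  have h4 : Exec E queryProg (start u v) (answer E u v).1 (answer E u v).2 := by
    unfold answer
    rw [dif_pos h3]
    exact h3.choose_spec
  obtain ⟨e1, e2⟩ := h1.unique h4
  exact ⟨h4, e1 ▸ e2 ▸ h2⟩

variable {n m β c : ℕ} {G : SimpleGraph (Fin n)} {w : Sym2 (Fin n) → ℝ} {b : ℕ} {Θ lam : ℝ}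
  {table : (Fin m → Fin n) → List ℕ} {T : List ℕ → Fin n → Fin n → ℕ}
  {path : List ℕ → Fin n → Fin n → List ℕ}

/-- Each of the two delays has mean at most Θ, and the constant 4 is at most 4Θ; together this gives
6Θ. The steps proportional to the reported path cancel against the subtracted term. -/
theorem expectedQueryTime_of_delay [Nonempty (Fin n)] (R : ∀ r, SearchRun G w r b β)
    (hm : 1 ≤ m) (hΘ : (n : ℝ) ≤ Θ * m) (hΘ1 : 1 ≤ Θ) (hlam : 0 ≤ lam)
    (hT : ∀ f u v, (T (table f) u v : ℝ) ≤ 10000 * (lam * ((R v).delay (pivots f) +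
      (R u).delay (pivots f) + 4)) + 10000 * hops (path (table f) u v))
    {A B : ℝ} (hA : 10000 ≤ A) (hB : 10000 * (lam * (6 * Θ)) ≤ A * B) :
    ExpectedQueryTime ((PMF.uniformOfFintype (Fin m → Fin n)).map table) T path A B := by
  have hsum : ∀ r, ∑ f : Fin m → Fin n, ((R r).delay (pivots f) : ℝ) ≤
      Θ * Fintype.card (Fin m → Fin n) := by
    intro r
    have h1 : ((m : ℝ) + 1) * ∑ f : Fin m → Fin n, ((R r).delay (pivots f) : ℝ) ≤
        (n : ℝ) ^ (m + 1) := by exact_mod_cast (R r).sum_delay_le m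
    have h2 : (0 : ℝ) ≤ ∑ f : Fin m → Fin n, ((R r).delay (pivots f) : ℝ) :=
      Finset.sum_nonneg fun _ _ => Nat.cast_nonneg _
    have hm0 : (0 : ℝ) < m := by exact_mod_cast hm
    have h3 : (n : ℝ) ^ m * n ≤ (n : ℝ) ^ m * (Θ * m) :=
      mul_le_mul_of_nonneg_left hΘ (by positivity)
    have h4 : (Fintype.card (Fin m → Fin n) : ℝ) = (n : ℝ) ^ m := by simp
    rw [h4]
    refine le_of_mul_le_mul_left ?_ hm0
    rw [pow_succ] at h1
    linarith
  intro u v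
  rw [expect_map]
  refine expect_uniform (g := fun f => 10000 * (lam * ((R v).delay (pivots f) +
      (R u).delay (pivots f) + 4))) (fun f => ENNReal.ofReal_le_ofReal ?_)
      (fun f => by positivity) ?_
  · have h1 := hT f u v
    have h2 := mul_le_mul_of_nonneg_right hA
      (Nat.cast_nonneg (α := ℝ) (hops (path (table f) u v)))
    linarith
  · rw [← Finset.mul_sum, ← Finset.mul_sum, Finset.sum_add_distrib, Finset.sum_add_distrib,
      Finset.sum_const, Finset.card_univ, nsmul_eq_mul]
    have h1 := hsum u
    have h2 := hsum v
    have hc : (0 : ℝ) ≤ Fintype.card (Fin m → Fin n) := Nat.cast_nonneg _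
    have h3 := mul_le_mul_of_nonneg_right hΘ1 hc
    have h4 : lam * (∑ f : Fin m → Fin n, ((R v).delay (pivots f) : ℝ) +
        ∑ f : Fin m → Fin n, ((R u).delay (pivots f) : ℝ) + Fintype.card (Fin m → Fin n) * 4) ≤
        lam * (6 * (Θ * Fintype.card (Fin m → Fin n))) :=
      mul_le_mul_of_nonneg_left (by linarith) hlam
    have h5 := mul_le_mul_of_nonneg_right hB hc
    linarith

/-- A fixed root is delayed by more than (c+1) Θ log n with probability at most n^(-(c+1)). The
union over the n possible roots costs one factor n, and outside of it all queries are fast at the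
same time. -/
theorem whpQueryTime_of_delay [Nonempty (Fin n)] (R : ∀ r, SearchRun G w r b β)
    (hn : 1 ≤ n) (hΘ : (n : ℝ) ≤ Θ * m) (hlam : 0 ≤ lam) (hΘ0 : 0 ≤ Θ)
    (hT : ∀ f u v, (T (table f) u v : ℝ) ≤ 10000 * (lam * ((R v).delay (pivots f) +
      (R u).delay (pivots f) + 4)) + 10000 * hops (path (table f) u v))
    {C B : ℝ} (hC : 10000 ≤ C)
    (hB : 10000 * (lam * (2 * ((c + 1) * Θ * Real.log n) + 4)) ≤ C * B) :
    WhpQueryTime c ((PMF.uniformOfFintype (Fin m → Fin n)).map table) T path C B := by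
  classical
  have hn1 : (1 : ℝ) ≤ n := by exact_mod_cast hn
  have hlog : 0 ≤ Real.log n := Real.log_nonneg hn1
  set J := ⌊(c + 1) * Θ * Real.log n⌋₊ with hJ
  refine whp_of_card_le _ (Finset.univ.biUnion fun r =>
    Finset.univ.filter (fun f => J < (R r).delay (pivots f))) (fun f hf => ?_) ?_
  · simp only [Finset.mem_biUnion, Finset.mem_univ, true_and, Finset.mem_filter, not_exists,
      not_lt] at hf
    have hd : ∀ r, ((R r).delay (pivots f) : ℝ) ≤ (c + 1) * Θ * Real.log n := fun r =>
      (Nat.cast_le.2 (hf r)).trans (Nat.floor_le (by positivity))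
    intro u v
    have h1 := hT f u v
    have h2 := mul_le_mul_of_nonneg_right hC
      (Nat.cast_nonneg (α := ℝ) (hops (path (table f) u v)))
    have h3 : lam * ((R v).delay (pivots f) + (R u).delay (pivots f) + 4) ≤
        lam * (2 * ((c + 1) * Θ * Real.log n) + 4) :=
      mul_le_mul_of_nonneg_left (by linarith [hd u, hd v]) hlam
    linarith
  · have h1 : (c + 1) * n * Real.log n ≤ (J + 1) * m := by
      have h2 := (Nat.lt_floor_add_one ((c + 1) * Θ * Real.log n)).le
      have h3 : (c + 1) * Real.log n * n ≤ (c + 1) * Real.log n * (Θ * m) :=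
        mul_le_mul_of_nonneg_left hΘ (by positivity)
      have h4 := mul_le_mul_of_nonneg_right h2 (Nat.cast_nonneg (α := ℝ) m)
      linarith
    have h2 : ((Finset.univ.biUnion fun r =>
        Finset.univ.filter (fun f : Fin m → Fin n => J < (R r).delay (pivots f))).card : ℝ) ≤
        ∑ _r : Fin n, (n : ℝ) ^ m * (1 / (n : ℝ) ^ (c + 1)) := by
      refine le_trans (Nat.cast_le.2 Finset.card_biUnion_le) ?_
      rw [Nat.cast_sum]
      refine Finset.sum_le_sum fun r _ => ?_
      convert (R r).card_delayed_le hn h1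
    refine h2.trans (le_of_eq ?_)
    rw [Finset.sum_const, Finset.card_univ, nsmul_eq_mul, Fintype.card_fin, Fintype.card_fun,
      Fintype.card_fin, Fintype.card_fin]
    push_cast
    field_simp
    ring

/-- The value β = 1 asks for breadth-first search and is chosen exactly for unit weights; this
removes the logarithm from the unweighted bound. -/
theorem exists_ranks (hn : 2 ≤ n) (hw : ∀ e ∈ G.edgeSet, 0 ≤ w e) : ∃ β, Suits G w 20 β ∧
    β ≤ ranks n ∧ ((∀ e ∈ G.edgeSet, w e = 1) → β = 1) := by
  have hF := fits_ranks G w hn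
  by_cases h : ∀ e ∈ G.edgeSet, w e = 1
  · exact ⟨1, ⟨⟨_, hF⟩, hw, .inl ⟨rfl, h⟩⟩, by unfold ranks; omega, fun _ => rfl⟩
  · exact ⟨_, ⟨⟨_, hF⟩, hw, .inr hF⟩, le_rfl, fun h' => absurd h' h⟩

end Final

end PathOracle

end

/-- There are a query program `Q` and a word length `Θ(log n)` such that for every weighted
undirected graph with at least one edge and every `k ≥ 1` there is a random oracle (a table `M` of
words) with which `Q` always reports walks of stretch `6k - 1`, whose size is `O(n)` whp, and whose
query time is bounded in expectation and whp, with a better bound if all weights are `1`. -/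
theorem theorem2 :
    ∃ (Q : PathOracle.Prog) (b : ℕ) (A : ℝ) (C : ℕ → ℝ),
      ∀ (n k : ℕ) (G : SimpleGraph (Fin n)) (w : Sym2 (Fin n) → ℝ),
        1 ≤ k → G ≠ ⊥ → (∀ e ∈ G.edgeSet, 0 ≤ w e) →
        ∃ (μ : PMF (List ℕ)) (T : List ℕ → Fin n → Fin n → ℕ)
          (path : List ℕ → Fin n → Fin n → List ℕ),
          -- every oracle consists of words and answers every query with stretch `6k - 1`
          (∀ M ∈ μ.support,
            (∀ x ∈ M, x < 2 ^ PathOracle.wordLength b n) ∧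
            ∀ u v : Fin n, ∃ δ : ℝ,
              PathOracle.Answers (PathOracle.env b G w M) Q u v (T M u v) (path M u v) δ ∧
              PathOracle.CorrectAnswer G w (6 * k - 1) u v (path M u v) δ) ∧
          -- size
          (∀ c : ℕ, PathOracle.Whp n c μ {M | (M.length : ℝ) ≤ C c * n}) ∧
          -- query time, weighted graphs
          PathOracle.ExpectedQueryTime μ T path A
            (PathOracle.mainTerm n k * (PathOracle.arboricity G + Real.log n)) ∧
          (∀ c : ℕ, PathOracle.WhpQueryTime c μ T path (C c)
            (PathOracle.mainTerm n k * (PathOracle.arboricity G + Real.log n) * Real.log n)) ∧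
          -- query time, unweighted graphs
          ((∀ e ∈ G.edgeSet, w e = 1) →
            PathOracle.ExpectedQueryTime μ T path A
              (PathOracle.mainTerm n k * PathOracle.arboricity G) ∧
            ∀ c : ℕ, PathOracle.WhpQueryTime c μ T path (C c)
              (PathOracle.mainTerm n k * PathOracle.arboricity G * Real.log n)) := by
  -- The expectation bound needs 10000 · 26 · 6 ≤ 2000000, where 26 bounds the ratio of λ + β to the
  -- factor in the claimed time. In the bound with high probability, c + 5 instead of c + 1 absorbs
  -- the additive constant 4, because Θ log n ≥ 1/2.
  refine ⟨PathOracle.queryProg, 20, 2000000, fun c => 2000000 * (c + 5),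
    fun n k G w hk hG hw => ?_⟩
  obtain ⟨a, e, hae⟩ := SimpleGraph.ne_bot_iff_exists_adj.1 hG
  have hn : 2 ≤ n := by
    have h1 := Fin.val_ne_of_ne hae.ne
    have h2 := a.2
    have h3 := e.2
    omega
  have : Nonempty (Fin n) := ⟨a⟩
  obtain ⟨β, hs, hβ, hβ1⟩ := PathOracle.exists_ranks hn hw
  obtain ⟨m, t, hm, ht, hmt, hmm, htm, hΘm⟩ := PathOracle.exists_parameters (show 1 ≤ n by omega) hk
  have hmain : PathOracle.mainTerm n k =
    (n : ℝ) ^ ((1 : ℝ) / 2 + 1 / (2 * (k : ℝ) + 2)) * k := rfl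
  rw [hmain]
  have hn1 : (1 : ℝ) ≤ n := by exact_mod_cast (show 1 ≤ n by omega)
  have hΘ1 : 1 ≤ (n : ℝ) ^ ((1 : ℝ) / 2 + 1 / (2 * (k : ℝ) + 2)) :=
    Real.one_le_rpow hn1 (by positivity)
  set Θ : ℝ := (n : ℝ) ^ ((1 : ℝ) / 2 + 1 / (2 * (k : ℝ) + 2))
  have hk1 : (1 : ℝ) ≤ k := by exact_mod_cast hk
  have hlam := PathOracle.one_le_arboricity hG
  have hL : 1 / 2 ≤ Real.log n := by
    have h1 : Real.log 2 ≤ Real.log n := Real.log_le_log (by norm_num) (by exact_mod_cast hn)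
    linarith [Real.log_two_gt_d9]
  have hβL : (β : ℝ) ≤ 26 * Real.log n := (Nat.cast_le.2 hβ).trans (PathOracle.ranks_le_log hn)
  have hex : ∀ r, Nonempty (PathOracle.SearchRun G w r 20 β) := PathOracle.exists_searchRun hs
  -- The runs are fixed before the pivots are drawn, so they do not depend on the random choices.
  let R := fun r => (hex r).some
  have hSm : ∀ f : Fin m → Fin n, (PathOracle.pivots f).card ≤ m := fun f =>
    Finset.card_image_le.trans (by simp)
  have hpar := fun f => PathOracle.parameters_fit hn ht (hSm f) hmm htm
  have htab : ∀ f : Fin m → Fin n, ∃ M ind,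
      PathOracle.OracleFor G w (PathOracle.pivots f) k 20 β M ind ∧ M.length ≤ 1000 * n := by
    intro f
    obtain ⟨M, ind, h1, h2⟩ := PathOracle.exists_oracle hs hk ((hSm f).trans hmt)
      (lt_of_le_of_lt (by omega) (hpar f).2)
    exact ⟨M, ind, h1, h2.trans (hpar f).1⟩
  choose table ind hO hlen using htab
  have hans := fun f u v => PathOracle.answer_spec
    (PathOracle.query_spec hw hlam hk (hO f) u v (R u) (R v))
  set T : List ℕ → Fin n → Fin n → ℕ := fun M u v =>
    (PathOracle.answer (PathOracle.env 20 G w M) u v).1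
  set path : List ℕ → Fin n → Fin n → List ℕ := fun M u v =>
    (PathOracle.answer (PathOracle.env 20 G w M) u v).2.out
  have hT : ∀ f u v, (T (table f) u v : ℝ) ≤ 10000 * ((PathOracle.arboricity G + β) *
      ((R v).delay (PathOracle.pivots f) + (R u).delay (PathOracle.pivots f) + 4)) +
      10000 * PathOracle.hops (path (table f) u v) := fun f u v => (hans f u v).2.2
  have hlβ : (0 : ℝ) ≤ PathOracle.arboricity G + β := by positivity
  have hexp : ∀ {lam : ℝ}, PathOracle.arboricity G + β ≤ 26 * lam →
      10000 * ((PathOracle.arboricity G + β) * (6 * Θ)) ≤ 2000000 * (Θ * k * lam) := by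
    intro lam h
    have hl : 0 ≤ lam := by linarith
    have h1 : (PathOracle.arboricity G + β) * (6 * Θ) ≤ 26 * lam * (6 * Θ) :=
      mul_le_mul_of_nonneg_right h (by positivity)
    have h2 : Θ * lam * 1 ≤ Θ * lam * k := mul_le_mul_of_nonneg_left hk1 (by positivity)
    have h3 : 0 ≤ Θ * lam := by positivity
    linarith
  have hwhp : ∀ {lam : ℝ} (c : ℕ), PathOracle.arboricity G + β ≤ 26 * lam →
      10000 * ((PathOracle.arboricity G + β) * (2 * ((c + 1) * Θ * Real.log n) + 4)) ≤
      2000000 * (c + 5) * (Θ * k * lam * Real.log n) := by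
    intro lam c h
    have hl : 0 ≤ lam := by linarith
    have h0 : 1 * (1 / 2) ≤ Θ * Real.log n := mul_le_mul hΘ1 hL (by norm_num) (by positivity)
    have h1 : (PathOracle.arboricity G + β) * (2 * ((c + 1) * Θ * Real.log n) + 4) ≤
        26 * lam * (2 * ((c + 5) * (Θ * Real.log n))) :=
      mul_le_mul h (by linarith) (by positivity) (by positivity)
    have h2 : (c + 5) * (Θ * lam * Real.log n) * 1 ≤ (c + 5) * (Θ * lam * Real.log n) * k :=
      mul_le_mul_of_nonneg_left hk1 (by positivity)
    have h3 : 0 ≤ (c + 5) * (Θ * lam * Real.log n) := by positivity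
    linarith
  have hC : ∀ c : ℕ, (10000 : ℝ) ≤ 2000000 * (c + 5) := fun c => by
    have := Nat.cast_nonneg (α := ℝ) c
    linarith
  have hw1 : PathOracle.arboricity G + β ≤ 26 * (PathOracle.arboricity G + Real.log n) := by
    linarith
  refine ⟨(PMF.uniformOfFintype (Fin m → Fin n)).map table, T, path, ?_, ?_, ?_, ?_, ?_⟩
  · intro M hM
    rw [PMF.support_map] at hM
    obtain ⟨f, -, rfl⟩ := hM
    exact ⟨(hO f).small, fun u v => ⟨_, ⟨_, (hans f u v).1, rfl, rfl⟩, (hans f u v).2.1⟩⟩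
  · intro c
    -- The bound on the size holds for every choice of the pivots, so there is no bad choice.
    refine PathOracle.whp_of_card_le _ ∅ (fun f _ => ?_) (by simp; positivity)
    have h1 : ((table f).length : ℝ) ≤ 1000 * n := by exact_mod_cast hlen f
    have h2 : (0 : ℝ) ≤ c * n := by positivity
    show ((table f).length : ℝ) ≤ 2000000 * (c + 5) * n
    linarith
  · exact PathOracle.expectedQueryTime_of_delay R hm hΘm hΘ1 hlβ hT (by norm_num) (hexp hw1)
  · exact fun c => PathOracle.whpQueryTime_of_delay R (by omega) hΘm hlβ (by positivity) hT (hC c)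
      (hwhp c hw1)
  · intro hunit
    -- Here β = 1 ≤ λ, since the graph has an edge.
    have hw2 : PathOracle.arboricity G + β ≤ 26 * PathOracle.arboricity G := by
      rw [hβ1 hunit]
      push_cast
      linarith
    exact ⟨PathOracle.expectedQueryTime_of_delay R hm hΘm hΘ1 hlβ hT (by norm_num) (hexp hw2),
      fun c => PathOracle.whpQueryTime_of_delay R (by omega) hΘm hlβ (by positivity) hT (hC c)
        (hwhp c hw2)⟩
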